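/- Let $U\subset\mathbb C$ be open and connected, let $c_0,c_1,c_2,c_3$ be analytic on $U$, and consider the Hamiltonian system $y'=\partial H/\partial x$, $x'=-\partial H/\partial y$ with $$H=H_3^{\mathrm{qP_{II}}}=\tfrac12x^2-x\,(y^3+c_3(z)y)-\tfrac13c_2(z)y^3-\tfrac12c_1(z)y^2-c_0(z)y ,$$ extended to $\mathbb{CP}^2$ with coordinates $[1:x:y]=[u_0:1:v_0]=[V_0:U_0:1]$. The blow-up of a point $(a,b)$ in a chart $(u,v)$ introduces the charts $(u_i,v_i)$, $(U_i,V_i)$ with $u=u_i+a=U_iV_i+a$, $v=u_iv_i+b=V_i+b$; its exceptional curve is $E_i=\{u_i=0\}\cup\{V_i=0\}$. For fixed $z$, a base point of a system $u'=P_1/Q_1$, $v'=P_2/Q_2$ (in lowest terms) is a point of indeterminacy ($P_j=Q_j=0$ for some $j$) that is an equilibrium of the system obtained by multiplying both right-hand sides by $\mathrm{lcm}(Q_1,Q_2)$. (1) For every $z\in U$ the system on $\mathbb{CP}^2$ has exactly two base points, $q_1\colon(u_0,v_0)=(0,0)$ and $q_{10}\colon(U_0,V_0)=(0,0)$. They are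 resolved by cascades of $9$ and $4$ blow-ups: for $i\neq 9,13$ the only base point on $E_i$ is $q_{i+1}$, and there is none on $E_9$ and $E_{13}$, where $$q_2\colon(U_1,V_1)=(0,0),\quad q_3\colon(u_2,v_2)=(0,0),\quad q_4\colon(U_3,V_3)=(2,0),\quad q_5\colon(U_4,V_4)=(0,0),\quad q_6\colon(U_5,V_5)=(8c_3,0),$$ $$q_7\colon(U_6,V_6)=(\tfrac83c_2,0),\quad q_8\colon(U_7,V_7)=(8(c_1+8c_3^2-2c_3'),0),\quad q_9\colon(U_8,V_8)=(32(c_0+\tfrac43c_2c_3-\tfrac13c_2'),0),$$ $$q_{11}\colon(U_{10},V_{10})=(-\tfrac13c_2,0),\quad q_{12}\colon(U_{11},V_{11})=(-\tfrac12c_1,0),\quad q_{13}\colon(U_{12},V_{12})=(\tfrac13(c_2c_3-c_2'-3c_0),0).$$ (2) The system after the last blow-up of the first cascade is a regular initial value problem for $(z,U_9)$ as functions of $V_9$ at all points $(U_9,V_9)=(h,0)$ and all $z\in U$ if and only if $c_3''-\tfrac12c_1'=0$ on $U$; equivalently, through each such point, at each $z_*\in U$, there is a solution $U_9=F(\tau)$,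 $V_9=G(\tau)$, $z=z_*+\tau^2$, with $F,G$ analytic at $\tau=0$, $F(0)=h$, $G(0)=0$, $G'(0)\ne0$. For the second cascade the same holds in $(U_{13},V_{13})$ with the condition $c_1'=0$ on $U$. Both conditions hold if and only if $c_1$ is constant and $c_3$ is at most linear. (3) Suppose that both conditions hold. Then the system has the quasi-Painlevé property with square-root algebraic poles: whenever a solution is continued analytically along a path of finite length in $U$ up to its end point $z_*\in U$, it is analytic at $z_*$, or it is given near $z_*$ by a series in $\tau=(z-z_*)^{1/2}$, meromorphic at $\tau=0$, with either $y\sim a\tau^{-1}$, $x\sim-a\tau^{-3}$, $a^2=-\tfrac12$, or $y\sim a\tau^{-1}$, $x\to-\tfrac13c_2(z_*)$, $a^2=\tfrac12$. The line at infinity and the intermediate exceptional curves $E_1,\dots,E_8,E_{10},E_{11},E_{12}$ are inaccessible: no solution continued along a path of finite length in $U$ ending at $z_*\in U$ reaches, or accumulates at, a point of one of these curves (on its first appearance) that is not a base point, and likewise not the point of $E_9$ on the strict transform of $E_8$, nor the point of $E_{13}$ on the strict transform of $E_{12}$. (4) Suppose moreover that $c_3(z)=z$ (so that $c_1$ is constant),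 and let $$W=H+\frac12\frac xy+\frac{c_2'}6\frac x{y^2}+\frac{c_2c_2'}9\frac yx .$$ Consider $z_*\in U$ and a point of the line at infinity or of an intermediate exceptional curve (on its first appearance) that is not a base point, and near which, for $z$ near $z_*$, the terms of $W$ are defined on the affine part ($y\neq0$, and $x\ne0$ whenever $c_2c_2'\neq0$). At this point $W$ is infinite ($|W|\to\infty$ as the point is approached from the affine part, $z\to z_*$), and the logarithmic derivative $W'/W$ along the flow is bounded near it. Near points $(U_9,V_9)=(h,0)$ and $(U_{13},V_{13})=(h,0)$ where the terms of $W$ are defined in the same sense, $W$ is bounded. -/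

import Mathlib

open Filter Topology

noncomputable section

namespace QPII

/-- The coefficient functions `c₀, c₁, c₂, c₃` of the Hamiltonian. -/
structure Coeffs where
  c0 : ℂ → ℂ
  c1 : ℂ → ℂ
  c2 : ℂ → ℂ
  c3 : ℂ → ℂ

namespace Coeffs

/-- The Hamiltonian
`H = x²/2 - x (y³ + c₃ y) - c₂ y³/3 - c₁ y²/2 - c₀ y`. -/
def H (c : Coeffs) (z x y : ℂ) : ℂ :=
  x ^ 2 / 2 - x * (y ^ 3 + c.c3 z * y) - c.c2 z / 3 * y ^ 3 - c.c1 z / 2 * y ^ 2 - c.c0 z * y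

/-- Hamilton's equation `x' = -∂H/∂y`. -/
def xdot (c : Coeffs) (z x y : ℂ) : ℂ := -deriv (fun η => c.H z x η) y

/-- Hamilton's equation `y' = ∂H/∂x`. -/
def ydot (c : Coeffs) (z x y : ℂ) : ℂ := deriv (fun ξ => c.H z ξ y) x

/-- The auxiliary function
`W = H + x/(2y) + (c₂'/6) x/y² + (c₂ c₂'/9) y/x`. -/
def W (c : Coeffs) (z x y : ℂ) : ℂ :=
  c.H z x y + 1 / 2 * (x / y) + deriv c.c2 z / 6 * (x / y ^ 2)
    + c.c2 z * deriv c.c2 z / 9 * (y / x)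

/-- The total `z`-derivative of `W` along the flow, `∂W/∂z + x' ∂W/∂x + y' ∂W/∂y`. -/
def Wdot (c : Coeffs) (z x y : ℂ) : ℂ :=
  deriv (fun ζ => c.W ζ x y) z + c.xdot z x y * deriv (fun ξ => c.W z ξ y) x
    + c.ydot z x y * deriv (fun η => c.W z x η) y

/-- The terms of `W` are defined at `(z, x, y)`: no denominator of a term with a non-zero
coefficient vanishes (the term `x/y` always has the non-zero coefficient `1/2`). -/
def WDefinedAt (c : Coeffs) (z x y : ℂ) : Prop :=
  y ≠ 0 ∧ (c.c2 z * deriv c.c2 z ≠ 0 → x ≠ 0)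

end Coeffs

/-! ### Charts of the blown-up phase space -/

/-- A (`z`-dependent) coordinate chart `(u, v)` of a surface obtained from `ℂP²` by blow-ups:
`[T0 : T1 : T2]` is the image of `(u, v)` in `ℂP²`, with the affine plane embedded as
`(x, y) ↦ [1 : x : y]`, and `velU`, `velV` are the right-hand sides of the differential system
for `(u, v)`, as functions of `(z, u, v)` (values on the polar set are irrelevant). -/
structure Chart where
  T0 : ℂ → ℂ → ℂ → ℂ
  T1 : ℂ → ℂ → ℂ → ℂ
  T2 : ℂ → ℂ → ℂ → ℂ
  velU : ℂ → ℂ → ℂ → ℂ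
  velV : ℂ → ℂ → ℂ → ℂ

/-- The original chart `(x, y)`. -/
def affineChart (c : Coeffs) : Chart where
  T0 _ _ _ := 1
  T1 _ x _ := x
  T2 _ _ y := y
  velU := c.xdot
  velV := c.ydot

/-- The chart `(u₀, v₀) = (1/x, y/x)`, `[1 : x : y] = [u₀ : 1 : v₀]`. -/
def chartu0 (c : Coeffs) : Chart where
  T0 _ u _ := u
  T1 _ _ _ := 1
  T2 _ _ v := v
  velU z u v := -u ^ 2 * c.xdot z (1 / u) (v / u)
  velV z u v := u * (c.ydot z (1 / u) (v / u) - v * c.xdot z (1 / u) (v / u))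

/-- The chart `(U₀, V₀) = (x/y, 1/y)`, `[1 : x : y] = [V₀ : U₀ : 1]`. -/
def chartU0 (c : Coeffs) : Chart where
  T0 _ _ v := v
  T1 _ u _ := u
  T2 _ _ _ := 1
  velU z u v := v * (c.xdot z (u / v) (1 / v) - u * c.ydot z (u / v) (1 / v))
  velV z u v := -v ^ 2 * c.ydot z (u / v) (1 / v)

/-- The chart `(u, v)` of the blow-up of the chart `C` at the point `(a(z), b(z))`; the old
coordinates are `(u + a, u v + b)` and the exceptional curve is `u = 0`. -/
def Chart.lower (C : Chart) (a b : ℂ → ℂ) : Chart where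
  T0 z u v := C.T0 z (u + a z) (u * v + b z)
  T1 z u v := C.T1 z (u + a z) (u * v + b z)
  T2 z u v := C.T2 z (u + a z) (u * v + b z)
  velU z u v := C.velU z (u + a z) (u * v + b z) - deriv a z
  velV z u v :=
    ((C.velV z (u + a z) (u * v + b z) - deriv b z)
      - v * (C.velU z (u + a z) (u * v + b z) - deriv a z)) / u

/-- The chart `(U, V)` of the blow-up of the chart `C` at the point `(a(z), b(z))`; the old
coordinates are `(U V + a, V + b)` and the exceptional curve is `V = 0`. -/
def Chart.upper (C : Chart) (a b : ℂ → ℂ) : Chart where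
  T0 z u v := C.T0 z (u * v + a z) (v + b z)
  T1 z u v := C.T1 z (u * v + a z) (v + b z)
  T2 z u v := C.T2 z (u * v + a z) (v + b z)
  velU z u v :=
    ((C.velU z (u * v + a z) (v + b z) - deriv a z)
      - u * (C.velV z (u * v + a z) (v + b z) - deriv b z)) / v
  velV z u v := C.velV z (u * v + a z) (v + b z) - deriv b z

/-! ### The two cascades -/

/-- The first coordinate of the blow-up centre `q_i`, in the chart `hostChart c i`; the second
coordinate of each of `q_1, …, q_13` is `0`. -/
def centre (c : Coeffs) : ℕ → ℂ → ℂ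
  | 4 => fun _ => 2
  | 6 => fun z => 8 * c.c3 z
  | 7 => fun z => 8 / 3 * c.c2 z
  | 8 => fun z => 8 * (c.c1 z + 8 * c.c3 z ^ 2 - 2 * deriv c.c3 z)
  | 9 => fun z => 32 * (c.c0 z + 4 / 3 * c.c2 z * c.c3 z - 1 / 3 * deriv c.c2 z)
  | 11 => fun z => -c.c2 z / 3
  | 12 => fun z => -c.c1 z / 2
  | 13 => fun z => 1 / 3 * (c.c2 z * c.c3 z - deriv c.c2 z - 3 * c.c0 z)
  | _ => fun _ => 0

/-- The chart in which `q_i` is blown up, `1 ≤ i ≤ 13`: `(u₀, v₀)` for `i = 1`, `(U₀, V₀)` for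
`i = 10` (where the second cascade starts), `(u₂, v₂)` for `i = 3`, and `(U_{i-1}, V_{i-1})`
otherwise. The value at `i = 0` is not used. -/
def hostChart (c : Coeffs) : ℕ → Chart
  | 0 => affineChart c
  | 1 => chartu0 c
  | 3 => (hostChart c 2).lower (centre c 2) (fun _ => 0)
  | 10 => chartU0 c
  | i + 1 => (hostChart c i).upper (centre c i) (fun _ => 0)

/-- The chart `(u_i, v_i)` after the blow-up of `q_i`, with exceptional curve `E_i = {u_i = 0}`. -/
def lowerChart (c : Coeffs) (i : ℕ) : Chart :=
  (hostChart c i).lower (centre c i) (fun _ => 0)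

/-- The chart `(U_i, V_i)` after the blow-up of `q_i`, with exceptional curve `E_i = {V_i = 0}`. -/
def upperChart (c : Coeffs) (i : ℕ) : Chart :=
  (hostChart c i).upper (centre c i) (fun _ => 0)

/-! ### Base points -/

/-- Value of a polynomial in two variables at `(u, v)`. -/
def evalAt (P : MvPolynomial (Fin 2) ℂ) (u v : ℂ) : ℂ := MvPolynomial.eval ![u, v] P

/-- `P / Q` is the rational function `f` in lowest terms. -/
def IsReducedFraction (f : ℂ → ℂ → ℂ) (P Q : MvPolynomial (Fin 2) ℂ) : Prop :=
  Q ≠ 0 ∧ IsRelPrime P Q ∧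
    ∃ S : MvPolynomial (Fin 2) ℂ, S ≠ 0 ∧
      ∀ u v : ℂ, evalAt S u v ≠ 0 → f u v * evalAt Q u v = evalAt P u v

/-- Base points, at fixed `z`, of the system `u' = P₁/Q₁`, `v' = P₂/Q₂` (in lowest terms): points
of indeterminacy (`P_j = Q_j = 0` for some `j`) that are equilibria of the orbitally equivalent
polynomial system obtained by multiplying both right-hand sides by `lcm(Q₁, Q₂) = Q₁R₁ = Q₂R₂`. -/
def IsBasePoint (C : Chart) (z u v : ℂ) : Prop :=
  ∃ P₁ Q₁ P₂ Q₂ R₁ R₂ : MvPolynomial (Fin 2) ℂ,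
    IsReducedFraction (C.velU z) P₁ Q₁ ∧ IsReducedFraction (C.velV z) P₂ Q₂ ∧
    Q₁ * R₁ = Q₂ * R₂ ∧ IsRelPrime R₁ R₂ ∧
    ((evalAt P₁ u v = 0 ∧ evalAt Q₁ u v = 0) ∨ (evalAt P₂ u v = 0 ∧ evalAt Q₂ u v = 0)) ∧
    evalAt (P₁ * R₁) u v = 0 ∧ evalAt (P₂ * R₂) u v = 0

/-! ### The system after a final blow-up -/

/-- With `V` as the independent variable and `z`, `U` as the dependent ones, the system in the
chart `C`, with exceptional curve `V = 0`, is a regular initial value problem at the point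
`(U, V) = (h, 0)`: `dz/dV = 1/V'` and `dU/dV = U'/V'` extend analytically to `(z, h, 0)`. -/
def RegularAfterSwap (C : Chart) (z h : ℂ) : Prop :=
  ∃ Φ Ψ : ℂ × ℂ × ℂ → ℂ, AnalyticAt ℂ Φ (z, h, 0) ∧ AnalyticAt ℂ Ψ (z, h, 0) ∧
    ∀ᶠ p in 𝓝 ((z, h, 0) : ℂ × ℂ × ℂ), p.2.2 ≠ 0 →
      C.velV p.1 p.2.1 p.2.2 ≠ 0 ∧
      Φ p = 1 / C.velV p.1 p.2.1 p.2.2 ∧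
      Ψ p = C.velU p.1 p.2.1 p.2.2 / C.velV p.1 p.2.1 p.2.2

/-- The system in the chart `C` has a solution through the point `(U, V) = (h, 0)` at `z`, given
by convergent power series in a square root `τ` of the distance to `z` (`U = F(τ)`, `V = G(τ)` at
the point `z + τ²`), that crosses the curve `V = 0` transversally in `τ`. -/
def HasSqrtExpansion (C : Chart) (z h : ℂ) : Prop :=
  ∃ F G : ℂ → ℂ, AnalyticAt ℂ F 0 ∧ AnalyticAt ℂ G 0 ∧ F 0 = h ∧ G 0 = 0 ∧ deriv G 0 ≠ 0 ∧
    ∀ᶠ τ in 𝓝[≠] (0 : ℂ),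
      HasDerivAt F (2 * τ * C.velU (z + τ ^ 2) (F τ) (G τ)) τ ∧
      HasDerivAt G (2 * τ * C.velV (z + τ ^ 2) (F τ) (G τ)) τ

/-! ### Solutions continued along paths and the quasi-Painlevé property -/

/-- `(ξ, η)` is an analytic solution `(x, y)` of Hamilton's equations near `z₀`. -/
def IsSolutionNear (c : Coeffs) (ξ η : ℂ → ℂ) (z₀ : ℂ) : Prop :=
  ∀ᶠ z in 𝓝 z₀, HasDerivAt ξ (c.xdot z (ξ z) (η z)) z ∧ HasDerivAt η (c.ydot z (ξ z) (η z)) z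

/-- `γ`, on `[0, 1]`, is a path of finite length in `U`. -/
def IsFinitePathIn (U : Set ℂ) (γ : ℝ → ℂ) : Prop :=
  ContinuousOn γ (Set.Icc 0 1) ∧ BoundedVariationOn γ (Set.Icc 0 1) ∧
    Set.MapsTo γ (Set.Icc 0 1) U

/-- `x t`, `y t` (`0 ≤ t < 1`) are the values at `γ t` of an analytic solution which is continued
analytically along `γ`, up to but not necessarily including the end point `γ 1`. -/
def IsContinuedAlong (c : Coeffs) (γ : ℝ → ℂ) (x y : ℝ → ℂ) : Prop :=
  ∀ t ∈ Set.Ico (0 : ℝ) 1, ∃ ξ η : ℂ → ℂ, IsSolutionNear c ξ η (γ t) ∧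
    ∀ᶠ s in 𝓝[Set.Ico (0 : ℝ) 1] t, x s = ξ (γ s) ∧ y s = η (γ s)

/-- The solution continues analytically to the end point of the path. -/
def EndsRegular (c : Coeffs) (γ : ℝ → ℂ) (x y : ℝ → ℂ) : Prop :=
  ∃ ξ η : ℂ → ℂ, IsSolutionNear c ξ η (γ 1) ∧
    ∀ᶠ s in 𝓝[<] (1 : ℝ), x s = ξ (γ s) ∧ y s = η (γ s)

/-- The solution has a square-root algebraic pole at the end point `z = γ 1` of the path: near the
end, `x = F(τ)`, `y = G(τ)`, where `τ² = ζ - z` is followed continuously along the path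
(`ζ = γ s`), `F` and `G` are meromorphic at `τ = 0` and solve the system on a whole punctured
neighbourhood, and either `y ~ a τ⁻¹`, `x ~ -a τ⁻³` with `a² = -1/2`, or `y ~ a τ⁻¹`,
`x → -c₂(z)/3` with `a² = 1/2`. -/
def EndsSqrtPole (c : Coeffs) (γ : ℝ → ℂ) (x y : ℝ → ℂ) : Prop :=
  ∃ (F G : ℂ → ℂ) (τ : ℝ → ℂ) (s₀ : ℝ) (a : ℂ),
    s₀ ∈ Set.Ico (0 : ℝ) 1 ∧ ContinuousOn τ (Set.Ico s₀ 1) ∧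
    (∀ s ∈ Set.Ico s₀ 1,
      τ s ≠ 0 ∧ τ s ^ 2 = γ s - γ 1 ∧ x s = F (τ s) ∧ y s = G (τ s)) ∧
    MeromorphicAt F 0 ∧ MeromorphicAt G 0 ∧
    (∀ᶠ w in 𝓝[≠] (0 : ℂ),
      HasDerivAt F (2 * w * c.xdot (γ 1 + w ^ 2) (F w) (G w)) w ∧
      HasDerivAt G (2 * w * c.ydot (γ 1 + w ^ 2) (F w) (G w)) w) ∧
    Tendsto (fun w => w * G w) (𝓝[≠] 0) (𝓝 a) ∧
    ((a ^ 2 = -1 / 2 ∧ Tendsto (fun w => w ^ 3 * F w) (𝓝[≠] 0) (𝓝 (-a))) ∨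
      (a ^ 2 = 1 / 2 ∧ Tendsto F (𝓝[≠] 0) (𝓝 (-c.c2 (γ 1) / 3))))

/-- The quasi-Painlevé property over `U`, with square-root algebraic poles: at the end point in
`U` of a path of finite length in `U`, a solution continued along the path is either analytic or
has a square-root algebraic pole. -/
def QuasiPainleve (c : Coeffs) (U : Set ℂ) : Prop :=
  ∀ (γ : ℝ → ℂ) (x y : ℝ → ℂ), IsFinitePathIn U γ → IsContinuedAlong c γ x y →
    EndsRegular c γ x y ∨ EndsSqrtPole c γ x y

/-! ### Intermediate curves and inaccessibility -/

/-- The point `(u, v)` of the chart `C` lies on the line at infinity or on the exceptional curve of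
an intermediate blow-up, i.e. of one that is not the last one (`i = 9`, `i = 13`) of its
cascade. -/
def OnIntermediateCurve (c : Coeffs) (C : Chart) (u v : ℂ) : Prop :=
  (C = chartu0 c ∧ u = 0) ∨ (C = chartU0 c ∧ v = 0) ∨
    ∃ i ∈ ({1, 2, 3, 4, 5, 6, 7, 8, 10, 11, 12} : Set ℕ),
      (C = lowerChart c i ∧ u = 0) ∨ (C = upperChart c i ∧ v = 0)

/-- The solution `(x, y)` along `γ` has the point `(u₀, v₀)` of the chart `C` as a limit point (in
the blown-up phase space) at the end of the path. -/
def HasLimitPoint (C : Chart) (γ : ℝ → ℂ) (x y : ℝ → ℂ) (u₀ v₀ : ℂ) : Prop :=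
  ∃ (t : ℕ → ℝ) (u v : ℕ → ℂ), (∀ n, t n ∈ Set.Ico (0 : ℝ) 1) ∧ Tendsto t atTop (𝓝 1) ∧
    (∀ n, C.T0 (γ (t n)) (u n) (v n) ≠ 0 ∧
      x (t n) * C.T0 (γ (t n)) (u n) (v n) = C.T1 (γ (t n)) (u n) (v n) ∧
      y (t n) * C.T0 (γ (t n)) (u n) (v n) = C.T2 (γ (t n)) (u n) (v n)) ∧
    Tendsto u atTop (𝓝 u₀) ∧ Tendsto v atTop (𝓝 v₀)

/-- The point `(u₀, v₀)` of the chart `C` is inaccessible at `z`: no solution, continued along a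
path of finite length in `U` that ends in `z`, reaches it (or even accumulates there). -/
def Inaccessible (c : Coeffs) (U : Set ℂ) (C : Chart) (z u₀ v₀ : ℂ) : Prop :=
  ∀ (γ : ℝ → ℂ) (x y : ℝ → ℂ), IsFinitePathIn U γ → γ 1 = z → IsContinuedAlong c γ x y →
    ¬ HasLimitPoint C γ x y u₀ v₀

/-- The filter of points `(z, u, v)` of the chart `C` that lie over the affine plane and tend to
`(z₀, u₀, v₀)`. -/
def finiteNhds (C : Chart) (z₀ u₀ v₀ : ℂ) : Filter (ℂ × ℂ × ℂ) :=
  𝓝[{p | C.T0 p.1 p.2.1 p.2.2 ≠ 0}] (z₀, u₀, v₀)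

/-- The coordinates `x = T1/T0` and `y = T2/T0` in a chart, at `p = (z, u, v)`. -/
def Chart.xOf (C : Chart) (p : ℂ × ℂ × ℂ) : ℂ :=
  C.T1 p.1 p.2.1 p.2.2 / C.T0 p.1 p.2.1 p.2.2

/-- See `Chart.xOf`. -/
def Chart.yOf (C : Chart) (p : ℂ × ℂ × ℂ) : ℂ :=
  C.T2 p.1 p.2.1 p.2.2 / C.T0 p.1 p.2.1 p.2.2

/-- The terms of `W` are defined at all points over the affine plane near `(z, u, v)`. -/
def WDefinedNear (c : Coeffs) (C : Chart) (z u v : ℂ) : Prop :=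
  ∀ᶠ p in finiteNhds C z u v, c.WDefinedAt p.1 (C.xOf p) (C.yOf p)

/-- `W` is infinite at the point `(u, v)` of the chart `C`. -/
def WInfinite (c : Coeffs) (C : Chart) (z u v : ℂ) : Prop :=
  Tendsto (fun p => ‖c.W p.1 (C.xOf p) (C.yOf p)‖) (finiteNhds C z u v) atTop

/-- The logarithmic derivative of `W` along the flow is bounded near the point `(u, v)` of the
chart `C`. -/
def WLogDerivBounded (c : Coeffs) (C : Chart) (z u v : ℂ) : Prop :=
  ∃ K : ℝ, ∀ᶠ p in finiteNhds C z u v,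
    ‖c.Wdot p.1 (C.xOf p) (C.yOf p) / c.W p.1 (C.xOf p) (C.yOf p)‖ ≤ K

/-- `W` is finite (bounded) near the point `(u, v)` of the chart `C`. -/
def WBounded (c : Coeffs) (C : Chart) (z u v : ℂ) : Prop :=
  ∃ K : ℝ, ∀ᶠ p in finiteNhds C z u v, ‖c.W p.1 (C.xOf p) (C.yOf p)‖ ≤ K

end QPII

end

/-!
The proof combines an algebraic analysis of the two cascades with an a priori bound for a modified
Hamiltonian.

*Base points.* The reduced fractions exist and are unique since polynomial rings are factorial, so
a base point can be recognised from any common denominator: `not_isBasePoint_of_ne` excludes base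
points, `isBasePoint_of_prime` produces them. The charts up to the third blow-up are computed
directly. From `(K, V) = (x/y³, y²/x)` and `(K, V) = (x/y, 1/y)` on, the blow-ups of each cascade
are those of a curve `K = tail(V)`, so that `K = tail(V) + V ^ m U` in the chart `(U, V)` after `m`
of them. `IsCascade` records what makes the tail the right one: `K - tail(V)` satisfies a linear
equation up to an error `V ^ n e`. This yields the base points in all charts at once
(`IsCascade.casc_isBasePoint_iff`, `IsCascade.lower_isBasePoint_iff`).

*Regularity.* After the last blow-up the system has the form `V' = q / (D V)`,
`U' = (κ + V N) / (D V²)` (`IsFinalChart`), where `κ` is the value of `e` at `V = 0`: a multiple of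
`c₃'' - c₁'/2` in the first cascade (`firstE_zero`), of `c₁'` in the second. With `V` as the
independent variable it is regular exactly if `κ = 0`. On its solutions `z - z₀` has a double zero
at `V = 0`, and a square root of `z - z₀` is a parameter (`exists_sqrt_of_curve`).

*Quasi-Painlevé property.* If `c₁' = 0` and `c₃'' = 0`, then `H + corr`, cut off for small `y`, has
a derivative that is at most proportional to its size (`exists_rate`), hence it is bounded along
paths of finite length (`exists_bound_of_relative_rate`). If `y` does not tend to infinity, the
solution accumulates at a finite point and is analytic there. Otherwise `x/y³` accumulates at `0`
or `2`, and the bound puts a limit point on the finite part of `E₁₃` or of `E₉`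
(`exists_modifiedH_second_bound`, `exists_modifiedH_first_bound`). Near that point the solution
follows a curve of the regular system, so it is analytic at the end or has a square-root pole.
Therefore limits are finite points or lie on the two last curves (`limit_cases`), which makes the
other curves inaccessible.

*The function `W`.* The derivative of `W` along the flow is at most of the order of `|y| + |W| + 1`
(`exists_Wdot_bound`). Near the two cascades `W` is comparable with `(K - tail) / V⁶` and
`(x - tail) y³` (`NormalizedOn.exists_W_first_bound`, `NormalizedOn.exists_W_second_bound`).
So `W` is bounded at the last curves, and at the earlier ones it is infinite and dominates `y`,
hence also its own derivative.
-/

/-! ### Uniform existence for analytic differential equations -/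

section ODE
variable {E : Type*} [NormedAddCommGroup E] [NormedSpace ℂ E]

/-- Mean value estimate on a ball, for the difference of two holomorphic functions. -/
theorem norm_sub_le_of_hasDerivAt_ball {φ ψ φ' ψ' : ℂ → E} {t₀ t₁ t : ℂ} {r C : ℝ}
    (hφ : ∀ s ∈ Metric.ball t₀ r, HasDerivAt φ (φ' s) s)
    (hψ : ∀ s ∈ Metric.ball t₀ r, HasDerivAt ψ (ψ' s) s)
    (hC : ∀ s ∈ Metric.ball t₀ r, ‖φ' s - ψ' s‖ ≤ C)
    (h₁ : t₁ ∈ Metric.ball t₀ r) (h : t ∈ Metric.ball t₀ r) (heq : φ t₁ = ψ t₁) :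
    ‖φ t - ψ t‖ ≤ C * ‖t - t₁‖ := by
  have := Convex.norm_image_sub_le_of_norm_hasDerivWithin_le (𝕜 := ℂ)
    (f := fun s => φ s - ψ s) (f' := fun s => φ' s - ψ' s)
    (fun s hs => ((hφ s hs).sub (hψ s hs)).hasDerivWithinAt) hC (convex_ball t₀ r) h₁ h
  simpa [heq] using this

/-- Complex Picard–Lindelöf theorem, with a disc of existence that does not depend on the
initial value. -/
theorem exists_uniform_solution [CompleteSpace E] {f : ℂ × E → E} {t₀ : ℂ} {y₀ : E}
    (hf : AnalyticAt ℂ f (t₀, y₀)) {ε : ℝ} (hε : 0 < ε) :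
    ∃ r > 0, ∃ δ > 0, ∀ t₁ ∈ Metric.ball t₀ r, ∀ y₁ ∈ Metric.ball y₀ δ, ∃ φ : ℂ → E,
      φ t₁ = y₁ ∧ ∀ t ∈ Metric.ball t₀ r,
        φ t ∈ Metric.closedBall y₀ ε ∧ HasDerivAt φ (f (t, φ t)) t := by
  obtain ⟨K, s, hs, hK⟩ := (hf.contDiffAt (n := 1)).exists_lipschitzOnWith
  obtain ⟨R₀, hR₀, hball⟩ := Metric.mem_nhds_iff.1 (inter_mem hs hf.eventually_analyticAt)
  obtain ⟨R, hR, hRε, hRR⟩ : ∃ R > 0, R ≤ ε ∧ R < R₀ :=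
    ⟨min ε (R₀ / 2), by positivity, min_le_left _ _, (min_le_right _ _).trans_lt (by linarith)⟩
  have hmem : ∀ t ∈ Metric.ball t₀ R, ∀ y ∈ Metric.closedBall y₀ R,
      (t, y) ∈ s ∧ AnalyticAt ℂ f (t, y) := fun t ht y hy => hball (by
    rw [Metric.mem_ball, Prod.dist_eq, max_lt_iff]
    exact ⟨(Metric.mem_ball.1 ht).trans hRR, (Metric.mem_closedBall.1 hy).trans_lt hRR⟩)
  set M : ℝ := ‖f (t₀, y₀)‖ + K * R with hM
  have hM0 : 0 ≤ M := by positivity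
  obtain ⟨r, hr, hrR, hrM, hrK⟩ : ∃ r > 0, r ≤ R ∧ M * (2 * r) ≤ R / 2 ∧ K * (2 * r) ≤ 1 / 2 := by
    refine ⟨min R (min (R / (4 * (M + 1))) (1 / (4 * (K + 1)))), by positivity, min_le_left _ _,
      ?_, ?_⟩
    · have h1 : min R (min (R / (4 * (M + 1))) (1 / (4 * ((K : ℝ) + 1)))) ≤ R / (4 * (M + 1)) :=
        (min_le_right _ _).trans (min_le_left _ _)
      calc _ ≤ M * (2 * (R / (4 * (M + 1)))) := by gcongr
        _ = R / 2 * (M / (M + 1)) := by field_simp; norm_num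
        _ ≤ R / 2 * 1 := by gcongr; rw [div_le_one (by positivity)]; linarith
        _ = R / 2 := mul_one _
    · have h1 : min R (min (R / (4 * (M + 1))) (1 / (4 * ((K : ℝ) + 1)))) ≤ 1 / (4 * (K + 1)) :=
        (min_le_right _ _).trans (min_le_right _ _)
      calc _ ≤ (K : ℝ) * (2 * (1 / (4 * (K + 1)))) := by gcongr
        _ = 1 / 2 * (K / (K + 1)) := by field_simp; norm_num
        _ ≤ 1 / 2 * 1 := by gcongr; rw [div_le_one (by positivity)]; linarith
        _ = 1 / 2 := mul_one _
  have hsub : Metric.ball t₀ r ⊆ Metric.ball t₀ R := Metric.ball_subset_ball hrR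
  have hfM : ∀ t ∈ Metric.ball t₀ r, ∀ y ∈ Metric.closedBall y₀ R, ‖f (t, y)‖ ≤ M := by
    intro t ht y hy
    have h1 := hK.dist_le_mul _ (hmem t (hsub ht) y hy).1 _
      (hmem t₀ (Metric.mem_ball_self hR) y₀ (Metric.mem_closedBall_self hR.le)).1
    have h2 : dist (t, y) (t₀, y₀) ≤ R := by
      rw [Prod.dist_eq, max_le_iff]; exact ⟨(Metric.mem_ball.1 (hsub ht)).le, hy⟩
    calc ‖f (t, y)‖ ≤ ‖f (t₀, y₀)‖ + ‖f (t, y) - f (t₀, y₀)‖ := norm_le_norm_add_norm_sub' _ _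
      _ ≤ _ := by
        rw [hM, ← dist_eq_norm]; gcongr; exact h1.trans (by gcongr)
  have hdist : ∀ t ∈ Metric.ball t₀ r, ∀ t₁ ∈ Metric.ball t₀ r, ‖t - t₁‖ ≤ 2 * r := by
    intro t ht t₁ ht₁
    rw [← dist_eq_norm]
    have := dist_triangle_right t t₁ t₀
    rw [Metric.mem_ball] at ht ht₁; linarith
  refine ⟨r, hr, R / 2, by positivity, fun t₁ ht₁ y₁ hy₁ => ?_⟩
  -- Picard iteration on holomorphic functions with values in the closed ball.
  let Adm := {φ : ℂ → E // DifferentiableOn ℂ φ (Metric.ball t₀ r) ∧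
    Set.MapsTo φ (Metric.ball t₀ r) (Metric.closedBall y₀ R)}
  have hstep : ∀ φ : Adm, ∃ ψ : Adm, ψ.1 t₁ = y₁ ∧
      ∀ t ∈ Metric.ball t₀ r, HasDerivAt ψ.1 (f (t, φ.1 t)) t := by
    rintro ⟨φ, hd, hm⟩
    have hdf : DifferentiableOn ℂ (fun t => f (t, φ t)) (Metric.ball t₀ r) := by
      intro t ht
      have h1 := (hmem t (hsub ht) (φ t) (hm ht)).2.differentiableAt
      exact (h1.comp_differentiableWithinAt (f := fun t => (t, φ t)) t
        (differentiableWithinAt_id.prodMk (hd t ht)))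
    obtain ⟨ψ, h1, h2⟩ := hdf.isExactOn_ball.with_val_at t₁ y₁
    refine ⟨⟨ψ, fun t ht => (h2 t ht).differentiableAt.differentiableWithinAt, ?_⟩, h1, h2⟩
    intro t ht
    have h3 := norm_sub_le_of_hasDerivAt_ball (ψ := fun _ => y₁) (ψ' := fun _ => 0) (C := M)
      h2 (fun s _ => hasDerivAt_const s y₁)
      (fun s hs => by simpa using hfM s hs _ (hm hs)) ht₁ ht h1
    rw [Metric.mem_closedBall, dist_eq_norm]
    have h4 : ‖y₁ - y₀‖ < R / 2 := by rw [← dist_eq_norm]; exact hy₁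
    have h5 : M * ‖t - t₁‖ ≤ M * (2 * r) := by gcongr; exact hdist t ht t₁ ht₁
    have h6 := norm_sub_le_norm_sub_add_norm_sub (ψ t) y₁ y₀
    linarith
  choose step hstep1 hstep2 using hstep
  let φ₀ : Adm := ⟨fun _ => y₀, differentiableOn_const _, fun _ _ => Metric.mem_closedBall_self hR.le⟩
  let Φ : ℕ → Adm := fun n => step^[n + 1] φ₀
  have hΦs : ∀ n, Φ (n + 1) = step (Φ n) := fun n => Function.iterate_succ_apply' step (n + 1) φ₀
  have hΦ1 : ∀ n, (Φ n).1 t₁ = y₁ := fun n => by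
    simp only [Φ, Function.iterate_succ_apply']; exact hstep1 _
  have hLip : ∀ n, ∀ t ∈ Metric.ball t₀ r, ∀ k, ‖f (t, (Φ n).1 t) - f (t, (Φ k).1 t)‖
      ≤ K * ‖(Φ n).1 t - (Φ k).1 t‖ := by
    intro n t ht k
    have := hK.dist_le_mul _ (hmem t (hsub ht) _ ((Φ n).2.2 ht)).1 _
      (hmem t (hsub ht) _ ((Φ k).2.2 ht)).1
    simpa [Prod.dist_eq, dist_eq_norm] using this
  have hgeom : ∀ n, ∀ t ∈ Metric.ball t₀ r,
      dist ((Φ n).1 t) ((Φ (n + 1)).1 t) ≤ 2 * R * (1 / 2) ^ n := by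
    intro n
    induction n with
    | zero =>
      intro t ht
      have h1 := (Φ 0).2.2 ht
      have h2 := (Φ 1).2.2 ht
      have := dist_triangle_right ((Φ 0).1 t) ((Φ 1).1 t) y₀
      rw [Metric.mem_closedBall] at h1 h2
      simp only [zero_add, pow_zero]; linarith
    | succ n ih =>
      intro t ht
      have := norm_sub_le_of_hasDerivAt_ball (φ := (Φ (n + 1)).1) (ψ := (Φ (n + 2)).1)
        (C := K * (2 * R * (1 / 2) ^ n))
        (fun s hs => by rw [hΦs n]; exact hstep2 _ s hs)
        (fun s hs => by rw [hΦs (n + 1)]; exact hstep2 _ s hs)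
        (fun s hs => (hLip n s hs (n + 1)).trans (by
          gcongr; rw [← dist_eq_norm]; exact ih s hs)) ht₁ ht (by rw [hΦ1, hΦ1])
      rw [dist_eq_norm]
      calc _ ≤ _ := this
        _ ≤ K * (2 * R * (1 / 2) ^ n) * (2 * r) := by gcongr; exact hdist t ht t₁ ht₁
        _ = K * (2 * r) * (2 * R * (1 / 2) ^ n) := by ring
        _ ≤ 1 / 2 * (2 * R * (1 / 2) ^ n) := by gcongr
        _ = _ := by rw [pow_succ]; ring
  have hcau : ∀ t ∈ Metric.ball t₀ r, CauchySeq fun n => (Φ n).1 t := fun t ht =>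
    cauchySeq_of_le_geometric _ _ (by norm_num) fun n => hgeom n t ht
  choose! φ hφ using fun t ht => cauchySeq_tendsto_of_complete (hcau t ht)
  have hlim : ∀ t ∈ Metric.ball t₀ r, ∀ n, dist ((Φ n).1 t) (φ t) ≤ 4 * R * (1 / 2) ^ n := by
    intro t ht n
    have := dist_le_of_le_geometric_of_tendsto (1 / 2 : ℝ) (2 * R) (by norm_num)
      (fun n => hgeom n t ht) (hφ t ht) n
    refine this.trans (le_of_eq ?_); ring
  have hmaps : ∀ t ∈ Metric.ball t₀ r, φ t ∈ Metric.closedBall y₀ R := fun t ht =>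
    Metric.isClosed_closedBall.mem_of_tendsto (hφ t ht) (Eventually.of_forall fun n => (Φ n).2.2 ht)
  have hpow : Tendsto (fun n : ℕ => 4 * R * (1 / 2 : ℝ) ^ n) atTop (𝓝 0) := by
    simpa using (tendsto_pow_atTop_nhds_zero_of_lt_one (r := (1 / 2 : ℝ)) (by norm_num)
      (by norm_num)).const_mul (4 * R)
  refine ⟨φ, tendsto_nhds_unique (hφ t₁ ht₁) (by simp [hΦ1]), fun t ht =>
    ⟨Metric.closedBall_subset_closedBall hRε (hmaps t ht), ?_⟩⟩
  refine hasDerivAt_of_tendstoUniformlyOn (l := atTop) (f := fun n => (Φ (n + 1)).1)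
    (f' := fun n t => f (t, (Φ n).1 t)) (g' := fun t => f (t, φ t)) Metric.isOpen_ball ?_
    (Eventually.of_forall fun n s hs => by
      show HasDerivAt (Φ (n + 1)).1 _ _
      rw [hΦs n]; exact hstep2 _ s hs) (fun s hs => (hφ s hs).comp (tendsto_add_atTop_nat 1)) ht
  rw [Metric.tendstoUniformlyOn_iff]
  intro η hη
  have h1 : Tendsto (fun n : ℕ => K * (4 * R * (1 / 2 : ℝ) ^ n)) atTop (𝓝 0) := by
    simpa using hpow.const_mul (K : ℝ)
  filter_upwards [h1.eventually_lt_const hη] with n hn s hs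
  refine lt_of_le_of_lt ?_ hn
  have h2 := hK.dist_le_mul _ (hmem s (hsub hs) _ (hmaps s hs)).1 _
    (hmem s (hsub hs) _ ((Φ n).2.2 hs)).1
  refine h2.trans ?_
  gcongr
  rw [dist_comm]
  simpa [Prod.dist_eq] using hlim s hs n

/-- Local uniqueness for holomorphic differential equations. -/
theorem eventuallyEq_of_hasDerivAt [CompleteSpace E] {f : ℂ × E → E} {t₀ : ℂ} {φ ψ : ℂ → E}
    (hf : AnalyticAt ℂ f (t₀, φ t₀))
    (hφ : ∀ᶠ t in 𝓝 t₀, HasDerivAt φ (f (t, φ t)) t)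
    (hψ : ∀ᶠ t in 𝓝 t₀, HasDerivAt ψ (f (t, ψ t)) t) (heq : φ t₀ = ψ t₀) :
    φ =ᶠ[𝓝 t₀] ψ := by
  obtain ⟨K, s, hs, hK⟩ := (hf.contDiffAt (n := 1)).exists_lipschitzOnWith
  have h1 : ∀ᶠ t in 𝓝 t₀, (t, φ t) ∈ s :=
    (continuousAt_id.prodMk hφ.self_of_nhds.continuousAt).eventually hs
  have h2 : ∀ᶠ t in 𝓝 t₀, (t, ψ t) ∈ s :=
    (continuousAt_id.prodMk hψ.self_of_nhds.continuousAt).eventually (by have h0 := hs; rw [heq] at h0; exact h0)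
  obtain ⟨R, hR, hball⟩ := Metric.eventually_nhds_iff_ball.1 (hφ.and (hψ.and (h1.and h2)))
  set r : ℝ := min (R / 2) (1 / (2 * (K + 1))) with hr
  have hr0 : 0 < r := by positivity
  have hrR : r < R := (min_le_left _ _).trans_lt (by linarith)
  have hrK : K * r ≤ 1 / 2 := by
    calc (K : ℝ) * r ≤ K * (1 / (2 * (K + 1))) := by gcongr; exact min_le_right _ _
      _ = 1 / 2 * (K / (K + 1)) := by field_simp
      _ ≤ 1 / 2 * 1 := by gcongr; rw [div_le_one (by positivity)]; linarith
      _ = 1 / 2 := mul_one _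
  have hsub : Metric.closedBall t₀ r ⊆ Metric.ball t₀ R := Metric.closedBall_subset_ball hrR
  have hcont : ContinuousOn (fun t => ‖φ t - ψ t‖) (Metric.closedBall t₀ r) := fun t ht =>
    (((hball t (hsub ht)).1.continuousAt.sub
      (hball t (hsub ht)).2.1.continuousAt).norm).continuousWithinAt
  obtain ⟨m, hm, hmax⟩ := (isCompact_closedBall t₀ r).exists_isMaxOn
    ⟨t₀, Metric.mem_closedBall_self hr0.le⟩ hcont
  have hz : ‖φ m - ψ m‖ ≤ 0 := by
    have h3 := Convex.norm_image_sub_le_of_norm_hasDerivWithin_le (𝕜 := ℂ)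
      (f := fun s => φ s - ψ s) (f' := fun s => f (s, φ s) - f (s, ψ s))
      (C := K * ‖φ m - ψ m‖) (s := Metric.closedBall t₀ r)
      (fun s hs => ((hball s (hsub hs)).1.sub (hball s (hsub hs)).2.1).hasDerivWithinAt)
      (fun s hs => by
        have h4 := hK.dist_le_mul _ (hball s (hsub hs)).2.2.1 _ (hball s (hsub hs)).2.2.2
        rw [← dist_eq_norm]
        refine h4.trans ?_
        gcongr
        simpa [Prod.dist_eq, dist_eq_norm] using hmax hs) (convex_closedBall t₀ r)
      (Metric.mem_closedBall_self hr0.le) hm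
    simp only [heq, sub_self, sub_zero] at h3
    have h5 : ‖m - t₀‖ ≤ r := by rw [← dist_eq_norm]; exact hm
    have h6 : K * ‖φ m - ψ m‖ * ‖m - t₀‖ ≤ 1 / 2 * ‖φ m - ψ m‖ := by
      calc _ ≤ K * ‖φ m - ψ m‖ * r := by gcongr
        _ = K * r * ‖φ m - ψ m‖ := by ring
        _ ≤ _ := by gcongr
    have := norm_nonneg (φ m - ψ m)
    linarith
  filter_upwards [Metric.closedBall_mem_nhds t₀ hr0] with t ht
  have := (hmax ht).trans hz
  exact sub_eq_zero.1 (norm_le_zero_iff.1 this)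

end ODE

/-! ### Square roots of a function with a critical point -/

section SquareRoot

/-- A double point `Z = Z 0 + φ²` of a holomorphic function, with the inverse `ψ` of `φ`. -/
theorem exists_sqrt_uniformizer {Z g : ℂ → ℂ} (hg : AnalyticAt ℂ g 0) (hg0 : g 0 ≠ 0)
    (hZ : ∀ᶠ V in 𝓝 (0 : ℂ), HasDerivAt Z (V * g V) V) :
    ∃ φ ψ : ℂ → ℂ, AnalyticAt ℂ φ 0 ∧ AnalyticAt ℂ ψ 0 ∧ φ 0 = 0 ∧ ψ 0 = 0 ∧
      deriv ψ 0 ≠ 0 ∧ deriv ψ 0 ^ 2 * g 0 = 2 ∧ (∀ᶠ V in 𝓝 (0 : ℂ), Z V = Z 0 + φ V ^ 2) ∧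
      (∀ᶠ V in 𝓝 (0 : ℂ), ψ (φ V) = V) ∧ (∀ᶠ τ in 𝓝 (0 : ℂ), φ (ψ τ) = τ) := by
  have hZa : AnalyticAt ℂ Z 0 := by
    rw [Complex.analyticAt_iff_eventually_differentiableAt]
    exact hZ.mono fun V h => h.differentiableAt
  obtain ⟨P, hP⟩ := hZa
  have hd1 : AnalyticAt ℂ (dslope Z 0) 0 := ⟨_, hP.has_fpower_series_dslope_fslope⟩
  obtain ⟨P', hP'⟩ := hd1
  have hk : AnalyticAt ℂ (dslope (dslope Z 0) 0) 0 := ⟨_, hP'.has_fpower_series_dslope_fslope⟩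
  -- `Z = Z 0 + V² k` with `k 0 ≠ 0`; a root of `k` gives `φ = V √k`.
  set k := dslope (dslope Z 0) 0 with hkdef
  have hZ0 : dslope Z 0 0 = 0 := by
    rw [dslope_same, hZ.self_of_nhds.deriv, zero_mul]
  have hZk : ∀ V, Z V = Z 0 + V ^ 2 * k V := by
    intro V
    have h1 := sub_smul_dslope Z 0 V
    have h2 := sub_smul_dslope (dslope Z 0) 0 V
    simp only [smul_eq_mul, sub_zero, hZ0] at h1 h2
    rw [← hkdef] at h2
    rw [← sub_eq_iff_eq_add', ← h1, ← h2]; ring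
  have hk0 : 2 * k 0 = g 0 := by
    have h1 : ∀ᶠ V in 𝓝[≠] (0 : ℂ), 2 * k V + V * deriv k V = g V := by
      filter_upwards [hZ.filter_mono nhdsWithin_le_nhds,
        hk.eventually_analyticAt.filter_mono nhdsWithin_le_nhds, self_mem_nhdsWithin] with V h1 h2 h3
      have h4 : HasDerivAt Z (2 * V * k V + V ^ 2 * deriv k V) V := by
        have h5 := ((hasDerivAt_pow 2 V).mul h2.differentiableAt.hasDerivAt).const_add (Z 0)
        have : Z = fun V => Z 0 + V ^ 2 * k V := funext fun V => hZk V
        rw [this]; simpa using h5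
      have h5 := h1.unique h4
      have h6 : V * (2 * k V + V * deriv k V) = V * g V := by rw [h5]; ring
      exact mul_left_cancel₀ h3 h6
    have h2 : ContinuousAt (fun V => 2 * k V + V * deriv k V) 0 :=
      (continuousAt_const.mul hk.continuousAt).add (continuousAt_id.mul hk.deriv.continuousAt)
    have h3 := tendsto_nhds_unique ((h2.tendsto.mono_left nhdsWithin_le_nhds).congr' h1)
      (hg.continuousAt.tendsto.mono_left nhdsWithin_le_nhds)
    simpa using h3
  have hk0' : k 0 ≠ 0 := fun h => hg0 (by rw [← hk0, h, mul_zero])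
  obtain ⟨κ, hκ⟩ := IsAlgClosed.exists_pow_nat_eq (k 0) (n := 2) (by norm_num)
  have hκ0 : κ ≠ 0 := fun h => hk0' (by rw [← hκ, h]; ring)
  set φ : ℂ → ℂ := fun V => V * (κ * Complex.exp (Complex.log (k V / k 0) / 2)) with hφ
  have hm : AnalyticAt ℂ (fun V => κ * Complex.exp (Complex.log (k V / k 0) / 2)) 0 := by
    have h1 : AnalyticAt ℂ (fun V => Complex.log (k V / k 0)) 0 :=
      (hk.div analyticAt_const hk0').clog (by simp [hk0'])
    exact analyticAt_const.mul (AnalyticAt.cexp (h1.div analyticAt_const (by norm_num)))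
  have hφa : AnalyticAt ℂ φ 0 := analyticAt_id.mul hm
  have hφ0 : φ 0 = 0 := by simp [hφ]
  have hφd : HasDerivAt φ κ 0 := by
    refine ((hasDerivAt_id (0 : ℂ)).mul hm.differentiableAt.hasDerivAt).congr_deriv ?_
    simp [hk0']
  have hφ2 : ∀ᶠ V in 𝓝 (0 : ℂ), Z V = Z 0 + φ V ^ 2 := by
    filter_upwards [hk.continuousAt.eventually_ne hk0'] with V hV
    rw [hZk V, hφ]
    have : Complex.exp (Complex.log (k V / k 0) / 2) ^ 2 = k V / k 0 := by
      rw [← Complex.exp_nat_mul]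
      push_cast
      rw [mul_div_cancel₀ _ (by norm_num : (2 : ℂ) ≠ 0), Complex.exp_log (div_ne_zero hV hk0')]
    simp only [mul_pow, this, hκ]
    field_simp
  have hd : deriv φ 0 ≠ 0 := by rw [hφd.deriv]; exact hκ0
  have hs := hφa.hasStrictDerivAt
  have h1 := hφa.analyticAt_localInverse hd
  have h2 := hs.eventually_left_inverse hd
  have h3 := hs.eventually_right_inverse hd
  have h4 := (hs.to_localInverse hd).hasDerivAt.deriv
  have h5 := h2.self_of_nhds
  rw [hφ0] at h1 h3 h4 h5
  refine ⟨φ, hs.localInverse _ _ _ hd, hφa, h1, hφ0, h5, ?_, ?_, hφ2, h2, h3⟩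
  · rw [h4]; exact inv_ne_zero hd
  · rw [h4, hφd.deriv, ← hk0, ← hκ]; field_simp

end SquareRoot

/-! ### Solution curves with a coordinate as the independent variable -/

section Curves

/-- The system `V' = p / V`, `U' = q / V`, written with `V` as the independent variable, has
solutions `(Z, U)` on a disc that does not depend on the initial value. -/
theorem exists_swapped_solutions {p q : ℂ × ℂ × ℂ → ℂ} {z h : ℂ}
    (hp : AnalyticAt ℂ p (z, h, 0)) (hq : AnalyticAt ℂ q (z, h, 0)) (hp0 : p (z, h, 0) ≠ 0)
    {A : ℂ × ℂ × ℂ → Prop} (hA : ∀ᶠ x in 𝓝 (z, h, 0), A x) :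
    ∃ r > 0, ∃ δ > 0, ∀ V₁ ∈ Metric.ball (0 : ℂ) r, ∀ z₁ ∈ Metric.ball z δ,
      ∀ U₁ ∈ Metric.ball h δ, ∃ Z Υ : ℂ → ℂ, Z V₁ = z₁ ∧ Υ V₁ = U₁ ∧
        ∀ V ∈ Metric.ball (0 : ℂ) r, A (Z V, Υ V, V) ∧
          HasDerivAt Z (V / p (Z V, Υ V, V)) V ∧
          HasDerivAt Υ (q (Z V, Υ V, V) / p (Z V, Υ V, V)) V := by
  set f : ℂ × (ℂ × ℂ) → ℂ × ℂ := fun x =>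
    (x.1 / p (x.2.1, x.2.2, x.1), q (x.2.1, x.2.2, x.1) / p (x.2.1, x.2.2, x.1)) with hf
  have hσ : AnalyticAt ℂ (fun x : ℂ × (ℂ × ℂ) => (x.2.1, x.2.2, x.1)) (0, (z, h)) :=
    (((ContinuousLinearMap.fst ℂ ℂ ℂ).comp (ContinuousLinearMap.snd ℂ ℂ (ℂ × ℂ))).analyticAt _).prod
      ((((ContinuousLinearMap.snd ℂ ℂ ℂ).comp
        (ContinuousLinearMap.snd ℂ ℂ (ℂ × ℂ))).analyticAt _).prod analyticAt_fst)
  have hp' : AnalyticAt ℂ (fun x : ℂ × (ℂ × ℂ) => p (x.2.1, x.2.2, x.1)) (0, (z, h)) :=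
    AnalyticAt.fun_comp (f := fun x : ℂ × (ℂ × ℂ) => (x.2.1, x.2.2, x.1)) hp hσ
  have hq' : AnalyticAt ℂ (fun x : ℂ × (ℂ × ℂ) => q (x.2.1, x.2.2, x.1)) (0, (z, h)) :=
    AnalyticAt.fun_comp (f := fun x : ℂ × (ℂ × ℂ) => (x.2.1, x.2.2, x.1)) hq hσ
  have hfa : AnalyticAt ℂ f (0, (z, h)) :=
    (analyticAt_fst.div hp' hp0).prod (hq'.div hp' hp0)
  obtain ⟨R, hR, hball⟩ := Metric.eventually_nhds_iff_ball.1 hA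
  obtain ⟨r, hr, δ, hδ, H⟩ := exists_uniform_solution hfa (ε := R / 2) (by positivity)
  refine ⟨min r R, by positivity, δ, hδ, fun V₁ hV₁ z₁ hz₁ U₁ hU₁ => ?_⟩
  obtain ⟨Φ, h1, h2⟩ := H V₁ (Metric.ball_subset_ball (min_le_left _ _) hV₁) (z₁, U₁) (by
    rw [Metric.mem_ball, Prod.dist_eq, max_lt_iff]; exact ⟨hz₁, hU₁⟩)
  refine ⟨fun V => (Φ V).1, fun V => (Φ V).2, by simp [h1], by simp [h1], fun V hV => ?_⟩
  obtain ⟨h3, h4⟩ := h2 V (Metric.ball_subset_ball (min_le_left _ _) hV)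
  refine ⟨hball _ ?_, h4.fst, h4.snd⟩
  have hVR : dist V 0 < R := lt_of_lt_of_le hV (min_le_right _ _)
  rw [Metric.mem_closedBall, Prod.dist_eq, max_le_iff] at h3
  rw [Metric.mem_ball, Prod.dist_eq, Prod.dist_eq, max_lt_iff, max_lt_iff]
  exact ⟨by linarith [h3.1], by linarith [h3.2], hVR⟩

end Curves

namespace QPII

/-! ### Criteria for base points -/

section BasePoints

/-- Polynomial functions of two variables. -/
inductive IsPoly : (ℂ → ℂ → ℂ) → Prop
  | const (a : ℂ) : IsPoly fun _ _ => a
  | fst : IsPoly fun u _ => u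
  | snd : IsPoly fun _ v => v
  | add {f g : ℂ → ℂ → ℂ} : IsPoly f → IsPoly g → IsPoly fun u v => f u v + g u v
  | sub {f g : ℂ → ℂ → ℂ} : IsPoly f → IsPoly g → IsPoly fun u v => f u v - g u v
  | mul {f g : ℂ → ℂ → ℂ} : IsPoly f → IsPoly g → IsPoly fun u v => f u v * g u v
  | neg {f : ℂ → ℂ → ℂ} : IsPoly f → IsPoly fun u v => -f u v
  | pow {f : ℂ → ℂ → ℂ} (n : ℕ) : IsPoly f → IsPoly fun u v => f u v ^ n

theorem IsPoly.exists_evalAt {f : ℂ → ℂ → ℂ} (hf : IsPoly f) :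
    ∃ P : MvPolynomial (Fin 2) ℂ, ∀ u v, evalAt P u v = f u v := by
  induction hf with
  | const a => exact ⟨MvPolynomial.C a, by simp [evalAt]⟩
  | fst => exact ⟨MvPolynomial.X 0, by simp [evalAt]⟩
  | snd => exact ⟨MvPolynomial.X 1, by simp [evalAt]⟩
  | add _ _ h₁ h₂ =>
    obtain ⟨⟨P, hP⟩, ⟨Q, hQ⟩⟩ := And.intro h₁ h₂
    exact ⟨P + Q, fun u v => by simp [← hP, ← hQ, evalAt]⟩
  | sub _ _ h₁ h₂ =>
    obtain ⟨⟨P, hP⟩, ⟨Q, hQ⟩⟩ := And.intro h₁ h₂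
    exact ⟨P - Q, fun u v => by simp [← hP, ← hQ, evalAt]⟩
  | mul _ _ h₁ h₂ =>
    obtain ⟨⟨P, hP⟩, ⟨Q, hQ⟩⟩ := And.intro h₁ h₂
    exact ⟨P * Q, fun u v => by simp [← hP, ← hQ, evalAt]⟩
  | neg _ h =>
    obtain ⟨P, hP⟩ := h
    exact ⟨-P, fun u v => by simp [← hP, evalAt]⟩
  | pow n _ h =>
    obtain ⟨P, hP⟩ := h
    exact ⟨P ^ n, fun u v => by simp [← hP, evalAt]⟩

theorem IsPoly.comp {f g h : ℂ → ℂ → ℂ} (hf : IsPoly f) (hg : IsPoly g) (hh : IsPoly h) :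
    IsPoly fun u v => f (g u v) (h u v) := by
  induction hf with
  | const a => exact .const a
  | fst => exact hg
  | snd => exact hh
  | add _ _ h₁ h₂ => exact h₁.add h₂
  | sub _ _ h₁ h₂ => exact h₁.sub h₂
  | mul _ _ h₁ h₂ => exact h₁.mul h₂
  | neg _ h => exact h.neg
  | pow n _ h => exact h.pow n

theorem evalAt_mul (P Q : MvPolynomial (Fin 2) ℂ) (u v : ℂ) :
    evalAt (P * Q) u v = evalAt P u v * evalAt Q u v := by simp [evalAt]

theorem evalAt_injective {P Q : MvPolynomial (Fin 2) ℂ} (h : ∀ u v, evalAt P u v = evalAt Q u v) :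
    P = Q := by
  refine MvPolynomial.funext fun x => ?_
  have : x = ![x 0, x 1] := by funext i; fin_cases i <;> rfl
  rw [this]
  exact h _ _

theorem ne_zero_of_evalAt {P : MvPolynomial (Fin 2) ℂ} {u v : ℂ} (h : evalAt P u v ≠ 0) :
    P ≠ 0 := by
  rintro rfl
  simp [evalAt] at h

theorem evalAt_eq_zero_of_dvd {P Q : MvPolynomial (Fin 2) ℂ} {u v : ℂ} (h : P ∣ Q)
    (hP : evalAt P u v = 0) : evalAt Q u v = 0 := by
  obtain ⟨R, rfl⟩ := h
  rw [evalAt_mul, hP, zero_mul]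

/-- `f` is the rational function `A / D`, not necessarily in lowest terms. -/
def IsFraction (f : ℂ → ℂ → ℂ) (A D : MvPolynomial (Fin 2) ℂ) : Prop :=
  D ≠ 0 ∧ ∃ S : MvPolynomial (Fin 2) ℂ, S ≠ 0 ∧
    ∀ u v : ℂ, evalAt S u v ≠ 0 → f u v * evalAt D u v = evalAt A u v

theorem IsFraction.cross_mul {f : ℂ → ℂ → ℂ} {A D P Q : MvPolynomial (Fin 2) ℂ}
    (h : IsFraction f A D) (h' : IsReducedFraction f P Q) : P * D = A * Q := by
  obtain ⟨-, S, hS, h1⟩ := h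
  obtain ⟨-, -, S', hS', h2⟩ := h'
  have h3 : S * S' * (P * D) = S * S' * (A * Q) := by
    refine evalAt_injective fun u v => ?_
    simp only [evalAt_mul]
    by_cases hs : evalAt S u v = 0
    · simp [hs]
    by_cases hs' : evalAt S' u v = 0
    · simp [hs']
    rw [← h1 u v hs, ← h2 u v hs']; ring
  exact mul_left_cancel₀ (mul_ne_zero hS hS') h3

/-- The common factor removed when a fraction is reduced. -/
theorem IsFraction.exists_factor {f : ℂ → ℂ → ℂ} {A D P Q : MvPolynomial (Fin 2) ℂ}
    (h : IsFraction f A D) (h' : IsReducedFraction f P Q) : ∃ w, A = P * w ∧ D = Q * w := by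
  have hc := h.cross_mul h'
  have hQ : Q ∣ D := h'.2.1.symm.dvd_of_dvd_mul_left (hc ▸ Dvd.intro_left A rfl)
  obtain ⟨w, rfl⟩ := hQ
  refine ⟨w, ?_, rfl⟩
  have : Q * A = Q * (P * w) := by rw [mul_comm Q A, ← hc]; ring
  exact mul_left_cancel₀ h'.1 this

theorem IsFraction.exists_reduced {f : ℂ → ℂ → ℂ} {A D : MvPolynomial (Fin 2) ℂ}
    (h : IsFraction f A D) : ∃ P Q, IsReducedFraction f P Q := by
  obtain ⟨hD, S, hS, h1⟩ := h
  obtain ⟨P, Q, w, hr, hA, hD'⟩ := UniqueFactorizationMonoid.exists_reduced_factors' A D hD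
  have hw : w ≠ 0 := by rintro rfl; exact hD (by rw [← hD', zero_mul])
  refine ⟨P, Q, ?_, ?_, S * w, mul_ne_zero hS hw, fun u v hs => ?_⟩
  · rintro rfl; exact hD (by rw [← hD', mul_zero])
  · exact hr
  · rw [evalAt_mul] at hs
    have h2 := h1 u v (left_ne_zero_of_mul hs)
    rw [← hA, ← hD', evalAt_mul, evalAt_mul] at h2
    refine mul_left_cancel₀ (right_ne_zero_of_mul hs) ?_
    rw [← h2]; ring

theorem exists_lcm_cofactors {Q₁ Q₂ : MvPolynomial (Fin 2) ℂ} (h₁ : Q₁ ≠ 0) :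
    ∃ R₁ R₂, Q₁ * R₁ = Q₂ * R₂ ∧ IsRelPrime R₁ R₂ := by
  obtain ⟨R₁, R₂, w, hr, h2, h1⟩ := UniqueFactorizationMonoid.exists_reduced_factors' Q₂ Q₁ h₁
  exact ⟨R₁, R₂, by rw [← h1, ← h2]; ring, hr⟩

/-- The polynomial system obtained from the reduced one with the least common denominator divides
the one obtained with any common denominator. -/
theorem exists_common_factor {f g : ℂ → ℂ → ℂ} {A B D P₁ Q₁ P₂ Q₂ R₁ R₂ : MvPolynomial (Fin 2) ℂ}
    (hf : IsFraction f A D) (hg : IsFraction g B D) (h₁ : IsReducedFraction f P₁ Q₁)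
    (h₂ : IsReducedFraction g P₂ Q₂) (hR : Q₁ * R₁ = Q₂ * R₂) (hr : IsRelPrime R₁ R₂) :
    ∃ w, A = P₁ * R₁ * w ∧ B = P₂ * R₂ * w ∧ D = Q₁ * R₁ * w := by
  obtain ⟨a, hA, hDa⟩ := hf.exists_factor h₁
  obtain ⟨b, hB, hDb⟩ := hg.exists_factor h₂
  have hQ₁ := h₁.1
  have hQ₂ := h₂.1
  have h3 : R₂ * a = R₁ * b := by
    have : Q₂ * (R₂ * a) = Q₂ * (R₁ * b) := by
      calc Q₂ * (R₂ * a) = (Q₂ * R₂) * a := by ring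
        _ = R₁ * (Q₁ * a) := by rw [← hR]; ring
        _ = R₁ * (Q₂ * b) := by rw [← hDa, ← hDb]
        _ = _ := by ring
    exact mul_left_cancel₀ hQ₂ this
  -- The cofactors of the least common multiple are coprime.
  have h4 : R₁ ∣ a := hr.dvd_of_dvd_mul_left (h3 ▸ Dvd.intro b rfl)
  obtain ⟨w, rfl⟩ := h4
  have hR₁ : R₁ ≠ 0 := by
    rintro rfl
    exact hf.1 (by rw [hDa]; simp)
  have h5 : b = R₂ * w := by
    refine (mul_left_cancel₀ hR₁ ?_).symm
    rw [← h3]; ring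
  exact ⟨w, by rw [hA]; ring, by rw [hB, h5]; ring, by rw [hDa]; ring⟩

theorem isFraction_of_forall {f A D : ℂ → ℂ → ℂ} {P Q : MvPolynomial (Fin 2) ℂ}
    (hP : ∀ u v, evalAt P u v = A u v) (hQ : ∀ u v, evalAt Q u v = D u v)
    (hne : ∃ u v, D u v ≠ 0)
    (h : ∀ u v, u ≠ 0 → v ≠ 0 → D u v ≠ 0 → f u v * D u v = A u v) : IsFraction f P Q := by
  obtain ⟨u₀, v₀, h₀⟩ := hne
  have hQ0 : Q ≠ 0 := ne_zero_of_evalAt (u := u₀) (v := v₀) (by rwa [hQ])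
  refine ⟨hQ0, MvPolynomial.X 0 * MvPolynomial.X 1 * Q,
    mul_ne_zero (mul_ne_zero (MvPolynomial.X_ne_zero _) (MvPolynomial.X_ne_zero _)) hQ0,
    fun u v hs => ?_⟩
  simp only [evalAt_mul, hQ] at hs
  simp only [evalAt, MvPolynomial.eval_X, Matrix.cons_val_zero, Matrix.cons_val_one] at hs
  rw [hP, hQ]
  exact h u v (left_ne_zero_of_mul (left_ne_zero_of_mul hs))
    (right_ne_zero_of_mul (left_ne_zero_of_mul hs)) (right_ne_zero_of_mul hs)

variable {C : Chart} {z u₀ v₀ : ℂ}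

/-- A point at which the system, multiplied by some common denominator, does not vanish is not a
base point. -/
theorem not_isBasePoint_of_ne {A B D : ℂ → ℂ → ℂ} (hA : IsPoly A) (hB : IsPoly B) (hD : IsPoly D)
    (hne : ∃ u v, D u v ≠ 0)
    (hU : ∀ u v, u ≠ 0 → v ≠ 0 → D u v ≠ 0 → C.velU z u v * D u v = A u v)
    (hV : ∀ u v, u ≠ 0 → v ≠ 0 → D u v ≠ 0 → C.velV z u v * D u v = B u v)
    (h : A u₀ v₀ ≠ 0 ∨ B u₀ v₀ ≠ 0) : ¬ IsBasePoint C z u₀ v₀ := by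
  rintro ⟨P₁, Q₁, P₂, Q₂, R₁, R₂, h₁, h₂, hR, hr, -, e₁, e₂⟩
  obtain ⟨PA, hPA⟩ := hA.exists_evalAt
  obtain ⟨PB, hPB⟩ := hB.exists_evalAt
  obtain ⟨PD, hPD⟩ := hD.exists_evalAt
  obtain ⟨w, hwA, hwB, -⟩ := exists_common_factor (isFraction_of_forall hPA hPD hne hU)
    (isFraction_of_forall hPB hPD hne hV) h₁ h₂ hR hr
  rw [← hPA, ← hPB, hwA, hwB, evalAt_mul (P₁ * R₁), evalAt_mul (P₂ * R₂), e₁, e₂] at h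
  simp at h

/-- A point at which neither component of the system is indeterminate is not a base point. -/
theorem not_isBasePoint_of_determinate {A D₁ B D₂ : ℂ → ℂ → ℂ} (hA : IsPoly A) (hD₁ : IsPoly D₁)
    (hB : IsPoly B) (hD₂ : IsPoly D₂) (hne₁ : ∃ u v, D₁ u v ≠ 0) (hne₂ : ∃ u v, D₂ u v ≠ 0)
    (hU : ∀ u v, u ≠ 0 → v ≠ 0 → D₁ u v ≠ 0 → C.velU z u v * D₁ u v = A u v)
    (hV : ∀ u v, u ≠ 0 → v ≠ 0 → D₂ u v ≠ 0 → C.velV z u v * D₂ u v = B u v)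
    (h₁ : A u₀ v₀ ≠ 0 ∨ D₁ u₀ v₀ ≠ 0) (h₂ : B u₀ v₀ ≠ 0 ∨ D₂ u₀ v₀ ≠ 0) :
    ¬ IsBasePoint C z u₀ v₀ := by
  rintro ⟨P₁, Q₁, P₂, Q₂, R₁, R₂, f₁, f₂, -, -, e, -, -⟩
  obtain ⟨PA, hPA⟩ := hA.exists_evalAt
  obtain ⟨PB, hPB⟩ := hB.exists_evalAt
  obtain ⟨PD₁, hPD₁⟩ := hD₁.exists_evalAt
  obtain ⟨PD₂, hPD₂⟩ := hD₂.exists_evalAt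
  obtain ⟨a, hA1, hA2⟩ := (isFraction_of_forall hPA hPD₁ hne₁ hU).exists_factor f₁
  obtain ⟨b, hB1, hB2⟩ := (isFraction_of_forall hPB hPD₂ hne₂ hV).exists_factor f₂
  rw [← hPA, ← hPD₁, hA1, hA2, evalAt_mul, evalAt_mul] at h₁
  rw [← hPB, ← hPD₂, hB1, hB2, evalAt_mul, evalAt_mul] at h₂
  rcases e with ⟨e1, e2⟩ | ⟨e1, e2⟩
  · simp [e1, e2] at h₁
  · simp [e1, e2] at h₂

theorem dvd_of_dvd_mul_prime_pow {w E ℓ : MvPolynomial (Fin 2) ℂ} {n : ℕ} (hℓ : Prime ℓ)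
    (hw : ¬ ℓ ∣ w) (h : w ∣ E * ℓ ^ n) : w ∣ E := by
  have h1 : IsRelPrime w (ℓ ^ n) :=
    ((hℓ.irreducible.isRelPrime_iff_not_dvd.2 hw).symm).pow_right
  exact h1.dvd_of_dvd_mul_right h

/-- Criterion for base points on the zero set of a prime `ℓ` that is the only factor of the
denominator vanishing at the point. -/
theorem isBasePoint_of_prime {A B E ℓ : MvPolynomial (Fin 2) ℂ} {n : ℕ} (hℓ : Prime ℓ)
    (hn : n ≠ 0) (hf : IsFraction (C.velU z) A (E * ℓ ^ n))
    (hg : IsFraction (C.velV z) B (E * ℓ ^ n)) (hE : evalAt E u₀ v₀ ≠ 0)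
    (hℓ0 : evalAt ℓ u₀ v₀ = 0) (hA : evalAt A u₀ v₀ = 0) (hB : evalAt B u₀ v₀ = 0)
    (h : ¬ ℓ ∣ A ∨ ¬ ℓ ∣ B) : IsBasePoint C z u₀ v₀ := by
  obtain ⟨P₁, Q₁, f₁⟩ := hf.exists_reduced
  obtain ⟨P₂, Q₂, f₂⟩ := hg.exists_reduced
  obtain ⟨R₁, R₂, hR, hr⟩ := exists_lcm_cofactors (Q₂ := Q₂) f₁.1
  obtain ⟨w, hwA, hwB, hwD⟩ := exists_common_factor hf hg f₁ f₂ hR hr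
  have key : ∀ (w X Y : MvPolynomial (Fin 2) ℂ), ¬ ℓ ∣ X → X = Y * w → w ∣ E * ℓ ^ n →
      evalAt w u₀ v₀ ≠ 0 := by
    intro w X Y hX hXY hw h0
    exact hE (evalAt_eq_zero_of_dvd (dvd_of_dvd_mul_prime_pow hℓ
      (fun h1 => hX (hXY ▸ h1.mul_left Y)) hw) h0)
  have hw0 : evalAt w u₀ v₀ ≠ 0 := by
    rcases h with h | h
    · exact key w A _ h hwA (hwD ▸ Dvd.intro_left _ rfl)
    · exact key w B _ h hwB (hwD ▸ Dvd.intro_left _ rfl)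
  have ind : ∀ (X P Q : MvPolynomial (Fin 2) ℂ) (F : ℂ → ℂ → ℂ), ¬ ℓ ∣ X →
      evalAt X u₀ v₀ = 0 → IsFraction F X (E * ℓ ^ n) → IsReducedFraction F P Q →
      evalAt P u₀ v₀ = 0 ∧ evalAt Q u₀ v₀ = 0 := by
    intro X P Q F hX hX0 hF hPQ
    obtain ⟨s, hs1, hs2⟩ := hF.exists_factor hPQ
    have hs0 := key s X P hX hs1 (hs2 ▸ Dvd.intro_left _ rfl)
    refine ⟨?_, ?_⟩
    · rw [hs1, evalAt_mul] at hX0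
      exact (mul_eq_zero.1 hX0).resolve_right hs0
    · have h1 : ℓ ∣ Q * s := hs2 ▸ (dvd_pow_self ℓ hn).mul_left E
      rcases hℓ.dvd_or_dvd h1 with h2 | h2
      · exact evalAt_eq_zero_of_dvd h2 hℓ0
      · exact absurd (hs1 ▸ h2.mul_left P) hX
  refine ⟨P₁, Q₁, P₂, Q₂, R₁, R₂, f₁, f₂, hR, hr, ?_, ?_, ?_⟩
  · exact h.imp (fun h => ind A P₁ Q₁ _ h hA hf f₁) (fun h => ind B P₂ Q₂ _ h hB hg f₂)
  · rw [hwA, evalAt_mul] at hA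
    exact (mul_eq_zero.1 hA).resolve_right hw0
  · rw [hwB, evalAt_mul] at hB
    exact (mul_eq_zero.1 hB).resolve_right hw0

theorem not_X_zero_dvd {A : ℂ → ℂ → ℂ} {P : MvPolynomial (Fin 2) ℂ}
    (hP : ∀ u v, evalAt P u v = A u v) {v : ℂ} (h : A 0 v ≠ 0) : ¬ MvPolynomial.X 0 ∣ P := by
  intro hd
  rw [← hP] at h
  exact h (evalAt_eq_zero_of_dvd hd (by simp [evalAt]))

theorem not_X_one_dvd {A : ℂ → ℂ → ℂ} {P : MvPolynomial (Fin 2) ℂ}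
    (hP : ∀ u v, evalAt P u v = A u v) {u : ℂ} (h : A u 0 ≠ 0) : ¬ MvPolynomial.X 1 ∣ P := by
  intro hd
  rw [← hP] at h
  exact h (evalAt_eq_zero_of_dvd hd (by simp [evalAt]))

/-- Base points on the exceptional curve `u = 0`. -/
theorem isBasePoint_lower {A B E : ℂ → ℂ → ℂ} {n : ℕ} (hn : n ≠ 0) (hA : IsPoly A) (hB : IsPoly B)
    (hE : IsPoly E)
    (hU : ∀ u v, u ≠ 0 → v ≠ 0 → E u v * u ^ n ≠ 0 → C.velU z u v * (E u v * u ^ n) = A u v)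
    (hV : ∀ u v, u ≠ 0 → v ≠ 0 → E u v * u ^ n ≠ 0 → C.velV z u v * (E u v * u ^ n) = B u v)
    (hne : ∃ u v, E u v * u ^ n ≠ 0)
    (hE0 : E 0 v₀ ≠ 0) (hA0 : A 0 v₀ = 0) (hB0 : B 0 v₀ = 0)
    (h : ∃ v, A 0 v ≠ 0 ∨ B 0 v ≠ 0) : IsBasePoint C z 0 v₀ := by
  obtain ⟨PA, hPA⟩ := hA.exists_evalAt
  obtain ⟨PB, hPB⟩ := hB.exists_evalAt
  obtain ⟨PE, hPE⟩ := hE.exists_evalAt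
  have hD : ∀ u v, evalAt (PE * MvPolynomial.X 0 ^ n) u v = E u v * u ^ n := fun u v => by
    rw [evalAt_mul, hPE]; simp [evalAt]
  obtain ⟨v, hv⟩ := h
  exact isBasePoint_of_prime (MvPolynomial.X_prime (i := 0)) hn
    (isFraction_of_forall hPA hD hne hU) (isFraction_of_forall hPB hD hne hV)
    (by rwa [hPE]) (by simp [evalAt]) (by rwa [hPA]) (by rwa [hPB])
    (hv.imp (not_X_zero_dvd hPA) (not_X_zero_dvd hPB))

/-- Base points on the exceptional curve `v = 0`. -/
theorem isBasePoint_upper {A B E : ℂ → ℂ → ℂ} {n : ℕ} (hn : n ≠ 0) (hA : IsPoly A) (hB : IsPoly B)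
    (hE : IsPoly E)
    (hU : ∀ u v, u ≠ 0 → v ≠ 0 → E u v * v ^ n ≠ 0 → C.velU z u v * (E u v * v ^ n) = A u v)
    (hV : ∀ u v, u ≠ 0 → v ≠ 0 → E u v * v ^ n ≠ 0 → C.velV z u v * (E u v * v ^ n) = B u v)
    (hne : ∃ u v, E u v * v ^ n ≠ 0)
    (hE0 : E u₀ 0 ≠ 0) (hA0 : A u₀ 0 = 0) (hB0 : B u₀ 0 = 0)
    (h : ∃ u, A u 0 ≠ 0 ∨ B u 0 ≠ 0) : IsBasePoint C z u₀ 0 := by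
  obtain ⟨PA, hPA⟩ := hA.exists_evalAt
  obtain ⟨PB, hPB⟩ := hB.exists_evalAt
  obtain ⟨PE, hPE⟩ := hE.exists_evalAt
  have hD : ∀ u v, evalAt (PE * MvPolynomial.X 1 ^ n) u v = E u v * v ^ n := fun u v => by
    rw [evalAt_mul, hPE]; simp [evalAt]
  obtain ⟨v, hv⟩ := h
  exact isBasePoint_of_prime (MvPolynomial.X_prime (i := 1)) hn
    (isFraction_of_forall hPA hD hne hU) (isFraction_of_forall hPB hD hne hV)
    (by rwa [hPE]) (by simp [evalAt]) (by rwa [hPA]) (by rwa [hPB])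
    (hv.imp (not_X_one_dvd hPA) (not_X_one_dvd hPB))

/-- A base point at the intersection `u = v = 0` of two curves, for a system
`u' = A / (u v)`, `v' = B / u²`. -/
theorem isBasePoint_origin {A B : ℂ → ℂ → ℂ} (hA : IsPoly A) (hB : IsPoly B)
    (hU : ∀ u v, u ≠ 0 → v ≠ 0 → C.velU z u v * (u * v) = A u v)
    (hV : ∀ u v, u ≠ 0 → v ≠ 0 → C.velV z u v * u ^ 2 = B u v)
    (hA0 : A 0 0 = 0) (hB0 : B 0 0 = 0)
    (h1 : ∃ v, A 0 v ≠ 0) (h2 : ∃ u, A u 0 ≠ 0) (h3 : ∃ v, B 0 v ≠ 0) :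
    IsBasePoint C z 0 0 := by
  obtain ⟨PA, hPA⟩ := hA.exists_evalAt
  obtain ⟨PB, hPB⟩ := hB.exists_evalAt
  obtain ⟨v, h1⟩ := h1
  obtain ⟨u, h2⟩ := h2
  obtain ⟨w, h3⟩ := h3
  have p0 : Prime (MvPolynomial.X 0 : MvPolynomial (Fin 2) ℂ) := MvPolynomial.X_prime
  have p1 : Prime (MvPolynomial.X 1 : MvPolynomial (Fin 2) ℂ) := MvPolynomial.X_prime
  have r0 : IsRelPrime PA (MvPolynomial.X 0) :=
    (p0.irreducible.isRelPrime_iff_not_dvd.2 (not_X_zero_dvd hPA h1)).symm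
  have r1 : IsRelPrime PA (MvPolynomial.X 1) :=
    (p1.irreducible.isRelPrime_iff_not_dvd.2 (not_X_one_dvd hPA h2)).symm
  have r2 : IsRelPrime PB (MvPolynomial.X 0) :=
    (p0.irreducible.isRelPrime_iff_not_dvd.2 (not_X_zero_dvd hPB h3)).symm
  have r3 : IsRelPrime (MvPolynomial.X 0 : MvPolynomial (Fin 2) ℂ) (MvPolynomial.X 1) :=
    p0.irreducible.isRelPrime_iff_not_dvd.2
      (not_X_zero_dvd (A := fun _ v => v) (v := 1) (by simp [evalAt]) (by simp))
  obtain ⟨-, S, hS, hS'⟩ := isFraction_of_forall (f := C.velU z) (A := A) (D := fun u v => u * v)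
    (Q := MvPolynomial.X 0 * MvPolynomial.X 1) hPA (by simp [evalAt]) ⟨1, 1, by simp⟩
    (fun u v hu hv _ => hU u v hu hv)
  obtain ⟨-, T, hT, hT'⟩ := isFraction_of_forall (f := C.velV z) (A := B) (D := fun u v => u ^ 2)
    (Q := MvPolynomial.X 0 ^ 2) hPB (by simp [evalAt]) ⟨1, 1, by simp⟩
    (fun u v hu hv _ => hV u v hu hv)
  refine ⟨PA, MvPolynomial.X 0 * MvPolynomial.X 1, PB, MvPolynomial.X 0 ^ 2, MvPolynomial.X 0,
    MvPolynomial.X 1, ⟨mul_ne_zero p0.ne_zero p1.ne_zero, r0.mul_right r1, S, hS, hS'⟩,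
    ⟨pow_ne_zero _ p0.ne_zero, r2.pow_right, T, hT, hT'⟩, by ring, r3, Or.inl ⟨?_, ?_⟩, ?_, ?_⟩
  · rw [hPA, hA0]
  · simp [evalAt]
  · rw [evalAt_mul, hPA, hA0, zero_mul]
  · rw [evalAt_mul, hPB, hB0, zero_mul]

end BasePoints

/-! ### The vector field in the charts -/

section Fields

variable (c : Coeffs)

theorem xdot_eq (z x y : ℂ) :
    c.xdot z x y = x * (3 * y ^ 2 + c.c3 z) + c.c2 z * y ^ 2 + c.c1 z * y + c.c0 z := by
  have h : HasDerivAt (fun η => c.H z x η)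
      (0 - x * (3 * y ^ 2 + c.c3 z) - c.c2 z / 3 * (3 * y ^ 2) - c.c1 z / 2 * (2 * y)
        - c.c0 z) y := by
    unfold Coeffs.H
    have h3 : HasDerivAt (fun η : ℂ => η ^ 3) (3 * y ^ 2) y := by simpa using hasDerivAt_pow 3 y
    have h2 : HasDerivAt (fun η : ℂ => η ^ 2) (2 * y) y := by simpa using hasDerivAt_pow 2 y
    have h1 : HasDerivAt (fun η : ℂ => c.c3 z * η) (c.c3 z) y := by
      simpa using (hasDerivAt_id y).const_mul (c.c3 z)
    have h0 : HasDerivAt (fun η : ℂ => c.c0 z * η) (c.c0 z) y := by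
      simpa using (hasDerivAt_id y).const_mul (c.c0 z)
    exact (((((hasDerivAt_const y (x ^ 2 / 2)).sub ((h3.add h1).const_mul x)).sub
      (h3.const_mul _)).sub (h2.const_mul _)).sub h0)
  rw [Coeffs.xdot, h.deriv]; ring

theorem ydot_eq (z x y : ℂ) : c.ydot z x y = x - y ^ 3 - c.c3 z * y := by
  have h : HasDerivAt (fun ξ => c.H z ξ y) (2 * x / 2 - 1 * (y ^ 3 + c.c3 z * y)) x := by
    unfold Coeffs.H
    have h2 : HasDerivAt (fun ξ : ℂ => ξ ^ 2) (2 * x) x := by simpa using hasDerivAt_pow 2 x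
    exact (((((h2.div_const 2).sub ((hasDerivAt_id x).mul_const _)).sub_const _).sub_const
      _).sub_const _)
  rw [Coeffs.ydot, h.deriv]; ring

theorem upper_velU (C : Chart) (a : ℂ → ℂ) (z u v : ℂ) :
    (C.upper a fun _ => 0).velU z u v =
      (C.velU z (u * v + a z) v - deriv a z - u * C.velV z (u * v + a z) v) / v := by
  simp [Chart.upper]

theorem upper_velV (C : Chart) (a : ℂ → ℂ) (z u v : ℂ) :
    (C.upper a fun _ => 0).velV z u v = C.velV z (u * v + a z) v := by
  simp [Chart.upper]

theorem lower_velU (C : Chart) (a : ℂ → ℂ) (z u v : ℂ) :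
    (C.lower a fun _ => 0).velU z u v = C.velU z (u + a z) (u * v) - deriv a z := by
  simp [Chart.lower]

theorem lower_velV (C : Chart) (a : ℂ → ℂ) (z u v : ℂ) :
    (C.lower a fun _ => 0).velV z u v =
      (C.velV z (u + a z) (u * v) - v * (C.velU z (u + a z) (u * v) - deriv a z)) / u := by
  simp [Chart.lower]

variable {c} {z u v : ℂ}

theorem chartu0_velU (hu : u ≠ 0) : (chartu0 c).velU z u v =
    -(3 * v ^ 2 + c.c3 z * u ^ 2 + c.c2 z * u * v ^ 2 + c.c1 z * u ^ 2 * v + c.c0 z * u ^ 3) / u := by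
  simp only [chartu0, xdot_eq]; field_simp

theorem chartu0_velV (hu : u ≠ 0) : (chartu0 c).velV z u v =
    (u ^ 2 - 4 * v ^ 3 - 2 * c.c3 z * u ^ 2 * v - c.c2 z * u * v ^ 3 - c.c1 z * u ^ 2 * v ^ 2
      - c.c0 z * u ^ 3 * v) / u ^ 2 := by
  simp only [chartu0, xdot_eq, ydot_eq]; field_simp; ring

theorem chartU0_velU (hv : v ≠ 0) : (chartU0 c).velU z u v =
    (4 * u + c.c2 z * v + (c.c1 z + 2 * c.c3 z * u - u ^ 2) * v ^ 2 + c.c0 z * v ^ 3) / v ^ 2 := by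
  simp only [chartU0, xdot_eq, ydot_eq]; field_simp; ring

theorem chartU0_velV (hv : v ≠ 0) : (chartU0 c).velV z u v =
    (1 + (c.c3 z - u) * v ^ 2) / v := by
  simp only [chartU0, ydot_eq]; field_simp; ring

theorem upperChart_one : upperChart c 1 = (chartu0 c).upper (fun _ => 0) fun _ => 0 := rfl
theorem lowerChart_one : lowerChart c 1 = (chartu0 c).lower (fun _ => 0) fun _ => 0 := rfl
theorem upperChart_two :
    upperChart c 2 = (upperChart c 1).upper (fun _ => 0) fun _ => 0 := rfl
theorem lowerChart_two :
    lowerChart c 2 = (upperChart c 1).lower (fun _ => 0) fun _ => 0 := rfl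
theorem upperChart_three :
    upperChart c 3 = (lowerChart c 2).upper (fun _ => 0) fun _ => 0 := rfl
theorem lowerChart_three :
    lowerChart c 3 = (lowerChart c 2).lower (fun _ => 0) fun _ => 0 := rfl

theorem upperChart_one_velU (hu : u ≠ 0) (hv : v ≠ 0) : (upperChart c 1).velU z u v =
    (-u ^ 2 + v + c.c3 z * u ^ 2 * v) / (u * v) := by
  simp only [upperChart_one, upper_velU, deriv_const, add_zero]
  rw [chartu0_velU (mul_ne_zero hu hv), chartu0_velV (mul_ne_zero hu hv)]
  field_simp; ring

theorem upperChart_one_velV (hu : u ≠ 0) (hv : v ≠ 0) : (upperChart c 1).velV z u v =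
    (u ^ 2 - 4 * v - 2 * c.c3 z * u ^ 2 * v - c.c2 z * u * v ^ 2 - c.c1 z * u ^ 2 * v ^ 2
      - c.c0 z * u ^ 3 * v ^ 2) / u ^ 2 := by
  simp only [upperChart_one, upper_velV, add_zero]
  rw [chartu0_velV (mul_ne_zero hu hv)]
  field_simp

theorem lowerChart_one_velU (hu : u ≠ 0) : (lowerChart c 1).velU z u v =
    -u * (3 * v ^ 2 + c.c3 z) - u ^ 2 * (c.c2 z * v ^ 2 + c.c1 z * v + c.c0 z) := by
  simp only [lowerChart_one, lower_velU, deriv_const, add_zero]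
  rw [chartu0_velU hu]
  field_simp; ring

theorem lowerChart_one_velV (hu : u ≠ 0) : (lowerChart c 1).velV z u v =
    (1 - u * (v ^ 3 + c.c3 z * v)) / u := by
  simp only [lowerChart_one, lower_velV, deriv_const, add_zero]
  rw [chartu0_velU hu, chartu0_velV hu]
  field_simp; ring

theorem upperChart_two_velU (hu : u ≠ 0) (hv : v ≠ 0) : (upperChart c 2).velU z u v =
    (5 - 2 * u ^ 2 * v + 3 * c.c3 z * u ^ 2 * v ^ 2 + c.c2 z * u * v ^ 2 + c.c1 z * u ^ 2 * v ^ 3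
      + c.c0 z * u ^ 3 * v ^ 4) / (u * v ^ 2) := by
  simp only [upperChart_two, upper_velU, deriv_const, add_zero]
  rw [upperChart_one_velU (mul_ne_zero hu hv) hv, upperChart_one_velV (mul_ne_zero hu hv) hv]
  field_simp; ring

theorem upperChart_two_velV (hu : u ≠ 0) (hv : v ≠ 0) : (upperChart c 2).velV z u v =
    (u ^ 2 * v - 4 - 2 * c.c3 z * u ^ 2 * v ^ 2 - c.c2 z * u * v ^ 2 - c.c1 z * u ^ 2 * v ^ 3
      - c.c0 z * u ^ 3 * v ^ 4) / (u ^ 2 * v) := by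
  simp only [upperChart_two, upper_velV, add_zero]
  rw [upperChart_one_velV (mul_ne_zero hu hv) hv]
  field_simp

theorem lowerChart_two_velU (hu : u ≠ 0) (hv : v ≠ 0) : (lowerChart c 2).velU z u v =
    (-u + v + c.c3 z * u ^ 2 * v) / (u * v) := by
  simp only [lowerChart_two, lower_velU, deriv_const, add_zero]
  rw [upperChart_one_velU hu (mul_ne_zero hu hv)]
  field_simp; ring

theorem lowerChart_two_velV (hu : u ≠ 0) (hv : v ≠ 0) : (lowerChart c 2).velV z u v =
    (2 * u - 5 * v - 3 * c.c3 z * u ^ 2 * v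
      - u ^ 2 * v ^ 2 * (c.c2 z + c.c1 z * u + c.c0 z * u ^ 2)) / u ^ 2 := by
  simp only [lowerChart_two, lower_velV, deriv_const, add_zero]
  rw [upperChart_one_velU hu (mul_ne_zero hu hv), upperChart_one_velV hu (mul_ne_zero hu hv)]
  field_simp; ring

theorem upperChart_three_velU (hu : u ≠ 0) (hv : v ≠ 0) : (upperChart c 3).velU z u v =
    (6 - 3 * u + 4 * c.c3 z * u ^ 2 * v ^ 2 + c.c2 z * u ^ 2 * v ^ 3 + c.c1 z * u ^ 3 * v ^ 4
      + c.c0 z * u ^ 4 * v ^ 5) / (u * v ^ 2) := by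
  simp only [upperChart_three, upper_velU, deriv_const, add_zero]
  rw [lowerChart_two_velU (mul_ne_zero hu hv) hv, lowerChart_two_velV (mul_ne_zero hu hv) hv]
  field_simp; ring

theorem upperChart_three_velV (hu : u ≠ 0) (hv : v ≠ 0) : (upperChart c 3).velV z u v =
    (2 * u - 5 - 3 * c.c3 z * u ^ 2 * v ^ 2 - c.c2 z * u ^ 2 * v ^ 3 - c.c1 z * u ^ 3 * v ^ 4
      - c.c0 z * u ^ 4 * v ^ 5) / (u ^ 2 * v) := by
  simp only [upperChart_three, upper_velV, add_zero]
  rw [lowerChart_two_velV (mul_ne_zero hu hv) hv]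
  field_simp; ring

theorem lowerChart_three_velU (hu : u ≠ 0) (hv : v ≠ 0) : (lowerChart c 3).velU z u v =
    (-1 + v + c.c3 z * u ^ 2 * v) / (u * v) := by
  simp only [lowerChart_three, lower_velU, deriv_const, add_zero]
  rw [lowerChart_two_velU hu (mul_ne_zero hu hv)]
  field_simp; ring

theorem lowerChart_three_velV (hu : u ≠ 0) (hv : v ≠ 0) : (lowerChart c 3).velV z u v =
    (3 - 6 * v - 4 * c.c3 z * u ^ 2 * v
      - u ^ 3 * v ^ 2 * (c.c2 z + c.c1 z * u + c.c0 z * u ^ 2)) / u ^ 2 := by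
  simp only [lowerChart_three, lower_velV, deriv_const, add_zero]
  rw [lowerChart_two_velU hu (mul_ne_zero hu hv), lowerChart_two_velV hu (mul_ne_zero hu hv)]
  field_simp; ring

end Fields

/-! ### Base points before the two cascades -/

section SpecialBasePoints

variable {c : Coeffs} {z : ℂ}

theorem affineChart_not_isBasePoint (x y : ℂ) : ¬ IsBasePoint (affineChart c) z x y := by
  refine not_isBasePoint_of_determinate
    (A := fun x y => x * (3 * y ^ 2 + c.c3 z) + c.c2 z * y ^ 2 + c.c1 z * y + c.c0 z)
    (D₁ := fun _ _ => 1) (B := fun x y => x - y ^ 3 - c.c3 z * y) (D₂ := fun _ _ => 1)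
    (by repeat' constructor) (by repeat' constructor) (by repeat' constructor) (by repeat' constructor)
    ⟨0, 0, one_ne_zero⟩ ⟨0, 0, one_ne_zero⟩ ?_ ?_ (Or.inr one_ne_zero) (Or.inr one_ne_zero)
  · intro u v _ _ _; simp [affineChart, xdot_eq]
  · intro u v _ _ _; simp [affineChart, ydot_eq]

theorem chartu0_isBasePoint_iff (v : ℂ) : IsBasePoint (chartu0 c) z 0 v ↔ v = 0 := by
  set A : ℂ → ℂ → ℂ := fun u v => -u * (3 * v ^ 2 + c.c3 z * u ^ 2 + c.c2 z * u * v ^ 2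
    + c.c1 z * u ^ 2 * v + c.c0 z * u ^ 3) with hAdef
  set B : ℂ → ℂ → ℂ := fun u v => u ^ 2 - 4 * v ^ 3 - 2 * c.c3 z * u ^ 2 * v - c.c2 z * u * v ^ 3
    - c.c1 z * u ^ 2 * v ^ 2 - c.c0 z * u ^ 3 * v with hBdef
  have hA : IsPoly A := by repeat' constructor
  have hB : IsPoly B := by repeat' constructor
  have hU : ∀ u v, u ≠ 0 → v ≠ 0 → (1 : ℂ) * u ^ 2 ≠ 0 →
      (chartu0 c).velU z u v * (1 * u ^ 2) = A u v := by
    intro u v hu _ _; rw [chartu0_velU hu]; simp only [hAdef]; field_simp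
  have hV : ∀ u v, u ≠ 0 → v ≠ 0 → (1 : ℂ) * u ^ 2 ≠ 0 →
      (chartu0 c).velV z u v * (1 * u ^ 2) = B u v := by
    intro u v hu _ _; rw [chartu0_velV hu]; simp only [hBdef]; field_simp
  constructor
  · contrapose!
    intro hv
    exact not_isBasePoint_of_ne hA hB (D := fun u _ => 1 * u ^ 2)
      (by repeat' constructor) ⟨1, 0, by simp⟩ hU hV (Or.inr (by simp [hBdef, hv]))
  · rintro rfl
    exact isBasePoint_lower (E := fun _ _ => 1) two_ne_zero hA hB (by repeat' constructor) hU hV ⟨1, 0, by simp⟩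
      one_ne_zero (by simp [hAdef]) (by simp [hBdef]) ⟨1, Or.inr (by simp [hBdef])⟩

theorem chartU0_isBasePoint_iff (u : ℂ) : IsBasePoint (chartU0 c) z u 0 ↔ u = 0 := by
  set A : ℂ → ℂ → ℂ := fun u v => 4 * u + c.c2 z * v + (c.c1 z + 2 * c.c3 z * u - u ^ 2) * v ^ 2
    + c.c0 z * v ^ 3 with hAdef
  set B : ℂ → ℂ → ℂ := fun u v => v * (1 + (c.c3 z - u) * v ^ 2) with hBdef
  have hA : IsPoly A := by repeat' constructor
  have hB : IsPoly B := by repeat' constructor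
  have hU : ∀ u v, u ≠ 0 → v ≠ 0 → (1 : ℂ) * v ^ 2 ≠ 0 →
      (chartU0 c).velU z u v * (1 * v ^ 2) = A u v := by
    intro u v _ hv _; rw [chartU0_velU hv]; simp only [hAdef]; field_simp
  have hV : ∀ u v, u ≠ 0 → v ≠ 0 → (1 : ℂ) * v ^ 2 ≠ 0 →
      (chartU0 c).velV z u v * (1 * v ^ 2) = B u v := by
    intro u v _ hv _; rw [chartU0_velV hv]; simp only [hBdef]; field_simp
  constructor
  · contrapose!
    intro hv
    exact not_isBasePoint_of_ne hA hB (D := fun _ v => 1 * v ^ 2)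
      (by repeat' constructor) ⟨0, 1, by simp⟩ hU hV (Or.inl (by simp [hAdef, hv]))
  · rintro rfl
    exact isBasePoint_upper (E := fun _ _ => 1) two_ne_zero hA hB (by repeat' constructor) hU hV ⟨0, 1, by simp⟩
      one_ne_zero (by simp [hAdef]) (by simp [hBdef]) ⟨1, Or.inl (by simp [hAdef])⟩

theorem upperChart_one_isBasePoint_iff (u : ℂ) : IsBasePoint (upperChart c 1) z u 0 ↔ u = 0 := by
  constructor
  · contrapose!
    intro hu
    refine not_isBasePoint_of_ne
      (A := fun u v => u * (-u ^ 2 + v + c.c3 z * u ^ 2 * v))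
      (B := fun u v => v * (u ^ 2 - 4 * v - 2 * c.c3 z * u ^ 2 * v - c.c2 z * u * v ^ 2
        - c.c1 z * u ^ 2 * v ^ 2 - c.c0 z * u ^ 3 * v ^ 2))
      (D := fun u v => u ^ 2 * v) (by repeat' constructor) (by repeat' constructor) (by repeat' constructor) ⟨1, 1, by simp⟩ ?_ ?_ (Or.inl (by simp [hu]))
    · intro u v hu hv _; rw [upperChart_one_velU hu hv]; field_simp
    · intro u v hu hv _; rw [upperChart_one_velV hu hv]; field_simp
  · rintro rfl
    refine isBasePoint_origin
      (A := fun u v => -u ^ 2 + v + c.c3 z * u ^ 2 * v)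
      (B := fun u v => u ^ 2 - 4 * v - 2 * c.c3 z * u ^ 2 * v - c.c2 z * u * v ^ 2
        - c.c1 z * u ^ 2 * v ^ 2 - c.c0 z * u ^ 3 * v ^ 2) (by repeat' constructor) (by repeat' constructor) ?_ ?_ (by simp) (by simp)
        ⟨1, by simp⟩ ⟨1, by simp⟩ ⟨1, by simp⟩
    · intro u v hu hv; rw [upperChart_one_velU hu hv]; field_simp
    · intro u v hu hv; rw [upperChart_one_velV hu hv]; field_simp

theorem lowerChart_one_not_isBasePoint (v : ℂ) : ¬ IsBasePoint (lowerChart c 1) z 0 v := by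
  refine not_isBasePoint_of_ne
    (A := fun u v => u * (-u * (3 * v ^ 2 + c.c3 z)
      - u ^ 2 * (c.c2 z * v ^ 2 + c.c1 z * v + c.c0 z)))
    (B := fun u v => 1 - u * (v ^ 3 + c.c3 z * v))
    (D := fun u _ => u) (by repeat' constructor) (by repeat' constructor) (by repeat' constructor) ⟨1, 1, by simp⟩ ?_ ?_ (Or.inr (by simp))
  · intro u v hu hv _; rw [lowerChart_one_velU hu]; ring
  · intro u v hu hv _; rw [lowerChart_one_velV hu]; field_simp

theorem lowerChart_two_isBasePoint_iff (v : ℂ) : IsBasePoint (lowerChart c 2) z 0 v ↔ v = 0 := by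
  constructor
  · contrapose!
    intro hv
    refine not_isBasePoint_of_ne
      (A := fun u v => u * (-u + v + c.c3 z * u ^ 2 * v))
      (B := fun u v => v * (2 * u - 5 * v - 3 * c.c3 z * u ^ 2 * v
        - u ^ 2 * v ^ 2 * (c.c2 z + c.c1 z * u + c.c0 z * u ^ 2)))
      (D := fun u v => u ^ 2 * v) (by repeat' constructor) (by repeat' constructor) (by repeat' constructor) ⟨1, 1, by simp⟩ ?_ ?_ (Or.inr (by simp [hv]))
    · intro u v hu hv _; rw [lowerChart_two_velU hu hv]; field_simp
    · intro u v hu hv _; rw [lowerChart_two_velV hu hv]; field_simp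
  · rintro rfl
    refine isBasePoint_origin
      (A := fun u v => -u + v + c.c3 z * u ^ 2 * v)
      (B := fun u v => 2 * u - 5 * v - 3 * c.c3 z * u ^ 2 * v
        - u ^ 2 * v ^ 2 * (c.c2 z + c.c1 z * u + c.c0 z * u ^ 2)) (by repeat' constructor) (by repeat' constructor) ?_ ?_ (by simp) (by simp)
        ⟨1, by simp⟩ ⟨1, by simp⟩ ⟨1, by simp⟩
    · intro u v hu hv; rw [lowerChart_two_velU hu hv]; field_simp
    · intro u v hu hv; rw [lowerChart_two_velV hu hv]; field_simp

theorem upperChart_two_not_isBasePoint (u : ℂ) : ¬ IsBasePoint (upperChart c 2) z u 0 := by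
  refine not_isBasePoint_of_determinate
    (A := fun u v => 5 - 2 * u ^ 2 * v + 3 * c.c3 z * u ^ 2 * v ^ 2 + c.c2 z * u * v ^ 2
      + c.c1 z * u ^ 2 * v ^ 3 + c.c0 z * u ^ 3 * v ^ 4)
    (D₁ := fun u v => u * v ^ 2)
    (B := fun u v => u ^ 2 * v - 4 - 2 * c.c3 z * u ^ 2 * v ^ 2 - c.c2 z * u * v ^ 2
      - c.c1 z * u ^ 2 * v ^ 3 - c.c0 z * u ^ 3 * v ^ 4) (D₂ := fun u v => u ^ 2 * v)
    (by repeat' constructor) (by repeat' constructor) (by repeat' constructor) (by repeat' constructor) ⟨1, 1, by simp⟩ ⟨1, 1, by simp⟩ ?_ ?_ (Or.inl (by simp)) (Or.inl (by simp))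
  · intro u v hu hv _; rw [upperChart_two_velU hu hv]; field_simp
  · intro u v hu hv _; rw [upperChart_two_velV hu hv]; field_simp

theorem upperChart_three_isBasePoint_iff (u : ℂ) :
    IsBasePoint (upperChart c 3) z u 0 ↔ u = 2 := by
  set A : ℂ → ℂ → ℂ := fun u v => 6 - 3 * u + 4 * c.c3 z * u ^ 2 * v ^ 2 + c.c2 z * u ^ 2 * v ^ 3
    + c.c1 z * u ^ 3 * v ^ 4 + c.c0 z * u ^ 4 * v ^ 5 with hAdef
  set B : ℂ → ℂ → ℂ := fun u v => 2 * u - 5 - 3 * c.c3 z * u ^ 2 * v ^ 2 - c.c2 z * u ^ 2 * v ^ 3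
    - c.c1 z * u ^ 3 * v ^ 4 - c.c0 z * u ^ 4 * v ^ 5 with hBdef
  have hA : IsPoly A := by repeat' constructor
  have hB : IsPoly B := by repeat' constructor
  constructor
  · contrapose!
    intro hu
    rcases eq_or_ne u 0 with rfl | hu0
    · refine not_isBasePoint_of_determinate (D₁ := fun u v => u * v ^ 2)
        (D₂ := fun u v => u ^ 2 * v) hA (by repeat' constructor) hB (by repeat' constructor) ⟨1, 1, by simp⟩ ⟨1, 1, by simp⟩ ?_ ?_
        (Or.inl (by simp [hAdef])) (Or.inl (by simp [hBdef]))
      · intro u v hu hv _; rw [upperChart_three_velU hu hv]; simp only [hAdef]; field_simp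
      · intro u v hu hv _; rw [upperChart_three_velV hu hv]; simp only [hBdef]; field_simp
    · refine not_isBasePoint_of_ne (A := fun u v => u * A u v) (B := fun u v => v * B u v)
        (D := fun u v => u ^ 2 * v ^ 2) (IsPoly.fst.mul hA) (IsPoly.snd.mul hB) (by repeat' constructor)
        ⟨1, 1, by simp⟩ ?_ ?_ (Or.inl ?_)
      · intro u v hu hv _; rw [upperChart_three_velU hu hv]; simp only [hAdef]; field_simp
      · intro u v hu hv _; rw [upperChart_three_velV hu hv]; simp only [hBdef]; field_simp
      · simp only [hAdef]
        refine mul_ne_zero hu0 fun h => hu ?_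
        linear_combination -h / 3
  · rintro rfl
    refine isBasePoint_upper (A := fun u v => u * A u v) (B := fun u v => v * B u v)
      (E := fun u _ => u ^ 2) two_ne_zero (IsPoly.fst.mul hA) (IsPoly.snd.mul hB) (by repeat' constructor) ?_ ?_
      ⟨1, 1, by simp⟩ (by simp) (by simp [hAdef]; norm_num) (by simp)
      ⟨1, Or.inl (by simp [hAdef]; norm_num)⟩
    · intro u v hu hv _; rw [upperChart_three_velU hu hv]; simp only [hAdef]; field_simp
    · intro u v hu hv _; rw [upperChart_three_velV hu hv]; simp only [hBdef]; field_simp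

theorem lowerChart_three_isBasePoint_iff (v : ℂ) :
    IsBasePoint (lowerChart c 3) z 0 v ↔ v * 2 = 1 := by
  set A : ℂ → ℂ → ℂ := fun u v => -1 + v + c.c3 z * u ^ 2 * v with hAdef
  set B : ℂ → ℂ → ℂ := fun u v => 3 - 6 * v - 4 * c.c3 z * u ^ 2 * v
      - u ^ 3 * v ^ 2 * (c.c2 z + c.c1 z * u + c.c0 z * u ^ 2) with hBdef
  have hA : IsPoly A := by repeat' constructor
  have hB : IsPoly B := by repeat' constructor
  constructor
  · contrapose!
    intro hv
    rcases eq_or_ne v 0 with rfl | hv0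
    · refine not_isBasePoint_of_determinate (D₁ := fun u v => u * v)
        (D₂ := fun u _ => u ^ 2) hA (by repeat' constructor) hB (by repeat' constructor) ⟨1, 1, by simp⟩ ⟨1, 1, by simp⟩ ?_ ?_
        (Or.inl (by simp [hAdef])) (Or.inl (by simp [hBdef]))
      · intro u v hu hv _; rw [lowerChart_three_velU hu hv]; simp only [hAdef]; field_simp
      · intro u v hu hv _; rw [lowerChart_three_velV hu hv]; simp only [hBdef]; field_simp
    · refine not_isBasePoint_of_ne (A := fun u v => u * A u v) (B := fun u v => v * B u v)
        (D := fun u v => v * u ^ 2) (IsPoly.fst.mul hA) (IsPoly.snd.mul hB) (by repeat' constructor)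
        ⟨1, 1, by simp⟩ ?_ ?_ (Or.inr ?_)
      · intro u v hu hv _; rw [lowerChart_three_velU hu hv]; simp only [hAdef]; field_simp
      · intro u v hu hv _; rw [lowerChart_three_velV hu hv]; simp only [hBdef]; field_simp
      · simp only [hBdef]
        refine mul_ne_zero hv0 fun h => hv ?_
        linear_combination -h / 3
  · intro hv
    have hv' : v = 1 / 2 := by linear_combination hv / 2
    subst hv'
    refine isBasePoint_lower (A := fun u v => u * A u v) (B := fun u v => v * B u v)
      (E := fun _ v => v) two_ne_zero (IsPoly.fst.mul hA) (IsPoly.snd.mul hB) (by repeat' constructor) ?_ ?_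
      ⟨1, 1, by simp⟩ (by simp) (by simp) (by simp [hBdef]; norm_num)
      ⟨1, Or.inr (by simp [hBdef]; norm_num)⟩
    · intro u v hu hv _; rw [lowerChart_three_velU hu hv]; simp only [hAdef]; field_simp
    · intro u v hu hv _; rw [lowerChart_three_velV hu hv]; simp only [hBdef]; field_simp

end SpecialBasePoints

/-! ### Division of polynomials by a variable -/

section PolyLemmas

variable {f : ℂ → ℂ → ℂ}

theorem IsPoly.continuous (hf : IsPoly f) : Continuous fun p : ℂ × ℂ => f p.1 p.2 := by
  induction hf with
  | const a => exact continuous_const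
  | fst => exact continuous_fst
  | snd => exact continuous_snd
  | add _ _ h₁ h₂ => exact h₁.add h₂
  | sub _ _ h₁ h₂ => exact h₁.sub h₂
  | mul _ _ h₁ h₂ => exact h₁.mul h₂
  | neg _ h => exact h.neg
  | pow n _ h => exact h.pow n

/-- Division with remainder by the second variable. -/
theorem IsPoly.exists_div_snd (hf : IsPoly f) :
    ∃ q, IsPoly q ∧ ∀ u v, f u v = f u 0 + v * q u v := by
  have h0 : ∀ {g : ℂ → ℂ → ℂ}, IsPoly g → IsPoly fun u _ => g u 0 := fun hg =>
    hg.comp .fst (.const 0)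
  have hmul : ∀ {f g p q : ℂ → ℂ → ℂ}, IsPoly f → IsPoly g → IsPoly p → IsPoly q →
      (∀ u v, f u v = f u 0 + v * p u v) → (∀ u v, g u v = g u 0 + v * q u v) →
      ∃ q, IsPoly q ∧ ∀ u v, f u v * g u v = f u 0 * g u 0 + v * q u v := by
    intro f g p q hf hg hp hq h₁ h₂
    refine ⟨fun u v => p u v * g u v + f u 0 * q u v, (hp.mul hg).add ((h0 hf).mul hq), fun u v => ?_⟩
    linear_combination g u v * h₁ u v + f u 0 * h₂ u v
  induction hf with
  | const a => exact ⟨fun _ _ => 0, .const 0, fun u v => by ring⟩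
  | fst => exact ⟨fun _ _ => 0, .const 0, fun u v => by ring⟩
  | snd => exact ⟨fun _ _ => 1, .const 1, fun u v => by ring⟩
  | add _ _ h₁ h₂ =>
    obtain ⟨⟨p, hp, h₁⟩, ⟨q, hq, h₂⟩⟩ := And.intro h₁ h₂
    exact ⟨_, hp.add hq, fun u v => by linear_combination h₁ u v + h₂ u v⟩
  | sub _ _ h₁ h₂ =>
    obtain ⟨⟨p, hp, h₁⟩, ⟨q, hq, h₂⟩⟩ := And.intro h₁ h₂
    exact ⟨_, hp.sub hq, fun u v => by linear_combination h₁ u v - h₂ u v⟩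
  | mul hf hg h₁ h₂ =>
    obtain ⟨⟨p, hp, h₁⟩, ⟨q, hq, h₂⟩⟩ := And.intro h₁ h₂
    exact hmul hf hg hp hq h₁ h₂
  | neg _ h =>
    obtain ⟨p, hp, h⟩ := h
    exact ⟨_, hp.neg, fun u v => by linear_combination -h u v⟩
  | @pow g n hg h =>
    obtain ⟨p, hp, h⟩ := h
    induction n with
    | zero => exact ⟨fun _ _ => 0, .const 0, fun u v => by ring⟩
    | succ n ih =>
      obtain ⟨q, hq, ih⟩ := ih
      obtain ⟨s, hs, h'⟩ := hmul (hg.pow n) hg hq hp ih h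
      exact ⟨s, hs, fun u v => by beta_reduce; rw [pow_succ, pow_succ, h']⟩

/-- Division with remainder by the first variable. -/
theorem IsPoly.exists_div_fst (hf : IsPoly f) :
    ∃ q, IsPoly q ∧ ∀ u v, f u v = f 0 v + u * q u v := by
  obtain ⟨q, hq, h⟩ := (hf.comp .snd .fst).exists_div_snd
  exact ⟨fun u v => q v u, hq.comp .snd .fst, fun u v => h v u⟩

theorem IsPoly.exists_ne (hf : IsPoly f) {u₀ v₀ : ℂ} (h : f u₀ v₀ ≠ 0) :
    ∃ u v, u ≠ 0 ∧ v ≠ 0 ∧ f u v ≠ 0 := by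
  obtain ⟨P, hP⟩ := hf.exists_evalAt
  have hP0 : P ≠ 0 := ne_zero_of_evalAt (u := u₀) (v := v₀) (by rwa [hP])
  have h1 : MvPolynomial.X 0 * MvPolynomial.X 1 * P ≠ 0 :=
    mul_ne_zero (mul_ne_zero (MvPolynomial.X_ne_zero _) (MvPolynomial.X_ne_zero _)) hP0
  by_contra! hcon
  refine h1 (evalAt_injective fun u v => ?_)
  simp only [evalAt_mul, hP]
  by_cases hu : u = 0
  · simp [hu, evalAt]
  by_cases hv : v = 0
  · simp [hv, evalAt]
  rw [hcon u v hu hv]; simp [evalAt]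

end PolyLemmas

/-! ### Cascades of blow-ups: the charts `(U, V)` -/

section Cascade

/-- The chart `(U_m, V_m)` after `m` blow-ups of the points `(a_j(z), 0)`, `j < m`, each one in the
`upper` chart of the preceding one. -/
noncomputable def casc (C : Chart) (a : ℕ → ℂ → ℂ) : ℕ → Chart
  | 0 => C
  | m + 1 => (casc C a m).upper (a m) fun _ => 0

/-- The first coordinate in the initial chart of the point `(U, V)` of the `m`-th chart of a
cascade: `∑_{j < m} a_j V^j + U V^m`. -/
def cascLift (a : ℕ → ℂ) : ℕ → ℂ → ℂ → ℂ
  | 0, U, _ => U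
  | m + 1, U, V => cascLift a m (U * V + a m) V

/-- The polynomial `∑_{i < j} a_{m+i} V^i`. -/
def cascTail (a : ℕ → ℂ) : ℕ → ℕ → ℂ → ℂ
  | 0, _, _ => 0
  | j + 1, m, V => a m + V * cascTail a j (m + 1) V

/-- The derivative of `cascTail a j m` with respect to `V`. -/
def cascTailDeriv (a : ℕ → ℂ) : ℕ → ℕ → ℂ → ℂ
  | 0, _, _ => 0
  | j + 1, m, V => cascTail a j (m + 1) V + V * cascTailDeriv a j (m + 1) V

theorem cascLift_sub_cascTail (a : ℕ → ℂ) (m j : ℕ) (U V : ℂ) :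
    cascLift a m U V - cascTail a (m + j) 0 V = V ^ m * (U - cascTail a j m V) := by
  induction m generalizing U j with
  | zero => simp [cascLift]
  | succ m ih =>
    have := ih (j + 1) (U * V + a m)
    rw [show m + (j + 1) = m + 1 + j by ring] at this
    rw [cascLift, this, cascTail]; ring

theorem cascLift_eq (a : ℕ → ℂ) (m : ℕ) (U V : ℂ) :
    cascLift a m U V = cascTail a m 0 V + V ^ m * U := by
  have := cascLift_sub_cascTail a m 0 U V
  rw [add_zero, cascTail] at this
  linear_combination this

theorem cascLift_zero_right (a : ℕ → ℂ) {m : ℕ} (hm : m ≠ 0) (U : ℂ) :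
    cascLift a m U 0 = a 0 := by
  obtain ⟨k, rfl⟩ := Nat.exists_eq_succ_of_ne_zero hm
  rw [cascLift_eq]; simp [cascTail]

theorem isPoly_cascTail (a : ℕ → ℂ) (j m : ℕ) : IsPoly fun _ v => cascTail a j m v := by
  induction j generalizing m with
  | zero => exact .const 0
  | succ j ih => exact (IsPoly.const _).add (IsPoly.snd.mul (ih _))

theorem isPoly_cascTailDeriv (a : ℕ → ℂ) (j m : ℕ) :
    IsPoly fun _ v => cascTailDeriv a j m v := by
  induction j generalizing m with
  | zero => exact .const 0
  | succ j ih => exact (isPoly_cascTail _ _ _).add (IsPoly.snd.mul (ih _))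

theorem isPoly_cascLift (a : ℕ → ℂ) (m : ℕ) : IsPoly (cascLift a m) := by
  have : cascLift a m = fun U V => cascTail a m 0 V + V ^ m * U := by
    funext U V; exact cascLift_eq a m U V
  rw [this]
  exact (isPoly_cascTail _ _ _).add ((IsPoly.snd.pow m).mul .fst)

/-- Normal form, at fixed `z`, of the system in the chart in which a cascade of `n` blow-ups
starts. The curve `K = S(V) = ∑ a_j V^j` through the centres `a_j` is invariant up to order
`V ^ n`, and the remainder `e` is the obstruction to a regular system after the last blow-up. -/
structure IsCascade (C : Chart) (a : ℕ → ℂ → ℂ) (n : ℕ) (P g d : ℂ → ℂ → ℂ → ℂ) (e : ℂ → ℂ → ℂ)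
    (p₀ z : ℂ) : Prop where
  velV : ∀ K V, V ≠ 0 → d z K V ≠ 0 → C.velV z K V = P z K V / (d z K V * V)
  velU : ∀ K V, V ≠ 0 → d z K V ≠ 0 → C.velU z K V =
    ((K - cascTail (fun j => a j z) n 0 V) * g z K V + V ^ n * e z V
      + V * cascTailDeriv (fun j => a j z) n 0 V * P z K V
      + V ^ 2 * d z K V * cascTail (fun j => deriv (a j) z) n 0 V) / (d z K V * V ^ 2)
  isPoly_P : IsPoly (P z)
  isPoly_g : IsPoly (g z)
  isPoly_d : IsPoly (d z)
  isPoly_e : IsPoly fun _ v => e z v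
  d_ne : d z (a 0 z) 0 ≠ 0
  P_eq : P z (a 0 z) 0 = p₀
  p₀_ne : p₀ ≠ 0
  g_eq : g z (a 0 z) 0 = n * p₀

namespace IsCascade

variable {C : Chart} {a : ℕ → ℂ → ℂ} {n : ℕ} {P g d : ℂ → ℂ → ℂ → ℂ} {e : ℂ → ℂ → ℂ} {p₀ z : ℂ}

theorem casc_velV (h : IsCascade C a n P g d e p₀ z) (m : ℕ) {U V : ℂ} (hV : V ≠ 0)
    (hd : d z (cascLift (fun j => a j z) m U V) V ≠ 0) :
    (casc C a m).velV z U V = P z (cascLift (fun j => a j z) m U V) V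
      / (d z (cascLift (fun j => a j z) m U V) V * V) := by
  induction m generalizing U with
  | zero => exact h.velV _ _ hV hd
  | succ m ih => rw [casc, upper_velV]; exact ih hd

theorem casc_velU (h : IsCascade C a n P g d e p₀ z) {m j : ℕ} (hn : m + j = n) {U V : ℂ}
    (hV : V ≠ 0) (hd : d z (cascLift (fun j => a j z) m U V) V ≠ 0) :
    (casc C a m).velU z U V =
      ((U - cascTail (fun j => a j z) j m V) * (g z (cascLift (fun j => a j z) m U V) V
          - m * P z (cascLift (fun j => a j z) m U V) V) + V ^ j * e z V
        + V * cascTailDeriv (fun j => a j z) j m V * P z (cascLift (fun j => a j z) m U V) V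
        + V ^ 2 * d z (cascLift (fun j => a j z) m U V) V
          * cascTail (fun j => deriv (a j) z) j m V)
      / (d z (cascLift (fun j => a j z) m U V) V * V ^ 2) := by
  induction m generalizing U j with
  | zero =>
    obtain rfl : j = n := by omega
    have := h.velU _ _ hV hd
    simpa [casc, cascLift] using this
  | succ m ih =>
    rw [casc, upper_velU, ih (j := j + 1) (by omega) hd, h.casc_velV m hV hd]
    rw [cascLift] at hd
    simp only [cascTail, cascTailDeriv, cascLift]
    field_simp
    push_cast
    ring

/-- The base points on the exceptional curve in the chart `(U_m, V_m)` of a cascade. -/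
theorem casc_isBasePoint_iff (h : IsCascade C a n P g d e p₀ z) {m : ℕ} (hm : m ≠ 0) (hmn : m < n)
    (u : ℂ) : IsBasePoint (casc C a m) z u 0 ↔ u = a m z := by
  obtain ⟨j, rfl⟩ : ∃ j, m + (j + 1) = n := ⟨n - m - 1, by omega⟩
  set α : ℕ → ℂ := fun j => a j z with hα
  set E : ℂ → ℂ → ℂ := fun u v => d z (cascLift α m u v) v with hEdef
  set Q : ℂ → ℂ → ℂ := fun u v => P z (cascLift α m u v) v with hQdef
  -- The system is `U' = A / (E V²)`, `V' = Q / (E V)`.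
  set A : ℂ → ℂ → ℂ := fun u v => (u - cascTail α (j + 1) m v) * (g z (cascLift α m u v) v
    - m * Q u v) + v ^ (j + 1) * e z v + v * cascTailDeriv α (j + 1) m v * Q u v
    + v ^ 2 * E u v * cascTail (fun j => deriv (a j) z) (j + 1) m v with hAdef
  have hL := isPoly_cascLift α m
  have hE : IsPoly E := h.isPoly_d.comp hL .snd
  have hQ : IsPoly Q := h.isPoly_P.comp hL .snd
  have hG : IsPoly fun u v => g z (cascLift α m u v) v := h.isPoly_g.comp hL .snd
  have hA : IsPoly A :=
    ((((IsPoly.fst.sub (isPoly_cascTail _ _ _)).mul (hG.sub ((IsPoly.const _).mul hQ))).add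
      ((IsPoly.snd.pow _).mul h.isPoly_e)).add
      ((IsPoly.snd.mul (isPoly_cascTailDeriv _ _ _)).mul hQ)).add
      (((IsPoly.snd.pow 2).mul hE).mul (isPoly_cascTail _ _ _))
  have hB : IsPoly fun u v => v * Q u v := IsPoly.snd.mul hQ
  have hE0 : ∀ u, E u 0 ≠ 0 := fun u => by
    simp only [hEdef, cascLift_zero_right α hm]; exact h.d_ne
  have hQ0 : ∀ u, Q u 0 = p₀ := fun u => by
    simp only [hQdef, cascLift_zero_right α hm]; exact h.P_eq
  have hA0 : ∀ u, A u 0 = (u - a m z) * ((j + 1) * p₀) := fun u => by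
    have : g z (cascLift α m u 0) 0 = ((m + (j + 1) : ℕ) : ℂ) * p₀ := by
      rw [cascLift_zero_right α hm]; exact h.g_eq
    simp only [hAdef, hQ0, this, cascTail]
    simp only [hα]
    push_cast; ring
  have hU : ∀ u v, u ≠ 0 → v ≠ 0 → E u v * v ^ 2 ≠ 0 →
      (casc C a m).velU z u v * (E u v * v ^ 2) = A u v := by
    intro u v _ hv hD
    rw [h.casc_velU rfl hv (left_ne_zero_of_mul hD)]
    exact div_mul_cancel₀ _ hD
  have hV : ∀ u v, u ≠ 0 → v ≠ 0 → E u v * v ^ 2 ≠ 0 →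
      (casc C a m).velV z u v * (E u v * v ^ 2) = v * Q u v := by
    intro u v _ hv hD
    have hE' : E u v ≠ 0 := left_ne_zero_of_mul hD
    rw [h.casc_velV m hv hE']
    change Q u v / (E u v * v) * _ = _
    field_simp
  have hne : ∃ u v, E u v * v ^ 2 ≠ 0 := by
    obtain ⟨u, v, -, hv, hE⟩ := hE.exists_ne (hE0 0)
    exact ⟨u, v, mul_ne_zero hE (pow_ne_zero 2 hv)⟩
  have hj : ((j : ℂ) + 1) * p₀ ≠ 0 := mul_ne_zero (by exact_mod_cast j.succ_ne_zero) h.p₀_ne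
  constructor
  · contrapose!
    intro hu
    refine not_isBasePoint_of_ne hA hB (hE.mul (IsPoly.snd.pow 2)) hne hU hV (Or.inl ?_)
    rw [hA0]
    exact mul_ne_zero (sub_ne_zero.2 hu) hj
  · rintro rfl
    refine isBasePoint_upper two_ne_zero hA hB hE hU hV hne (hE0 _) (by rw [hA0]; simp) (by simp)
      ⟨a m z + 1, Or.inl ?_⟩
    rw [hA0]; simpa using hj

/-- After the last blow-up there is no base point on the exceptional curve `V = 0`. -/
theorem casc_last_not_isBasePoint (h : IsCascade C a n P g d e p₀ z) (hn : n ≠ 0) (u : ℂ) :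
    ¬ IsBasePoint (casc C a n) z u 0 := by
  set α : ℕ → ℂ := fun j => a j z with hα
  set E : ℂ → ℂ → ℂ := fun u v => d z (cascLift α n u v) v with hEdef
  set Q : ℂ → ℂ → ℂ := fun u v => P z (cascLift α n u v) v with hQdef
  set A : ℂ → ℂ → ℂ := fun u v => u * (g z (cascLift α n u v) v - n * Q u v) + e z v with hAdef
  have hL := isPoly_cascLift α n
  have hE : IsPoly E := h.isPoly_d.comp hL .snd
  have hQ : IsPoly Q := h.isPoly_P.comp hL .snd
  have hG : IsPoly fun u v => g z (cascLift α n u v) v := h.isPoly_g.comp hL .snd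
  have hA : IsPoly A :=
    (IsPoly.fst.mul (hG.sub ((IsPoly.const _).mul hQ))).add h.isPoly_e
  have hE0 : ∀ u, E u 0 ≠ 0 := fun u => by
    simp only [hEdef, cascLift_zero_right α hn]; exact h.d_ne
  have hQ0 : ∀ u, Q u 0 = p₀ := fun u => by
    simp only [hQdef, cascLift_zero_right α hn]; exact h.P_eq
  have hA0 : ∀ u, A u 0 = e z 0 := fun u => by
    have : g z (cascLift α n u 0) 0 = n * p₀ := by
      rw [cascLift_zero_right α hn]; exact h.g_eq
    simp only [hAdef, this, hQ0]
    ring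
  have hU : ∀ u v, v ≠ 0 → E u v ≠ 0 → (casc C a n).velU z u v * (E u v * v ^ 2) = A u v := by
    intro u v hv hD
    rw [h.casc_velU (j := 0) rfl hv hD]
    simp only [cascTail, cascTailDeriv, hAdef]
    change _ / (E u v * v ^ 2) * _ = _
    rw [div_mul_cancel₀ _ (mul_ne_zero hD (pow_ne_zero 2 hv))]
    simp only [hQdef]; ring
  have hV : ∀ u v, v ≠ 0 → E u v ≠ 0 → (casc C a n).velV z u v * (E u v * v) = Q u v := by
    intro u v hv hE'
    rw [h.casc_velV n hv hE']
    exact div_mul_cancel₀ _ (mul_ne_zero hE' hv)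
  obtain ⟨u₁, v₁, -, hv₁, hE₁⟩ := hE.exists_ne (hE0 0)
  by_cases hκ : e z 0 = 0
  · obtain ⟨q, hq, hAq⟩ := hA.exists_div_snd
    refine not_isBasePoint_of_ne hq hQ (hE.mul .snd) ⟨u₁, v₁, mul_ne_zero hE₁ hv₁⟩ ?_ ?_
      (Or.inr (by rw [hQ0]; exact h.p₀_ne))
    · intro u v _ hv hD
      have h1 := hU u v hv (left_ne_zero_of_mul hD)
      rw [hAq, hA0, hκ, zero_add] at h1
      refine mul_left_cancel₀ hv ?_
      rw [← h1]; ring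
    · intro u v _ hv hD
      exact hV u v hv (left_ne_zero_of_mul hD)
  · refine not_isBasePoint_of_ne hA (B := fun u v => v * Q u v) (IsPoly.snd.mul hQ)
      (hE.mul (IsPoly.snd.pow 2)) ⟨u₁, v₁, mul_ne_zero hE₁ (pow_ne_zero 2 hv₁)⟩ ?_ ?_
      (Or.inl (by rw [hA0]; exact hκ))
    · intro u v _ hv hD
      exact hU u v hv (left_ne_zero_of_mul hD)
    · intro u v _ hv hD
      rw [← hV u v hv (left_ne_zero_of_mul hD)]; ring

end IsCascade

end Cascade

/-! ### Cascades of blow-ups: the charts `(u, v)` -/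

section CascadeLower

namespace IsCascade

variable {C : Chart} {a : ℕ → ℂ → ℂ} {n : ℕ} {P g d : ℂ → ℂ → ℂ → ℂ} {e : ℂ → ℂ → ℂ} {p₀ z : ℂ}

/-- The system in the chart `(u, v)` of a blow-up in a cascade, with `u = 0` the exceptional curve:
`u' = N / (d u v²)` and `v' = (Q - N) / (d u² v)`. -/
theorem exists_lower (h : IsCascade C a n P g d e p₀ z) {m j : ℕ} (hn : m + (j + 1) = n) :
    ∃ E Q N : ℂ → ℂ → ℂ, IsPoly E ∧ IsPoly Q ∧ IsPoly N ∧ (∀ v, E 0 v ≠ 0) ∧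
      (∀ v, N 0 v = (1 - v * cascTail (fun j => a j z) j (m + 1) 0) * ((j + 1) * p₀)
        + 0 ^ j * v * e z 0 + v * cascTail (fun j => a j z) j (m + 1) 0 * p₀) ∧
      (∀ v, Q 0 v = p₀) ∧ (m ≠ 0 → ∀ u, Q u 0 = p₀ ∧ N u 0 = (j + 1) * p₀) ∧
      (∀ u v, u ≠ 0 → v ≠ 0 → E u v ≠ 0 →
        ((casc C a m).lower (a m) fun _ => 0).velU z u v * (E u v * (u * v ^ 2)) = N u v ∧
        ((casc C a m).lower (a m) fun _ => 0).velV z u v * (E u v * (u ^ 2 * v)) =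
          Q u v - N u v) := by
  set α : ℕ → ℂ := fun j => a j z with hα
  set β : ℕ → ℂ := fun j => deriv (a j) z with hβ
  set L : ℂ → ℂ → ℂ := fun u v => cascLift α m (u + α m) (u * v) with hL
  set T : ℂ → ℂ → ℂ := fun u v => cascTail α j (m + 1) (u * v) with hT
  set E : ℂ → ℂ → ℂ := fun u v => d z (L u v) (u * v) with hEdef
  set Q : ℂ → ℂ → ℂ := fun u v => P z (L u v) (u * v) with hQdef
  set G : ℂ → ℂ → ℂ := fun u v => g z (L u v) (u * v) with hGdef
  set N : ℂ → ℂ → ℂ := fun u v => (1 - v * T u v) * (G u v - m * Q u v)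
    + u ^ j * v ^ (j + 1) * e z (u * v)
    + v * (T u v + u * v * cascTailDeriv α j (m + 1) (u * v)) * Q u v
    + u * v ^ 2 * E u v * (u * v * cascTail β j (m + 1) (u * v)) with hNdef
  have huv : IsPoly fun u v => u * v := IsPoly.fst.mul .snd
  have hLp : IsPoly L := (isPoly_cascLift α m).comp (IsPoly.fst.add (.const _)) huv
  have hTp : IsPoly T := (isPoly_cascTail α j (m + 1)).comp .fst huv
  have hE : IsPoly E := h.isPoly_d.comp hLp huv
  have hQ : IsPoly Q := h.isPoly_P.comp hLp huv
  have hG : IsPoly G := h.isPoly_g.comp hLp huv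
  have he : IsPoly fun u v => e z (u * v) := h.isPoly_e.comp .fst huv
  have hN : IsPoly N :=
    (((((IsPoly.const 1).sub (IsPoly.snd.mul hTp)).mul (hG.sub ((IsPoly.const _).mul hQ))).add
      (((IsPoly.fst.pow j).mul (IsPoly.snd.pow (j + 1))).mul he)).add
      ((IsPoly.snd.mul (hTp.add (huv.mul
        ((isPoly_cascTailDeriv α j (m + 1)).comp .fst huv)))).mul hQ)).add
      (((IsPoly.fst.mul (IsPoly.snd.pow 2)).mul hE).mul
        (huv.mul ((isPoly_cascTail β j (m + 1)).comp .fst huv)))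
  have hL0 : ∀ v, L 0 v = a 0 z := fun v => by
    rcases eq_or_ne m 0 with rfl | hm
    · simp [hL, cascLift, hα]
    · change cascLift α m _ _ = α 0
      rw [zero_mul, cascLift_zero_right α hm]
  have hL1 : m ≠ 0 → ∀ u, L u 0 = a 0 z := fun hm u => by
    change cascLift α m _ _ = α 0
    rw [mul_zero, cascLift_zero_right α hm]
  have hG0 : ∀ v, G 0 v = ((m + (j + 1) : ℕ) : ℂ) * p₀ := fun v => by
    simp only [hGdef, hL0, zero_mul, h.g_eq, ← hn]
  have hQ0 : ∀ v, Q 0 v = p₀ := fun v => by simp only [hQdef, hL0, zero_mul, h.P_eq]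
  refine ⟨E, Q, N, hE, hQ, hN, fun v => ?_, fun v => ?_, hQ0, fun hm u => ⟨?_, ?_⟩, ?_⟩
  · simp only [hEdef, hL0, zero_mul]; exact h.d_ne
  · have hT0 : T 0 v = cascTail α j (m + 1) 0 := by simp [hT]
    simp only [hNdef, hG0, hQ0, hT0, zero_mul, add_zero]
    rcases j with _ | j
    · push_cast; ring
    · push_cast; rw [zero_pow j.succ_ne_zero]; ring
  · simp only [hQdef, hL1 hm, mul_zero, h.P_eq]
  · have h1 : G u 0 = ((m + (j + 1) : ℕ) : ℂ) * p₀ := by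
      simp only [hGdef, hL1 hm, mul_zero, h.g_eq, ← hn]
    have h2 : Q u 0 = p₀ := by simp only [hQdef, hL1 hm, mul_zero, h.P_eq]
    simp only [hNdef, h1, h2]
    push_cast
    simp
    ring
  · intro u v hu hv hE'
    have huv0 : u * v ≠ 0 := mul_ne_zero hu hv
    have hE'' : d z (cascLift α m (u + α m) (u * v)) (u * v) ≠ 0 := hE'
    have h1 := h.casc_velU hn huv0 hE''
    have h2 := h.casc_velV m huv0 hE''
    simp only [cascTail, cascTailDeriv] at h1
    change _ = ((u + α m - (α m + u * v * T u v)) * (G u v - m * Q u v)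
      + (u * v) ^ (j + 1) * e z (u * v)
      + u * v * (T u v + u * v * cascTailDeriv α j (m + 1) (u * v)) * Q u v
      + (u * v) ^ 2 * E u v * (β m + u * v * cascTail β j (m + 1) (u * v)))
      / (E u v * (u * v) ^ 2) at h1
    change _ = Q u v / (E u v * (u * v)) at h2
    have h1' : (casc C a m).velU z (u + α m) (u * v) - β m = N u v / (E u v * (u * v ^ 2)) := by
      rw [h1]
      simp only [hNdef]
      field_simp
      ring
    rw [lower_velU, lower_velV]
    change ((casc C a m).velU z (u + α m) (u * v) - β m) * _ = _ ∧
      ((casc C a m).velV z (u + α m) (u * v)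
        - v * ((casc C a m).velU z (u + α m) (u * v) - β m)) / u * _ = _
    rw [h1', h2]
    constructor
    · field_simp
    · field_simp

theorem exists_ne_of_lower {E : ℂ → ℂ → ℂ} (hE : IsPoly E) (h : ∀ v, E 0 v ≠ 0) (i k : ℕ) :
    ∃ u v, E u v * (u ^ i * v ^ k) ≠ 0 := by
  obtain ⟨u, v, hu, hv, hE⟩ := hE.exists_ne (h 0)
  exact ⟨u, v, mul_ne_zero hE (mul_ne_zero (pow_ne_zero _ hu) (pow_ne_zero _ hv))⟩

/-- Base points on the exceptional curve in the chart `(u, v)` of a blow-up in a cascade that is not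
the last one. -/
theorem lower_isBasePoint_iff (h : IsCascade C a n P g d e p₀ z) {m : ℕ} (hmn : m + 1 < n)
    (v : ℂ) :
    IsBasePoint ((casc C a m).lower (a m) fun _ => 0) z 0 v ↔ v * a (m + 1) z = 1 := by
  obtain ⟨j, hj⟩ : ∃ j, m + (j + 1 + 1) = n := ⟨n - m - 2, by omega⟩
  obtain ⟨E, Q, N, hE, hQ, hN, hE0, hN0, hQ0, -, hvel⟩ := h.exists_lower hj
  have hN0' : ∀ v, N 0 v = ((j + 2) - (j + 1) * (v * a (m + 1) z)) * p₀ := fun v => by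
    rw [hN0 v]; simp only [cascTail]; push_cast; ring
  have hj1 : ((j : ℂ) + 1) * p₀ ≠ 0 := mul_ne_zero (by exact_mod_cast j.succ_ne_zero) h.p₀_ne
  have hB0 : ∀ v, v * (Q 0 v - N 0 v) = v * (v * a (m + 1) z - 1) * ((j + 1) * p₀) := fun v => by
    rw [hN0', hQ0]; ring
  have hA : IsPoly fun u v => u * N u v := IsPoly.fst.mul hN
  have hB : IsPoly fun u v => v * (Q u v - N u v) := IsPoly.snd.mul (hQ.sub hN)
  have hD : IsPoly fun u v => E u v * v ^ 2 := hE.mul (IsPoly.snd.pow 2)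
  have hU : ∀ u v, u ≠ 0 → v ≠ 0 → E u v * v ^ 2 * u ^ 2 ≠ 0 →
      ((casc C a m).lower (a m) fun _ => 0).velU z u v * (E u v * v ^ 2 * u ^ 2) = u * N u v := by
    intro u v hu hv hD
    rw [← (hvel u v hu hv (left_ne_zero_of_mul (left_ne_zero_of_mul hD))).1]; ring
  have hV : ∀ u v, u ≠ 0 → v ≠ 0 → E u v * v ^ 2 * u ^ 2 ≠ 0 →
      ((casc C a m).lower (a m) fun _ => 0).velV z u v * (E u v * v ^ 2 * u ^ 2) =
        v * (Q u v - N u v) := by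
    intro u v hu hv hD
    rw [← (hvel u v hu hv (left_ne_zero_of_mul (left_ne_zero_of_mul hD))).2]; ring
  have hne : ∃ u v, E u v * v ^ 2 * u ^ 2 ≠ 0 := by
    obtain ⟨u, v, h1⟩ := exists_ne_of_lower hE hE0 2 2
    exact ⟨u, v, by convert h1 using 1; ring⟩
  constructor
  · contrapose!
    intro hv
    rcases eq_or_ne v 0 with rfl | hv0
    · have h2 : ((j : ℂ) + 2) * p₀ ≠ 0 :=
        mul_ne_zero (by exact_mod_cast (by omega : j + 2 ≠ 0)) h.p₀_ne
      refine not_isBasePoint_of_determinate hN (hE.mul (IsPoly.fst.mul (IsPoly.snd.pow 2)))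
        (hQ.sub hN) (hE.mul ((IsPoly.fst.pow 2).mul IsPoly.snd))
        (by simpa using exists_ne_of_lower hE hE0 1 2) (by simpa using exists_ne_of_lower hE hE0 2 1)
        ?_ ?_ (Or.inl ?_) (Or.inl ?_)
      · exact fun u v hu hv hD => (hvel u v hu hv (left_ne_zero_of_mul hD)).1
      · exact fun u v hu hv hD => (hvel u v hu hv (left_ne_zero_of_mul hD)).2
      · rw [hN0']; simpa using h2
      · rw [hN0', hQ0]
        intro h3
        apply hj1
        linear_combination -h3
    · refine not_isBasePoint_of_ne hA hB (hD.mul (IsPoly.fst.pow 2)) hne hU hV (Or.inr ?_)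
      rw [hB0]
      exact mul_ne_zero (mul_ne_zero hv0 (sub_ne_zero.2 hv)) hj1
  · intro hv
    have hv0 : v ≠ 0 := by rintro rfl; simp at hv
    refine isBasePoint_lower two_ne_zero hA hB hD hU hV hne
      (mul_ne_zero (hE0 v) (pow_ne_zero 2 hv0)) (by simp) (by rw [hB0, hv]; simp)
      ⟨v / 2, Or.inr ?_⟩
    rw [hB0]
    refine mul_ne_zero (mul_ne_zero (by simpa using hv0) ?_) hj1
    intro h3
    have : v * a (m + 1) z = 2 := by linear_combination 2 * h3
    rw [hv] at this
    norm_num at this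

/-- After the last blow-up there is no base point in the chart `(u, v)` either. -/
theorem lower_last_not_isBasePoint {m : ℕ} (h : IsCascade C a (m + 1) P g d e p₀ z) (hm : m ≠ 0)
    (v : ℂ) : ¬ IsBasePoint ((casc C a m).lower (a m) fun _ => 0) z 0 v := by
  obtain ⟨E, Q, N, hE, hQ, hN, hE0, hN0, hQ0, hv0, hvel⟩ := h.exists_lower (m := m) (j := 0) rfl
  have hN0' : ∀ v, N 0 v = p₀ + v * e z 0 := fun v => by
    rw [hN0 v]; simp only [cascTail]; push_cast; ring
  obtain ⟨q, hq, hqQ⟩ := (hQ.sub hN).exists_div_snd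
  have hq1 : ∀ u v, Q u v - N u v = v * q u v := fun u v => by
    have := hqQ u v
    obtain ⟨h1, h2⟩ := hv0 hm u
    rw [this, h1, h2]; push_cast; ring
  have hq0 : ∀ v, q 0 v = -e z 0 := by
    have h1 : ∀ v, v ≠ 0 → q 0 v = -e z 0 := fun v hv => by
      have := hq1 0 v
      rw [hQ0, hN0'] at this
      refine mul_left_cancel₀ hv ?_
      rw [← this]; ring
    have h2 : Continuous fun v => q 0 v :=
      hq.continuous.comp (continuous_const.prodMk continuous_id)
    have h3 : (fun v => q 0 v) = fun _ => -e z 0 := by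
      refine Continuous.ext_on (dense_compl_singleton (0 : ℂ)) h2 continuous_const fun v hv => h1 v hv
    exact fun v => congrFun h3 v
  have hne := fun i k => exists_ne_of_lower hE hE0 i k
  have hU : ∀ u v, u ≠ 0 → v ≠ 0 → E u v ≠ 0 →
      ((casc C a m).lower (a m) fun _ => 0).velU z u v * (E u v * (u * v ^ 2)) = N u v :=
    fun u v hu hv hD => (hvel u v hu hv hD).1
  have hV : ∀ u v, u ≠ 0 → v ≠ 0 → E u v ≠ 0 →
      ((casc C a m).lower (a m) fun _ => 0).velV z u v * (E u v * u ^ 2) = q u v := by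
    intro u v hu hv hD
    refine mul_left_cancel₀ hv ?_
    rw [← hq1, ← (hvel u v hu hv hD).2]; ring
  by_cases hκ : e z 0 = 0
  · obtain ⟨r, hr, hqr⟩ := hq.exists_div_fst
    refine not_isBasePoint_of_ne hN (B := fun u v => v ^ 2 * r u v)
      (D := fun u v => E u v * (u ^ 1 * v ^ 2)) ((IsPoly.snd.pow 2).mul hr)
      (hE.mul ((IsPoly.fst.pow 1).mul (IsPoly.snd.pow 2))) (hne 1 2) ?_ ?_
      (Or.inl (by rw [hN0', hκ]; simpa using h.p₀_ne))
    · intro u v hu hv hD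
      rw [← hU u v hu hv (left_ne_zero_of_mul hD)]; ring
    · intro u v hu hv hD
      have h1 := hV u v hu hv (left_ne_zero_of_mul hD)
      rw [hqr, hq0, hκ, neg_zero, zero_add] at h1
      refine mul_left_cancel₀ hu ?_
      linear_combination v ^ 2 * h1
  · rcases eq_or_ne v 0 with rfl | hv
    · refine not_isBasePoint_of_determinate hN (D₁ := fun u v => E u v * (u ^ 1 * v ^ 2))
        (hE.mul ((IsPoly.fst.pow 1).mul (IsPoly.snd.pow 2))) hq
        (D₂ := fun u v => E u v * (u ^ 2 * v ^ 0))
        (hE.mul ((IsPoly.fst.pow 2).mul (IsPoly.snd.pow 0))) (hne 1 2) (hne 2 0) ?_ ?_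
        (Or.inl (by rw [hN0']; simpa using h.p₀_ne))
        (Or.inl (by rw [hq0]; exact neg_ne_zero.2 hκ))
      · intro u v hu hv hD
        rw [← hU u v hu hv (left_ne_zero_of_mul hD)]; ring
      · intro u v hu hv hD
        rw [← hV u v hu hv (left_ne_zero_of_mul hD)]; ring
    · refine not_isBasePoint_of_ne (A := fun u v => u * N u v) (B := fun u v => v ^ 2 * q u v)
        (D := fun u v => E u v * (u ^ 2 * v ^ 2)) (IsPoly.fst.mul hN)
        ((IsPoly.snd.pow 2).mul hq) (hE.mul ((IsPoly.fst.pow 2).mul (IsPoly.snd.pow 2))) (hne 2 2)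
        ?_ ?_ (Or.inr ?_)
      · intro u v hu hv hD
        rw [← hU u v hu hv (left_ne_zero_of_mul hD)]; ring
      · intro u v hu hv hD
        rw [← hV u v hu hv (left_ne_zero_of_mul hD)]; ring
      · rw [hq0]
        exact mul_ne_zero (pow_ne_zero 2 hv) (neg_ne_zero.2 hκ)

end IsCascade

end CascadeLower

/-! ### Polynomials with analytic coefficients -/

section Normal

/-- Polynomials in two variables whose coefficients are functions of `z`, analytic at `z₀`. -/
inductive IsPolyNear (z₀ : ℂ) : (ℂ → ℂ → ℂ → ℂ) → Prop
  | coeff {a : ℂ → ℂ} : AnalyticAt ℂ a z₀ → IsPolyNear z₀ fun z _ _ => a z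
  | fst : IsPolyNear z₀ fun _ u _ => u
  | snd : IsPolyNear z₀ fun _ _ v => v
  | add {f g} : IsPolyNear z₀ f → IsPolyNear z₀ g → IsPolyNear z₀ fun z u v => f z u v + g z u v
  | sub {f g} : IsPolyNear z₀ f → IsPolyNear z₀ g → IsPolyNear z₀ fun z u v => f z u v - g z u v
  | mul {f g} : IsPolyNear z₀ f → IsPolyNear z₀ g → IsPolyNear z₀ fun z u v => f z u v * g z u v
  | pow {f} (n : ℕ) : IsPolyNear z₀ f → IsPolyNear z₀ fun z u v => f z u v ^ n

namespace IsPolyNear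

variable {z₀ : ℂ} {f p q : ℂ → ℂ → ℂ → ℂ}

theorem isPoly (hf : IsPolyNear z₀ f) (z : ℂ) : IsPoly (f z) := by
  induction hf with
  | coeff => exact .const _
  | fst => exact .fst
  | snd => exact .snd
  | add _ _ h₁ h₂ => exact h₁.add h₂
  | sub _ _ h₁ h₂ => exact h₁.sub h₂
  | mul _ _ h₁ h₂ => exact h₁.mul h₂
  | pow n _ h => exact h.pow n

theorem analyticAt (hf : IsPolyNear z₀ f) (u v : ℂ) :
    AnalyticAt ℂ (fun p : ℂ × ℂ × ℂ => f p.1 p.2.1 p.2.2) (z₀, u, v) := by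
  induction hf with
  | coeff ha => exact ha.comp_of_eq analyticAt_fst rfl
  | fst => exact analyticAt_fst.comp analyticAt_snd
  | snd => exact analyticAt_snd.comp analyticAt_snd
  | add _ _ h₁ h₂ => exact h₁.add h₂
  | sub _ _ h₁ h₂ => exact h₁.sub h₂
  | mul _ _ h₁ h₂ => exact h₁.mul h₂
  | pow n _ h => exact h.pow n

theorem comp (hf : IsPolyNear z₀ f) (hp : IsPolyNear z₀ p) (hq : IsPolyNear z₀ q) :
    IsPolyNear z₀ fun z u v => f z (p z u v) (q z u v) := by
  induction hf with
  | coeff ha => exact .coeff ha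
  | fst => exact hp
  | snd => exact hq
  | add _ _ h₁ h₂ => exact h₁.add h₂
  | sub _ _ h₁ h₂ => exact h₁.sub h₂
  | mul _ _ h₁ h₂ => exact h₁.mul h₂
  | pow n _ h => exact h.pow n

theorem const (a : ℂ) : IsPolyNear z₀ fun _ _ _ => a := .coeff analyticAt_const

/-- Division with remainder by the second variable. -/
theorem exists_div_snd (hf : IsPolyNear z₀ f) :
    ∃ q, IsPolyNear z₀ q ∧ ∀ z u v, f z u v = f z u 0 + v * q z u v := by
  have h0 : ∀ {g : ℂ → ℂ → ℂ → ℂ}, IsPolyNear z₀ g → IsPolyNear z₀ fun z u _ => g z u 0 :=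
    fun hg => hg.comp .fst (.const 0)
  have hmul : ∀ {f g p q : ℂ → ℂ → ℂ → ℂ}, IsPolyNear z₀ f → IsPolyNear z₀ g →
      IsPolyNear z₀ p → IsPolyNear z₀ q → (∀ z u v, f z u v = f z u 0 + v * p z u v) →
      (∀ z u v, g z u v = g z u 0 + v * q z u v) →
      ∃ q, IsPolyNear z₀ q ∧ ∀ z u v, f z u v * g z u v = f z u 0 * g z u 0 + v * q z u v := by
    intro f g p q hf hg hp hq h₁ h₂
    refine ⟨fun z u v => p z u v * g z u v + f z u 0 * q z u v,
      (hp.mul hg).add ((h0 hf).mul hq), fun z u v => ?_⟩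
    linear_combination g z u v * h₁ z u v + f z u 0 * h₂ z u v
  induction hf with
  | coeff => exact ⟨_, .const 0, fun z u v => by ring⟩
  | fst => exact ⟨_, .const 0, fun z u v => by ring⟩
  | snd => exact ⟨_, .const 1, fun z u v => by ring⟩
  | add _ _ h₁ h₂ =>
    obtain ⟨⟨p, hp, h₁⟩, ⟨q, hq, h₂⟩⟩ := And.intro h₁ h₂
    exact ⟨_, hp.add hq, fun z u v => by linear_combination h₁ z u v + h₂ z u v⟩
  | sub _ _ h₁ h₂ =>
    obtain ⟨⟨p, hp, h₁⟩, ⟨q, hq, h₂⟩⟩ := And.intro h₁ h₂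
    exact ⟨_, hp.sub hq, fun z u v => by linear_combination h₁ z u v - h₂ z u v⟩
  | mul hf hg h₁ h₂ =>
    obtain ⟨⟨p, hp, h₁⟩, ⟨q, hq, h₂⟩⟩ := And.intro h₁ h₂
    exact hmul hf hg hp hq h₁ h₂
  | @pow g n hg h =>
    obtain ⟨p, hp, h⟩ := h
    induction n with
    | zero => exact ⟨_, .const 0, fun z u v => by ring⟩
    | succ n ih =>
      obtain ⟨q, hq, ih⟩ := ih
      obtain ⟨s, hs, h'⟩ := hmul (hg.pow n) hg hq hp ih h
      exact ⟨s, hs, fun z u v => by beta_reduce; rw [pow_succ, pow_succ, h']⟩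

theorem cascTail {a : ℕ → ℂ → ℂ} (ha : ∀ j, AnalyticAt ℂ (a j) z₀) (j m : ℕ) :
    IsPolyNear z₀ fun z _ v => cascTail (fun j => a j z) j m v := by
  induction j generalizing m with
  | zero => exact .const 0
  | succ j ih => exact (IsPolyNear.coeff (ha m)).add (IsPolyNear.snd.mul (ih _))

theorem cascTailDeriv {a : ℕ → ℂ → ℂ} (ha : ∀ j, AnalyticAt ℂ (a j) z₀) (j m : ℕ) :
    IsPolyNear z₀ fun z _ v => cascTailDeriv (fun j => a j z) j m v := by
  induction j generalizing m with
  | zero => exact .const 0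
  | succ j ih => exact (cascTail ha _ _).add (IsPolyNear.snd.mul (ih _))

theorem cascLift {a : ℕ → ℂ → ℂ} (ha : ∀ j, AnalyticAt ℂ (a j) z₀) (m : ℕ) :
    IsPolyNear z₀ fun z u v => cascLift (fun j => a j z) m u v := by
  simp only [cascLift_eq]
  exact (cascTail ha _ _).add ((IsPolyNear.snd.pow m).mul .fst)

end IsPolyNear

end Normal

/-! ### The first cascade -/

section FirstCascade

variable (c : Coeffs)

/-- The coefficient functions of the Hamiltonian are analytic at `z`. -/
structure Coeffs.AnalyticAt (z : ℂ) : Prop where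
  c0 : _root_.AnalyticAt ℂ c.c0 z
  c1 : _root_.AnalyticAt ℂ c.c1 z
  c2 : _root_.AnalyticAt ℂ c.c2 z
  c3 : _root_.AnalyticAt ℂ c.c3 z

variable {c}

theorem Coeffs.AnalyticAt.centre {z : ℂ} (h : c.AnalyticAt z) (i : ℕ) :
    _root_.AnalyticAt ℂ (centre c i) z := by
  have h0 := h.c0
  have h1 := h.c1
  have h2 := h.c2
  have h3 := h.c3
  have h2' := h.c2.deriv
  have h3' := h.c3.deriv
  unfold QPII.centre
  split <;> fun_prop

variable (c)

/-- The centres `q₄, …, q₉` of the blow-ups of the first cascade. -/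
noncomputable def firstCentre (j : ℕ) : ℂ → ℂ := centre c (4 + j)

/-- The polynomial `P` with `V' = P / (K² V)` in the chart `(K, V) = (x/y³, y²/x)`. -/
noncomputable def firstP (z K V : ℂ) : ℂ :=
  2 * K - 5 - 3 * c.c3 z * K ^ 2 * V ^ 2 - c.c2 z * K ^ 2 * V ^ 3 - c.c1 z * K ^ 3 * V ^ 4
    - c.c0 z * K ^ 4 * V ^ 5

/-- The divided difference `(G(K) - G(S)) / (K - S)` for the first cascade, where `G` is the
right-hand side of the equation for `K`, less the one for the tail. -/
noncomputable def firstDivDiff (z K S T R V : ℂ) : ℂ :=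
  (6 - 2 * V * T) + (-3 - R * V ^ 2 + V * T * (3 * c.c3 z * V ^ 2 + c.c2 z * V ^ 3)) * (K + S)
    + (4 * c.c3 z * V ^ 2 + c.c2 z * V ^ 3 + V * T * c.c1 z * V ^ 4) * (K ^ 2 + K * S + S ^ 2)
    + (c.c1 z * V ^ 4 + V * T * c.c0 z * V ^ 5) * (K ^ 3 + K ^ 2 * S + K * S ^ 2 + S ^ 3)
    + c.c0 z * V ^ 5 * (K ^ 4 + K ^ 3 * S + K ^ 2 * S ^ 2 + K * S ^ 3 + S ^ 4)

/-- The function `firstDivDiff` for the tail of the first cascade. -/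
noncomputable def firstG (z K V : ℂ) : ℂ :=
  firstDivDiff c z K (cascTail (fun j => firstCentre c j z) 6 0 V)
    (cascTailDeriv (fun j => firstCentre c j z) 6 0 V)
    (cascTail (fun j => deriv (firstCentre c j) z) 6 0 V) V

/-- The remainder of the first cascade: the equation for `K` is satisfied by the tail up to
`V⁶ firstE`. Here `s`, `t`, `w` are the parts of the tail `S = 2 + V² s` and its derivatives with
respect to `V` and `z`. -/
noncomputable def firstE (z V : ℂ) : ℂ :=
  let σ₂ := centre c 8 z + V * centre c 9 z
  let σ := 8 / 3 * c.c2 z + V * σ₂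
  let s := 8 * c.c3 z + V * σ
  let τ := 2 * centre c 8 z + 3 * V * centre c 9 z
  let t := 8 / 3 * c.c2 z + V * τ
  let ω := deriv (centre c 8) z + V * deriv (centre c 9) z
  let w := 8 * deriv c.c3 z + V * (8 / 3 * deriv c.c2 z + V * ω)
  let S := 2 + V ^ 2 * s
  let r := 2 * s + V * t
  4 * c.c2 z * t + 20 * c.c2 z * σ - 40 * c.c3 z * σ₂ - 7 * σ ^ 2 - 4 * ω - 4 * c.c3 z * τ - 2 * σ * t
    + (4 * c.c3 z + V * c.c2 z) * s ^ 2 * (6 + V ^ 2 * s)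
    + c.c1 z * s * (S ^ 3 + 2 * S ^ 2 + 4 * S + 8) - w * s * (S + 2)
    + (3 * c.c3 z + V * c.c2 z) * s * (S + 2) * r
    + V * c.c0 z * s * (S ^ 4 + 2 * S ^ 3 + 4 * S ^ 2 + 8 * S + 16)
    + (c.c1 z * S ^ 3 + V * c.c0 z * S ^ 4) * r

theorem firstDivDiff_spec (z K S T R V : ℂ) :
    K * (6 - 3 * K + 4 * c.c3 z * K ^ 2 * V ^ 2 + c.c2 z * K ^ 2 * V ^ 3 + c.c1 z * K ^ 3 * V ^ 4
        + c.c0 z * K ^ 4 * V ^ 5) - R * K ^ 2 * V ^ 2 - V * T * firstP c z K V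
      - (S * (6 - 3 * S + 4 * c.c3 z * S ^ 2 * V ^ 2 + c.c2 z * S ^ 2 * V ^ 3
        + c.c1 z * S ^ 3 * V ^ 4 + c.c0 z * S ^ 4 * V ^ 5) - R * S ^ 2 * V ^ 2
        - V * T * firstP c z S V) =
    (K - S) * firstDivDiff c z K S T R V := by
  simp only [firstP, firstDivDiff]; ring

variable {c}

theorem firstCascade_lift (z V : ℂ) :
    let s := 8 * c.c3 z + V * (8 / 3 * c.c2 z) + V ^ 2 * centre c 8 z + V ^ 3 * centre c 9 z
    let t := 8 / 3 * c.c2 z + 2 * V * centre c 8 z + 3 * V ^ 2 * centre c 9 z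
    let w := 8 * deriv c.c3 z + V * (8 / 3 * deriv c.c2 z) + V ^ 2 * deriv (centre c 8) z
      + V ^ 3 * deriv (centre c 9) z
    cascTail (fun j => firstCentre c j z) 6 0 V = 2 + V ^ 2 * s ∧
    cascTailDeriv (fun j => firstCentre c j z) 6 0 V = 2 * V * s + V ^ 2 * t ∧
    cascTail (fun j => deriv (firstCentre c j) z) 6 0 V = V ^ 2 * w := by
  have h0 : firstCentre c 0 = fun _ => 2 := rfl
  have h1 : firstCentre c 1 = fun _ => 0 := rfl
  have h2 : firstCentre c 2 = fun z => 8 * c.c3 z := rfl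
  have h3 : firstCentre c 3 = fun z => 8 / 3 * c.c2 z := rfl
  have h4 : firstCentre c 4 = centre c 8 := rfl
  have h5 : firstCentre c 5 = centre c 9 := rfl
  simp only [cascTail, cascTailDeriv, h0, h1, h2, h3, h4, h5, Nat.reduceAdd, deriv_const,
    deriv_const_mul_field]
  refine ⟨by ring, by ring, by ring⟩

theorem firstE_spec (z V : ℂ) :
    let S := cascTail (fun j => firstCentre c j z) 6 0 V
    let T := cascTailDeriv (fun j => firstCentre c j z) 6 0 V
    let R := cascTail (fun j => deriv (firstCentre c j) z) 6 0 V
    S * (6 - 3 * S + 4 * c.c3 z * S ^ 2 * V ^ 2 + c.c2 z * S ^ 2 * V ^ 3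
        + c.c1 z * S ^ 3 * V ^ 4 + c.c0 z * S ^ 4 * V ^ 5) - R * S ^ 2 * V ^ 2
        - V * T * firstP c z S V = V ^ 6 * firstE c z V := by
  obtain ⟨hS, hT, hR⟩ := firstCascade_lift (c := c) z V
  have h8 : centre c 8 z = 8 * (c.c1 z + 8 * c.c3 z ^ 2 - 2 * deriv c.c3 z) := rfl
  have h9 : centre c 9 z = 32 * (c.c0 z + 4 / 3 * c.c2 z * c.c3 z - 1 / 3 * deriv c.c2 z) := rfl
  intro S T R
  change S = _ at hS
  change T = _ at hT
  change R = _ at hR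
  rw [hS, hT, hR]
  dsimp only [firstE, firstP]
  rw [h8, h9]
  ring

theorem first_isPolyNear {z₀ : ℂ} (h : c.AnalyticAt z₀) :
    IsPolyNear z₀ (firstP c) ∧ IsPolyNear z₀ (firstG c) ∧
      (IsPolyNear z₀ fun z _ V => firstE c z V) ∧ (IsPolyNear z₀ fun _ K _ => K ^ 2) := by
  have hS := IsPolyNear.cascTail (a := firstCentre c) (fun j => h.centre (4 + j)) 6 0
  have hT := IsPolyNear.cascTailDeriv (a := firstCentre c) (fun j => h.centre (4 + j)) 6 0
  have hR := IsPolyNear.cascTail (a := fun j => deriv (firstCentre c j))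
    (fun j => (h.centre (4 + j)).deriv) 6 0
  have hC := h.centre
  obtain ⟨h0, h1, h2, h3⟩ := h
  dsimp only [firstP, firstG, firstDivDiff, firstE]
  refine ⟨?_, ?_, ?_, ?_⟩ <;> repeat' first | assumption | fun_prop | constructor

/-- The charts from `q₄` on form a cascade; the centres make the error divisible by `V⁶`. -/
theorem firstCascade {z : ℂ} (h : c.AnalyticAt z) :
    IsCascade (upperChart c 3) (firstCentre c) 6 (firstP c) (firstG c) (fun _ K _ => K ^ 2)
      (firstE c) (-1) z := by
  obtain ⟨hP, hG, hE, hd⟩ := first_isPolyNear h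
  have h0 : firstCentre c 0 z = 2 := rfl
  have hS := cascTail
  refine ⟨?_, ?_, hP.isPoly z, hG.isPoly z, hd.isPoly z, hE.isPoly z, ?_, ?_, by norm_num, ?_⟩
  · intro K V hV hd
    have hK : K ≠ 0 := by rintro rfl; simp at hd
    rw [upperChart_three_velV hK hV]; rfl
  · intro K V hV hd
    have hK : K ≠ 0 := by rintro rfl; simp at hd
    have h1 := firstDivDiff_spec c z K (cascTail (fun j => firstCentre c j z) 6 0 V)
      (cascTailDeriv (fun j => firstCentre c j z) 6 0 V)
      (cascTail (fun j => deriv (firstCentre c j) z) 6 0 V) V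
    rw [firstE_spec z V] at h1
    rw [upperChart_three_velU hK hV, div_eq_div_iff (mul_ne_zero hK (pow_ne_zero 2 hV))
      (mul_ne_zero hd (pow_ne_zero 2 hV))]
    rw [firstG]
    linear_combination (K * V ^ 2) * h1
  · simp [h0]
  · simp only [firstP, h0]; norm_num
  · have h1 : cascTail (fun j => firstCentre c j z) 6 0 0 = 2 := by simp [cascTail, h0]
    simp only [firstG, firstDivDiff, h0, h1]; norm_num

/-- The obstruction to regularity after the first cascade. -/
theorem firstE_zero {z : ℂ} (h : c.AnalyticAt z) :
    firstE c z 0 = 64 * (deriv (deriv c.c3) z - 1 / 2 * deriv c.c1 z) := by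
  have h8 : deriv (centre c 8) z
      = 8 * (deriv c.c1 z + 8 * (2 * c.c3 z * deriv c.c3 z) - 2 * deriv (deriv c.c3) z) := by
    have h1 := h.c1.differentiableAt.hasDerivAt
    have h3 := h.c3.differentiableAt.hasDerivAt
    have h3' := h.c3.deriv.differentiableAt.hasDerivAt
    have := ((h1.add ((h3.pow 2).const_mul 8)).sub (h3'.const_mul 2)).const_mul 8
    have h4 := this.deriv
    simp only [Nat.cast_ofNat, Nat.add_one_sub_one, pow_one] at h4
    exact h4
  have h8' : centre c 8 z = 8 * (c.c1 z + 8 * c.c3 z ^ 2 - 2 * deriv c.c3 z) := rfl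
  simp only [firstE, h8, h8']
  ring

end FirstCascade

/-! ### The second cascade -/

section SecondCascade

variable (c : Coeffs)

/-- The centres `q₁₀, …, q₁₃` of the blow-ups of the second cascade. -/
noncomputable def secondCentre (j : ℕ) : ℂ → ℂ := centre c (10 + j)

/-- The polynomial `P` with `V' = P / V` in the chart `(K, V) = (x/y, 1/y)`. -/
noncomputable def secondP (z K V : ℂ) : ℂ := 1 + (c.c3 z - K) * V ^ 2

/-- The divided difference `(G(K) - G(S)) / (K - S)` for the second cascade. -/
noncomputable def secondG (z K V : ℂ) : ℂ :=
  4 + 2 * c.c3 z * V ^ 2 - (K + cascTail (fun j => secondCentre c j z) 4 0 V) * V ^ 2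
    + V ^ 3 * cascTailDeriv (fun j => secondCentre c j z) 4 0 V

/-- The remainder of the second cascade. -/
noncomputable def secondE (z V : ℂ) : ℂ :=
  let s := centre c 11 z + V * centre c 12 z + V ^ 2 * centre c 13 z
  let t := centre c 11 z + 2 * V * centre c 12 z + 3 * V ^ 2 * centre c 13 z
  s * t - s ^ 2 - V * deriv (centre c 13) z - V * c.c3 z * centre c 13 z - deriv (centre c 12) z

variable {c}

theorem second_isPolyNear {z₀ : ℂ} (h : c.AnalyticAt z₀) :
    IsPolyNear z₀ (secondP c) ∧ IsPolyNear z₀ (secondG c) ∧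
      (IsPolyNear z₀ fun z _ V => secondE c z V) ∧ (IsPolyNear z₀ fun _ _ _ => 1) := by
  have hS := IsPolyNear.cascTail (a := secondCentre c) (fun j => h.centre (10 + j)) 4 0
  have hT := IsPolyNear.cascTailDeriv (a := secondCentre c) (fun j => h.centre (10 + j)) 4 0
  have hC := h.centre
  have h3 := h.c3
  dsimp only [secondP, secondG, secondE]
  refine ⟨?_, ?_, ?_, ?_⟩ <;> repeat' first | assumption | fun_prop | constructor

theorem secondCascade {z : ℂ} (h : c.AnalyticAt z) :
    IsCascade (chartU0 c) (secondCentre c) 4 (secondP c) (secondG c) (fun _ _ _ => 1)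
      (secondE c) 1 z := by
  obtain ⟨hP, hG, hE, hd⟩ := second_isPolyNear h
  have h0 : secondCentre c 0 = fun _ => 0 := rfl
  have h1 : secondCentre c 1 = fun z => -c.c2 z / 3 := rfl
  have h1' : secondCentre c 1 = centre c 11 := rfl
  have h2 : secondCentre c 2 = centre c 12 := rfl
  have h3 : secondCentre c 3 = centre c 13 := rfl
  have hd1 : deriv (centre c 11) z = -deriv c.c2 z / 3 := by
    rw [← h1', h1]; simp
  refine ⟨?_, ?_, hP.isPoly z, hG.isPoly z, hd.isPoly z, hE.isPoly z, ?_, ?_, by norm_num, ?_⟩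
  · intro K V hV hd
    rw [chartU0_velV hV, secondP, one_mul]
  · intro K V hV hd
    rw [chartU0_velU hV, one_mul]
    congr 1
    simp only [secondG, secondE, secondP, cascTail, cascTailDeriv, h0, h1', h2, h3, Nat.reduceAdd,
      deriv_const, hd1]
    have e1 : centre c 11 z = -c.c2 z / 3 := rfl
    have e2 : centre c 12 z = -c.c1 z / 2 := rfl
    have e3 : centre c 13 z = 1 / 3 * (c.c2 z * c.c3 z - deriv c.c2 z - 3 * c.c0 z) := rfl
    rw [e1, e2, e3]
    ring
  · simp
  · simp [secondP]
  · simp [secondG]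

theorem secondE_zero (z : ℂ) : secondE c z 0 = 1 / 2 * deriv c.c1 z := by
  have h : deriv (centre c 12) z = -deriv c.c1 z / 2 := by
    change deriv (fun z => -c.c1 z / 2) z = _
    simp
  simp only [secondE, h]
  ring

end SecondCascade

/-! ### Base points of the intermediate curves -/

section Link

variable {c : Coeffs}

theorem hostChart_first {m : ℕ} (hm : m ≤ 5) :
    hostChart c (4 + m) = casc (upperChart c 3) (firstCentre c) m := by
  interval_cases m <;> rfl

theorem upperChart_first {m : ℕ} (hm : m ≤ 5) :
    upperChart c (4 + m) = casc (upperChart c 3) (firstCentre c) (m + 1) := by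
  interval_cases m <;> rfl

theorem hostChart_second {m : ℕ} (hm : m ≤ 3) :
    hostChart c (10 + m) = casc (chartU0 c) (secondCentre c) m := by
  interval_cases m <;> rfl

theorem upperChart_second {m : ℕ} (hm : m ≤ 3) :
    upperChart c (10 + m) = casc (chartU0 c) (secondCentre c) (m + 1) := by
  interval_cases m <;> rfl

theorem lowerChart_first {m : ℕ} (hm : m ≤ 5) : lowerChart c (4 + m) =
    (casc (upperChart c 3) (firstCentre c) m).lower (firstCentre c m) fun _ => 0 := by
  rw [← hostChart_first hm]; rfl

theorem lowerChart_second {m : ℕ} (hm : m ≤ 3) : lowerChart c (10 + m) =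
    (casc (chartU0 c) (secondCentre c) m).lower (secondCentre c m) fun _ => 0 := by
  rw [← hostChart_second hm]; rfl

theorem isBasePoint_intermediate {z : ℂ} (h : c.AnalyticAt z) {i : ℕ}
    (hi : i ∈ ({1, 3, 4, 5, 6, 7, 8, 10, 11, 12} : Set ℕ)) :
    (∀ u : ℂ, IsBasePoint (upperChart c i) z u 0 ↔ u = centre c (i + 1) z) ∧
      (∀ v : ℂ, IsBasePoint (lowerChart c i) z 0 v ↔ v * centre c (i + 1) z = 1) := by
  have hA : ∀ m ≤ 4, (∀ u : ℂ, IsBasePoint (upperChart c (4 + m)) z u 0 ↔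
      u = centre c (4 + m + 1) z) ∧
      (∀ v : ℂ, IsBasePoint (lowerChart c (4 + m)) z 0 v ↔ v * centre c (4 + m + 1) z = 1) := by
    intro m hm
    rw [upperChart_first (by omega), lowerChart_first (by omega)]
    exact ⟨(firstCascade h).casc_isBasePoint_iff m.succ_ne_zero (by omega),
      (firstCascade h).lower_isBasePoint_iff (by omega)⟩
  have hB : ∀ m ≤ 2, (∀ u : ℂ, IsBasePoint (upperChart c (10 + m)) z u 0 ↔
      u = centre c (10 + m + 1) z) ∧
      (∀ v : ℂ, IsBasePoint (lowerChart c (10 + m)) z 0 v ↔ v * centre c (10 + m + 1) z = 1) := by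
    intro m hm
    rw [upperChart_second (by omega), lowerChart_second (by omega)]
    exact ⟨(secondCascade h).casc_isBasePoint_iff m.succ_ne_zero (by omega),
      (secondCascade h).lower_isBasePoint_iff (by omega)⟩
  simp only [Set.mem_insert_iff, Set.mem_singleton_iff] at hi
  rcases hi with rfl | rfl | rfl | rfl | rfl | rfl | rfl | rfl | rfl | rfl
  · refine ⟨fun u => upperChart_one_isBasePoint_iff u, fun v => ?_⟩
    have : ¬ IsBasePoint (lowerChart c 1) z 0 v := lowerChart_one_not_isBasePoint v
    simp [this, centre]
  · exact ⟨fun u => upperChart_three_isBasePoint_iff u,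
      fun v => lowerChart_three_isBasePoint_iff v⟩
  · exact hA 0 (by norm_num)
  · exact hA 1 (by norm_num)
  · exact hA 2 (by norm_num)
  · exact hA 3 (by norm_num)
  · exact hA 4 (by norm_num)
  · exact hB 0 (by norm_num)
  · exact hB 1 (by norm_num)
  · exact hB 2 (by norm_num)

theorem not_isBasePoint_last {z : ℂ} (h : c.AnalyticAt z) {i : ℕ} (hi : i ∈ ({9, 13} : Set ℕ)) :
    (∀ u : ℂ, ¬ IsBasePoint (upperChart c i) z u 0) ∧
      (∀ v : ℂ, ¬ IsBasePoint (lowerChart c i) z 0 v) := by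
  simp only [Set.mem_insert_iff, Set.mem_singleton_iff] at hi
  rcases hi with rfl | rfl
  · exact ⟨(firstCascade h).casc_last_not_isBasePoint (by norm_num),
      (firstCascade h).lower_last_not_isBasePoint (m := 5) (by norm_num)⟩
  · exact ⟨(secondCascade h).casc_last_not_isBasePoint (by norm_num),
      (secondCascade h).lower_last_not_isBasePoint (m := 3) (by norm_num)⟩

end Link

/-! ### The system after the last blow-up -/

section FinalChart

/-- Normal form, for `z` near `z₀`, of the system in the chart after the last blow-up of a
cascade: `V' = q / (D V)` and `U' = (κ + V N) / (D V²)`, where `q` and `D` have non-zero constant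
values on the exceptional curve `V = 0`. -/
structure IsFinalChart (C : Chart) (κ : ℂ → ℂ) (q N D : ℂ → ℂ → ℂ → ℂ) (p₀ d₀ z₀ : ℂ) :
    Prop where
  κ_analytic : AnalyticAt ℂ κ z₀
  q_poly : IsPolyNear z₀ q
  N_poly : IsPolyNear z₀ N
  D_poly : IsPolyNear z₀ D
  p₀_ne : p₀ ≠ 0
  d₀_ne : d₀ ≠ 0
  q_zero : ∀ u, q z₀ u 0 = p₀
  D_zero : ∀ u, D z₀ u 0 = d₀
  vel : ∀ᶠ z in 𝓝 z₀, ∀ u v, v ≠ 0 → D z u v ≠ 0 →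
    C.velV z u v = q z u v / (D z u v * v) ∧
      C.velU z u v = (κ z + v * N z u v) / (D z u v * v ^ 2)

/-- The last chart of a cascade is a final chart, with the error at `V = 0` as `κ`. -/
theorem exists_isFinalChart {C : Chart} {a : ℕ → ℂ → ℂ} {n : ℕ} {P g d : ℂ → ℂ → ℂ → ℂ}
    {e : ℂ → ℂ → ℂ} {p₀ z₀ : ℂ} (h : ∀ᶠ z in 𝓝 z₀, IsCascade C a n P g d e p₀ z) (hn : n ≠ 0)
    (ha : ∀ j, AnalyticAt ℂ (a j) z₀) (hP : IsPolyNear z₀ P) (hg : IsPolyNear z₀ g)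
    (hd : IsPolyNear z₀ d) (he : IsPolyNear z₀ fun z _ v => e z v) :
    ∃ q N D, IsFinalChart (casc C a n) (fun z => e z 0) q N D p₀ (d z₀ (a 0 z₀) 0) z₀ := by
  have hL := IsPolyNear.cascLift ha n
  set q : ℂ → ℂ → ℂ → ℂ := fun z u v => P z (cascLift (fun j => a j z) n u v) v with hq
  have hqp : IsPolyNear z₀ q := hP.comp hL .snd
  set D : ℂ → ℂ → ℂ → ℂ := fun z u v => d z (cascLift (fun j => a j z) n u v) v with hD
  have hDp : IsPolyNear z₀ D := hd.comp hL .snd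
  obtain ⟨r, hr, hr'⟩ := ((hg.comp hL .snd).sub ((IsPolyNear.const n).mul hqp)).exists_div_snd
  obtain ⟨s, hs, hs'⟩ := he.exists_div_snd
  refine ⟨q, fun z u v => u * r z u v + s z u v, D, ?_, hqp, (IsPolyNear.fst.mul hr).add hs, hDp,
    h.self_of_nhds.p₀_ne, h.self_of_nhds.d_ne, fun u => ?_, fun u => ?_, ?_⟩
  · exact (he.analyticAt 0 0).comp_of_eq (f := fun z => (z, (0 : ℂ), (0 : ℂ)))
      (analyticAt_id.prod analyticAt_const) rfl
  · simp only [hq, cascLift_zero_right _ hn, h.self_of_nhds.P_eq]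
  · simp only [hD, cascLift_zero_right _ hn]
  · filter_upwards [h] with z hz u v hv hDv
    refine ⟨hz.casc_velV n hv hDv, ?_⟩
    rw [hz.casc_velU (j := 0) rfl hv hDv]
    have h1 := hr' z u v
    have h2 := hs' z u v
    simp only [hq, cascLift_zero_right _ hn, hz.P_eq, hz.g_eq, sub_self, zero_add] at h1
    simp only [cascTail, cascTailDeriv]
    congr 1
    linear_combination u * h1 + h2

namespace IsFinalChart

variable {C : Chart} {κ : ℂ → ℂ} {q N D : ℂ → ℂ → ℂ → ℂ} {p₀ d₀ z₀ : ℂ}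

theorem eventually_ne (h : IsFinalChart C κ q N D p₀ d₀ z₀) (u : ℂ) :
    ∀ᶠ p in 𝓝 ((z₀, u, 0) : ℂ × ℂ × ℂ),
      q p.1 p.2.1 p.2.2 ≠ 0 ∧ D p.1 p.2.1 p.2.2 ≠ 0 := by
  refine ((h.q_poly.analyticAt u 0).continuousAt.eventually_ne ?_).and
    ((h.D_poly.analyticAt u 0).continuousAt.eventually_ne ?_)
  · simp only [h.q_zero]; exact h.p₀_ne
  · simp only [h.D_zero]; exact h.d₀_ne

theorem eventually_vel (h : IsFinalChart C κ q N D p₀ d₀ z₀) (u : ℂ) :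
    ∀ᶠ p in 𝓝 ((z₀, u, 0) : ℂ × ℂ × ℂ), q p.1 p.2.1 p.2.2 ≠ 0 ∧ D p.1 p.2.1 p.2.2 ≠ 0 ∧
      (p.2.2 ≠ 0 → C.velV p.1 p.2.1 p.2.2 = q p.1 p.2.1 p.2.2 / (D p.1 p.2.1 p.2.2 * p.2.2) ∧
      C.velU p.1 p.2.1 p.2.2 =
        (κ p.1 + p.2.2 * N p.1 p.2.1 p.2.2) / (D p.1 p.2.1 p.2.2 * p.2.2 ^ 2)) := by
  have h1 : ∀ᶠ p in 𝓝 ((z₀, u, 0) : ℂ × ℂ × ℂ), ∀ u v, v ≠ 0 → D p.1 u v ≠ 0 →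
    C.velV p.1 u v = q p.1 u v / (D p.1 u v * v) ∧
      C.velU p.1 u v = (κ p.1 + v * N p.1 u v) / (D p.1 u v * v ^ 2) :=
    (continuous_fst.tendsto (z₀, u, (0 : ℂ))).eventually h.vel
  filter_upwards [h1, h.eventually_ne u] with p hp hne
  exact ⟨hne.1, hne.2, fun hv => hp _ _ hv hne.2⟩

/-- If `κ = 0`, a factor `V` cancels in `dU/dV = (κ + V N) / (q V)`. -/
theorem regularAfterSwap (h : IsFinalChart C κ q N D p₀ d₀ z₀) (hκ : ∀ᶠ z in 𝓝 z₀, κ z = 0)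
    (u : ℂ) : RegularAfterSwap C z₀ u := by
  have hq := h.q_poly.analyticAt u 0
  have hq0 : q z₀ u 0 ≠ 0 := by rw [h.q_zero]; exact h.p₀_ne
  have hv : AnalyticAt ℂ (fun p : ℂ × ℂ × ℂ => p.2.2) (z₀, u, 0) :=
    analyticAt_snd.comp analyticAt_snd
  refine ⟨fun p => p.2.2 * D p.1 p.2.1 p.2.2 / q p.1 p.2.1 p.2.2,
    fun p => N p.1 p.2.1 p.2.2 / q p.1 p.2.1 p.2.2,
    (hv.mul (h.D_poly.analyticAt u 0)).div hq hq0,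
    (h.N_poly.analyticAt u 0).div hq hq0, ?_⟩
  have h1 : ∀ᶠ p in 𝓝 ((z₀, u, 0) : ℂ × ℂ × ℂ), κ p.1 = 0 :=
    (continuous_fst.tendsto (z₀, u, (0 : ℂ))).eventually hκ
  filter_upwards [h1, h.eventually_vel u] with p hp ⟨hqp, hDp, hvel⟩ hvp
  obtain ⟨e1, e2⟩ := hvel hvp
  rw [e1, e2, hp]
  refine ⟨by positivity, ?_, ?_⟩
  · field_simp
  · field_simp; simp

theorem eq_zero_of_regularAfterSwap (h : IsFinalChart C κ q N D p₀ d₀ z₀) {u : ℂ}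
    (hr : RegularAfterSwap C z₀ u) : κ z₀ = 0 := by
  obtain ⟨Φ, Ψ, -, hΨ, hev⟩ := hr
  have hi : ContinuousAt (fun v : ℂ => ((z₀, u, v) : ℂ × ℂ × ℂ)) 0 := by fun_prop
  have hc : ∀ {f : ℂ × ℂ × ℂ → ℂ}, AnalyticAt ℂ f (z₀, u, 0) →
      Tendsto (fun v => f (z₀, u, v)) (𝓝[≠] 0) (𝓝 (f (z₀, u, 0))) := fun hf =>
    (ContinuousAt.comp (f := fun v : ℂ => ((z₀, u, v) : ℂ × ℂ × ℂ)) hf.continuousAt hi).tendsto.mono_left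
      nhdsWithin_le_nhds
  have hid : Tendsto (fun v : ℂ => v) (𝓝[≠] 0) (𝓝 0) := nhdsWithin_le_nhds
  have t1 := (hc hΨ).mul (hid.mul (hc (h.q_poly.analyticAt u 0)))
  have t2 := (hid.mul (hc (h.N_poly.analyticAt u 0))).const_add (κ z₀)
  simp only [zero_mul, mul_zero, add_zero] at t1 t2
  refine tendsto_nhds_unique t2 (t1.congr' ?_)
  have e1 := (hi.tendsto.eventually hev).filter_mono (nhdsWithin_le_nhds (s := {0}ᶜ))
  have e2 := (hi.tendsto.eventually (h.eventually_vel u)).filter_mono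
    (nhdsWithin_le_nhds (s := {0}ᶜ))
  filter_upwards [e1, e2, self_mem_nhdsWithin] with v hv1 ⟨hqp, hDp, hvel⟩ hv
  have hv : v ≠ 0 := hv
  obtain ⟨h1, h2⟩ := hvel hv
  obtain ⟨-, -, h3⟩ := hv1 hv
  rw [h3, h1, h2]
  field_simp

/-- Solution curves near the exceptional curve, with `V` as the independent variable. -/
theorem exists_curves (h : IsFinalChart C κ q N D p₀ d₀ z₀) (u : ℂ) {A : ℂ × ℂ × ℂ → Prop}
    (hA : ∀ᶠ x in 𝓝 (z₀, u, 0), A x) :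
    ∃ r > 0, ∃ δ > 0, ∀ V₁ ∈ Metric.ball (0 : ℂ) r, ∀ z₁ ∈ Metric.ball z₀ δ,
      ∀ U₁ ∈ Metric.ball u δ, ∃ Z Υ : ℂ → ℂ, Z V₁ = z₁ ∧ Υ V₁ = U₁ ∧
        ∀ V ∈ Metric.ball (0 : ℂ) r, A (Z V, Υ V, V) ∧
          q (Z V) (Υ V) V ≠ 0 ∧ D (Z V) (Υ V) V ≠ 0 ∧
          HasDerivAt Z (V * (D (Z V) (Υ V) V / q (Z V) (Υ V) V)) V ∧
          HasDerivAt Υ (N (Z V) (Υ V) V / q (Z V) (Υ V) V) V := by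
  have hq := h.q_poly.analyticAt u 0
  have hD := h.D_poly.analyticAt u 0
  have hq0 : q z₀ u 0 ≠ 0 := by rw [h.q_zero]; exact h.p₀_ne
  have hD0 : D z₀ u 0 ≠ 0 := by rw [h.D_zero]; exact h.d₀_ne
  obtain ⟨r, hr, δ, hδ, hsol⟩ := exists_swapped_solutions (hq.fun_div hD hD0)
    ((h.N_poly.analyticAt u 0).fun_div hD hD0) (div_ne_zero hq0 hD0) ((h.eventually_ne u).and hA)
  refine ⟨r, hr, δ, hδ, fun V₁ hV₁ z₁ hz₁ U₁ hU₁ => ?_⟩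
  obtain ⟨Z, Υ, h1, h2, h3⟩ := hsol V₁ hV₁ z₁ hz₁ U₁ hU₁
  refine ⟨Z, Υ, h1, h2, fun V hV => ?_⟩
  obtain ⟨⟨⟨hqp, hDp⟩, hA'⟩, hZ, hΥ⟩ := h3 V hV
  dsimp only at hqp hDp hZ hΥ
  refine ⟨hA', hqp, hDp, ?_, ?_⟩
  · convert hZ using 1; field_simp
  · convert hΥ using 1; field_simp

end IsFinalChart

/-- A solution curve that reaches the exceptional curve `V = 0` at `z₀`, parametrised by a square
root `τ` of `z - z₀`. -/
theorem exists_sqrt_of_curve {q N D : ℂ → ℂ → ℂ → ℂ} {z₀ : ℂ} (hq : IsPolyNear z₀ q)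
    (hD : IsPolyNear z₀ D) {Z Υ : ℂ → ℂ} {r : ℝ} (hr : 0 < r) (hZ0 : Z 0 = z₀)
    (hZ : ∀ V ∈ Metric.ball (0 : ℂ) r, q (Z V) (Υ V) V ≠ 0 ∧ D (Z V) (Υ V) V ≠ 0 ∧
      HasDerivAt Z (V * (D (Z V) (Υ V) V / q (Z V) (Υ V) V)) V ∧
      HasDerivAt Υ (N (Z V) (Υ V) V / q (Z V) (Υ V) V) V) :
    ∃ φ ψ : ℂ → ℂ, AnalyticAt ℂ φ 0 ∧ AnalyticAt ℂ ψ 0 ∧ AnalyticAt ℂ Υ 0 ∧ φ 0 = 0 ∧ ψ 0 = 0 ∧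
      deriv ψ 0 ≠ 0 ∧ deriv ψ 0 ^ 2 * (D z₀ (Υ 0) 0 / q z₀ (Υ 0) 0) = 2 ∧
      (∀ᶠ V in 𝓝 (0 : ℂ), Z V = z₀ + φ V ^ 2) ∧ (∀ᶠ V in 𝓝 (0 : ℂ), ψ (φ V) = V) ∧
      (∀ᶠ τ in 𝓝 (0 : ℂ), Z (ψ τ) = z₀ + τ ^ 2 ∧ ψ τ ∈ Metric.ball (0 : ℂ) r) ∧
      ∀ᶠ τ in 𝓝[≠] (0 : ℂ), ψ τ ≠ 0 ∧
        HasDerivAt ψ (2 * τ * (q (z₀ + τ ^ 2) (Υ (ψ τ)) (ψ τ) /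
          (D (z₀ + τ ^ 2) (Υ (ψ τ)) (ψ τ) * ψ τ))) τ ∧
        HasDerivAt (Υ ∘ ψ) (2 * τ * (N (z₀ + τ ^ 2) (Υ (ψ τ)) (ψ τ) /
          (D (z₀ + τ ^ 2) (Υ (ψ τ)) (ψ τ) * ψ τ))) τ := by
  obtain ⟨hq0, hD0, -, -⟩ := hZ 0 (Metric.mem_ball_self hr)
  rw [hZ0] at hq0 hD0
  have hZa : AnalyticAt ℂ Z 0 :=
    DifferentiableOn.analyticAt (s := Metric.ball 0 r)
      (fun V hV => (hZ V hV).2.2.1.differentiableAt.differentiableWithinAt)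
      (Metric.ball_mem_nhds 0 hr)
  have hΥa : AnalyticAt ℂ Υ 0 :=
    DifferentiableOn.analyticAt (s := Metric.ball 0 r)
      (fun V hV => (hZ V hV).2.2.2.differentiableAt.differentiableWithinAt)
      (Metric.ball_mem_nhds 0 hr)
  have hcurve : AnalyticAt ℂ (fun V => (Z V, Υ V, V)) 0 := hZa.prod (hΥa.prod analyticAt_id)
  have hga : AnalyticAt ℂ (fun V => D (Z V) (Υ V) V / q (Z V) (Υ V) V) 0 := by
    refine AnalyticAt.fun_div (AnalyticAt.comp_of_eq (hD.analyticAt (Υ 0) 0) hcurve ?_)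
      (AnalyticAt.comp_of_eq (hq.analyticAt (Υ 0) 0) hcurve ?_) ?_
    · rw [hZ0]
    · rw [hZ0]
    · rw [hZ0]; exact hq0
  have hball : ∀ᶠ V in 𝓝 (0 : ℂ), V ∈ Metric.ball (0 : ℂ) r := Metric.ball_mem_nhds 0 hr
  obtain ⟨φ, ψ, hφ, hψ, hφ0, hψ0, hψ', hψ2, hZφ, hψφ, hφψ⟩ :=
    exists_sqrt_uniformizer (Z := Z) hga (by rw [hZ0]; exact div_ne_zero hD0 hq0) (by
      filter_upwards [hball] with V hV using (hZ V hV).2.2.1)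
  rw [hZ0] at hZφ hψ2
  have hψt : Tendsto ψ (𝓝 0) (𝓝 0) := by simpa [hψ0] using hψ.continuousAt.tendsto
  have hZψ : ∀ᶠ τ in 𝓝 (0 : ℂ), Z (ψ τ) = z₀ + τ ^ 2 := by
    filter_upwards [hψt.eventually hZφ, hφψ] with τ h1 h2
    rw [h1, h2]
  have hψne : ∀ᶠ τ in 𝓝[≠] (0 : ℂ), ψ τ ≠ 0 :=
    (hψ.differentiableAt.hasDerivAt).eventually_ne (c := 0) hψ'
  refine ⟨φ, ψ, hφ, hψ, hΥa, hφ0, hψ0, hψ', hψ2, hZφ, hψφ, hZψ.and (hψt.eventually hball), ?_⟩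
  have hev : ∀ᶠ τ in 𝓝[≠] (0 : ℂ), (∀ᶠ w in 𝓝 τ, Z (ψ w) = z₀ + w ^ 2) ∧
      ψ τ ∈ Metric.ball (0 : ℂ) r ∧ DifferentiableAt ℂ ψ τ :=
    (hZψ.eventually_nhds.and ((hψt.eventually hball).and
      (hψ.eventually_analyticAt.mono fun _ h => h.differentiableAt))).filter_mono nhdsWithin_le_nhds
  filter_upwards [hev, hψne] with τ ⟨hZw, hτ, hd⟩ hne
  obtain ⟨hqp, hDp, hZ', hΥ'⟩ := hZ _ hτ
  have hτ2 : Z (ψ τ) = z₀ + τ ^ 2 := hZw.self_of_nhds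
  have hder : deriv ψ τ = 2 * τ * (q (Z (ψ τ)) (Υ (ψ τ)) (ψ τ) /
      (D (Z (ψ τ)) (Υ (ψ τ)) (ψ τ) * ψ τ)) := by
    have a1 := hZ'.comp τ hd.hasDerivAt
    have a2 : HasDerivAt (fun w : ℂ => z₀ + w ^ 2) (2 * τ) τ := by
      simpa using (hasDerivAt_pow 2 τ).const_add z₀
    rw [(a2.congr_of_eventuallyEq hZw).unique a1]
    field_simp
  rw [← hτ2]
  refine ⟨hne, ?_, ?_⟩
  · rw [← hder]; exact hd.hasDerivAt
  · refine (hΥ'.comp τ hd.hasDerivAt).congr_deriv ?_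
    rw [hder]
    field_simp

namespace IsFinalChart

variable {C : Chart} {κ : ℂ → ℂ} {q N D : ℂ → ℂ → ℂ → ℂ} {p₀ d₀ z₀ : ℂ}

theorem hasSqrtExpansion (h : IsFinalChart C κ q N D p₀ d₀ z₀) (hκ : ∀ᶠ z in 𝓝 z₀, κ z = 0)
    (u : ℂ) : HasSqrtExpansion C z₀ u := by
  have h1 : ∀ᶠ p in 𝓝 ((z₀, u, 0) : ℂ × ℂ × ℂ), κ p.1 = 0 :=
    (continuous_fst.tendsto (z₀, u, (0 : ℂ))).eventually hκ
  obtain ⟨r, hr, δ, hδ, hsol⟩ := h.exists_curves u ((h.eventually_vel u).and h1)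
  obtain ⟨Z, Υ, hZ0, hΥ0, hZ⟩ := hsol 0 (Metric.mem_ball_self hr) z₀ (Metric.mem_ball_self hδ) u
    (Metric.mem_ball_self hδ)
  obtain ⟨φ, ψ, hφ, hψ, hΥa, hφ0, hψ0, hψ', -, -, -, hZψ, hev⟩ :=
    exists_sqrt_of_curve h.q_poly h.D_poly hr hZ0 fun V hV => (hZ V hV).2
  refine ⟨Υ ∘ ψ, ψ, hΥa.comp_of_eq hψ hψ0, hψ, by simp [hψ0, hΥ0], hψ0, hψ', ?_⟩
  filter_upwards [hev, hZψ.filter_mono nhdsWithin_le_nhds] with τ ⟨hne, hψd, hΥd⟩ ⟨hτ2, hτ⟩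
  obtain ⟨⟨⟨hqp, hDp, hvel⟩, hκτ⟩, -⟩ := hZ _ hτ
  dsimp only at hqp hDp hvel hκτ
  obtain ⟨e1, e2⟩ := hvel hne
  rw [hκτ, zero_add] at e2
  rw [hτ2] at e1 e2 hDp
  rw [Function.comp_apply, e1, e2]
  refine ⟨?_, hψd⟩
  convert hΥd using 1
  field_simp

theorem eq_zero_of_hasSqrtExpansion (h : IsFinalChart C κ q N D p₀ d₀ z₀) {u : ℂ}
    (hs : HasSqrtExpansion C z₀ u) : κ z₀ = 0 := by
  obtain ⟨F, G, hF, hG, hF0, hG0, hG', hev⟩ := hs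
  have hcurve : AnalyticAt ℂ (fun τ => (z₀ + τ ^ 2, F τ, G τ)) 0 :=
    (by fun_prop : AnalyticAt ℂ (fun τ : ℂ => z₀ + τ ^ 2) 0).prod (hF.prod hG)
  have hc0 : (z₀ + (0 : ℂ) ^ 2, F 0, G 0) = (z₀, u, 0) := by simp [hF0, hG0]
  have hct : Tendsto (fun τ => (z₀ + τ ^ 2, F τ, G τ)) (𝓝[≠] 0) (𝓝 (z₀, u, 0)) := by
    rw [← hc0]; exact hcurve.continuousAt.tendsto.mono_left nhdsWithin_le_nhds
  have hc : ∀ {f : ℂ × ℂ × ℂ → ℂ}, AnalyticAt ℂ f (z₀, u, 0) →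
      Tendsto (fun τ => f (z₀ + τ ^ 2, F τ, G τ)) (𝓝[≠] 0) (𝓝 (f (z₀, u, 0))) := fun hf =>
    hf.continuousAt.tendsto.comp hct
  have hGt : Tendsto G (𝓝[≠] 0) (𝓝 0) := by
    have := hG.continuousAt.tendsto
    rw [hG0] at this
    exact this.mono_left nhdsWithin_le_nhds
  have hsl : Tendsto (fun τ => τ⁻¹ * G τ) (𝓝[≠] 0) (𝓝 (deriv G 0)) := by
    have := hG.differentiableAt.hasDerivAt.tendsto_slope_zero
    simpa [hG0] using this
  have hF' : Tendsto (deriv F) (𝓝[≠] 0) (𝓝 (deriv F 0)) :=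
    hF.deriv.continuousAt.tendsto.mono_left nhdsWithin_le_nhds
  have hne : ∀ᶠ τ in 𝓝[≠] (0 : ℂ), G τ ≠ 0 :=
    (hG.differentiableAt.hasDerivAt).eventually_ne (c := 0) hG'
  have hκ : AnalyticAt ℂ (fun p : ℂ × ℂ × ℂ => κ p.1) (z₀, u, 0) :=
    h.κ_analytic.comp_of_eq analyticAt_fst rfl
  have t1 := (hc hκ).add (hGt.mul (hc (h.N_poly.analyticAt u 0)))
  have t2 := ((hF'.mul (hc (h.D_poly.analyticAt u 0))).mul (hGt.mul hsl)).div_const 2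
  simp only [zero_mul, mul_zero, add_zero, zero_div] at t1 t2
  -- Along the curve `κ + G N = F' D G (G / τ) / 2`, and the right-hand side tends to zero.
  refine tendsto_nhds_unique t1 (t2.congr' ?_)
  filter_upwards [hev, hct.eventually (h.eventually_vel u), hne, self_mem_nhdsWithin]
    with τ ⟨h1, _⟩ ⟨hqp, hDp, hvel⟩ hGτ hτ
  have hτ : τ ≠ 0 := hτ
  obtain ⟨-, e2⟩ := hvel hGτ
  rw [h1.deriv, e2]
  field_simp

end IsFinalChart

end FinalChart

end QPII

/-! ### The two conditions -/

section Conditions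

namespace QPII

variable {c : Coeffs} {U : Set ℂ}

theorem upperChart_nine :
    upperChart c 9 = casc (upperChart c 3) (firstCentre c) 6 := upperChart_first le_rfl

theorem upperChart_thirteen :
    upperChart c 13 = casc (chartU0 c) (secondCentre c) 4 := upperChart_second le_rfl

theorem exists_isFinalChart_nine {z₀ : ℂ} (hc : ∀ᶠ z in 𝓝 z₀, c.AnalyticAt z) :
    ∃ q N D, IsFinalChart (upperChart c 9) (fun z => firstE c z 0) q N D (-1) 4 z₀ := by
  obtain ⟨hP, hG, hE, hd⟩ := first_isPolyNear hc.self_of_nhds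
  obtain ⟨q, N, D, h⟩ := exists_isFinalChart (hc.mono fun z hz => firstCascade hz) (by norm_num)
    (fun j => hc.self_of_nhds.centre _) hP hG hd hE
  rw [← upperChart_nine] at h
  have h2 : firstCentre c 0 z₀ ^ 2 = 4 := by
    change (2 : ℂ) ^ 2 = 4
    norm_num
  rw [h2] at h
  exact ⟨q, N, D, h⟩

theorem exists_isFinalChart_thirteen {z₀ : ℂ} (hc : ∀ᶠ z in 𝓝 z₀, c.AnalyticAt z) :
    ∃ q N D, IsFinalChart (upperChart c 13) (fun z => secondE c z 0) q N D 1 1 z₀ := by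
  obtain ⟨hP, hG, hE, hd⟩ := second_isPolyNear hc.self_of_nhds
  obtain ⟨q, N, D, h⟩ := exists_isFinalChart (hc.mono fun z hz => secondCascade hz) (by norm_num)
    (fun j => hc.self_of_nhds.centre _) hP hG hd hE
  rw [← upperChart_thirteen] at h
  exact ⟨q, N, D, h⟩

/-- Both forms of regularity at all points of the last curve are equivalent to `κ = 0`. -/
theorem forall_regular_iff {C : Chart} {κ K : ℂ → ℂ} {p₀ d₀ k : ℂ} (hU : IsOpen U)
    (h : ∀ z ∈ U, ∃ q N D, IsFinalChart C κ q N D p₀ d₀ z) (hk : k ≠ 0)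
    (hK : ∀ z ∈ U, κ z = k * K z) :
    ((∀ z ∈ U, ∀ u, RegularAfterSwap C z u) ↔ ∀ z ∈ U, K z = 0) ∧
      ((∀ z ∈ U, ∀ u, HasSqrtExpansion C z u) ↔ ∀ z ∈ U, K z = 0) := by
  have h0 : (∀ z ∈ U, K z = 0) → ∀ z ∈ U, ∀ᶠ w in 𝓝 z, κ w = 0 := fun hz z hzU => by
    filter_upwards [hU.mem_nhds hzU] with w hw
    rw [hK w hw, hz w hw, mul_zero]
  have h1 : ∀ z ∈ U, κ z = 0 → K z = 0 := fun z hz e => by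
    rw [hK z hz] at e
    exact (mul_eq_zero.1 e).resolve_left hk
  refine ⟨⟨fun hr z hz => ?_, fun hz z hzU u => ?_⟩, ⟨fun hr z hz => ?_, fun hz z hzU u => ?_⟩⟩
  · obtain ⟨q, N, D, hF⟩ := h z hz
    exact h1 z hz (hF.eq_zero_of_regularAfterSwap (hr z hz 0))
  · obtain ⟨q, N, D, hF⟩ := h z hzU
    exact hF.regularAfterSwap (h0 hz z hzU) u
  · obtain ⟨q, N, D, hF⟩ := h z hz
    exact h1 z hz (hF.eq_zero_of_hasSqrtExpansion (hr z hz 0))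
  · obtain ⟨q, N, D, hF⟩ := h z hzU
    exact hF.hasSqrtExpansion (h0 hz z hzU) u

theorem exists_const_of_deriv_eq_zero {f : ℂ → ℂ} (hU : IsOpen U) (hUc : IsPreconnected U)
    (hf : AnalyticOnNhd ℂ f U) (h : ∀ z ∈ U, deriv f z = 0) : ∃ κ, ∀ z ∈ U, f z = κ := by
  exact hU.exists_is_const_of_deriv_eq_zero hUc hf.differentiableOn h

theorem conditions_iff (hU : IsOpen U) (hUc : IsPreconnected U) (h1 : AnalyticOnNhd ℂ c.c1 U)
    (h3 : AnalyticOnNhd ℂ c.c3 U) :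
    ((∀ z ∈ U, deriv (deriv c.c3) z - 1 / 2 * deriv c.c1 z = 0) ∧ ∀ z ∈ U, deriv c.c1 z = 0) ↔
      (∃ κ : ℂ, ∀ z ∈ U, c.c1 z = κ) ∧ ∃ α β : ℂ, ∀ z ∈ U, c.c3 z = α * z + β := by
  constructor
  · rintro ⟨hA, hB⟩
    refine ⟨exists_const_of_deriv_eq_zero hU hUc h1 hB, ?_⟩
    obtain ⟨α, hα⟩ := exists_const_of_deriv_eq_zero hU hUc h3.deriv fun z hz => by
      have := hA z hz
      rw [hB z hz] at this
      simpa using this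
    obtain ⟨β, hβ⟩ := exists_const_of_deriv_eq_zero (f := fun z => c.c3 z - α * z) hU hUc
      (h3.sub (analyticOnNhd_const.mul analyticOnNhd_id)) fun z hz => by
        have := ((h3 z hz).differentiableAt.hasDerivAt.sub
          ((hasDerivAt_id z).const_mul α)).deriv
        rw [hα z hz, mul_one, sub_self] at this
        exact this
    exact ⟨α, β, fun z hz => by linear_combination hβ z hz⟩
  · rintro ⟨⟨κ, hκ⟩, α, β, hαβ⟩
    have hc1 : ∀ z ∈ U, deriv c.c1 z = 0 := fun z hz => by
      have : c.c1 =ᶠ[𝓝 z] fun _ => κ := by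
        filter_upwards [hU.mem_nhds hz] with w hw using hκ w hw
      rw [this.deriv_eq, deriv_const]
    have hc3 : ∀ z ∈ U, deriv c.c3 z = α := fun z hz => by
      have : c.c3 =ᶠ[𝓝 z] fun z => α * z + β := by
        filter_upwards [hU.mem_nhds hz] with w hw using hαβ w hw
      rw [this.deriv_eq]
      simp
    refine ⟨fun z hz => ?_, hc1⟩
    have : deriv c.c3 =ᶠ[𝓝 z] fun _ => α := by
      filter_upwards [hU.mem_nhds hz] with w hw using hc3 w hw
    rw [this.deriv_eq, hc1 z hz]; simp

end QPII

end Conditions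

namespace QPII

/-! ### Continuation along paths -/

section Continuation

/-- Induction along `[t₀, 1)`. -/
theorem forall_mem_Ico_of_continuation {S : ℝ → Prop} {t₀ : ℝ} (h0 : S t₀)
    (hclosed : ∀ s ∈ Set.Ioo t₀ 1, (∀ s' ∈ Set.Ico t₀ s, S s') → S s)
    (hopen : ∀ s ∈ Set.Ico t₀ 1, S s → ∀ᶠ s' in 𝓝[>] s, S s') : ∀ s ∈ Set.Ico t₀ 1, S s := by
  by_contra! hcon
  obtain ⟨b, hb, hSb⟩ := hcon
  set B : Set ℝ := {s | s ∈ Set.Ico t₀ 1 ∧ ¬ S s} with hB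
  have hBb : b ∈ B := ⟨hb, hSb⟩
  have hbdd : BddBelow B := ⟨t₀, fun s hs => hs.1.1⟩
  have hle : sInf B ≤ b := csInf_le hbdd hBb
  have hge : t₀ ≤ sInf B := le_csInf ⟨b, hBb⟩ fun s hs => hs.1.1
  have hi1 : sInf B < 1 := hle.trans_lt hb.2
  have hlt : ∀ s' ∈ Set.Ico t₀ (sInf B), S s' := fun s' hs' => by
    by_contra hns
    exact absurd (csInf_le hbdd ⟨⟨hs'.1, hs'.2.trans hi1⟩, hns⟩) (not_le.2 hs'.2)
  have hi : S (sInf B) := by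
    rcases hge.eq_or_lt with h | h
    · rwa [← h]
    · exact hclosed _ ⟨h, hi1⟩ hlt
  obtain ⟨e, he, hee⟩ := (mem_nhdsGT_iff_exists_Ioo_subset).1 (hopen _ ⟨hge, hi1⟩ hi)
  have : e ≤ sInf B := le_csInf ⟨b, hBb⟩ fun s hs => by
    by_contra! hse
    rcases (csInf_le hbdd hs).eq_or_lt with h | h
    · exact hs.2 (h ▸ hi)
    · exact hs.2 (hee ⟨h, hse⟩)
  exact absurd this (not_le.2 he)

variable {c : Coeffs} {U : Set ℂ} {γ : ℝ → ℂ} {x y : ℝ → ℂ}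

theorem analyticAt_xdot {z x y : ℂ} (hc : c.AnalyticAt z) :
    AnalyticAt ℂ (fun p : ℂ × ℂ × ℂ => c.xdot p.1 p.2.1 p.2.2) (z, x, y) := by
  simp only [xdot_eq]
  have h1 : AnalyticAt ℂ (fun p : ℂ × ℂ × ℂ => p.2.1) (z, x, y) := analyticAt_fst.comp analyticAt_snd
  have h2 : AnalyticAt ℂ (fun p : ℂ × ℂ × ℂ => p.2.2) (z, x, y) := analyticAt_snd.comp analyticAt_snd
  have hf : ∀ {f : ℂ → ℂ}, AnalyticAt ℂ f z →
      AnalyticAt ℂ (fun p : ℂ × ℂ × ℂ => f p.1) (z, x, y) := fun hf =>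
    hf.comp_of_eq analyticAt_fst rfl
  exact (((h1.mul ((analyticAt_const.mul (h2.pow 2)).add (hf hc.c3))).add
    ((hf hc.c2).mul (h2.pow 2))).add ((hf hc.c1).mul h2)).add (hf hc.c0)

theorem analyticAt_ydot {z x y : ℂ} (hc : c.AnalyticAt z) :
    AnalyticAt ℂ (fun p : ℂ × ℂ × ℂ => c.ydot p.1 p.2.1 p.2.2) (z, x, y) := by
  simp only [ydot_eq]
  have h1 : AnalyticAt ℂ (fun p : ℂ × ℂ × ℂ => p.2.1) (z, x, y) := analyticAt_fst.comp analyticAt_snd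
  have h2 : AnalyticAt ℂ (fun p : ℂ × ℂ × ℂ => p.2.2) (z, x, y) := analyticAt_snd.comp analyticAt_snd
  have hf : ∀ {f : ℂ → ℂ}, AnalyticAt ℂ f z →
      AnalyticAt ℂ (fun p : ℂ × ℂ × ℂ => f p.1) (z, x, y) := fun hf =>
    hf.comp_of_eq analyticAt_fst rfl
  exact (h1.sub (h2.pow 3)).sub ((hf hc.c3).mul h2)

theorem IsSolutionNear.eventually_eq {ξ η ξ' η' : ℂ → ℂ} {z : ℂ} (hc : c.AnalyticAt z)
    (h : IsSolutionNear c ξ η z) (h' : IsSolutionNear c ξ' η' z) (hξ : ξ z = ξ' z)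
    (hη : η z = η' z) : ∀ᶠ w in 𝓝 z, ξ w = ξ' w ∧ η w = η' w := by
  have hf : AnalyticAt ℂ (fun p : ℂ × (ℂ × ℂ) => (c.xdot p.1 p.2.1 p.2.2, c.ydot p.1 p.2.1 p.2.2))
      (z, (ξ z, η z)) := (analyticAt_xdot hc).prod (analyticAt_ydot hc)
  have := eventuallyEq_of_hasDerivAt (φ := fun w => (ξ w, η w)) (ψ := fun w => (ξ' w, η' w)) hf
    (h.mono fun w hw => hw.1.prodMk hw.2) (h'.mono fun w hw => hw.1.prodMk hw.2) (by simp [hξ, hη])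
  filter_upwards [this] with w hw
  exact ⟨congrArg Prod.fst hw, congrArg Prod.snd hw⟩

theorem IsFinitePathIn.continuousWithinAt (hγ : IsFinitePathIn U γ) {t : ℝ}
    (ht : t ∈ Set.Icc (0 : ℝ) 1) : ContinuousWithinAt γ (Set.Ico 0 1) t :=
  (hγ.1 t ht).mono Set.Ico_subset_Icc_self

theorem IsFinitePathIn.eventually_right (hγ : IsFinitePathIn U γ) {t : ℝ}
    (ht : t ∈ Set.Ico (0 : ℝ) 1) {p : ℂ → Prop} (hp : ∀ᶠ w in 𝓝 (γ t), p w) :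
    ∀ᶠ s in 𝓝[>] t, p (γ s) := by
  have h2 := (hγ.continuousWithinAt (Set.Ico_subset_Icc_self ht)).eventually hp
  have h3 : 𝓝[>] t ≤ 𝓝[Set.Ico 0 1] t := by
    rw [← nhdsWithin_Ioo_eq_nhdsGT ht.2]
    exact nhdsWithin_mono t fun s hs => ⟨ht.1.trans hs.1.le, hs.2⟩
  exact h3 h2

theorem IsContinuedAlong.continuousOn (hγ : IsFinitePathIn U γ) (h : IsContinuedAlong c γ x y) :
    ContinuousOn x (Set.Ico 0 1) ∧ ContinuousOn y (Set.Ico 0 1) := by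
  have key : ∀ t ∈ Set.Ico (0 : ℝ) 1, ContinuousWithinAt x (Set.Ico 0 1) t ∧
      ContinuousWithinAt y (Set.Ico 0 1) t := by
    intro t ht
    obtain ⟨ξ, η, hsol, hev⟩ := h t ht
    have hγt := hγ.continuousWithinAt (Set.Ico_subset_Icc_self ht)
    have h0 := hev.self_of_nhdsWithin ht
    have hd := hsol.self_of_nhds
    refine ⟨ContinuousWithinAt.congr_of_eventuallyEq (f := fun s => ξ (γ s)) ?_
      (hev.mono fun s hs => hs.1) h0.1,
      ContinuousWithinAt.congr_of_eventuallyEq (f := fun s => η (γ s)) ?_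
      (hev.mono fun s hs => hs.2) h0.2⟩
    · exact hd.1.continuousAt.comp_continuousWithinAt hγt
    · exact hd.2.continuousAt.comp_continuousWithinAt hγt
  exact ⟨fun t ht => (key t ht).1, fun t ht => (key t ht).2⟩

/-- A solution of the system on a neighbourhood of a point of the path that has the same values
there as the solution continued along the path agrees with it to the right of that point. -/
theorem IsContinuedAlong.eventually_eq (hγ : IsFinitePathIn U γ) (h : IsContinuedAlong c γ x y)
    {t : ℝ} (ht : t ∈ Set.Ico (0 : ℝ) 1) (hc : c.AnalyticAt (γ t)) {ξ η : ℂ → ℂ}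
    (hsol : IsSolutionNear c ξ η (γ t)) (hξ : x t = ξ (γ t)) (hη : y t = η (γ t)) :
    ∀ᶠ s in 𝓝[>] t, x s = ξ (γ s) ∧ y s = η (γ s) := by
  obtain ⟨ξ', η', hsol', hev⟩ := h t ht
  have h0 := hev.self_of_nhdsWithin ht
  have h1 := hsol'.eventually_eq hc hsol (h0.1 ▸ hξ) (h0.2 ▸ hη)
  have h2 := (hγ.continuousWithinAt (Set.Ico_subset_Icc_self ht)).eventually h1
  have h3 : 𝓝[>] t ≤ 𝓝[Set.Ico 0 1] t := by
    rw [← nhdsWithin_Ioo_eq_nhdsGT ht.2]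
    exact nhdsWithin_mono t fun s hs => ⟨ht.1.trans hs.1.le, hs.2⟩
  filter_upwards [h3 hev, h3 h2] with s h4 h5
  exact ⟨h4.1.trans h5.1, h4.2.trans h5.2⟩

theorem IsFinitePathIn.tendsto_one (hγ : IsFinitePathIn U γ) :
    Tendsto γ (𝓝[<] 1) (𝓝 (γ 1)) := by
  have := hγ.continuousWithinAt (t := 1) (by simp)
  have h3 : 𝓝[<] (1 : ℝ) ≤ 𝓝[Set.Ico 0 1] 1 := by
    rw [← nhdsWithin_Ico_eq_nhdsLT (zero_lt_one' ℝ)]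
  exact this.mono_left h3

theorem tendsto_nhdsLT_one {t : ℕ → ℝ} (ht : ∀ n, t n ∈ Set.Ico (0 : ℝ) 1)
    (ht1 : Tendsto t atTop (𝓝 1)) : Tendsto t atTop (𝓝[<] 1) :=
  tendsto_nhdsWithin_iff.2 ⟨ht1, Eventually.of_forall fun n => (ht n).2⟩

theorem exists_forall_Ico_of_eventually {p : ℝ → Prop} (hp : ∀ᶠ s in 𝓝[<] (1 : ℝ), p s)
    {t : ℕ → ℝ} (ht : Tendsto t atTop (𝓝[<] 1)) :
    ∀ᶠ n in atTop, ∀ s ∈ Set.Ico (t n) 1, p s := by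
  obtain ⟨l, hl, hlp⟩ := (mem_nhdsLT_iff_exists_Ioo_subset).1 hp
  filter_upwards [ht.eventually (Ioo_mem_nhdsLT hl)] with n hn s hs
  exact hlp ⟨hn.1.trans_le hs.1, hs.2⟩

/-- A solution that accumulates at a finite point at the end of the path is analytic there. -/
theorem endsRegular_of_limit (hγ : IsFinitePathIn U γ) (h : IsContinuedAlong c γ x y)
    (hc : ∀ z ∈ U, c.AnalyticAt z) {t : ℕ → ℝ} (ht : ∀ n, t n ∈ Set.Ico (0 : ℝ) 1)
    (ht1 : Tendsto t atTop (𝓝 1)) {x₁ y₁ : ℂ} (hx : Tendsto (fun n => x (t n)) atTop (𝓝 x₁))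
    (hy : Tendsto (fun n => y (t n)) atTop (𝓝 y₁)) : EndsRegular c γ x y := by
  have hU1 : γ 1 ∈ U := hγ.2.2 (by simp)
  have hf : AnalyticAt ℂ (fun p : ℂ × (ℂ × ℂ) => (c.xdot p.1 p.2.1 p.2.2, c.ydot p.1 p.2.1 p.2.2))
      (γ 1, (x₁, y₁)) := (analyticAt_xdot (hc _ hU1)).prod (analyticAt_ydot (hc _ hU1))
  obtain ⟨r, hr, δ, hδ, hsol⟩ := exists_uniform_solution hf one_pos
  have htl := tendsto_nhdsLT_one ht ht1
  have hball : ∀ᶠ s in 𝓝[<] (1 : ℝ), γ s ∈ Metric.ball (γ 1) r :=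
    hγ.tendsto_one.eventually (Metric.ball_mem_nhds _ hr)
  obtain ⟨n, hn1, hn2⟩ := ((exists_forall_Ico_of_eventually hball htl).and
    ((hx.prodMk_nhds hy).eventually (Metric.ball_mem_nhds _ hδ))).exists
  obtain ⟨φ, hφ0, hφ⟩ := hsol (γ (t n)) (hn1 _ ⟨le_rfl, (ht n).2⟩) _ hn2
  have hφs : ∀ w ∈ Metric.ball (γ 1) r,
      IsSolutionNear c (fun w => (φ w).1) (fun w => (φ w).2) w := fun w hw => by
    filter_upwards [Metric.isOpen_ball.mem_nhds hw] with v hv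
    exact ⟨(hφ v hv).2.fst, (hφ v hv).2.snd⟩
  have hcont := h.continuousOn hγ
  have hall : ∀ s ∈ Set.Ico (t n) 1, x s = (φ (γ s)).1 ∧ y s = (φ (γ s)).2 := by
    refine forall_mem_Ico_of_continuation ?_ ?_ ?_
    · rw [hφ0]; exact ⟨rfl, rfl⟩
    · intro s hs hS
      have hs0 : s ∈ Set.Ico (0 : ℝ) 1 := ⟨(ht n).1.trans hs.1.le, hs.2⟩
      have hle : 𝓝[Set.Ico (t n) s] s ≤ 𝓝[Set.Ico 0 1] s :=
        nhdsWithin_mono s fun s' hs' => ⟨(ht n).1.trans hs'.1, hs'.2.trans hs.2⟩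
      have : (𝓝[Set.Ico (t n) s] s).NeBot := by
        rw [nhdsWithin_Ico_eq_nhdsLT hs.1]; infer_instance
      have hγs := (hγ.continuousWithinAt (Set.Ico_subset_Icc_self hs0)).mono_left hle
      have hφc : Tendsto φ (𝓝 (γ s)) (𝓝 (φ (γ s))) :=
        (hφ _ (hn1 s ⟨hs.1.le, hs.2⟩)).2.continuousAt.tendsto
      have h1 := hφc.comp hγs
      constructor
      · refine tendsto_nhds_unique_of_eventuallyEq ((hcont.1 s hs0).mono_left hle)
          ((continuous_fst.tendsto _).comp h1) ?_
        filter_upwards [self_mem_nhdsWithin] with s' hs' using (hS s' hs').1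
      · refine tendsto_nhds_unique_of_eventuallyEq ((hcont.2 s hs0).mono_left hle)
          ((continuous_snd.tendsto _).comp h1) ?_
        filter_upwards [self_mem_nhdsWithin] with s' hs' using (hS s' hs').2
    · intro s hs hS
      have hs0 : s ∈ Set.Ico (0 : ℝ) 1 := ⟨(ht n).1.trans hs.1, hs.2⟩
      exact h.eventually_eq hγ hs0 (hc _ (hγ.2.2 (Set.Ico_subset_Icc_self hs0)))
        (hφs _ (hn1 s hs)) hS.1 hS.2
  refine ⟨fun w => (φ w).1, fun w => (φ w).2, hφs _ (Metric.mem_ball_self hr), ?_⟩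
  filter_upwards [Ioo_mem_nhdsLT (ht n).2] with s hs using hall s ⟨hs.1.le, hs.2⟩

/-- A quantity along a path of finite length whose relative rate of change is bounded is
bounded. -/
theorem exists_bound_of_relative_rate (hγ : IsFinitePathIn U γ) {g : ℝ → ℂ} {K : ℝ} (hK : 0 ≤ K)
    (hg : ∀ t ∈ Set.Ico (0 : ℝ) 1, ∀ᶠ s in 𝓝[Set.Ico (0 : ℝ) 1] t,
      ‖g s - g t‖ ≤ K * (1 + ‖g t‖) * ‖γ s - γ t‖) :
    ∃ M, ∀ t ∈ Set.Ico (0 : ℝ) 1, ‖g t‖ ≤ M := by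
  have hbv : LocallyBoundedVariationOn γ (Set.Icc 0 1) := hγ.2.1.locallyBoundedVariationOn
  set L : ℝ → ℝ := fun t => variationOnFromTo γ (Set.Icc 0 1) 0 t with hL
  have hmono : MonotoneOn L (Set.Icc 0 1) := variationOnFromTo.monotoneOn hbv (by simp)
  have hdist : ∀ s ∈ Set.Icc (0 : ℝ) 1, ∀ t ∈ Set.Icc (0 : ℝ) 1, s ≤ t →
      ‖γ t - γ s‖ ≤ L t - L s := fun s hs t ht hst => by
    have h1 := variationOnFromTo.add hbv (show (0 : ℝ) ∈ Set.Icc (0 : ℝ) 1 by simp) hs ht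
    have h2 : ‖γ t - γ s‖ ≤ variationOnFromTo γ (Set.Icc 0 1) s t := by
      rw [variationOnFromTo.eq_of_le _ _ hst, ← dist_eq_norm, dist_edist]
      refine ENNReal.toReal_mono (hbv s t hs ht) ?_
      exact eVariationOn.edist_le γ ⟨ht, hst, le_rfl⟩ ⟨hs, le_rfl, hst⟩
    simp only [hL]
    linarith
  have hcontg : ∀ t ∈ Set.Ico (0 : ℝ) 1, ContinuousWithinAt g (Set.Ico 0 1) t := fun t ht => by
    have hγt := hγ.continuousWithinAt (Set.Ico_subset_Icc_self ht)
    rw [ContinuousWithinAt, tendsto_iff_norm_sub_tendsto_zero]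
    refine squeeze_zero' (Eventually.of_forall fun s => norm_nonneg _) (hg t ht) ?_
    have := (tendsto_iff_norm_sub_tendsto_zero.1 hγt).const_mul (K * (1 + ‖g t‖))
    simpa using this
  -- Gronwall's inequality with respect to the arc length `L`.
  have hall : ∀ s ∈ Set.Ico (0 : ℝ) 1, 1 + ‖g s‖ ≤ (1 + ‖g 0‖) * Real.exp (K * L s) := by
    refine forall_mem_Ico_of_continuation ?_ ?_ ?_
    · have : L 0 = 0 := variationOnFromTo.self _ _ _
      simp [this]
    · intro s hs hS
      have hs0 : s ∈ Set.Ico (0 : ℝ) 1 := ⟨hs.1.le, hs.2⟩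
      have hle : 𝓝[Set.Ico 0 s] s ≤ 𝓝[Set.Ico 0 1] s :=
        nhdsWithin_mono s fun s' hs' => ⟨hs'.1, hs'.2.trans hs.2⟩
      have : (𝓝[Set.Ico 0 s] s).NeBot := by
        rw [nhdsWithin_Ico_eq_nhdsLT hs.1]; infer_instance
      refine le_of_tendsto (((hcontg s hs0).mono_left hle).norm.const_add 1) ?_
      filter_upwards [self_mem_nhdsWithin] with s' hs'
      refine (hS s' hs').trans ?_
      gcongr
      exact hmono ⟨hs'.1, (hs'.2.trans hs.2).le⟩ ⟨hs.1.le, hs.2.le⟩ hs'.2.le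
    · intro s hs hS
      have h3 : 𝓝[>] s ≤ 𝓝[Set.Ico 0 1] s := by
        rw [← nhdsWithin_Ioo_eq_nhdsGT hs.2]
        exact nhdsWithin_mono s fun s' hs' => ⟨hs.1.trans hs'.1.le, hs'.2⟩
      filter_upwards [h3 (hg s hs), Ioo_mem_nhdsGT hs.2] with s' h1 hs'
      have h2 := hdist s ⟨hs.1, hs.2.le⟩ s' ⟨hs.1.trans hs'.1.le, hs'.2.le⟩ hs'.1.le
      have h4 : ‖g s'‖ ≤ ‖g s‖ + K * (1 + ‖g s‖) * ‖γ s' - γ s‖ := by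
        have := norm_add_le (g s' - g s) (g s)
        rw [sub_add_cancel] at this
        linarith
      have h5 : 1 + K * (L s' - L s) ≤ Real.exp (K * (L s' - L s)) := by
        rw [add_comm]; exact Real.add_one_le_exp _
      have hpos : 0 ≤ 1 + ‖g s‖ := by positivity
      calc 1 + ‖g s'‖ ≤ (1 + ‖g s‖) * (1 + K * ‖γ s' - γ s‖) := by linarith
        _ ≤ (1 + ‖g s‖) * (1 + K * (L s' - L s)) := by gcongr
        _ ≤ (1 + ‖g s‖) * Real.exp (K * (L s' - L s)) := by gcongr
        _ ≤ ((1 + ‖g 0‖) * Real.exp (K * L s)) * Real.exp (K * (L s' - L s)) := by gcongr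
        _ = (1 + ‖g 0‖) * Real.exp (K * L s') := by
          rw [mul_assoc, ← Real.exp_add]; ring_nf
  refine ⟨(1 + ‖g 0‖) * Real.exp (K * L 1), fun t ht => ?_⟩
  have h1 := hall t ht
  have h2 : L t ≤ L 1 := hmono ⟨ht.1, ht.2.le⟩ (by simp) ht.2.le
  have h3 : (1 + ‖g 0‖) * Real.exp (K * L t) ≤ (1 + ‖g 0‖) * Real.exp (K * L 1) := by gcongr
  linarith

end Continuation

/-! ### The flow in the charts -/

section PushForward

variable (c : Coeffs)

/-- At the points over the affine plane with `z = z₁`, the vector field of the chart `C` is mapped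
to Hamilton's equations. Solutions are allowed to be parametrised by a variable with respect to
which `z` has the derivative `l`. -/
def PushesForward (C : Chart) (z₁ : ℂ) : Prop :=
  ∀ (z u v : ℂ → ℂ) (τ l : ℂ), z τ = z₁ → C.T0 (z τ) (u τ) (v τ) ≠ 0 → HasDerivAt z l τ →
    HasDerivAt u (l * C.velU (z τ) (u τ) (v τ)) τ →
    HasDerivAt v (l * C.velV (z τ) (u τ) (v τ)) τ →
    HasDerivAt (fun s => C.T1 (z s) (u s) (v s) / C.T0 (z s) (u s) (v s))
      (l * c.xdot (z τ) (C.T1 (z τ) (u τ) (v τ) / C.T0 (z τ) (u τ) (v τ))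
        (C.T2 (z τ) (u τ) (v τ) / C.T0 (z τ) (u τ) (v τ))) τ ∧
    HasDerivAt (fun s => C.T2 (z s) (u s) (v s) / C.T0 (z s) (u s) (v s))
      (l * c.ydot (z τ) (C.T1 (z τ) (u τ) (v τ) / C.T0 (z τ) (u τ) (v τ))
        (C.T2 (z τ) (u τ) (v τ) / C.T0 (z τ) (u τ) (v τ))) τ

variable {c} {C : Chart} {a : ℂ → ℂ} {z₁ : ℂ}

theorem pushesForward_chartu0 : PushesForward c (chartu0 c) z₁ := by
  intro z u v τ l _ hT _ hu hv
  have hT : u τ ≠ 0 := hT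
  simp only [chartu0] at hu hv ⊢
  constructor
  · refine ((hasDerivAt_const τ (1 : ℂ)).div hu hT).congr_deriv ?_
    field_simp; ring
  · refine (hv.div hu hT).congr_deriv ?_
    field_simp; ring

theorem pushesForward_chartU0 : PushesForward c (chartU0 c) z₁ := by
  intro z u v τ l _ hT _ hu hv
  have hT : v τ ≠ 0 := hT
  simp only [chartU0] at hu hv ⊢
  constructor
  · refine (hu.div hv hT).congr_deriv ?_
    field_simp; ring
  · refine ((hasDerivAt_const τ (1 : ℂ)).div hv hT).congr_deriv ?_
    field_simp; ring

theorem PushesForward.upper (h : PushesForward c C z₁) (ha : DifferentiableAt ℂ a z₁)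
    (h0 : C.T0 z₁ (a z₁) 0 = 0) : PushesForward c (C.upper a fun _ => 0) z₁ := by
  intro z u v τ l hz hT hz' hu hv
  have hv0 : v τ ≠ 0 := fun h => hT (by simp [Chart.upper, h, hz, h0])
  rw [upper_velU] at hu
  rw [upper_velV] at hv
  have ha' : HasDerivAt (fun s => a (z s)) (deriv a (z τ) * l) τ :=
    (hz ▸ ha : DifferentiableAt ℂ a (z τ)).hasDerivAt.comp τ hz'
  have hT' : C.T0 (z τ) (u τ * v τ + a (z τ)) (v τ) ≠ 0 := by simpa [Chart.upper] using hT
  have := h z (fun s => u s * v s + a (z s)) v τ l hz hT' hz'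
    (((hu.mul hv).add ha').congr_deriv (by field_simp; ring)) hv
  simpa [Chart.upper] using this

theorem PushesForward.lower (h : PushesForward c C z₁) (ha : DifferentiableAt ℂ a z₁)
    (h0 : C.T0 z₁ (a z₁) 0 = 0) : PushesForward c (C.lower a fun _ => 0) z₁ := by
  intro z u v τ l hz hT hz' hu hv
  have hu0 : u τ ≠ 0 := fun h => hT (by simp [Chart.lower, h, hz, h0])
  rw [lower_velU] at hu
  rw [lower_velV] at hv
  have ha' : HasDerivAt (fun s => a (z s)) (deriv a (z τ) * l) τ :=
    (hz ▸ ha : DifferentiableAt ℂ a (z τ)).hasDerivAt.comp τ hz'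
  have hT' : C.T0 (z τ) (u τ + a (z τ)) (u τ * v τ) ≠ 0 := by simpa [Chart.lower] using hT
  have := h z (fun s => u s + a (z s)) (fun s => u s * v s) τ l hz hT' hz'
    ((hu.add ha').congr_deriv (by ring)) ((hu.mul hv).congr_deriv (by field_simp; ring))
  simpa [Chart.lower] using this

theorem casc_T (C : Chart) (a : ℕ → ℂ → ℂ) (m : ℕ) (z U V : ℂ) :
    (casc C a m).T0 z U V = C.T0 z (cascLift (fun j => a j z) m U V) V ∧
    (casc C a m).T1 z U V = C.T1 z (cascLift (fun j => a j z) m U V) V ∧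
    (casc C a m).T2 z U V = C.T2 z (cascLift (fun j => a j z) m U V) V := by
  induction m generalizing U with
  | zero => exact ⟨rfl, rfl, rfl⟩
  | succ m ih =>
    have := ih (U * V + a m z)
    simpa [casc, Chart.upper, cascLift] using this

theorem PushesForward.casc (h : PushesForward c C z₁) {a : ℕ → ℂ → ℂ}
    (ha : ∀ j, DifferentiableAt ℂ (a j) z₁) (h0 : ∀ K, C.T0 z₁ K 0 = 0) (m : ℕ) :
    PushesForward c (casc C a m) z₁ := by
  induction m with
  | zero => exact h
  | succ m ih => exact ih.upper (ha m) (by rw [(casc_T C a m _ _ _).1, h0])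

theorem chartU0_T (z K V : ℂ) :
    (chartU0 c).T0 z K V = V ∧ (chartU0 c).T1 z K V = K ∧ (chartU0 c).T2 z K V = 1 :=
  ⟨rfl, rfl, rfl⟩

theorem upperChart_three_T (z K V : ℂ) :
    (upperChart c 3).T0 z K V = K ^ 2 * V ^ 3 ∧ (upperChart c 3).T1 z K V = 1 ∧
      (upperChart c 3).T2 z K V = K * V ^ 2 := by
  simp only [upperChart_three, lowerChart_two, upperChart_one, Chart.upper, Chart.lower, chartu0]
  refine ⟨by ring, trivial, by ring⟩

theorem pushesForward_upperChart_three : PushesForward c (upperChart c 3) z₁ := by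
  have h1 : PushesForward c (upperChart c 1) z₁ :=
    pushesForward_chartu0.upper (differentiableAt_const _) rfl
  have h2 : PushesForward c (lowerChart c 2) z₁ :=
    h1.lower (differentiableAt_const _) (by simp [upperChart_one, Chart.upper, chartu0])
  exact h2.upper (differentiableAt_const _)
    (by simp [lowerChart_two, upperChart_one, Chart.upper, Chart.lower, chartu0])

end PushForward

/-! ### Solutions with a limit point on the last curve -/

section Pole

variable {c : Coeffs} {U : Set ℂ} {γ : ℝ → ℂ} {x y : ℝ → ℂ}

/-- The chart after the last blow-up of a cascade, as a set of coordinates at infinity. -/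
structure IsPolarChart (c : Coeffs) (U : Set ℂ) (C : Chart) : Prop where
  push : ∀ z ∈ U, PushesForward c C z
  T0_poly : ∀ z ∈ U, IsPolyNear z C.T0
  T1_poly : ∀ z ∈ U, IsPolyNear z C.T1
  T2_poly : ∀ z ∈ U, IsPolyNear z C.T2
  T0_zero : ∀ z u, C.T0 z u 0 = 0
  T0_ne : ∀ z ∈ U, ∀ u, ∀ᶠ p in 𝓝 ((z, u, 0) : ℂ × ℂ × ℂ), p.2.2 ≠ 0 → C.T0 p.1 p.2.1 p.2.2 ≠ 0
  one : ∀ z u v, C.T1 z u v = 1 ∨ C.T2 z u v = 1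
  exists_coord : ∃ f : ℂ × ℂ → ℂ, ∀ z u v, C.T0 z u v ≠ 0 →
    ContinuousAt f (C.T1 z u v / C.T0 z u v, C.T2 z u v / C.T0 z u v) ∧
      f (C.T1 z u v / C.T0 z u v, C.T2 z u v / C.T0 z u v) = v

/-- `(x, y)` are the affine coordinates of the point `(u, v)` of the chart `C`. -/
def IsOver (C : Chart) (z u v x y : ℂ) : Prop :=
  C.T0 z u v ≠ 0 ∧ x * C.T0 z u v = C.T1 z u v ∧ y * C.T0 z u v = C.T2 z u v

theorem IsOver.eq {C : Chart} {z u v x y : ℂ} (h : IsOver C z u v x y) :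
    x = C.T1 z u v / C.T0 z u v ∧ y = C.T2 z u v / C.T0 z u v :=
  ⟨eq_div_of_mul_eq h.1 h.2.1, eq_div_of_mul_eq h.1 h.2.2⟩

theorem isOver_of_eq {C : Chart} {z u v x y : ℂ} (hT : C.T0 z u v ≠ 0)
    (hx : x = C.T1 z u v / C.T0 z u v) (hy : y = C.T2 z u v / C.T0 z u v) :
    IsOver C z u v x y :=
  ⟨hT, by rw [hx, div_mul_cancel₀ _ hT], by rw [hy, div_mul_cancel₀ _ hT]⟩

/-- The solution reaches the curve `V = 0` of the chart `C` at the end of the path, along a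
solution curve `(Ξ, ψ)` of the system in the chart that depends analytically on `τ`,
`τ² = z - γ 1`, and crosses the curve `V = 0` with `ψ'(0)² m = 2`. -/
def EndsOnCurve (c : Coeffs) (C : Chart) (m : ℂ) (γ : ℝ → ℂ) (x y : ℝ → ℂ) : Prop :=
  ∃ (τ : ℝ → ℂ) (s₀ : ℝ) (Ξ ψ : ℂ → ℂ), s₀ ∈ Set.Ico (0 : ℝ) 1 ∧ ContinuousOn τ (Set.Ico s₀ 1) ∧
    Tendsto τ (𝓝[<] 1) (𝓝 0) ∧ AnalyticAt ℂ Ξ 0 ∧ AnalyticAt ℂ ψ 0 ∧ ψ 0 = 0 ∧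
    deriv ψ 0 ^ 2 * m = 2 ∧
    (∀ s ∈ Set.Ico s₀ 1, τ s ≠ 0 ∧ τ s ^ 2 = γ s - γ 1 ∧
      IsOver C (γ s) (Ξ (τ s)) (ψ (τ s)) (x s) (y s)) ∧
    ∀ᶠ w in 𝓝[≠] (0 : ℂ), ψ w ≠ 0 ∧ C.T0 (γ 1 + w ^ 2) (Ξ w) (ψ w) ≠ 0 ∧
      HasDerivAt (fun w => C.T1 (γ 1 + w ^ 2) (Ξ w) (ψ w) / C.T0 (γ 1 + w ^ 2) (Ξ w) (ψ w))
        (2 * w * c.xdot (γ 1 + w ^ 2)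
          (C.T1 (γ 1 + w ^ 2) (Ξ w) (ψ w) / C.T0 (γ 1 + w ^ 2) (Ξ w) (ψ w))
          (C.T2 (γ 1 + w ^ 2) (Ξ w) (ψ w) / C.T0 (γ 1 + w ^ 2) (Ξ w) (ψ w))) w ∧
      HasDerivAt (fun w => C.T2 (γ 1 + w ^ 2) (Ξ w) (ψ w) / C.T0 (γ 1 + w ^ 2) (Ξ w) (ψ w))
        (2 * w * c.ydot (γ 1 + w ^ 2)
          (C.T1 (γ 1 + w ^ 2) (Ξ w) (ψ w) / C.T0 (γ 1 + w ^ 2) (Ξ w) (ψ w))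
          (C.T2 (γ 1 + w ^ 2) (Ξ w) (ψ w) / C.T0 (γ 1 + w ^ 2) (Ξ w) (ψ w))) w

theorem norm_sq_le_of_curve {Z D : ℂ → ℂ} {m : ℂ} {r : ℝ}
    (hZ : ∀ V ∈ Metric.ball (0 : ℂ) r, HasDerivAt Z (V * D V) V ∧ ‖D V - m‖ ≤ ‖m‖ / 4)
    {V : ℂ} (hV : V ∈ Metric.ball (0 : ℂ) r) :
    ‖m‖ / 4 * ‖V‖ ^ 2 ≤ ‖Z V - Z 0‖ ∧ ‖Z V - Z 0‖ ≤ ‖m‖ * ‖V‖ ^ 2 := by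
  have hsub : Metric.closedBall (0 : ℂ) ‖V‖ ⊆ Metric.ball 0 r := by
    apply Metric.closedBall_subset_ball; simpa using hV
  have h1 : ∀ W ∈ Metric.closedBall (0 : ℂ) ‖V‖,
      HasDerivWithinAt (fun W => Z W - m * W ^ 2 / 2) (W * (D W - m))
        (Metric.closedBall (0 : ℂ) ‖V‖) W := fun W hW => by
    refine HasDerivAt.hasDerivWithinAt ?_
    refine ((hZ W (hsub hW)).1.sub
      (((hasDerivAt_pow 2 W).const_mul m).div_const 2)).congr_deriv ?_
    push_cast; ring
  have h2 := (convex_closedBall (0 : ℂ) ‖V‖).norm_image_sub_le_of_norm_hasDerivWithin_le h1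
    (C := ‖V‖ * (‖m‖ / 4)) (fun W hW => by
      rw [norm_mul]
      have : ‖W‖ ≤ ‖V‖ := by simpa using hW
      exact mul_le_mul this (hZ W (hsub hW)).2 (norm_nonneg _) (norm_nonneg _))
    (Metric.mem_closedBall_self (norm_nonneg V)) (by simp : V ∈ Metric.closedBall (0 : ℂ) ‖V‖)
  have h3 : Z V - m * V ^ 2 / 2 - (Z 0 - m * 0 ^ 2 / 2) = (Z V - Z 0) - m * V ^ 2 / 2 := by ring
  rw [h3, sub_zero] at h2
  have h4 : ‖m * V ^ 2 / 2‖ = ‖m‖ * ‖V‖ ^ 2 / 2 := by simp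
  have h5 := norm_sub_norm_le (m * V ^ 2 / 2) (Z V - Z 0)
  have h6 := norm_sub_norm_le (Z V - Z 0) (m * V ^ 2 / 2)
  rw [norm_sub_rev (m * V ^ 2 / 2)] at h5
  rw [h4] at h5 h6
  have h7 : 0 ≤ ‖m‖ * ‖V‖ ^ 2 := by positivity
  constructor <;> nlinarith

/-- A solution that accumulates at the point `(h, 0)` of the exceptional curve of a final chart
whose system is regular with respect to `V` follows one of the solution curves `(Z(V), Υ(V), V)`
near that point. -/
theorem exists_curve_of_limit {C : Chart} {κ : ℂ → ℂ} {q N D : ℂ → ℂ → ℂ → ℂ} {p₀ d₀ : ℂ}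
    (hγ : IsFinitePathIn U γ) (hxy : IsContinuedAlong c γ x y) (hc : ∀ z ∈ U, c.AnalyticAt z)
    (hU : IsOpen U) (hC : IsPolarChart c U C) (hF : IsFinalChart C κ q N D p₀ d₀ (γ 1))
    (hκ : ∀ᶠ z in 𝓝 (γ 1), κ z = 0) {h : ℂ} (hlim : HasLimitPoint C γ x y h 0) :
    ∃ (Z Υ : ℂ → ℂ) (V : ℝ → ℂ) (r s₀ : ℝ), 0 < r ∧ s₀ ∈ Set.Ico (0 : ℝ) 1 ∧
      (∀ W ∈ Metric.ball (0 : ℂ) r, (Z W ∈ U ∧ κ (Z W) = 0 ∧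
        (W ≠ 0 → C.T0 (Z W) (Υ W) W ≠ 0 ∧
          C.velV (Z W) (Υ W) W = q (Z W) (Υ W) W / (D (Z W) (Υ W) W * W) ∧
          C.velU (Z W) (Υ W) W = N (Z W) (Υ W) W / (D (Z W) (Υ W) W * W)) ∧
        ‖D (Z W) (Υ W) W / q (Z W) (Υ W) W - d₀ / p₀‖ ≤ ‖d₀ / p₀‖ / 4) ∧
        q (Z W) (Υ W) W ≠ 0 ∧ D (Z W) (Υ W) W ≠ 0 ∧
        HasDerivAt Z (W * (D (Z W) (Υ W) W / q (Z W) (Υ W) W)) W ∧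
        HasDerivAt Υ (N (Z W) (Υ W) W / q (Z W) (Υ W) W) W) ∧
      ∀ s ∈ Set.Ico s₀ 1, V s ∈ Metric.closedBall (0 : ℂ) (r / 2) ∧ Z (V s) = γ s ∧
        IsOver C (γ s) (Υ (V s)) (V s) (x s) (y s) := by
  obtain ⟨t, u, v, ht, ht1, hT, hu, hv⟩ := hlim
  have hz1U : γ 1 ∈ U := hγ.2.2 (by simp)
  have hm0 : d₀ / p₀ ≠ 0 := div_ne_zero hF.d₀_ne hF.p₀_ne
  have hfst : Tendsto (fun p : ℂ × ℂ × ℂ => p.1) (𝓝 (γ 1, h, 0)) (𝓝 (γ 1)) :=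
    continuous_fst.tendsto _
  have hDq : ∀ᶠ p in 𝓝 ((γ 1, h, 0) : ℂ × ℂ × ℂ),
      ‖D p.1 p.2.1 p.2.2 / q p.1 p.2.1 p.2.2 - d₀ / p₀‖ ≤ ‖d₀ / p₀‖ / 4 := by
    have h1 : ContinuousAt (fun p : ℂ × ℂ × ℂ => D p.1 p.2.1 p.2.2 / q p.1 p.2.1 p.2.2)
        (γ 1, h, 0) :=
      (hF.D_poly.analyticAt h 0).continuousAt.div (hF.q_poly.analyticAt h 0).continuousAt
        (by simp only [hF.q_zero]; exact hF.p₀_ne)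
    have h2 := h1.tendsto
    simp only [hF.q_zero, hF.D_zero] at h2
    have h3 := h2.eventually (Metric.closedBall_mem_nhds (d₀ / p₀)
      (by positivity : 0 < ‖d₀ / p₀‖ / 4))
    filter_upwards [h3] with p hp
    rwa [dist_eq_norm] at hp
  have hA : ∀ᶠ p in 𝓝 ((γ 1, h, 0) : ℂ × ℂ × ℂ), p.1 ∈ U ∧ κ p.1 = 0 ∧
      (p.2.2 ≠ 0 → C.T0 p.1 p.2.1 p.2.2 ≠ 0 ∧
        C.velV p.1 p.2.1 p.2.2 = q p.1 p.2.1 p.2.2 / (D p.1 p.2.1 p.2.2 * p.2.2) ∧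
        C.velU p.1 p.2.1 p.2.2 = N p.1 p.2.1 p.2.2 / (D p.1 p.2.1 p.2.2 * p.2.2)) ∧
      ‖D p.1 p.2.1 p.2.2 / q p.1 p.2.1 p.2.2 - d₀ / p₀‖ ≤ ‖d₀ / p₀‖ / 4 := by
    filter_upwards [hfst.eventually (hU.mem_nhds hz1U), hfst.eventually hκ, hC.T0_ne _ hz1U h,
      hF.eventually_vel h, hDq] with p h1 h2 h3 ⟨_, h4, h5⟩ h6
    refine ⟨h1, h2, fun hp => ⟨h3 hp, (h5 hp).1, ?_⟩, h6⟩
    rw [(h5 hp).2, h2]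
    field_simp
    ring
  obtain ⟨r, hr, δ, hδ, hsol⟩ := hF.exists_curves h hA
  have htl := tendsto_nhdsLT_one ht ht1
  have hmpos : 0 < ‖d₀ / p₀‖ := norm_pos_iff.2 hm0
  set ε : ℝ := ‖d₀ / p₀‖ * r ^ 2 / 128 with hε
  have hεpos : 0 < ε := by positivity
  have e1 : ∀ᶠ s in 𝓝[<] (1 : ℝ), γ s ∈ Metric.ball (γ 1) (min δ ε) :=
    hγ.tendsto_one.eventually (Metric.ball_mem_nhds _ (lt_min hδ hεpos))
  obtain ⟨n, hn1, hn2, hn3⟩ := ((exists_forall_Ico_of_eventually e1 htl).and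
    ((hu.eventually (Metric.ball_mem_nhds h hδ)).and
      (hv.eventually (Metric.ball_mem_nhds 0 (by positivity : 0 < r / 8))))).exists
  have hn1' : ∀ s ∈ Set.Ico (t n) 1, ‖γ s - γ 1‖ < δ ∧ ‖γ s - γ 1‖ < ε := fun s hs => by
    have := hn1 s hs
    rw [mem_ball_iff_norm] at this
    exact ⟨this.trans_le (min_le_left _ _), this.trans_le (min_le_right _ _)⟩
  have hvn : ‖v n‖ < r / 8 := by simpa using hn3
  have hvr : v n ∈ Metric.ball (0 : ℂ) r := by
    rw [mem_ball_zero_iff]; linarith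
  obtain ⟨Z, Υ, hZ1, hΥ1, hZ⟩ := hsol (v n) hvr (γ (t n))
    (by rw [mem_ball_iff_norm]; exact (hn1' _ ⟨le_rfl, (ht n).2⟩).1) (u n) hn2
  have hest : ∀ W ∈ Metric.ball (0 : ℂ) r, ‖d₀ / p₀‖ / 4 * ‖W‖ ^ 2 ≤ ‖Z W - Z 0‖ ∧
      ‖Z W - Z 0‖ ≤ ‖d₀ / p₀‖ * ‖W‖ ^ 2 := fun W hW =>
    norm_sq_le_of_curve (D := fun V => D (Z V) (Υ V) V / q (Z V) (Υ V) V)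
      (fun V hV => ⟨(hZ V hV).2.2.2.1, (hZ V hV).1.2.2.2⟩) hW
  have hZc : ∀ W ∈ Metric.ball (0 : ℂ) r, ContinuousAt (fun W => (Z W, Υ W, W)) W := fun W hW =>
    (hZ W hW).2.2.2.1.continuousAt.prodMk
      ((hZ W hW).2.2.2.2.continuousAt.prodMk continuousAt_id)
  -- As `|Z W - Z 0|` is of the order of `|W|²`, the parameter cannot leave the disc.
  have hsmall : ∀ s ∈ Set.Ico (t n) 1, ∀ W ∈ Metric.ball (0 : ℂ) r, Z W = γ s → ‖W‖ < r / 2 := by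
    intro s hs W hW hWs
    have h1 := (hest W hW).1
    have h2 := (hest _ hvr).2
    rw [hWs] at h1
    rw [hZ1] at h2
    have h3 : ‖γ s - Z 0‖ ≤ ‖γ s - γ 1‖ + ‖γ (t n) - γ 1‖ + ‖γ (t n) - Z 0‖ := by
      have e : γ s - Z 0 = (γ s - γ 1) - (γ (t n) - γ 1) + (γ (t n) - Z 0) := by ring
      rw [e]
      exact (norm_add_le _ _).trans (by gcongr; exact norm_sub_le _ _)
    have h4 := (hn1' s hs).2
    have h5 := (hn1' (t n) ⟨le_rfl, (ht n).2⟩).2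
    have h6 : ‖v n‖ ^ 2 ≤ (r / 8) ^ 2 := by gcongr
    have h7 : ‖d₀ / p₀‖ / 4 * ‖W‖ ^ 2 < ‖d₀ / p₀‖ / 4 * (r / 2) ^ 2 := by
      have h8 : ‖d₀ / p₀‖ * ‖v n‖ ^ 2 ≤ ‖d₀ / p₀‖ * (r / 8) ^ 2 := by gcongr
      have h9 : 0 < ‖d₀ / p₀‖ * r ^ 2 := by positivity
      nlinarith
    have h8 := lt_of_mul_lt_mul_left h7 (by positivity)
    exact lt_of_pow_lt_pow_left₀ 2 (by positivity) h8
  have hcont := hxy.continuousOn hγ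
  have hball2 : Metric.closedBall (0 : ℂ) (r / 2) ⊆ Metric.ball 0 r :=
    Metric.closedBall_subset_ball (by linarith)
  -- the values of the chart on the solution curve
  set X0 : ℂ → ℂ := fun W => C.T0 (Z W) (Υ W) W with hX0
  set X1 : ℂ → ℂ := fun W => C.T1 (Z W) (Υ W) W with hX1
  set X2 : ℂ → ℂ := fun W => C.T2 (Z W) (Υ W) W with hX2
  have hXc : ∀ W ∈ Metric.ball (0 : ℂ) r, ContinuousAt X0 W ∧ ContinuousAt X1 W ∧
      ContinuousAt X2 W := fun W hW => by
    have hWU := (hZ W hW).1.1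
    refine ⟨ContinuousAt.comp (g := fun p : ℂ × ℂ × ℂ => C.T0 p.1 p.2.1 p.2.2)
        (f := fun W => (Z W, Υ W, W)) ((hC.T0_poly _ hWU).analyticAt _ _).continuousAt (hZc W hW),
      ContinuousAt.comp (g := fun p : ℂ × ℂ × ℂ => C.T1 p.1 p.2.1 p.2.2)
        (f := fun W => (Z W, Υ W, W)) ((hC.T1_poly _ hWU).analyticAt _ _).continuousAt (hZc W hW),
      ContinuousAt.comp (g := fun p : ℂ × ℂ × ℂ => C.T2 p.1 p.2.1 p.2.2)
        (f := fun W => (Z W, Υ W, W)) ((hC.T2_poly _ hWU).analyticAt _ _).continuousAt (hZc W hW)⟩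
  have hall : ∀ s ∈ Set.Ico (t n) 1, ∃ V ∈ Metric.closedBall (0 : ℂ) (r / 2), Z V = γ s ∧
      IsOver C (γ s) (Υ V) V (x s) (y s) := by
    refine forall_mem_Ico_of_continuation ?_ ?_ ?_
    · refine ⟨v n, ?_, hZ1, ?_⟩
      · rw [mem_closedBall_zero_iff]; linarith
      · rw [hΥ1]; exact hT n
    · intro s hs hS
      have hs0 : s ∈ Set.Ico (0 : ℝ) 1 := ⟨(ht n).1.trans hs.1.le, hs.2⟩
      obtain ⟨σ, -, hσ, hσs⟩ := exists_seq_strictMono_tendsto' hs.1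
      have hσm : ∀ k, σ k ∈ Set.Ico (t n) s := fun k => ⟨(hσ k).1.le, (hσ k).2⟩
      choose V hVb hVZ hVo using fun k => hS (σ k) (hσm k)
      obtain ⟨V₁, hV₁, χ, hχ, hlim⟩ := (isCompact_closedBall (0 : ℂ) (r / 2)).tendsto_subseq hVb
      have hV₁r := hball2 hV₁
      have hσχ : Tendsto (fun k => σ (χ k)) atTop (𝓝[Set.Ico 0 1] s) := by
        refine tendsto_nhdsWithin_iff.2 ⟨hσs.comp hχ.tendsto_atTop, Eventually.of_forall fun k => ?_⟩
        exact ⟨(ht n).1.trans (hσm _).1, (hσm _).2.trans hs.2⟩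
      have hγs : Tendsto (fun k => γ (σ (χ k))) atTop (𝓝 (γ s)) :=
        (hγ.continuousWithinAt (Set.Ico_subset_Icc_self hs0)).tendsto.comp hσχ
      have hxs : Tendsto (fun k => x (σ (χ k))) atTop (𝓝 (x s)) :=
        (hcont.1 s hs0).tendsto.comp hσχ
      have hys : Tendsto (fun k => y (σ (χ k))) atTop (𝓝 (y s)) :=
        (hcont.2 s hs0).tendsto.comp hσχ
      have hZV : Z V₁ = γ s := by
        refine tendsto_nhds_unique_of_eventuallyEq
          ((hZ V₁ hV₁r).2.2.2.1.continuousAt.tendsto.comp hlim) hγs (Eventually.of_forall fun k => ?_)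
        exact hVZ _
      obtain ⟨c0, c1, c2⟩ := hXc V₁ hV₁r
      have r1 : x s * X0 V₁ = X1 V₁ := by
        refine tendsto_nhds_unique_of_eventuallyEq (hxs.mul (c0.tendsto.comp hlim))
          (c1.tendsto.comp hlim) (Eventually.of_forall fun k => ?_)
        have := (hVo (χ k)).2.1
        rw [← hVZ] at this
        exact this
      have r2 : y s * X0 V₁ = X2 V₁ := by
        refine tendsto_nhds_unique_of_eventuallyEq (hys.mul (c0.tendsto.comp hlim))
          (c2.tendsto.comp hlim) (Eventually.of_forall fun k => ?_)
        have := (hVo (χ k)).2.2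
        rw [← hVZ] at this
        exact this
      have r0 : X0 V₁ ≠ 0 := by
        intro h0
        rw [h0, mul_zero] at r1 r2
        rcases hC.one (Z V₁) (Υ V₁) V₁ with h | h
        · exact one_ne_zero (h.symm.trans r1.symm)
        · exact one_ne_zero (h.symm.trans r2.symm)
      refine ⟨V₁, hV₁, hZV, ?_⟩
      rw [← hZV]
      exact ⟨r0, r1, r2⟩
    · rintro s hs ⟨V₁, hV₁, hZV, hVo⟩
      have hs0 : s ∈ Set.Ico (0 : ℝ) 1 := ⟨(ht n).1.trans hs.1, hs.2⟩
      have hV₁r := hball2 hV₁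
      have hV₁0 : V₁ ≠ 0 := by
        rintro rfl
        exact hVo.1 (hC.T0_zero _ _)
      obtain ⟨-, hq1, hD1, hZ', -⟩ := hZ V₁ hV₁r
      have hZa : AnalyticAt ℂ Z V₁ :=
        DifferentiableOn.analyticAt (s := Metric.ball 0 r)
          (fun V hV => (hZ V hV).2.2.2.1.differentiableAt.differentiableWithinAt)
          (Metric.isOpen_ball.mem_nhds hV₁r)
      have hd : deriv Z V₁ ≠ 0 := by
        rw [hZ'.deriv]
        exact mul_ne_zero hV₁0 (div_ne_zero hD1 hq1)
      have hst := hZa.hasStrictDerivAt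
      have hω := hZa.analyticAt_localInverse hd
      have hωl := hst.eventually_left_inverse hd
      have hωr := hst.eventually_right_inverse hd
      set ω := hst.localInverse _ _ _ hd with hωdef
      have hω0 : ω (γ s) = V₁ := by rw [← hZV]; exact hωl.self_of_nhds
      rw [hZV] at hω hωr
      have hωt : Tendsto ω (𝓝 (γ s)) (𝓝 V₁) := by
        have := hω.continuousAt.tendsto
        rwa [hω0] at this
      have hωb : ∀ᶠ w in 𝓝 (γ s), ω w ∈ Metric.ball (0 : ℂ) r ∧ X0 (ω w) ≠ 0 := by
        have hmem : ∀ᶠ W in 𝓝 V₁, W ∈ Metric.ball (0 : ℂ) r := Metric.isOpen_ball.mem_nhds hV₁r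
        have hne : ∀ᶠ W in 𝓝 V₁, X0 W ≠ 0 :=
          (hXc V₁ hV₁r).1.eventually_ne (by simp only [hX0, hZV]; exact hVo.1)
        exact hωt.eventually (hmem.and hne)
      have hsolw : IsSolutionNear c (fun w => X1 (ω w) / X0 (ω w)) (fun w => X2 (ω w) / X0 (ω w))
          (γ s) := by
        filter_upwards [hωb, hωr.eventually_nhds, hω.eventually_analyticAt]
          with w ⟨hwb, hw0⟩ hwr hwa
        obtain ⟨⟨hwU, -, hwvel, -⟩, hqw, hDw, hZw, hΥw⟩ := hZ _ hwb
        have hw1 : ω w ≠ 0 := fun h => hw0 (by simp only [hX0, h]; exact hC.T0_zero _ _)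
        obtain ⟨-, hvV, hvU⟩ := hwvel hw1
        have hωw := hwa.differentiableAt.hasDerivAt
        have hone : ω w * (D (Z (ω w)) (Υ (ω w)) (ω w) / q (Z (ω w)) (Υ (ω w)) (ω w))
            * deriv ω w = 1 :=
          ((hZw.comp w hωw).congr_of_eventuallyEq
            (hwr.mono fun w h => h.symm)).unique (hasDerivAt_id w)
        have hdω : deriv ω w = C.velV (Z (ω w)) (Υ (ω w)) (ω w) := by
          rw [hvV]; field_simp at hone ⊢; linear_combination hone
        have hwz : Z (ω w) = w := hwr.self_of_nhds
        have := hC.push (Z (ω w)) hwU (fun w => Z (ω w)) (fun w => Υ (ω w)) ω w 1 rfl hw0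
          ((hasDerivAt_id w).congr_of_eventuallyEq hwr)
          ((hΥw.comp w hωw).congr_deriv (by
            rw [one_mul, hdω, hvV, hvU]; field_simp))
          (hωw.congr_deriv (by rw [one_mul, hdω]))
        simpa [hX0, hX1, hX2, hwz] using this
      have hval := hVo.eq
      have hin := hγ.eventually_right hs0 (hωb.and hωr)
      filter_upwards [hxy.eventually_eq hγ hs0 (hc _ (hγ.2.2 (Set.Ico_subset_Icc_self hs0))) hsolw
        (by simp only [hX0, hX1, hω0, hZV]; exact hval.1)
        (by simp only [hX0, hX2, hω0, hZV]; exact hval.2), hin, Ioo_mem_nhdsGT hs.2]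
        with s' h1 ⟨⟨h2, h3⟩, h4⟩ h5
      refine ⟨ω (γ s'), ?_, h4, ?_⟩
      · rw [mem_closedBall_zero_iff]
        exact (hsmall s' ⟨hs.1.trans h5.1.le, h5.2⟩ _ h2 h4).le
      · have h6 := isOver_of_eq (C := C) h3 h1.1 h1.2
        rwa [h4] at h6
  choose! V hV using hall
  exact ⟨Z, Υ, V, r, t n, hr, ht n, hZ, hV⟩

end Pole

/-! ### Square-root poles -/

section Pole

variable {c : Coeffs} {U : Set ℂ} {γ : ℝ → ℂ} {x y : ℝ → ℂ}

/-- A solution that accumulates at a point `(h, 0)` of the exceptional curve of a final chart either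
passes it by and is analytic at the end of the path, or reaches the curve. -/
theorem endsRegular_or_endsOnCurve {C : Chart} {κ : ℂ → ℂ} {q N D : ℂ → ℂ → ℂ → ℂ} {p₀ d₀ : ℂ}
    (hγ : IsFinitePathIn U γ) (hxy : IsContinuedAlong c γ x y) (hc : ∀ z ∈ U, c.AnalyticAt z)
    (hU : IsOpen U) (hC : IsPolarChart c U C) (hF : IsFinalChart C κ q N D p₀ d₀ (γ 1))
    (hκ : ∀ᶠ z in 𝓝 (γ 1), κ z = 0) {h : ℂ} (hlim : HasLimitPoint C γ x y h 0) :
    EndsRegular c γ x y ∨ EndsOnCurve c C (d₀ / p₀) γ x y := by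
  obtain ⟨Z, Υ, V, r, s₀, hr, hs₀, hZ, hV⟩ := exists_curve_of_limit hγ hxy hc hU hC hF hκ hlim
  have hz1U : γ 1 ∈ U := hγ.2.2 (by simp)
  have hball2 : Metric.closedBall (0 : ℂ) (r / 2) ⊆ Metric.ball 0 r :=
    Metric.closedBall_subset_ball (by linarith)
  have hcont := hxy.continuousOn hγ
  have hZc : ∀ W ∈ Metric.ball (0 : ℂ) r, ContinuousAt (fun W => (Z W, Υ W, W)) W := fun W hW =>
    (hZ W hW).2.2.2.1.continuousAt.prodMk
      ((hZ W hW).2.2.2.2.continuousAt.prodMk continuousAt_id)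
  have hTc : ∀ {T : ℂ → ℂ → ℂ → ℂ}, (∀ z ∈ U, IsPolyNear z T) → ∀ W ∈ Metric.ball (0 : ℂ) r,
      ContinuousAt (fun W => T (Z W) (Υ W) W) W := fun {T} hT W hW =>
    ContinuousAt.comp (g := fun p : ℂ × ℂ × ℂ => T p.1 p.2.1 p.2.2)
      (f := fun W => (Z W, Υ W, W)) ((hT _ (hZ W hW).1.1).analyticAt _ _).continuousAt (hZc W hW)
  have hVr : ∀ s ∈ Set.Ico s₀ 1, V s ∈ Metric.ball (0 : ℂ) r := fun s hs => hball2 (hV s hs).1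
  -- Either the curve meets `V = 0` exactly at the end of the path, or it passes by.
  by_cases hZ0 : Z 0 = γ 1
  · right
    have hmpos : 0 < ‖d₀ / p₀‖ := norm_pos_iff.2 (div_ne_zero hF.d₀_ne hF.p₀_ne)
    have hVt : Tendsto V (𝓝[<] 1) (𝓝 0) := by
      rw [tendsto_zero_iff_norm_tendsto_zero]
      have h1 : Tendsto (fun s => Real.sqrt (4 / ‖d₀ / p₀‖ * ‖γ s - γ 1‖)) (𝓝[<] 1) (𝓝 0) := by
        have h2 := (tendsto_iff_norm_sub_tendsto_zero.1 hγ.tendsto_one).const_mul (4 / ‖d₀ / p₀‖)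
        have h3 := (Real.continuous_sqrt.tendsto _).comp h2
        rw [mul_zero, Real.sqrt_zero] at h3
        exact h3
      refine squeeze_zero' (Eventually.of_forall fun s => norm_nonneg _) ?_ h1
      filter_upwards [Ioo_mem_nhdsLT hs₀.2] with s hs
      have hs' : s ∈ Set.Ico s₀ 1 := ⟨hs.1.le, hs.2⟩
      have h4 := (norm_sq_le_of_curve (D := fun V => D (Z V) (Υ V) V / q (Z V) (Υ V) V)
        (fun V hV => ⟨(hZ V hV).2.2.2.1, (hZ V hV).1.2.2.2⟩) (hVr s hs')).1
      rw [hZ0, (hV s hs').2.1] at h4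
      apply Real.le_sqrt_of_sq_le
      rw [div_mul_eq_mul_div, le_div_iff₀ hmpos]
      linarith
    obtain ⟨f, hf⟩ := hC.exists_coord
    have hVc : ContinuousOn V (Set.Ico s₀ 1) := by
      intro s hs
      have hsub : Set.Ico s₀ 1 ⊆ Set.Ico (0 : ℝ) 1 := Set.Ico_subset_Ico_left hs₀.1
      have h1 : ContinuousWithinAt (fun s => f (x s, y s)) (Set.Ico s₀ 1) s := by
        have h2 := (hV s hs).2.2
        have h3 := (hf _ _ _ h2.1).1
        rw [← h2.eq.1, ← h2.eq.2] at h3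
        exact ContinuousAt.comp_continuousWithinAt (f := fun s => (x s, y s)) h3
          (((hcont.1 s (hsub hs)).mono hsub).prodMk ((hcont.2 s (hsub hs)).mono hsub))
      have h4 : ∀ s ∈ Set.Ico s₀ 1, V s = f (x s, y s) := fun s hs => by
        have h2 := (hV s hs).2.2
        have h3 := (hf _ _ _ h2.1).2
        rwa [← h2.eq.1, ← h2.eq.2, eq_comm] at h3
      exact h1.congr h4 (h4 s hs)
    obtain ⟨φ, ψ, hφ, hψ, hΥa, hφ0, hψ0, hψ', hψ2, hZφ, hψφ, hZψ, hev⟩ :=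
      exists_sqrt_of_curve hF.q_poly hF.D_poly hr hZ0 fun V hV => (hZ V hV).2
    rw [hF.q_zero, hF.D_zero] at hψ2
    have hgood : ∀ᶠ s in 𝓝[<] (1 : ℝ), AnalyticAt ℂ φ (V s) ∧ Z (V s) = γ 1 + φ (V s) ^ 2 ∧
        ψ (φ (V s)) = V s :=
      hVt.eventually (hφ.eventually_analyticAt.and (hZφ.and hψφ))
    obtain ⟨l, hl, hlp⟩ := (mem_nhdsLT_iff_exists_Ioo_subset).1 hgood
    obtain ⟨s₁, hs₁⟩ := exists_between (max_lt hl hs₀.2 : max l s₀ < 1)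
    have hs₁' : ∀ s ∈ Set.Ico s₁ 1, s ∈ Set.Ico s₀ 1 ∧ s ∈ Set.Ioo l 1 := fun s hs =>
      ⟨⟨((le_max_right l s₀).trans hs₁.1.le).trans hs.1, hs.2⟩,
        ⟨((le_max_left l s₀).trans_lt hs₁.1).trans_le hs.1, hs.2⟩⟩
    refine ⟨fun s => φ (V s), s₁, Υ ∘ ψ, ψ, ⟨(hs₀.1.trans (le_max_right l s₀)).trans hs₁.1.le, hs₁.2⟩,
      ?_, ?_, hΥa.comp_of_eq hψ hψ0, hψ, hψ0, hψ2, ?_, ?_⟩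
    · intro s hs
      obtain ⟨h1, h2⟩ := hs₁' s hs
      exact (hlp h2).1.continuousAt.comp_continuousWithinAt
        ((hVc s h1).mono fun s hs => (hs₁' s hs).1)
    · have := hφ.continuousAt.tendsto
      rw [hφ0] at this
      exact this.comp hVt
    · intro s hs
      obtain ⟨h1, h2⟩ := hs₁' s hs
      obtain ⟨-, h3, h4⟩ := hlp h2
      obtain ⟨-, h5, h6⟩ := hV s h1
      refine ⟨?_, ?_, ?_⟩
      · intro h0
        have h0 : φ (V s) = 0 := h0
        rw [h0, hψ0] at h4
        rw [← h4] at h6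
        exact h6.1 (hC.T0_zero _ _)
      · rw [← h5, h3]; ring
      · rw [Function.comp_apply, h4]; exact h6
    · filter_upwards [hev, hZψ.filter_mono nhdsWithin_le_nhds] with w ⟨hne, hψd, hΥd⟩ ⟨hZw, hwr⟩
      obtain ⟨⟨hwU, -, hwvel, -⟩, -, hD, -⟩ := hZ _ hwr
      obtain ⟨hT0, hvV, hvU⟩ := hwvel hne
      rw [hZw] at hT0 hvV hvU hwU hD
      refine ⟨hne, hT0, ?_⟩
      have hz : HasDerivAt (fun w : ℂ => γ 1 + w ^ 2) (2 * w) w := by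
        simpa using (hasDerivAt_pow 2 w).const_add (γ 1)
      exact hC.push _ hwU (fun w => γ 1 + w ^ 2) (Υ ∘ ψ) ψ w (2 * w) rfl hT0 hz
        (hΥd.congr_deriv (by rw [Function.comp_apply, hvU])) (hψd.congr_deriv (by
          rw [Function.comp_apply, hvV]))
  · left
    obtain ⟨t, -, ht, ht1⟩ := exists_seq_strictMono_tendsto' hs₀.2
    have htm : ∀ n, t n ∈ Set.Ico s₀ 1 := fun n => ⟨(ht n).1.le, (ht n).2⟩
    obtain ⟨V₁, hV₁, χ, hχ, hlimV⟩ := (isCompact_closedBall (0 : ℂ) (r / 2)).tendsto_subseq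
      fun n => (hV (t n) (htm n)).1
    have hV₁r := hball2 hV₁
    have htχ : ∀ n, t (χ n) ∈ Set.Ico (0 : ℝ) 1 := fun n => ⟨hs₀.1.trans (htm _).1, (htm _).2⟩
    have htχ1 : Tendsto (fun n => t (χ n)) atTop (𝓝 1) := ht1.comp hχ.tendsto_atTop
    have hZ1 : Z V₁ = γ 1 := by
      refine tendsto_nhds_unique_of_eventuallyEq
        ((hZ V₁ hV₁r).2.2.2.1.continuousAt.tendsto.comp hlimV)
        (hγ.tendsto_one.comp (tendsto_nhdsLT_one htχ htχ1)) (Eventually.of_forall fun n => ?_)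
      exact (hV _ (htm _)).2.1
    have hV₁0 : V₁ ≠ 0 := by rintro rfl; exact hZ0 hZ1
    have hT0 := ((hZ V₁ hV₁r).1.2.2.1 hV₁0).1
    have hl : ∀ {T : ℂ → ℂ → ℂ → ℂ}, (∀ z ∈ U, IsPolyNear z T) →
        Tendsto (fun n => T (γ (t (χ n))) (Υ (V (t (χ n)))) (V (t (χ n)))) atTop
          (𝓝 (T (Z V₁) (Υ V₁) V₁)) := fun hT => by
      refine ((hTc hT V₁ hV₁r).tendsto.comp hlimV).congr fun n => ?_
      simp only [Function.comp_apply, (hV _ (htm (χ n))).2.1]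
    refine endsRegular_of_limit hγ hxy hc htχ htχ1
      (((hl hC.T1_poly).div (hl hC.T0_poly) hT0).congr fun n => ?_)
      (((hl hC.T2_poly).div (hl hC.T0_poly) hT0).congr fun n => ?_)
    · exact (hV _ (htm (χ n))).2.2.eq.1.symm
    · exact (hV _ (htm (χ n))).2.2.eq.2.symm

theorem isPolyNear_casc_T {C : Chart} {a : ℕ → ℂ → ℂ} {z₀ : ℂ} (ha : ∀ j, AnalyticAt ℂ (a j) z₀)
    (h0 : IsPolyNear z₀ C.T0) (h1 : IsPolyNear z₀ C.T1) (h2 : IsPolyNear z₀ C.T2) (m : ℕ) :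
    IsPolyNear z₀ (casc C a m).T0 ∧ IsPolyNear z₀ (casc C a m).T1 ∧
      IsPolyNear z₀ (casc C a m).T2 := by
  have hL := IsPolyNear.cascLift ha m
  have e0 : (casc C a m).T0 = fun z U V => C.T0 z (cascLift (fun j => a j z) m U V) V := by
    funext z U V; exact (casc_T C a m z U V).1
  have e1 : (casc C a m).T1 = fun z U V => C.T1 z (cascLift (fun j => a j z) m U V) V := by
    funext z U V; exact (casc_T C a m z U V).2.1
  have e2 : (casc C a m).T2 = fun z U V => C.T2 z (cascLift (fun j => a j z) m U V) V := by
    funext z U V; exact (casc_T C a m z U V).2.2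
  rw [e0, e1, e2]
  exact ⟨h0.comp hL .snd, h1.comp hL .snd, h2.comp hL .snd⟩

theorem isPolarChart_nine (hc : ∀ z ∈ U, c.AnalyticAt z) : IsPolarChart c U (upperChart c 9) := by
  have hT := fun z U V => casc_T (upperChart c 3) (firstCentre c) 6 z U V
  have hp : ∀ z ∈ U, IsPolyNear z (casc (upperChart c 3) (firstCentre c) 6).T0 ∧
      IsPolyNear z (casc (upperChart c 3) (firstCentre c) 6).T1 ∧
      IsPolyNear z (casc (upperChart c 3) (firstCentre c) 6).T2 := fun z hz => by
    refine isPolyNear_casc_T (fun j => (hc z hz).centre _) ?_ ?_ ?_ 6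
    · have : (upperChart c 3).T0 = fun _ K V => K ^ 2 * V ^ 3 := by
        funext z K V; exact (upperChart_three_T z K V).1
      rw [this]; exact (IsPolyNear.fst.pow 2).mul (IsPolyNear.snd.pow 3)
    · have : (upperChart c 3).T1 = fun _ K V => 1 := by
        funext z K V; exact (upperChart_three_T z K V).2.1
      rw [this]; exact .const 1
    · have : (upperChart c 3).T2 = fun _ K V => K * V ^ 2 := by
        funext z K V; exact (upperChart_three_T z K V).2.2
      rw [this]; exact IsPolyNear.fst.mul (IsPolyNear.snd.pow 2)
  rw [upperChart_nine]
  refine ⟨fun z hz => ?_, fun z hz => (hp z hz).1, fun z hz => (hp z hz).2.1,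
    fun z hz => (hp z hz).2.2, fun z u => ?_, fun z hz u => ?_, fun z u v => ?_,
    ⟨fun p => p.2 ^ 2 / p.1, fun z u v hT0 => ?_⟩⟩
  · exact pushesForward_upperChart_three.casc (fun j => ((hc z hz).centre _).differentiableAt)
      (fun K => by rw [(upperChart_three_T z K 0).1]; ring) 6
  · rw [(hT z u 0).1, (upperChart_three_T _ _ _).1]; ring
  · have hL := (IsPolyNear.cascLift (a := firstCentre c) (fun j => (hc z hz).centre _) 6).analyticAt u 0
    have h2 : firstCentre c 0 z = 2 := rfl
    have : ∀ᶠ p in 𝓝 ((z, u, 0) : ℂ × ℂ × ℂ),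
        cascLift (fun j => firstCentre c j p.1) 6 p.2.1 p.2.2 ≠ 0 := by
      refine hL.continuousAt.eventually_ne ?_
      simp only [cascLift_zero_right _ (show (6 : ℕ) ≠ 0 by norm_num), h2]
      norm_num
    filter_upwards [this] with p hp hp0
    rw [(hT _ _ _).1, (upperChart_three_T _ _ _).1]
    exact mul_ne_zero (pow_ne_zero _ hp) (pow_ne_zero _ hp0)
  · left; rw [(hT z u v).2.1, (upperChart_three_T _ _ _).2.1]
  · rw [(hT z u v).1, (upperChart_three_T _ _ _).1] at hT0 ⊢
    rw [(hT z u v).2.1, (hT z u v).2.2, (upperChart_three_T _ _ _).2.1, (upperChart_three_T _ _ _).2.2]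
    have hK := fun h => hT0 (mul_eq_zero.2 (Or.inl (pow_eq_zero_iff two_ne_zero |>.2 h)))
    have hV : v ≠ 0 := fun h => hT0 (by rw [h]; ring)
    refine ⟨ContinuousAt.div (by fun_prop) (by fun_prop) (by simpa using ⟨hV, hK⟩), ?_⟩
    field_simp

theorem isPolarChart_thirteen (hc : ∀ z ∈ U, c.AnalyticAt z) :
    IsPolarChart c U (upperChart c 13) := by
  have hT := fun z U V => casc_T (chartU0 c) (secondCentre c) 4 z U V
  have hp : ∀ z ∈ U, IsPolyNear z (casc (chartU0 c) (secondCentre c) 4).T0 ∧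
      IsPolyNear z (casc (chartU0 c) (secondCentre c) 4).T1 ∧
      IsPolyNear z (casc (chartU0 c) (secondCentre c) 4).T2 := fun z hz =>
    isPolyNear_casc_T (fun j => (hc z hz).centre _) .snd .fst (.const 1) 4
  rw [upperChart_thirteen]
  refine ⟨fun z hz => ?_, fun z hz => (hp z hz).1, fun z hz => (hp z hz).2.1,
    fun z hz => (hp z hz).2.2, fun z u => (hT z u 0).1, fun z hz u => ?_,
    fun z u v => Or.inr (hT z u v).2.2, ⟨fun p => 1 / p.2, fun z u v hT0 => ?_⟩⟩
  · exact pushesForward_chartU0.casc (fun j => ((hc z hz).centre _).differentiableAt)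
      (fun K => rfl) 4
  · refine Eventually.of_forall fun p hp => ?_
    rw [(hT _ _ _).1]; exact hp
  · rw [(hT z u v).1] at hT0 ⊢
    rw [(hT z u v).2.1, (hT z u v).2.2]
    have hT0 : v ≠ 0 := hT0
    change ContinuousAt _ (_ / v, 1 / v) ∧ 1 / (1 / v) = v
    refine ⟨ContinuousAt.div (by fun_prop) (by fun_prop) (by simpa using hT0), ?_⟩
    field_simp

/-- A solution that reaches the last curve has a square-root pole, given the leading terms of `x` and
`y` along the curve. -/
theorem EndsOnCurve.endsSqrtPole_aux {C : Chart} {m : ℂ} (hC : IsPolarChart c U C)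
    (hU : γ 1 ∈ U) (h : EndsOnCurve c C m γ x y)
    (has : ∀ Ξ ψ : ℂ → ℂ, AnalyticAt ℂ Ξ 0 → AnalyticAt ℂ ψ 0 → ψ 0 = 0 → deriv ψ 0 ^ 2 * m = 2 →
      ∃ a : ℂ, Tendsto (fun w => w * (C.T2 (γ 1 + w ^ 2) (Ξ w) (ψ w)
          / C.T0 (γ 1 + w ^ 2) (Ξ w) (ψ w))) (𝓝[≠] 0) (𝓝 a) ∧
        ((a ^ 2 = -1 / 2 ∧ Tendsto (fun w => w ^ 3 * (C.T1 (γ 1 + w ^ 2) (Ξ w) (ψ w)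
          / C.T0 (γ 1 + w ^ 2) (Ξ w) (ψ w))) (𝓝[≠] 0) (𝓝 (-a))) ∨
        (a ^ 2 = 1 / 2 ∧ Tendsto (fun w => C.T1 (γ 1 + w ^ 2) (Ξ w) (ψ w)
          / C.T0 (γ 1 + w ^ 2) (Ξ w) (ψ w)) (𝓝[≠] 0) (𝓝 (-c.c2 (γ 1) / 3))))) :
    EndsSqrtPole c γ x y := by
  obtain ⟨τ, s₀, Ξ, ψ, hs₀, hτc, -, hΞ, hψ, hψ0, hψ2, hs, hev⟩ := h
  obtain ⟨a, ha, ha'⟩ := has Ξ ψ hΞ hψ hψ0 hψ2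
  have hT : ∀ {T : ℂ → ℂ → ℂ → ℂ}, (∀ z ∈ U, IsPolyNear z T) →
      AnalyticAt ℂ (fun w => T (γ 1 + w ^ 2) (Ξ w) (ψ w)) 0 := fun {T} hT => by
    refine AnalyticAt.comp_of_eq (g := fun p : ℂ × ℂ × ℂ => T p.1 p.2.1 p.2.2)
      (f := fun w => (γ 1 + w ^ 2, Ξ w, ψ w)) ((hT _ hU).analyticAt (Ξ 0) (ψ 0)) ?_ (by simp)
    exact (by fun_prop : AnalyticAt ℂ (fun w : ℂ => γ 1 + w ^ 2) 0).prod (hΞ.prod hψ)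
  refine ⟨_, _, τ, s₀, a, hs₀, hτc, fun s hs' => ?_,
    (hT hC.T1_poly).meromorphicAt.fun_div (hT hC.T0_poly).meromorphicAt,
    (hT hC.T2_poly).meromorphicAt.fun_div (hT hC.T0_poly).meromorphicAt, hev.mono fun w h => h.2.2,
    ha, ha'⟩
  obtain ⟨h1, h2, h3⟩ := hs s hs'
  have h4 : γ 1 + τ s ^ 2 = γ s := by rw [h2]; ring
  refine ⟨h1, h2, ?_⟩
  simp only [h4]
  exact h3.eq

theorem tendsto_div_of_deriv {ψ : ℂ → ℂ} (hψ : AnalyticAt ℂ ψ 0) (hψ0 : ψ 0 = 0)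
    (hd : deriv ψ 0 ≠ 0) : Tendsto (fun w => w / ψ w) (𝓝[≠] 0) (𝓝 (deriv ψ 0)⁻¹) := by
  have := (hψ.differentiableAt.hasDerivAt.tendsto_slope_zero).inv₀ hd
  refine this.congr fun w => ?_
  simp [hψ0, div_eq_mul_inv]
  ring

theorem tendsto_lift {a : ℕ → ℂ → ℂ} {z₀ : ℂ} (ha : ∀ j, AnalyticAt ℂ (a j) z₀) (m : ℕ)
    {Ξ ψ : ℂ → ℂ} (hΞ : AnalyticAt ℂ Ξ 0) (hψ : AnalyticAt ℂ ψ 0) :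
    Tendsto (fun w => cascLift (fun j => a j (z₀ + w ^ 2)) m (Ξ w) (ψ w)) (𝓝[≠] 0)
      (𝓝 (cascLift (fun j => a j z₀) m (Ξ 0) (ψ 0))) := by
  have h1 : AnalyticAt ℂ (fun w => (z₀ + w ^ 2, Ξ w, ψ w)) 0 :=
    (by fun_prop : AnalyticAt ℂ (fun w : ℂ => z₀ + w ^ 2) 0).prod (hΞ.prod hψ)
  have h2 := ((IsPolyNear.cascLift ha m).analyticAt (Ξ 0) (ψ 0)).continuousAt
  have h3 : ContinuousAt (fun w => cascLift (fun j => a j (z₀ + w ^ 2)) m (Ξ w) (ψ w)) 0 :=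
    ContinuousAt.comp_of_eq (g := fun p : ℂ × ℂ × ℂ => cascLift (fun j => a j p.1) m p.2.1 p.2.2)
      (f := fun w => (z₀ + w ^ 2, Ξ w, ψ w)) h2 h1.continuousAt (by simp)
  have h4 := h3.tendsto.mono_left (nhdsWithin_le_nhds (s := {0}ᶜ))
  simpa using h4

theorem EndsOnCurve.endsSqrtPole_nine (hc : ∀ z ∈ U, c.AnalyticAt z) (hU : γ 1 ∈ U)
    (h : EndsOnCurve c (upperChart c 9) (4 / -1) γ x y) : EndsSqrtPole c γ x y := by
  refine h.endsSqrtPole_aux (isPolarChart_nine hc) hU fun Ξ ψ hΞ hψ hψ0 hψ2 => ?_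
  have hd : deriv ψ 0 ≠ 0 := by rintro h; rw [h] at hψ2; norm_num at hψ2
  have t1 := tendsto_div_of_deriv hψ hψ0 hd
  have t2 := tendsto_lift (a := firstCentre c) (fun j => (hc _ hU).centre _) 6 hΞ hψ
  have h2 : firstCentre c 0 (γ 1) = 2 := rfl
  rw [hψ0, cascLift_zero_right _ (by norm_num), h2] at t2
  have hne : ∀ᶠ w in 𝓝[≠] (0 : ℂ), ψ w ≠ 0 :=
    (hψ.differentiableAt.hasDerivAt).eventually_ne (c := 0) hd
  have hne2 := t2.eventually_ne two_ne_zero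
  have hT := fun z U V => casc_T (upperChart c 3) (firstCentre c) 6 z U V
  rw [upperChart_nine]
  simp only [(hT _ _ _).1, (hT _ _ _).2.1, (hT _ _ _).2.2, (upperChart_three_T _ _ _).1,
    (upperChart_three_T _ _ _).2.1, (upperChart_three_T _ _ _).2.2]
  have e : deriv ψ 0 ^ 2 = -1 / 2 := by linear_combination (-1 / 4) * hψ2
  refine ⟨(deriv ψ 0)⁻¹ / 2, ?_, Or.inl ⟨?_, ?_⟩⟩
  · refine (t1.div t2 two_ne_zero).congr' ?_
    filter_upwards [hne, hne2] with w h1 h2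
    simp only [Pi.div_apply]
    field_simp
  · rw [div_pow, inv_pow, e]; norm_num
  · have e2 : -((deriv ψ 0)⁻¹ / 2) = (deriv ψ 0)⁻¹ ^ 3 / 2 ^ 2 := by
      field_simp
      rw [e]; norm_num
    rw [e2]
    refine ((t1.pow 3).div (t2.pow 2) (by norm_num)).congr' ?_
    filter_upwards [hne, hne2] with w h1 h2
    simp only [Pi.div_apply]
    field_simp

theorem EndsOnCurve.endsSqrtPole_thirteen (hc : ∀ z ∈ U, c.AnalyticAt z) (hU : γ 1 ∈ U)
    (h : EndsOnCurve c (upperChart c 13) (1 / 1) γ x y) : EndsSqrtPole c γ x y := by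
  refine h.endsSqrtPole_aux (isPolarChart_thirteen hc) hU fun Ξ ψ hΞ hψ hψ0 hψ2 => ?_
  have hd : deriv ψ 0 ≠ 0 := by rintro h; rw [h] at hψ2; norm_num at hψ2
  have t1 := tendsto_div_of_deriv hψ hψ0 hd
  have hne : ∀ᶠ w in 𝓝[≠] (0 : ℂ), ψ w ≠ 0 :=
    (hψ.differentiableAt.hasDerivAt).eventually_ne (c := 0) hd
  have t2 := tendsto_lift (a := fun j => secondCentre c (j + 1)) (z₀ := γ 1)
    (fun j => (hc _ hU).centre _) 3 hΞ hψ
  rw [hψ0, cascLift_zero_right _ (by norm_num)] at t2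
  have hT := fun z U V => casc_T (chartU0 c) (secondCentre c) 4 z U V
  have hL : ∀ z U V, cascLift (fun j => secondCentre c j z) 4 U V
      = V * cascLift (fun j => secondCentre c (j + 1) z) 3 U V := fun z U V => by
    have h0 : secondCentre c 0 z = 0 := rfl
    simp only [cascLift_eq, cascTail, h0, Nat.reduceAdd]
    ring
  rw [upperChart_thirteen]
  simp only [(hT _ _ _).1, (hT _ _ _).2.1, (hT _ _ _).2.2, (chartU0_T _ _ _).1,
    (chartU0_T _ _ _).2.1, (chartU0_T _ _ _).2.2, hL]
  have e : deriv ψ 0 ^ 2 = 2 := by linear_combination hψ2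
  refine ⟨(deriv ψ 0)⁻¹, ?_, Or.inr ⟨?_, ?_⟩⟩
  · refine t1.congr fun w => ?_
    rw [mul_one_div]
  · rw [inv_pow, e]; norm_num
  · refine t2.congr' ?_
    filter_upwards [hne] with w h1
    field_simp

end Pole

/-! ### The modified Hamiltonian -/

section Modified

variable (c : Coeffs)

/-- The coefficient `θ = c₂ c₃' / 6 - c₀'` of the modified Hamiltonian. -/
noncomputable def theta (z : ℂ) : ℂ := deriv c.c3 z * c.c2 z / 6 - deriv c.c0 z

/-- The coefficient `μ = c₂'' / 3 - c₂' c₃ / 3 - θ` of the modified Hamiltonian. -/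
noncomputable def muCoeff (z : ℂ) : ℂ :=
  deriv (deriv c.c2) z / 3 - deriv c.c2 z * c.c3 z / 3 - theta c z

/-- The correction to the Hamiltonian that removes the terms of its derivative that grow at
infinity. -/
noncomputable def corr (z x y : ℂ) : ℂ :=
  deriv c.c3 z / 2 * (x / y) + deriv c.c2 z / 3 * (x / y ^ 2 - y) + theta c z * (x / y ^ 4)
    + muCoeff c z * (1 / y)

variable {c} {z : ℂ} {ξ η : ℂ → ℂ}

theorem hasDerivAt_H (hc : c.AnalyticAt z) (hξ : HasDerivAt ξ (c.xdot z (ξ z) (η z)) z)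
    (hη : HasDerivAt η (c.ydot z (ξ z) (η z)) z) :
    HasDerivAt (fun w => c.H w (ξ w) (η w))
      (-(deriv c.c3 z * ξ z * η z) - deriv c.c2 z / 3 * η z ^ 3 - deriv c.c1 z / 2 * η z ^ 2
        - deriv c.c0 z * η z) z := by
  have h0 := hc.c0.differentiableAt.hasDerivAt
  have h1 := hc.c1.differentiableAt.hasDerivAt
  have h2 := hc.c2.differentiableAt.hasDerivAt
  have h3 := hc.c3.differentiableAt.hasDerivAt
  unfold Coeffs.H
  have := ((((hξ.fun_pow 2).div_const 2).fun_sub (hξ.fun_mul ((hη.fun_pow 3).fun_add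
    (h3.fun_mul hη)))).fun_sub ((h2.div_const 3).fun_mul (hη.fun_pow 3))).fun_sub
    ((h1.div_const 2).fun_mul (hη.fun_pow 2)) |>.fun_sub (h0.fun_mul hη)
  refine this.congr_deriv ?_
  rw [xdot_eq, ydot_eq]
  push_cast
  ring

theorem hasDerivAt_inv_y (hη : HasDerivAt η (c.ydot z (ξ z) (η z)) z) (hy : η z ≠ 0) :
    HasDerivAt (fun w => 1 / η w) (-(ξ z / η z ^ 2) + η z + c.c3 z / η z) z := by
  refine ((hasDerivAt_const z (1 : ℂ)).fun_div hη hy).congr_deriv ?_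
  rw [ydot_eq]
  field_simp
  ring

theorem hasDerivAt_x_div_y (hξ : HasDerivAt ξ (c.xdot z (ξ z) (η z)) z)
    (hη : HasDerivAt η (c.ydot z (ξ z) (η z)) z) (hy : η z ≠ 0) :
    HasDerivAt (fun w => ξ w / η w)
      (2 * ξ z * η z - 2 * c.H z (ξ z) (η z) / η z ^ 2 + c.c2 z * η z / 3 - c.c0 z / η z) z := by
  refine (hξ.fun_div hη hy).congr_deriv ?_
  rw [xdot_eq, ydot_eq]
  unfold Coeffs.H
  field_simp
  ring

theorem hasDerivAt_x_div_y_sq (hξ : HasDerivAt ξ (c.xdot z (ξ z) (η z)) z)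
    (hη : HasDerivAt η (c.ydot z (ξ z) (η z)) z) (hy : η z ≠ 0) :
    HasDerivAt (fun w => ξ w / η w ^ 2)
      (ξ z - c.c3 z * ξ z / η z ^ 2 - 4 * c.H z (ξ z) (η z) / η z ^ 3 - c.c2 z / 3
        - c.c1 z / η z - 3 * c.c0 z / η z ^ 2) z := by
  refine (hξ.fun_div (hη.fun_pow 2) (pow_ne_zero 2 hy)).congr_deriv ?_
  rw [xdot_eq, ydot_eq]
  unfold Coeffs.H
  field_simp
  ring

theorem hasDerivAt_x_div_y_pow_four (hξ : HasDerivAt ξ (c.xdot z (ξ z) (η z)) z)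
    (hη : HasDerivAt η (c.ydot z (ξ z) (η z)) z) (hy : η z ≠ 0) :
    HasDerivAt (fun w => ξ w / η w ^ 4)
      (-(ξ z / η z ^ 2) - 3 * c.c3 z * ξ z / η z ^ 4 - 8 * c.H z (ξ z) (η z) / η z ^ 5
        - 5 / 3 * c.c2 z / η z ^ 2 - 3 * c.c1 z / η z ^ 3 - 7 * c.c0 z / η z ^ 4) z := by
  refine (hξ.fun_div (hη.fun_pow 4) (pow_ne_zero 4 hy)).congr_deriv ?_
  rw [xdot_eq, ydot_eq]
  unfold Coeffs.H
  field_simp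
  ring

theorem analyticAt_theta (hc : c.AnalyticAt z) : AnalyticAt ℂ (theta c) z := by
  have h0 := hc.c0.deriv
  have h2 := hc.c2
  have h3 := hc.c3.deriv
  unfold theta
  fun_prop

theorem analyticAt_muCoeff (hc : c.AnalyticAt z) : AnalyticAt ℂ (muCoeff c) z := by
  have h2 := hc.c2.deriv
  have h2' := hc.c2.deriv.deriv
  have h3 := hc.c3
  have h := analyticAt_theta hc
  unfold muCoeff
  fun_prop

/-- Under the resonance conditions, all terms of the derivative of the modified Hamiltonian along
the flow that are not controlled by its size at infinity cancel. -/
theorem hasDerivAt_modified (hc : c.AnalyticAt z) (h1 : deriv c.c1 z = 0)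
    (h3 : deriv (deriv c.c3) z = 0) (hξ : HasDerivAt ξ (c.xdot z (ξ z) (η z)) z)
    (hη : HasDerivAt η (c.ydot z (ξ z) (η z)) z) (hy : η z ≠ 0) :
    HasDerivAt (fun w => c.H w (ξ w) (η w) + corr c w (ξ w) (η w))
      ((-deriv c.c3 z * c.c0 z * (1 / η z) / 2
          - deriv c.c2 z / 3 * (c.c2 z / 3 + c.c1 z * (1 / η z) + 3 * c.c0 z * (1 / η z) ^ 2)
          + deriv (muCoeff c) z * (1 / η z) + muCoeff c z * c.c3 z * (1 / η z)
          - theta c z * (5 / 3 * c.c2 z * (1 / η z) ^ 2 + 3 * c.c1 z * (1 / η z) ^ 3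
            + 7 * c.c0 z * (1 / η z) ^ 4))
        + (-deriv c.c3 z - 4 / 3 * deriv c.c2 z * (1 / η z) - 8 * theta c z * (1 / η z) ^ 3)
          * (c.H z (ξ z) (η z) / η z ^ 2)
        + (deriv (theta c) z - 3 * theta c z * c.c3 z) * (ξ z / η z ^ 4)) z := by
  have hH := hasDerivAt_H hc hξ hη
  have d3 : HasDerivAt (deriv c.c3) (deriv (deriv c.c3) z) z :=
    hc.c3.deriv.differentiableAt.hasDerivAt
  have d2 : HasDerivAt (deriv c.c2) (deriv (deriv c.c2) z) z :=
    hc.c2.deriv.differentiableAt.hasDerivAt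
  have dθ := (analyticAt_theta hc).differentiableAt.hasDerivAt
  have dμ := (analyticAt_muCoeff hc).differentiableAt.hasDerivAt
  have e1 := (d3.div_const 2).fun_mul (hasDerivAt_x_div_y hξ hη hy)
  have e2 := (d2.div_const 3).fun_mul ((hasDerivAt_x_div_y_sq hξ hη hy).fun_sub hη)
  have e3 := dθ.fun_mul (hasDerivAt_x_div_y_pow_four hξ hη hy)
  have e4 := dμ.fun_mul (hasDerivAt_inv_y hη hy)
  unfold corr
  refine (hH.fun_add (((e1.fun_add e2).fun_add e3).fun_add e4)).congr_deriv ?_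
  rw [h1, h3, ydot_eq]
  have hμ : muCoeff c z = deriv (deriv c.c2) z / 3 - deriv c.c2 z * c.c3 z / 3 - theta c z := rfl
  have hθ : theta c z = deriv c.c3 z * c.c2 z / 6 - deriv c.c0 z := rfl
  have hc0 : deriv c.c0 z = deriv c.c3 z * c.c2 z / 6 - theta c z := by rw [hθ]; ring
  have hcc : deriv (deriv c.c2) z = 3 * muCoeff c z + deriv c.c2 z * c.c3 z + 3 * theta c z := by
    rw [hμ]; ring
  rw [hc0, hcc]
  generalize c.H z (ξ z) (η z) = H
  field_simp
  ring

end Modified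

/-! ### Bounds for the modified Hamiltonian -/

section Bounds

variable {c : Coeffs} {U : Set ℂ}

theorem exists_bound_of_isPolyNear {F : ℂ → ℂ → ℂ → ℂ} {P : Set ℂ} (hP : IsCompact P)
    (hF : ∀ z ∈ P, IsPolyNear z F) (R : ℝ) :
    ∃ K, 0 ≤ K ∧ ∀ z ∈ P, ∀ u v : ℂ, ‖u‖ ≤ R → ‖v‖ ≤ R → ‖F z u v‖ ≤ K := by
  have hc : IsCompact (P ×ˢ (Metric.closedBall (0 : ℂ) R ×ˢ Metric.closedBall (0 : ℂ) R)) :=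
    hP.prod ((isCompact_closedBall 0 R).prod (isCompact_closedBall 0 R))
  obtain ⟨K, hK⟩ := hc.exists_bound_of_continuousOn
    (f := fun p : ℂ × ℂ × ℂ => F p.1 p.2.1 p.2.2) fun p hp =>
      ((hF p.1 hp.1).analyticAt p.2.1 p.2.2).continuousAt.continuousWithinAt
  refine ⟨max K 0, le_max_right _ _, fun z hz u v hu hv => ?_⟩
  refine (hK (z, u, v) ⟨hz, ?_, ?_⟩).trans (le_max_left _ _)
  · simpa using hu
  · simpa using hv

end Bounds

section Bounds

variable {c : Coeffs} {z x y : ℂ} {B : ℝ}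

/-- The coefficient functions that enter the modified Hamiltonian are bounded by `B` at `z`. -/
structure CoeffBound (c : Coeffs) (z : ℂ) (B : ℝ) : Prop where
  one_le : 1 ≤ B
  c0 : ‖c.c0 z‖ ≤ B
  c1 : ‖c.c1 z‖ ≤ B
  c2 : ‖c.c2 z‖ ≤ B
  c3 : ‖c.c3 z‖ ≤ B
  d0 : ‖deriv c.c0 z‖ ≤ B
  d2 : ‖deriv c.c2 z‖ ≤ B
  d3 : ‖deriv c.c3 z‖ ≤ B
  θ : ‖theta c z‖ ≤ B
  μ : ‖muCoeff c z‖ ≤ B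

theorem exists_coeffBound {P : Set ℂ} (hP : IsCompact P) (hc : ∀ z ∈ P, c.AnalyticAt z) :
    ∃ B, ∀ z ∈ P, CoeffBound c z B := by
  have key : ∀ f : ℂ → ℂ, (∀ z ∈ P, AnalyticAt ℂ f z) → ∃ K, 0 ≤ K ∧ ∀ z ∈ P, ‖f z‖ ≤ K := by
    intro f hf
    obtain ⟨K, hK0, hK⟩ := exists_bound_of_isPolyNear (F := fun z _ _ => f z) hP
      (fun z hz => .coeff (hf z hz)) 0
    exact ⟨K, hK0, fun z hz => hK z hz 0 0 (by simp) (by simp)⟩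
  obtain ⟨K0, p0, b0⟩ := key _ fun z hz => (hc z hz).c0
  obtain ⟨K1, p1, b1⟩ := key _ fun z hz => (hc z hz).c1
  obtain ⟨K2, p2, b2⟩ := key _ fun z hz => (hc z hz).c2
  obtain ⟨K3, p3, b3⟩ := key _ fun z hz => (hc z hz).c3
  obtain ⟨K4, p4, b4⟩ := key _ fun z hz => (hc z hz).c0.deriv
  obtain ⟨K5, p5, b5⟩ := key _ fun z hz => (hc z hz).c2.deriv
  obtain ⟨K6, p6, b6⟩ := key _ fun z hz => (hc z hz).c3.deriv
  obtain ⟨K7, p7, b7⟩ := key _ fun z hz => analyticAt_theta (hc z hz)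
  obtain ⟨K8, p8, b8⟩ := key _ fun z hz => analyticAt_muCoeff (hc z hz)
  refine ⟨1 + K0 + K1 + K2 + K3 + K4 + K5 + K6 + K7 + K8, fun z hz => ⟨?_, ?_, ?_, ?_, ?_, ?_, ?_,
    ?_, ?_, ?_⟩⟩
  · linarith
  · linarith [b0 z hz]
  · linarith [b1 z hz]
  · linarith [b2 z hz]
  · linarith [b3 z hz]
  · linarith [b4 z hz]
  · linarith [b5 z hz]
  · linarith [b6 z hz]
  · linarith [b7 z hz]
  · linarith [b8 z hz]

theorem norm_x_sq_le (h : CoeffBound c z B) {w : ℝ} (hw : 1 ≤ w) (hy : ‖y‖ ≤ w) :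
    ‖x‖ ^ 2 ≤ 4 * ‖c.H z x y‖ + 24 * B ^ 2 * w ^ 6 := by
  have hB := h.one_le
  have hx : x ^ 2 = 2 * c.H z x y + 2 * x * (y ^ 3 + c.c3 z * y)
      + (2 / 3 * c.c2 z * y ^ 3 + c.c1 z * y ^ 2 + 2 * c.c0 z * y) := by
    unfold Coeffs.H; ring
  have hw2 : w ≤ w ^ 3 := le_self_pow₀ hw (by norm_num)
  have hw3 : w ^ 2 ≤ w ^ 3 := pow_le_pow_right₀ hw (by norm_num)
  have hw0 : 0 ≤ w := by linarith
  have hy0 := norm_nonneg y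
  have p1 : ‖y ^ 3 + c.c3 z * y‖ ≤ 2 * B * w ^ 3 := by
    calc ‖y ^ 3 + c.c3 z * y‖ ≤ ‖y‖ ^ 3 + ‖c.c3 z‖ * ‖y‖ := by
          refine (norm_add_le _ _).trans ?_; rw [norm_pow, norm_mul]
      _ ≤ w ^ 3 + B * w := by gcongr; exact h.c3
      _ ≤ B * w ^ 3 + B * w ^ 3 := by
          have : 1 * w ^ 3 ≤ B * w ^ 3 := by gcongr
          gcongr; linarith
      _ = 2 * B * w ^ 3 := by ring
  have p2 : ‖2 / 3 * c.c2 z * y ^ 3 + c.c1 z * y ^ 2 + 2 * c.c0 z * y‖ ≤ 4 * B * w ^ 3 := by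
    calc ‖2 / 3 * c.c2 z * y ^ 3 + c.c1 z * y ^ 2 + 2 * c.c0 z * y‖
        ≤ 2 / 3 * ‖c.c2 z‖ * ‖y‖ ^ 3 + ‖c.c1 z‖ * ‖y‖ ^ 2 + 2 * ‖c.c0 z‖ * ‖y‖ := by
          refine (norm_add₃_le).trans ?_
          simp only [norm_mul, norm_pow, norm_div, RCLike.norm_ofNat]; rfl
      _ ≤ 2 / 3 * B * w ^ 3 + B * w ^ 2 + 2 * B * w := by
          gcongr
          exacts [h.c2, h.c1, h.c0]
      _ ≤ 2 / 3 * B * w ^ 3 + B * w ^ 3 + 2 * B * w ^ 3 := by gcongr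
      _ ≤ 4 * B * w ^ 3 := by
          have : 0 ≤ B * w ^ 3 := by positivity
          linarith
  have p3 : ‖x‖ ^ 2 ≤ 2 * ‖c.H z x y‖ + 2 * ‖x‖ * (2 * B * w ^ 3) + 4 * B * w ^ 3 := by
    rw [← norm_pow, hx]
    refine (norm_add₃_le).trans ?_
    simp only [norm_mul, RCLike.norm_ofNat]
    gcongr
  have p4 : 4 * B * w ^ 3 ≤ 4 * B ^ 2 * w ^ 6 := by
    have : 1 ≤ B * w ^ 3 := one_le_mul_of_one_le_of_one_le hB (one_le_pow₀ hw)
    nlinarith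
  nlinarith [sq_nonneg (‖x‖ - 4 * B * w ^ 3)]

theorem norm_corr_le (h : CoeffBound c z B) (hy : 1 ≤ ‖y‖) :
    ‖corr c z x y‖ ≤ 2 * B * (‖x‖ / ‖y‖) + 2 * B * ‖y‖ := by
  have hB := h.one_le
  have hy0 : 0 < ‖y‖ := by linarith
  have hx0 := norm_nonneg x
  have q1 : ‖x‖ / ‖y‖ ^ 2 ≤ ‖x‖ / ‖y‖ := by
    gcongr; exact le_self_pow₀ hy (by norm_num)
  have q2 : ‖x‖ / ‖y‖ ^ 4 ≤ ‖x‖ / ‖y‖ := by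
    gcongr; exact le_self_pow₀ hy (by norm_num)
  have q3 : 1 / ‖y‖ ≤ ‖y‖ := by rw [div_le_iff₀ hy0]; nlinarith
  have q0 : 0 ≤ ‖x‖ / ‖y‖ := by positivity
  have n1 : ‖deriv c.c3 z / 2 * (x / y)‖ ≤ B / 2 * (‖x‖ / ‖y‖) := by
    rw [norm_mul, norm_div, norm_div, RCLike.norm_ofNat]; gcongr; exact h.d3
  have n2 : ‖deriv c.c2 z / 3 * (x / y ^ 2 - y)‖ ≤ B / 3 * (‖x‖ / ‖y‖ + ‖y‖) := by
    rw [norm_mul, norm_div, RCLike.norm_ofNat]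
    have : ‖x / y ^ 2 - y‖ ≤ ‖x‖ / ‖y‖ + ‖y‖ := by
      refine (norm_sub_le _ _).trans ?_
      rw [norm_div, norm_pow]; gcongr
    gcongr
    exact h.d2
  have n3 : ‖theta c z * (x / y ^ 4)‖ ≤ B * (‖x‖ / ‖y‖) := by
    rw [norm_mul, norm_div, norm_pow]
    gcongr
    exact h.θ
  have n4 : ‖muCoeff c z * (1 / y)‖ ≤ B * ‖y‖ := by
    rw [norm_mul, norm_div, norm_one]
    gcongr
    exact h.μ
  unfold corr
  refine (norm_add_le_of_le (norm_add₃_le.trans (add_le_add_three n1 n2 n3)) n4).trans ?_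
  have : 0 ≤ B * (‖x‖ / ‖y‖) := by positivity
  have : 0 ≤ B * ‖y‖ := by positivity
  linarith

/-- The Hamiltonian is controlled by the modified one, up to a multiple of `y²`. Corrections with
a weight `χ ∈ [0, 1]` that vanishes for `|y| < 1` are allowed. -/
theorem norm_H_le (h : CoeffBound c z B) {χ : ℝ} (h0 : 0 ≤ χ) (h1 : χ ≤ 1) (hχ : χ = 0 ∨ 1 ≤ ‖y‖)
    {w : ℝ} (hw : 1 ≤ w) (hy : ‖y‖ ≤ w) :
    ‖c.H z x y‖ ≤ 2 * ‖c.H z x y + χ * corr c z x y‖ + 40 * B ^ 2 * w ^ 2 := by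
  have hB := h.one_le
  rcases hχ with rfl | hy1
  · have : 0 ≤ 40 * B ^ 2 * w ^ 2 := by positivity
    simp only [Complex.ofReal_zero, zero_mul, add_zero]
    linarith [norm_nonneg (c.H z x y)]
  · have hy0 : 0 < ‖y‖ := by linarith
    have e1 := norm_corr_le (x := x) h hy1
    have e2 := norm_x_sq_le (x := x) h hy1 le_rfl
    have e3 : ‖(χ : ℂ) * corr c z x y‖ ≤ ‖corr c z x y‖ := by
      rw [norm_mul, Complex.norm_real, Real.norm_of_nonneg h0]
      exact mul_le_of_le_one_left (norm_nonneg _) h1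
    have e4 : ‖c.H z x y‖ ≤ ‖c.H z x y + χ * corr c z x y‖ + ‖(χ : ℂ) * corr c z x y‖ := by
      have := norm_sub_le (c.H z x y + χ * corr c z x y) (χ * corr c z x y)
      rwa [add_sub_cancel_right] at this
    have e5 : 2 * B * (‖x‖ / ‖y‖) ≤ ‖c.H z x y‖ / 4 + 18 * B ^ 2 * ‖y‖ ^ 2 := by
      have s1 : 2 * B * (‖x‖ / ‖y‖) = 2 * (‖x‖ / (4 * ‖y‖ ^ 2)) * (4 * B * ‖y‖) := by
        field_simp
      have s2 : (‖x‖ / (4 * ‖y‖ ^ 2)) ^ 2 ≤ ‖c.H z x y‖ / 4 + 2 * B ^ 2 * ‖y‖ ^ 2 := by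
        rw [div_pow, div_le_iff₀ (by positivity)]
        have s3 : 1 ≤ ‖y‖ ^ 4 := one_le_pow₀ hy1
        have s4 := mul_le_mul_of_nonneg_left s3 (norm_nonneg (c.H z x y))
        have s5 : 0 ≤ B ^ 2 * ‖y‖ ^ 6 := by positivity
        calc ‖x‖ ^ 2 ≤ 4 * ‖c.H z x y‖ + 24 * B ^ 2 * ‖y‖ ^ 6 := e2
          _ ≤ 4 * (‖c.H z x y‖ * ‖y‖ ^ 4) + 32 * (B ^ 2 * ‖y‖ ^ 6) := by linarith
          _ = _ := by ring
      rw [s1]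
      nlinarith [two_mul_le_add_sq (‖x‖ / (4 * ‖y‖ ^ 2)) (4 * B * ‖y‖)]
    have e6 : 2 * B * ‖y‖ ≤ 2 * B ^ 2 * ‖y‖ ^ 2 := by
      have : 1 ≤ B * ‖y‖ := one_le_mul_of_one_le_of_one_le hB hy1
      nlinarith
    have e7 : ‖c.H z x y‖ ≤ 2 * ‖c.H z x y + χ * corr c z x y‖ + 40 * B ^ 2 * ‖y‖ ^ 2 := by
      have : 0 ≤ B ^ 2 * ‖y‖ ^ 2 := by positivity
      linarith [norm_nonneg (c.H z x y + χ * corr c z x y)]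
    refine e7.trans ?_
    gcongr

theorem norm_Hdot_le (h : CoeffBound c z B) (hy : ‖y‖ ≤ 2) :
    ‖-(deriv c.c3 z * x * y) - deriv c.c2 z / 3 * y ^ 3 - 0 / 2 * y ^ 2
        - deriv c.c0 z * y‖ ≤ 6 * B * (1 + ‖x‖) := by
  have hB := h.one_le
  have hx0 := norm_nonneg x
  have n1 : ‖-(deriv c.c3 z * x * y)‖ ≤ B * ‖x‖ * 2 := by
    rw [norm_neg, norm_mul, norm_mul]; gcongr; exact h.d3
  have n2 : ‖deriv c.c2 z / 3 * y ^ 3‖ ≤ B / 3 * 2 ^ 3 := by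
    rw [norm_mul, norm_div, norm_pow, RCLike.norm_ofNat]; gcongr; exact h.d2
  have n3 : ‖deriv c.c0 z * y‖ ≤ B * 2 := by
    rw [norm_mul]; gcongr; exact h.d0
  have e : -(deriv c.c3 z * x * y) - deriv c.c2 z / 3 * y ^ 3 - 0 / 2 * y ^ 2 - deriv c.c0 z * y
      = -(deriv c.c3 z * x * y) - deriv c.c2 z / 3 * y ^ 3 - deriv c.c0 z * y := by ring
  rw [e]
  refine (norm_sub_le_of_le (norm_sub_le_of_le n1 n2) n3).trans ?_
  nlinarith

theorem norm_ydot_le (h : CoeffBound c z B) (hy : ‖y‖ ≤ 2) :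
    ‖c.ydot z x y‖ ≤ 10 * B * (1 + ‖x‖) := by
  have hB := h.one_le
  have hx0 := norm_nonneg x
  rw [ydot_eq]
  have n1 : ‖y ^ 3‖ ≤ 2 ^ 3 := by rw [norm_pow]; gcongr
  have n2 : ‖c.c3 z * y‖ ≤ B * 2 := by rw [norm_mul]; gcongr; exact h.c3
  refine (norm_sub_le_of_le (norm_sub_le_of_le (le_refl ‖x‖) n1) n2).trans ?_
  nlinarith

end Bounds

/-! ### Growth of the modified Hamiltonian along solutions -/

section Rate

variable {c : Coeffs} {z : ℂ} {ξ η : ℂ → ℂ}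

theorem eventually_norm_sub_le_of_hasDerivAt {f : ℂ → ℂ} {f' z₀ : ℂ} (hf : HasDerivAt f f' z₀)
    {L : ℝ} (hL : ‖f'‖ < L) : ∀ᶠ z in 𝓝 z₀, ‖f z - f z₀‖ ≤ L * ‖z - z₀‖ := by
  have h1 := (hasDerivAt_iff_isLittleO.1 hf).def (sub_pos.2 hL)
  filter_upwards [h1] with z hz
  have h2 := norm_add_le (f z - f z₀ - (z - z₀) • f') ((z - z₀) • f')
  rw [sub_add_cancel, norm_smul] at h2
  nlinarith

/-- A Lipschitz cut-off function that is `0` for `r ≤ 1` and `1` for `r ≥ 2`. -/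
noncomputable def cutoff (r : ℝ) : ℝ := max 0 (min 1 (r - 1))

theorem cutoff_nonneg (r : ℝ) : 0 ≤ cutoff r := le_max_left _ _

theorem cutoff_le_one (r : ℝ) : cutoff r ≤ 1 := max_le zero_le_one (min_le_left _ _)

theorem cutoff_of_le {r : ℝ} (h : r ≤ 1) : cutoff r = 0 :=
  max_eq_left ((min_le_right _ _).trans (by linarith))

theorem cutoff_of_ge {r : ℝ} (h : 2 ≤ r) : cutoff r = 1 := by
  rw [cutoff, min_eq_left (by linarith)]; norm_num

theorem cutoff_sub_le (r s : ℝ) : |cutoff r - cutoff s| ≤ |r - s| := by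
  have h1 := abs_max_sub_max_le_max 0 (min 1 (r - 1)) 0 (min 1 (s - 1))
  have h2 := abs_min_sub_min_le_max 1 (r - 1) 1 (s - 1)
  simp only [sub_self, abs_zero, abs_nonneg, sup_of_le_right, sub_sub_sub_cancel_right] at h1 h2
  exact h1.trans h2

/-- The modified Hamiltonian, with the corrections cut off for bounded `y`. -/
noncomputable def Wcut (c : Coeffs) (z x y : ℂ) : ℂ := c.H z x y + cutoff ‖y‖ * corr c z x y

/-- The derivative of the modified Hamiltonian is bounded in terms of its size. -/
theorem exists_modified_bound {P : Set ℂ} (hP : IsCompact P) (hc : ∀ z ∈ P, c.AnalyticAt z) :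
    ∃ K, 0 ≤ K ∧ ∀ z ∈ P, ∀ x y : ℂ, 1 ≤ ‖y‖ →
      ‖(-deriv c.c3 z * c.c0 z * (1 / y) / 2
          - deriv c.c2 z / 3 * (c.c2 z / 3 + c.c1 z * (1 / y) + 3 * c.c0 z * (1 / y) ^ 2)
          + deriv (muCoeff c) z * (1 / y) + muCoeff c z * c.c3 z * (1 / y)
          - theta c z * (5 / 3 * c.c2 z * (1 / y) ^ 2 + 3 * c.c1 z * (1 / y) ^ 3
            + 7 * c.c0 z * (1 / y) ^ 4))
        + (-deriv c.c3 z - 4 / 3 * deriv c.c2 z * (1 / y) - 8 * theta c z * (1 / y) ^ 3)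
          * (c.H z x y / y ^ 2)
        + (deriv (theta c) z - 3 * theta c z * c.c3 z) * (x / y ^ 4)‖
        ≤ K * (1 + ‖Wcut c z x y‖) := by
  obtain ⟨B, hB⟩ := exists_coeffBound hP hc
  have p0 : ∀ z ∈ P, IsPolyNear z fun z i _ => -deriv c.c3 z * c.c0 z * i / 2
      - deriv c.c2 z / 3 * (c.c2 z / 3 + c.c1 z * i + 3 * c.c0 z * i ^ 2)
      + deriv (muCoeff c) z * i + muCoeff c z * c.c3 z * i
      - theta c z * (5 / 3 * c.c2 z * i ^ 2 + 3 * c.c1 z * i ^ 3 + 7 * c.c0 z * i ^ 4) := by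
    intro z hz
    have hμ := analyticAt_muCoeff (hc z hz)
    have hθ := analyticAt_theta (hc z hz)
    obtain ⟨h0, h1, h2, h3⟩ := hc z hz
    simp only [div_eq_mul_inv]
    repeat' first | assumption | fun_prop | constructor
  have p1 : ∀ z ∈ P, IsPolyNear z fun z i _ =>
      -deriv c.c3 z - 4 / 3 * deriv c.c2 z * i - 8 * theta c z * i ^ 3 := by
    intro z hz
    have hθ := analyticAt_theta (hc z hz)
    obtain ⟨h0, h1, h2, h3⟩ := hc z hz
    repeat' first | assumption | fun_prop | constructor
  have p2 : ∀ z ∈ P, IsPolyNear z fun z _ _ => deriv (theta c) z - 3 * theta c z * c.c3 z := by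
    intro z hz
    have hθ := analyticAt_theta (hc z hz)
    have h3 := (hc z hz).c3
    exact .coeff (by fun_prop)
  obtain ⟨K0, k0, b0⟩ := exists_bound_of_isPolyNear hP p0 1
  obtain ⟨K1, k1, b1⟩ := exists_bound_of_isPolyNear hP p1 1
  obtain ⟨K2, k2, b2⟩ := exists_bound_of_isPolyNear hP p2 1
  refine ⟨K0 + K1 * (2 + 40 * B ^ 2) + K2 * (9 + 184 * B ^ 2), by positivity,
    fun z hz x y hy => ?_⟩
  have hBz := hB z hz
  have hy0 : 0 < ‖y‖ := by linarith
  have hi : ‖1 / y‖ ≤ 1 := by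
    rw [norm_div, norm_one, div_le_one hy0]; exact hy
  have hH := norm_H_le (x := x) hBz (cutoff_nonneg ‖y‖) (cutoff_le_one ‖y‖) (Or.inr hy) hy le_rfl
  change ‖c.H z x y‖ ≤ 2 * ‖Wcut c z x y‖ + _ at hH
  have hx := norm_x_sq_le (x := x) hBz hy le_rfl
  have hH2 : ‖c.H z x y / y ^ 2‖ ≤ (2 + 40 * B ^ 2) * (1 + ‖Wcut c z x y‖) := by
    rw [norm_div, norm_pow, div_le_iff₀ (by positivity)]
    have h1 : 1 ≤ ‖y‖ ^ 2 := one_le_pow₀ hy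
    have h2 := mul_le_mul_of_nonneg_left h1 (norm_nonneg (Wcut c z x y))
    have h3 : 0 ≤ B ^ 2 * ‖y‖ ^ 2 * ‖Wcut c z x y‖ := by positivity
    nlinarith
  have hx4 : ‖x / y ^ 4‖ ≤ (9 + 184 * B ^ 2) * (1 + ‖Wcut c z x y‖) := by
    have h1 : ‖x / y ^ 4‖ ≤ 1 + ‖x / y ^ 4‖ ^ 2 := by nlinarith [sq_nonneg (‖x / y ^ 4‖ - 1)]
    have h2 : ‖x / y ^ 4‖ ^ 2 ≤ 8 * ‖Wcut c z x y‖ + 184 * B ^ 2 := by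
      rw [norm_div, norm_pow, div_pow, div_le_iff₀ (by positivity)]
      have g1 : 1 ≤ (‖y‖ ^ 4) ^ 2 := one_le_pow₀ (one_le_pow₀ hy)
      have g2 : ‖y‖ ^ 2 ≤ (‖y‖ ^ 4) ^ 2 := by
        rw [← pow_mul]; exact pow_le_pow_right₀ hy (by norm_num)
      have g3 : ‖y‖ ^ 6 ≤ (‖y‖ ^ 4) ^ 2 := by
        rw [← pow_mul]; exact pow_le_pow_right₀ hy (by norm_num)
      have g4 := mul_le_mul_of_nonneg_left g1 (norm_nonneg (Wcut c z x y))
      have g5 := mul_le_mul_of_nonneg_left g2 (sq_nonneg B)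
      have g6 := mul_le_mul_of_nonneg_left g3 (sq_nonneg B)
      nlinarith
    have h3 : 0 ≤ B ^ 2 * ‖Wcut c z x y‖ := by positivity
    nlinarith [norm_nonneg (Wcut c z x y)]
  have hW0 := norm_nonneg (Wcut c z x y)
  refine (norm_add₃_le).trans ?_
  rw [norm_mul, norm_mul]
  have t0 := b0 z hz (1 / y) 0 hi (by simp)
  have t1 := b1 z hz (1 / y) 0 hi (by simp)
  have t2 := b2 z hz (1 / y) 0 hi (by simp)
  refine (add_le_add_three t0 (mul_le_mul t1 hH2 (norm_nonneg _) k1)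
    (mul_le_mul t2 hx4 (norm_nonneg _) k2)).trans ?_
  nlinarith

/-- The cut-off modified Hamiltonian changes along solutions at a rate that is at most proportional
to its size. -/
theorem exists_rate {P : Set ℂ} (hP : IsCompact P) (hc : ∀ z ∈ P, c.AnalyticAt z)
    (h1 : ∀ z ∈ P, deriv c.c1 z = 0) (h3 : ∀ z ∈ P, deriv (deriv c.c3) z = 0) :
    ∃ K, 0 ≤ K ∧ ∀ z ∈ P, ∀ ξ η : ℂ → ℂ, HasDerivAt ξ (c.xdot z (ξ z) (η z)) z →
      HasDerivAt η (c.ydot z (ξ z) (η z)) z →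
      ∀ᶠ w in 𝓝 z, ‖Wcut c w (ξ w) (η w) - Wcut c z (ξ z) (η z)‖ ≤
        K * (1 + ‖Wcut c z (ξ z) (η z)‖) * ‖w - z‖ := by
  obtain ⟨B, hB⟩ := exists_coeffBound hP hc
  obtain ⟨K, hK, hKb⟩ := exists_modified_bound hP hc
  set L : ℝ := 300 * B ^ 2 * (10 + 1800 * B ^ 2) with hL
  refine ⟨2 * K + L + 3, by positivity, fun z hz ξ η hξ hη => ?_⟩
  have hBz := hB z hz
  have hB1 := hBz.one_le
  set f := Wcut c z (ξ z) (η z) with hf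
  have hf0 := norm_nonneg f
  have hH := hasDerivAt_H (hc z hz) hξ hη
  have hηc : Tendsto (fun w => ‖η w‖) (𝓝 z) (𝓝 ‖η z‖) := hη.continuousAt.norm.tendsto
  have hL0 : 0 ≤ L := by positivity
  -- For `|y| > 2` the correction is present in full; for `|y| ≤ 2` the size of `H` controls `x²`.
  rcases lt_or_ge 2 ‖η z‖ with hy | hy
  · have hy1 : 1 ≤ ‖η z‖ := by linarith
    have hy0 : η z ≠ 0 := by rw [← norm_pos_iff]; linarith
    have hW := hasDerivAt_modified (hc z hz) (h1 z hz) (h3 z hz) hξ hη hy0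
    have hb := hKb z hz (ξ z) (η z) hy1
    have he := eventually_norm_sub_le_of_hasDerivAt hW
      (L := (2 * K + L + 3) * (1 + ‖f‖)) (hb.trans_lt (by nlinarith))
    have hcut : ∀ w, 2 ≤ ‖η w‖ → Wcut c w (ξ w) (η w)
        = c.H w (ξ w) (η w) + corr c w (ξ w) (η w) := fun w hw => by
      rw [Wcut, cutoff_of_ge hw]; simp
    filter_upwards [he, hηc.eventually (lt_mem_nhds hy)] with w hw hwy
    rwa [← hcut w hwy.le, ← hcut z hy.le] at hw
  · have hX2 : (1 + ‖ξ z‖) ^ 2 ≤ (10 + 1800 * B ^ 2) * (1 + ‖f‖) * 2 := by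
      have g1 := norm_x_sq_le (x := ξ z) hBz one_le_two hy
      have g2 := norm_H_le (x := ξ z) hBz (cutoff_nonneg ‖η z‖) (cutoff_le_one ‖η z‖) (by
        rcases le_total ‖η z‖ 1 with h | h
        · exact Or.inl (cutoff_of_le h)
        · exact Or.inr h) one_le_two hy
      change ‖c.H z (ξ z) (η z)‖ ≤ 2 * ‖f‖ + _ at g2
      have g3 : 0 ≤ B ^ 2 * ‖f‖ := by positivity
      nlinarith [sq_nonneg (‖ξ z‖ - 1)]
    have hX0 := norm_nonneg (ξ z)
    have hHd := norm_Hdot_le (x := ξ z) hBz hy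
    rw [h1 z hz] at hH
    have hXle : 1 + ‖ξ z‖ ≤ (1 + ‖ξ z‖) ^ 2 := by nlinarith
    have hHf : 6 * B * (1 + ‖ξ z‖) ≤ L * (1 + ‖f‖) / 5 := by
      have g : 6 * B ≤ 6 * B ^ 2 := by nlinarith
      have g2 : 6 * B * (1 + ‖ξ z‖) ≤ 6 * B ^ 2 * (1 + ‖ξ z‖) ^ 2 := by gcongr
      refine g2.trans ?_
      have g3 : 6 * B ^ 2 * (1 + ‖ξ z‖) ^ 2
          ≤ 6 * B ^ 2 * ((10 + 1800 * B ^ 2) * (1 + ‖f‖) * 2) := by gcongr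
      refine g3.trans ?_
      rw [hL]
      have : 0 ≤ B ^ 2 * (10 + 1800 * B ^ 2) * (1 + ‖f‖) := by positivity
      linarith
    have heH := eventually_norm_sub_le_of_hasDerivAt hH
      (L := L * (1 + ‖f‖) / 5 + 1) (hHd.trans_lt (by linarith))
    rcases lt_or_ge ‖η z‖ 1 with hy1 | hy1
    · have hcut : ∀ w, ‖η w‖ ≤ 1 → Wcut c w (ξ w) (η w) = c.H w (ξ w) (η w) := fun w hw => by
        rw [Wcut, cutoff_of_le hw]; simp
      filter_upwards [heH, hηc.eventually (gt_mem_nhds hy1)] with w hw hwy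
      rw [← hcut w hwy.le, ← hcut z hy1.le] at hw
      refine hw.trans ?_
      gcongr
      nlinarith
    · have hy0 : η z ≠ 0 := by rw [← norm_pos_iff]; linarith
      have hW := hasDerivAt_modified (hc z hz) (h1 z hz) (h3 z hz) hξ hη hy0
      have hb := hKb z hz (ξ z) (η z) hy1
      have hR : HasDerivAt (fun w => corr c w (ξ w) (η w)) _ z :=
        (hW.fun_sub hH).congr_of_eventuallyEq (Eventually.of_forall fun w => by ring)
      have hRd := (norm_sub_le_of_le hb hHd).trans_lt
        (show K * (1 + ‖f‖) + 6 * B * (1 + ‖ξ z‖) < K * (1 + ‖f‖) + L * (1 + ‖f‖) / 5 + 1 by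
          linarith)
      have heR := eventually_norm_sub_le_of_hasDerivAt hR hRd
      have heη := eventually_norm_sub_le_of_hasDerivAt hη
        (L := 10 * B * (1 + ‖ξ z‖) + 1) ((norm_ydot_le hBz hy).trans_lt (by linarith))
      have hRc : ∀ᶠ w in 𝓝 z, ‖corr c w (ξ w) (η w)‖ < ‖corr c z (ξ z) (η z)‖ + 1 :=
        hR.continuousAt.norm.tendsto.eventually (gt_mem_nhds (lt_add_one _))
      have hRb : ‖corr c z (ξ z) (η z)‖ ≤ 4 * B * (1 + ‖ξ z‖) := by
        refine (norm_corr_le (x := ξ z) hBz hy1).trans ?_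
        have : ‖ξ z‖ / ‖η z‖ ≤ ‖ξ z‖ := div_le_self hX0 hy1
        nlinarith
      filter_upwards [heH, heR, heη, hRc] with w e1 e2 e3 e4
      have hdec : Wcut c w (ξ w) (η w) - f = (c.H w (ξ w) (η w) - c.H z (ξ z) (η z))
          + cutoff ‖η z‖ * (corr c w (ξ w) (η w) - corr c z (ξ z) (η z))
          + ((cutoff ‖η w‖ - cutoff ‖η z‖ : ℝ) : ℂ) * corr c w (ξ w) (η w) := by
        rw [hf, Wcut, Wcut]; push_cast; ring
      have n1 : ‖(cutoff ‖η z‖ : ℂ) * (corr c w (ξ w) (η w) - corr c z (ξ z) (η z))‖ ≤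
          (K * (1 + ‖f‖) + L * (1 + ‖f‖) / 5 + 1) * ‖w - z‖ := by
        rw [norm_mul, Complex.norm_real, Real.norm_of_nonneg (cutoff_nonneg _)]
        exact (mul_le_of_le_one_left (norm_nonneg _) (cutoff_le_one _)).trans e2
      have n2 : ‖((cutoff ‖η w‖ - cutoff ‖η z‖ : ℝ) : ℂ) * corr c w (ξ w) (η w)‖ ≤
          (10 * B * (1 + ‖ξ z‖) + 1) * ‖w - z‖ * (4 * B * (1 + ‖ξ z‖) + 1) := by
        rw [norm_mul, Complex.norm_real, Real.norm_eq_abs]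
        have g1 : |cutoff ‖η w‖ - cutoff ‖η z‖| ≤ (10 * B * (1 + ‖ξ z‖) + 1) * ‖w - z‖ :=
          (cutoff_sub_le _ _).trans ((abs_norm_sub_norm_le _ _).trans e3)
        exact mul_le_mul g1 (e4.le.trans (by linarith)) (norm_nonneg _) (by positivity)
      rw [hdec]
      refine (norm_add₃_le.trans (add_le_add_three e1 n1 n2)).trans ?_
      have n3 : (10 * B * (1 + ‖ξ z‖) + 1) * (4 * B * (1 + ‖ξ z‖) + 1) ≤ L * (1 + ‖f‖) / 2 := by
        have g1 : 1 ≤ B * (1 + ‖ξ z‖) := by nlinarith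
        have g2 : (10 * B * (1 + ‖ξ z‖) + 1) * (4 * B * (1 + ‖ξ z‖) + 1)
            ≤ 55 * B ^ 2 * (1 + ‖ξ z‖) ^ 2 := by
          nlinarith
        refine g2.trans ?_
        have g3 : 55 * B ^ 2 * (1 + ‖ξ z‖) ^ 2
            ≤ 55 * B ^ 2 * ((10 + 1800 * B ^ 2) * (1 + ‖f‖) * 2) := by gcongr
        refine g3.trans ?_
        rw [hL]
        have : 0 ≤ B ^ 2 * (10 + 1800 * B ^ 2) * (1 + ‖f‖) := by positivity
        linarith
      have n4 : 0 ≤ L * (1 + ‖f‖) := by positivity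
      have n5 : 0 ≤ K * (1 + ‖f‖) := by positivity
      calc _ = ((L * (1 + ‖f‖) / 5 + 1) + (K * (1 + ‖f‖) + L * (1 + ‖f‖) / 5 + 1)
            + (10 * B * (1 + ‖ξ z‖) + 1) * (4 * B * (1 + ‖ξ z‖) + 1)) * ‖w - z‖ := by ring
        _ ≤ (2 * K + L + 3) * (1 + ‖f‖) * ‖w - z‖ := by
          gcongr
          nlinarith

end Rate

/-! ### The modified Hamiltonian near the last curves -/

section Expansion

variable (c : Coeffs)

/-- The modified Hamiltonian. -/
noncomputable def modifiedH (z x y : ℂ) : ℂ := c.H z x y + corr c z x y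

/-- The polynomial `a₁ + a₂ V + a₃ V²` in `V = 1/y` that `x` has to approach in the second
cascade. -/
noncomputable def secondTail (z V : ℂ) : ℂ :=
  centre c 11 z + V * (centre c 12 z + V * centre c 13 z)

/-- The polynomial in `V = y²/x` that `x/y³` has to approach in the first cascade. -/
noncomputable def firstTail (z V : ℂ) : ℂ := cascTail (fun j => firstCentre c j z) 6 0 V

/-- The divided difference in `K` of the polynomial part of the expansion of the modified
Hamiltonian along the first cascade. -/
noncomputable def firstDiff (z K V : ℂ) : ℂ :=
  2 * c.c3 z * (K + firstTail c z V) + 2 / 3 * c.c2 z * V * (K + firstTail c z V)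
    - V ^ 2 * (deriv c.c3 z * ((K + firstTail c z V) * (K ^ 2 + firstTail c z V ^ 2))
      - c.c1 z * (K ^ 2 + K * firstTail c z V + firstTail c z V ^ 2))
    - V ^ 3 * (2 / 3 * deriv c.c2 z * (K ^ 4 + K ^ 3 * firstTail c z V
        + K ^ 2 * firstTail c z V ^ 2 + K * firstTail c z V ^ 3 + firstTail c z V ^ 4
        - (K + firstTail c z V) * (K ^ 2 + firstTail c z V ^ 2))
      - 2 * c.c0 z * ((K + firstTail c z V) * (K ^ 2 + firstTail c z V ^ 2)))
    - V ^ 5 * (2 * theta c z * (K ^ 6 + K ^ 5 * firstTail c z V + K ^ 4 * firstTail c z V ^ 2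
        + K ^ 3 * firstTail c z V ^ 3 + K ^ 2 * firstTail c z V ^ 4 + K * firstTail c z V ^ 5
        + firstTail c z V ^ 6)
      + 2 * muCoeff c z * (K ^ 5 + K ^ 4 * firstTail c z V + K ^ 3 * firstTail c z V ^ 2
        + K ^ 2 * firstTail c z V ^ 3 + K * firstTail c z V ^ 4 + firstTail c z V ^ 5))

/-- The remainder of the expansion of the modified Hamiltonian along the first cascade. -/
noncomputable def firstRem (z V : ℂ) : ℂ :=
  let s := 8 * c.c3 z + V * (8 / 3 * c.c2 z) + V ^ 2 * centre c 8 z + V ^ 3 * centre c 9 z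
  let S := 2 + V ^ 2 * s
  s * (deriv c.c3 z * ((S + 2) * (S ^ 2 + 4)) - c.c1 z * (S ^ 2 + 2 * S + 4))
    + V * s * (2 / 3 * deriv c.c2 z * (S ^ 4 + 2 * S ^ 3 + 4 * S ^ 2 + 8 * S + 16
        - (S + 2) * (S ^ 2 + 4)) - 2 * c.c0 z * ((S + 2) * (S ^ 2 + 4)))
    + V * (2 * theta c z * S ^ 7 + 2 * muCoeff c z * S ^ 6)
    - 8 * c.c3 z * (centre c 8 z + V * centre c 9 z) - 2 * c.c3 z * s ^ 2
    - 8 / 3 * c.c2 z * (8 / 3 * c.c2 z + V * centre c 8 z + V ^ 2 * centre c 9 z)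
    - 2 / 3 * c.c2 z * V * s ^ 2

variable {c} {z : ℂ}

theorem firstTail_eq (V : ℂ) : firstTail c z V = 2 + V ^ 2 * (8 * c.c3 z + V * (8 / 3 * c.c2 z)
    + V ^ 2 * centre c 8 z + V ^ 3 * centre c 9 z) :=
  (firstCascade_lift z V).1

/-- The expansion of the modified Hamiltonian along the second cascade. -/
theorem modifiedH_second {x V : ℂ} (hV : V ≠ 0) :
    V ^ 3 * modifiedH c z x (1 / V) =
      -((x - secondTail c z V) * (1 + V * (c.c3 z * V - deriv c.c3 z / 2 * V ^ 3
          - deriv c.c2 z / 3 * V ^ 4 - theta c z * V ^ 6) - x * V ^ 3 / 2))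
      - V ^ 3 * ((centre c 12 z + V * centre c 13 z) * c.c3 z - muCoeff c z * V
        - secondTail c z V * (deriv c.c3 z / 2 * V + deriv c.c2 z / 3 * V ^ 2 + theta c z * V ^ 4)
        - x / 2 * secondTail c z V) := by
  have h1 : centre c 11 z = -c.c2 z / 3 := rfl
  have h2 : centre c 12 z = -c.c1 z / 2 := rfl
  have h3 : centre c 13 z = 1 / 3 * (c.c2 z * c.c3 z - deriv c.c2 z - 3 * c.c0 z) := rfl
  rw [modifiedH, corr, Coeffs.H, secondTail, h1, h2, h3]
  field_simp
  ring

theorem firstRem_spec (V : ℂ) :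
    firstTail c z V - 2 - V ^ 2 * (2 * c.c3 z * firstTail c z V ^ 2
        + 2 / 3 * c.c2 z * firstTail c z V ^ 2 * V
        - (deriv c.c3 z * firstTail c z V ^ 4 - c.c1 z * firstTail c z V ^ 3) * V ^ 2
        - (2 / 3 * deriv c.c2 z * (firstTail c z V ^ 5 - firstTail c z V ^ 4)
          - 2 * c.c0 z * firstTail c z V ^ 4) * V ^ 3
        - V ^ 5 * (2 * theta c z * firstTail c z V ^ 7 + 2 * muCoeff c z * firstTail c z V ^ 6))
      = V ^ 6 * firstRem c z V := by
  have h8 : centre c 8 z = 8 * (c.c1 z + 8 * c.c3 z ^ 2 - 2 * deriv c.c3 z) := rfl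
  have h9 : centre c 9 z = 32 * (c.c0 z + 4 / 3 * c.c2 z * c.c3 z - 1 / 3 * deriv c.c2 z) := rfl
  simp only [firstTail_eq, firstRem]
  set s := 8 * c.c3 z + V * (8 / 3 * c.c2 z) + V ^ 2 * centre c 8 z + V ^ 3 * centre c 9 z with hs
  have e : s = 8 * c.c3 z + V * (8 / 3 * c.c2 z) + V ^ 2 * centre c 8 z + V ^ 3 * centre c 9 z := hs
  rw [h8, h9] at *
  clear_value s
  linear_combination (V ^ 2 - 8 * c.c3 z * V ^ 4 - 8 / 3 * c.c2 z * V ^ 5) * e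

/-- The expansion of the modified Hamiltonian along the first cascade. -/
theorem modifiedH_first {K V : ℂ} (hK : K ≠ 0) (hV : V ≠ 0) :
    2 * K ^ 5 * V ^ 6 * modifiedH c z (1 / (K ^ 2 * V ^ 3)) (1 / (K * V)) =
      (K - firstTail c z V) * (1 - V ^ 2 * firstDiff c z K V) + V ^ 6 * firstRem c z V := by
  have h1 : 2 * K ^ 5 * V ^ 6 * modifiedH c z (1 / (K ^ 2 * V ^ 3)) (1 / (K * V)) =
      K - 2 - V ^ 2 * (2 * c.c3 z * K ^ 2 + 2 / 3 * c.c2 z * K ^ 2 * V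
        - (deriv c.c3 z * K ^ 4 - c.c1 z * K ^ 3) * V ^ 2
        - (2 / 3 * deriv c.c2 z * (K ^ 5 - K ^ 4) - 2 * c.c0 z * K ^ 4) * V ^ 3
        - V ^ 5 * (2 * theta c z * K ^ 7 + 2 * muCoeff c z * K ^ 6)) := by
    rw [modifiedH, corr, Coeffs.H]
    field_simp
    ring
  rw [h1, ← firstRem_spec, firstDiff]
  ring

end Expansion

section ExpansionBounds

variable {c : Coeffs}

/-- Along the second cascade, the modified Hamiltonian is comparable with `(x - tail) y³`, up to
bounded terms. -/
theorem exists_modifiedH_second_bound {P : Set ℂ} (hP : IsCompact P)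
    (hc : ∀ z ∈ P, c.AnalyticAt z) :
    ∃ δ C : ℝ, 0 < δ ∧ δ ≤ 1 ∧ 0 ≤ C ∧ ∀ z ∈ P, ‖centre c 11 z‖ ≤ C ∧
      ∀ x V : ℂ, V ≠ 0 → ‖V‖ ≤ δ → ‖x * V ^ 3‖ ≤ δ →
      ‖secondTail c z V‖ ≤ C ∧
      ‖x - secondTail c z V‖ ≤ 4 * ‖V‖ ^ 3 * (‖modifiedH c z x (1 / V)‖ + C) ∧
      ‖V‖ ^ 3 * ‖modifiedH c z x (1 / V)‖ ≤ 4 * (‖x - secondTail c z V‖ + C * ‖V‖ ^ 3) := by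
  have p0 : ∀ z ∈ P, (IsPolyNear z fun z _ V => c.c3 z * V - deriv c.c3 z / 2 * V ^ 3
          - deriv c.c2 z / 3 * V ^ 4 - theta c z * V ^ 6) ∧
      (IsPolyNear z fun z _ V => secondTail c z V) ∧
      IsPolyNear z fun z _ V => (centre c 12 z + V * centre c 13 z) * c.c3 z - muCoeff c z * V
        - secondTail c z V
          * (deriv c.c3 z / 2 * V + deriv c.c2 z / 3 * V ^ 2 + theta c z * V ^ 4) := by
    intro z hz
    have hμ := analyticAt_muCoeff (hc z hz)
    have hθ := analyticAt_theta (hc z hz)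
    have hC := (hc z hz).centre
    obtain ⟨h0, h1, h2, h3⟩ := hc z hz
    simp only [div_eq_mul_inv, secondTail]
    refine ⟨?_, ?_, ?_⟩ <;>
    repeat' first | assumption | fun_prop | constructor
  obtain ⟨K0, k0, b0⟩ := exists_bound_of_isPolyNear hP (fun z hz => (p0 z hz).1) 1
  obtain ⟨K1, k1, b1⟩ := exists_bound_of_isPolyNear hP (fun z hz => (p0 z hz).2.1) 1
  obtain ⟨K2, k2, b2⟩ := exists_bound_of_isPolyNear hP (fun z hz => (p0 z hz).2.2) 1
  refine ⟨1 / (4 * (1 + K0 + K1)), K1 + K2 + K1 ^ 2, by positivity, ?_, by positivity,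
    fun z hz => ⟨?_, fun x V hV hVδ hx => ?_⟩⟩
  · rw [div_le_one (by positivity)]; linarith
  · have := b1 z hz 0 0 (by simp) (by simp)
    simp only [secondTail, zero_mul, add_zero] at this
    nlinarith
  have hδ1 : 1 / (4 * (1 + K0 + K1)) ≤ 1 := by rw [div_le_one (by positivity)]; linarith
  have hδ2 : 1 / (4 * (1 + K0 + K1)) * (1 + K0 + K1) = 1 / 4 := by field_simp
  set δ := 1 / (4 * (1 + K0 + K1)) with hδ
  have hδ0 : 0 < δ := by positivity
  have hV1 : ‖V‖ ≤ 1 := hVδ.trans hδ1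
  have hV0 : 0 < ‖V‖ := norm_pos_iff.2 hV
  have hid := modifiedH_second (c := c) (z := z) (x := x) hV
  set T := secondTail c z V with hT
  set W := modifiedH c z x (1 / V)
  set A := c.c3 z * V - deriv c.c3 z / 2 * V ^ 3 - deriv c.c2 z / 3 * V ^ 4 - theta c z * V ^ 6
  set R := (centre c 12 z + V * centre c 13 z) * c.c3 z - muCoeff c z * V
        - T * (deriv c.c3 z / 2 * V + deriv c.c2 z / 3 * V ^ 2 + theta c z * V ^ 4) with hR
  have hA : ‖A‖ ≤ K0 := b0 z hz 0 V (by simp) hV1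
  have hTb : ‖T‖ ≤ K1 := b1 z hz 0 V (by simp) hV1
  have hRb : ‖R‖ ≤ K2 := b2 z hz 0 V (by simp) hV1
  have hm : ‖V * A - x * V ^ 3 / 2‖ ≤ 1 / 4 := by
    have e1 : ‖V * A‖ ≤ δ * K0 := by rw [norm_mul]; gcongr
    have e2 : ‖x * V ^ 3 / 2‖ ≤ δ := by
      rw [norm_div, RCLike.norm_ofNat]
      linarith [norm_nonneg (x * V ^ 3)]
    refine (norm_sub_le_of_le e1 e2).trans ?_
    nlinarith
  have hVc : ‖V‖ ^ 3 * K1 ≤ 1 / 4 := by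
    have : ‖V‖ ^ 3 ≤ ‖V‖ := pow_le_of_le_one hV0.le hV1 (by norm_num)
    have : ‖V‖ ^ 3 * K1 ≤ δ * K1 := by gcongr; linarith
    nlinarith
  have hR' : ‖R - x / 2 * T‖ ≤ K2 + K1 ^ 2 + K1 / 2 * ‖x - T‖ := by
    have e1 : ‖x‖ ≤ ‖x - T‖ + K1 := by
      have := norm_add_le (x - T) T
      rw [sub_add_cancel] at this; linarith
    have e2 : ‖x / 2 * T‖ ≤ ‖x‖ / 2 * K1 := by
      rw [norm_mul, norm_div, RCLike.norm_ofNat]; gcongr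
    refine (norm_sub_le_of_le hRb e2).trans ?_
    nlinarith
  have hsplit : V ^ 3 * W + (x - T) = -((x - T) * (V * A - x * V ^ 3 / 2))
      - V ^ 3 * (R - x / 2 * T) := by
    rw [hid]; ring
  have hest : ‖V ^ 3 * W + (x - T)‖ ≤ ‖x - T‖ * (3 / 8) + ‖V‖ ^ 3 * (K2 + K1 ^ 2) := by
    rw [hsplit]
    have e1 : ‖-((x - T) * (V * A - x * V ^ 3 / 2))‖ ≤ ‖x - T‖ * (1 / 4) := by
      rw [norm_neg, norm_mul]; gcongr
    have e2 : ‖V ^ 3 * (R - x / 2 * T)‖ ≤ ‖V‖ ^ 3 * (K2 + K1 ^ 2 + K1 / 2 * ‖x - T‖) := by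
      rw [norm_mul, norm_pow]; gcongr
    refine (norm_sub_le_of_le e1 e2).trans ?_
    have := mul_le_mul_of_nonneg_right hVc (norm_nonneg (x - T))
    nlinarith
  have hVW : ‖V ^ 3 * W‖ = ‖V‖ ^ 3 * ‖W‖ := by rw [norm_mul, norm_pow]
  have hp : 0 ≤ ‖V‖ ^ 3 * (K2 + K1 ^ 2) := by positivity
  have hp1 : 0 ≤ ‖V‖ ^ 3 * K1 := by positivity
  refine ⟨by nlinarith, ?_, ?_⟩
  · have := norm_sub_le (V ^ 3 * W + (x - T)) (V ^ 3 * W)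
    rw [add_sub_cancel_left, hVW] at this
    have h4 : 0 ≤ ‖V‖ ^ 3 * ‖W‖ := by positivity
    nlinarith
  · have := norm_sub_le (V ^ 3 * W + (x - T)) (x - T)
    rw [add_sub_cancel_right, hVW] at this
    nlinarith [norm_nonneg (x - T)]

theorem firstRem_isPolyNear {z : ℂ} (hc : c.AnalyticAt z) :
    (IsPolyNear z fun z _ V => firstTail c z V) ∧ (IsPolyNear z fun z K V => firstDiff c z K V) ∧
      IsPolyNear z fun z _ V => firstRem c z V := by
  have hS : IsPolyNear z fun z _ V => firstTail c z V :=
    IsPolyNear.cascTail (a := firstCentre c) (fun j => hc.centre _) 6 0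
  have hμ := analyticAt_muCoeff hc
  have hθ := analyticAt_theta hc
  have hC := hc.centre
  obtain ⟨h0, h1, h2, h3⟩ := hc
  dsimp only [firstDiff, firstRem]
  refine ⟨hS, ?_, ?_⟩ <;> repeat' first | assumption | fun_prop | constructor

/-- Along the first cascade, with `K = x/y³` and `V = y²/x`, the modified Hamiltonian is comparable
with `(K - tail) / V⁶`, up to bounded terms. -/
theorem exists_modifiedH_first_bound {P : Set ℂ} (hP : IsCompact P)
    (hc : ∀ z ∈ P, c.AnalyticAt z) :
    ∃ δ C : ℝ, 0 < δ ∧ δ ≤ 1 ∧ 1 ≤ C ∧ ∀ z ∈ P, ∀ K V : ℂ, V ≠ 0 → ‖V‖ ≤ δ → ‖K - 2‖ ≤ 1 →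
      ‖firstTail c z V - 2‖ ≤ C * ‖V‖ ^ 2 ∧
      ‖K - firstTail c z V‖ ≤
        C * ‖V‖ ^ 6 * (‖modifiedH c z (1 / (K ^ 2 * V ^ 3)) (1 / (K * V))‖ + 1) ∧
      ‖V‖ ^ 6 * ‖modifiedH c z (1 / (K ^ 2 * V ^ 3)) (1 / (K * V))‖ ≤
        C * (‖K - firstTail c z V‖ + ‖V‖ ^ 6) := by
  obtain ⟨K0, k0, b0⟩ := exists_bound_of_isPolyNear hP
    (fun z hz => (firstRem_isPolyNear (hc z hz)).2.1) 3
  obtain ⟨K1, k1, b1⟩ := exists_bound_of_isPolyNear hP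
    (fun z hz => (firstRem_isPolyNear (hc z hz)).2.2) 3
  have hs : ∀ z ∈ P, IsPolyNear z fun z _ V =>
      8 * c.c3 z + V * (8 / 3 * c.c2 z) + V ^ 2 * centre c 8 z + V ^ 3 * centre c 9 z := by
    intro z hz
    have hC := (hc z hz).centre
    obtain ⟨h0, h1, h2, h3⟩ := hc z hz
    repeat' first | assumption | fun_prop | constructor
  obtain ⟨K2, k2, b2⟩ := exists_bound_of_isPolyNear hP hs 3
  refine ⟨1 / (2 * (1 + K0)), 1000 + 2 * K1 + K2, by positivity, ?_, by linarith,
    fun z hz K V hV hVδ hK => ?_⟩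
  · rw [div_le_one (by positivity)]; linarith
  have hδ1 : 1 / (2 * (1 + K0)) ≤ 1 := by rw [div_le_one (by positivity)]; linarith
  have hδ2 : 1 / (2 * (1 + K0)) * (1 + K0) = 1 / 2 := by field_simp
  set δ := 1 / (2 * (1 + K0)) with hδ
  have hδ0 : 0 < δ := by positivity
  have hV1 : ‖V‖ ≤ 1 := hVδ.trans hδ1
  have hV0 : 0 < ‖V‖ := norm_pos_iff.2 hV
  have hK3 : ‖K‖ ≤ 3 := by
    have := norm_add_le (K - 2) 2
    rw [sub_add_cancel, RCLike.norm_ofNat] at this; linarith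
  have hK1 : 1 ≤ ‖K‖ := by
    have := norm_sub_le (K - 2) K
    rw [sub_sub_cancel_left, norm_neg, RCLike.norm_ofNat] at this; linarith
  have hK0 : K ≠ 0 := norm_pos_iff.1 (by linarith)
  have hid := modifiedH_first (c := c) (z := z) hK0 hV
  set S := firstTail c z V with hS
  set W := modifiedH c z (1 / (K ^ 2 * V ^ 3)) (1 / (K * V))
  set D := firstDiff c z K V
  set B := firstRem c z V
  have hD : ‖D‖ ≤ K0 := b0 z hz K V hK3 (by linarith)
  have hB : ‖B‖ ≤ K1 := b1 z hz 0 V (by simp) (by linarith)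
  have hVD : ‖V ^ 2 * D‖ ≤ 1 / 2 := by
    rw [norm_mul, norm_pow]
    have : ‖V‖ ^ 2 ≤ ‖V‖ := pow_le_of_le_one hV0.le hV1 (by norm_num)
    have : ‖V‖ ^ 2 * ‖D‖ ≤ δ * K0 := by gcongr; linarith
    nlinarith
  have hn : ‖2 * K ^ 5 * V ^ 6 * W‖ = 2 * ‖K‖ ^ 5 * (‖V‖ ^ 6 * ‖W‖) := by
    simp only [norm_mul, norm_pow, RCLike.norm_ofNat]; ring
  have hp : 0 ≤ ‖V‖ ^ 6 * ‖W‖ := by positivity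
  have hK5 : ‖K‖ ^ 5 ≤ 3 ^ 5 := by gcongr
  have hK5' : 1 ≤ ‖K‖ ^ 5 := one_le_pow₀ hK1
  have hest : ‖2 * K ^ 5 * V ^ 6 * W - (K - S)‖ ≤ ‖K - S‖ / 2 + ‖V‖ ^ 6 * K1 := by
    have : 2 * K ^ 5 * V ^ 6 * W - (K - S) = -((K - S) * (V ^ 2 * D)) + V ^ 6 * B := by
      rw [hid]; ring
    rw [this]
    have e1 : ‖-((K - S) * (V ^ 2 * D))‖ ≤ ‖K - S‖ * (1 / 2) := by
      rw [norm_neg, norm_mul]; gcongr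
    have e2 : ‖V ^ 6 * B‖ ≤ ‖V‖ ^ 6 * K1 := by rw [norm_mul, norm_pow]; gcongr
    linarith [norm_add_le_of_le e1 e2]
  have hV6 : 0 < ‖V‖ ^ 6 := by positivity
  refine ⟨?_, ?_, ?_⟩
  · rw [hS, firstTail_eq, add_sub_cancel_left, norm_mul, norm_pow, mul_comm]
    have := b2 z hz 0 V (by simp) (by linarith)
    gcongr
    linarith
  · have h1 := norm_sub_le (2 * K ^ 5 * V ^ 6 * W) (2 * K ^ 5 * V ^ 6 * W - (K - S))
    rw [sub_sub_cancel, hn] at h1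
    have h2 : 2 * ‖K‖ ^ 5 * (‖V‖ ^ 6 * ‖W‖) ≤ 2 * 3 ^ 5 * (‖V‖ ^ 6 * ‖W‖) := by gcongr
    have h3 : ‖K - S‖ ≤ 972 * (‖V‖ ^ 6 * ‖W‖) + 2 * K1 * ‖V‖ ^ 6 := by linarith
    have h4 : 0 ≤ (28 + 2 * K1 + K2) * (‖V‖ ^ 6 * ‖W‖) := by positivity
    have h5 : 0 ≤ (1000 + K2) * ‖V‖ ^ 6 := by positivity
    linarith
  · have h1 := norm_add_le (2 * K ^ 5 * V ^ 6 * W - (K - S)) (K - S)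
    rw [sub_add_cancel, hn] at h1
    have h2 : 2 * 1 * (‖V‖ ^ 6 * ‖W‖) ≤ 2 * ‖K‖ ^ 5 * (‖V‖ ^ 6 * ‖W‖) := by gcongr
    have h3 : 0 ≤ (1000 + 3 / 2 * K1 + K2) * ‖V‖ ^ 6 := by positivity
    have h4 : 0 ≤ (999 + 1 / 4 + 2 * K1 + K2) * ‖K - S‖ := by positivity
    linarith

end ExpansionBounds

/-! ### The quasi-Painlevé property -/

section Trichotomy

variable {c : Coeffs} {U : Set ℂ} {γ : ℝ → ℂ} {x y : ℝ → ℂ}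

theorem Wcut_eq_modifiedH {z x y : ℂ} (hy : 2 ≤ ‖y‖) : Wcut c z x y = modifiedH c z x y := by
  rw [Wcut, cutoff_of_ge hy, modifiedH]; simp

/-- The modified Hamiltonian stays bounded along a path of finite length. -/
theorem exists_Wcut_bound (hγ : IsFinitePathIn U γ) (hxy : IsContinuedAlong c γ x y)
    (hc : ∀ z ∈ U, c.AnalyticAt z) (h1 : ∀ z ∈ U, deriv c.c1 z = 0)
    (h3 : ∀ z ∈ U, deriv (deriv c.c3) z = 0) :
    ∃ M, ∀ t ∈ Set.Ico (0 : ℝ) 1, ‖Wcut c (γ t) (x t) (y t)‖ ≤ M := by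
  have hP : IsCompact (γ '' Set.Icc 0 1) := isCompact_Icc.image_of_continuousOn hγ.1
  have hPU : ∀ z ∈ γ '' Set.Icc 0 1, z ∈ U := by rintro _ ⟨t, ht, rfl⟩; exact hγ.2.2 ht
  obtain ⟨K, hK, hrate⟩ := exists_rate hP (fun z hz => hc z (hPU z hz))
    (fun z hz => h1 z (hPU z hz)) (fun z hz => h3 z (hPU z hz))
  refine exists_bound_of_relative_rate hγ hK fun t ht => ?_
  obtain ⟨ξ, η, hsol, hev⟩ := hxy t ht
  have h0 := hev.self_of_nhdsWithin ht
  have hs := hsol.self_of_nhds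
  have hr := hrate (γ t) ⟨t, Set.Ico_subset_Icc_self ht, rfl⟩ ξ η hs.1 hs.2
  filter_upwards [hev, (hγ.continuousWithinAt (Set.Ico_subset_Icc_self ht)).eventually hr]
    with s e1 e2
  rw [e1.1, e1.2, h0.1, h0.2]
  exact e2

/-- A bound for `Wcut` confines `x/y³`, and forces it close to `0` or `2` for large `y`: the leading
term of `H` is `y⁶ k (k - 2) / 2` with `k = x/y³`. -/
theorem norm_ratio_le {z x y : ℂ} {B M : ℝ} (h : CoeffBound c z B) (hy : 1 ≤ ‖y‖)
    (hW : ‖Wcut c z x y‖ ≤ M) : ‖x / y ^ 3‖ ≤ 1 + 8 * M + 184 * B ^ 2 ∧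
      ‖x / y ^ 3 * (x / y ^ 3 - 2)‖ ≤
        (2 * (2 * M + 40 * B ^ 2) + 2 * (1 + 8 * M + 184 * B ^ 2) * B + 4 * B) * ‖1 / y‖ := by
  have hB := h.one_le
  have hM : 0 ≤ M := (norm_nonneg _).trans hW
  have hy0 : y ≠ 0 := norm_pos_iff.1 (by linarith)
  have hi : ‖1 / y‖ ≤ 1 := by
    rw [norm_div, norm_one, div_le_one (by linarith)]; exact hy
  have hi0 : 0 ≤ ‖1 / y‖ := norm_nonneg _
  have hiy : ‖1 / y‖ * ‖y‖ = 1 := by rw [← norm_mul, one_div_mul_cancel hy0, norm_one]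
  have hH := norm_H_le (x := x) h (cutoff_nonneg ‖y‖) (cutoff_le_one ‖y‖) (Or.inr hy) hy le_rfl
  change ‖c.H z x y‖ ≤ 2 * ‖Wcut c z x y‖ + _ at hH
  have hx := norm_x_sq_le (x := x) h hy le_rfl
  set i := 1 / y with hi_def
  have hyi : y * i = 1 := by rw [hi_def]; field_simp
  have hHi : ‖c.H z x y * i ^ 6‖ ≤ (2 * M + 40 * B ^ 2) * ‖i‖ := by
    rw [norm_mul, norm_pow]
    have e1 : ‖i‖ ^ 6 * ‖y‖ ^ 2 = ‖i‖ ^ 4 := by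
      calc ‖i‖ ^ 6 * ‖y‖ ^ 2 = ‖i‖ ^ 4 * (‖i‖ * ‖y‖) ^ 2 := by ring
        _ = ‖i‖ ^ 4 := by rw [hiy]; ring
    have e2 : ‖i‖ ^ 4 ≤ ‖i‖ := pow_le_of_le_one hi0 hi (by norm_num)
    have e3 : ‖i‖ ^ 6 ≤ ‖i‖ := pow_le_of_le_one hi0 hi (by norm_num)
    calc ‖c.H z x y‖ * ‖i‖ ^ 6 ≤ (2 * M + 40 * B ^ 2 * ‖y‖ ^ 2) * ‖i‖ ^ 6 := by
          gcongr; linarith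
      _ = 2 * M * ‖i‖ ^ 6 + 40 * B ^ 2 * (‖i‖ ^ 6 * ‖y‖ ^ 2) := by ring
      _ ≤ 2 * M * ‖i‖ + 40 * B ^ 2 * ‖i‖ := by rw [e1]; gcongr
      _ = _ := by ring
  have hxi : x / y ^ 3 = x * i ^ 3 := by rw [hi_def]; field_simp
  obtain ⟨k, hk⟩ : ∃ k, k = x * i ^ 3 := ⟨_, rfl⟩
  rw [hxi, ← hk]
  have hk2 : ‖k‖ ^ 2 ≤ 8 * M + 184 * B ^ 2 := by
    have e0 : ‖i‖ ^ 6 * ‖y‖ ^ 6 = 1 := by rw [← mul_pow, hiy, one_pow]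
    have e1 : ‖k‖ ^ 2 = ‖x‖ ^ 2 * ‖i‖ ^ 6 := by rw [hk, norm_mul, norm_pow]; ring
    have e2 : ‖c.H z x y‖ * ‖i‖ ^ 6 ≤ 2 * M + 40 * B ^ 2 := by
      rw [norm_mul, norm_pow] at hHi
      exact hHi.trans (mul_le_of_le_one_right (by positivity) hi)
    rw [e1]
    have e3 := mul_le_mul_of_nonneg_right hx (show 0 ≤ ‖i‖ ^ 6 by positivity)
    calc _ ≤ _ := e3
      _ = 4 * (‖c.H z x y‖ * ‖i‖ ^ 6) + 24 * B ^ 2 * (‖i‖ ^ 6 * ‖y‖ ^ 6) := by ring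
      _ ≤ 4 * (2 * M + 40 * B ^ 2) + 24 * B ^ 2 * 1 := by rw [e0]; gcongr
      _ = _ := by ring
  have hkb : ‖k‖ ≤ 1 + 8 * M + 184 * B ^ 2 := by nlinarith [sq_nonneg (‖k‖ - 1)]
  refine ⟨hkb, ?_⟩
  have hdec : k * (k - 2) = 2 * (c.H z x y * i ^ 6) + 2 * k * (c.c3 z * i ^ 2)
      + (2 / 3 * c.c2 z * i ^ 3 + c.c1 z * i ^ 4 + 2 * c.c0 z * i ^ 5) := by
    rw [hk, Coeffs.H]
    have hxe : y = 1 / i := by rw [hi_def]; field_simp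
    have hi0 : i ≠ 0 := by rw [hi_def]; exact one_div_ne_zero hy0
    rw [hxe]
    field_simp
    ring
  have hp : ∀ n : ℕ, n ≠ 0 → ‖i‖ ^ n ≤ ‖i‖ := fun n hn => pow_le_of_le_one hi0 hi hn
  have n1 : ‖2 * (c.H z x y * i ^ 6)‖ ≤ 2 * ((2 * M + 40 * B ^ 2) * ‖i‖) := by
    rw [norm_mul, RCLike.norm_ofNat]; gcongr
  have n2 : ‖2 * k * (c.c3 z * i ^ 2)‖ ≤ 2 * (1 + 8 * M + 184 * B ^ 2) * (B * ‖i‖) := by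
    rw [norm_mul, norm_mul, norm_mul, RCLike.norm_ofNat, norm_pow]
    gcongr
    exacts [h.c3, hp 2 (by norm_num)]
  have n3 : ‖2 / 3 * c.c2 z * i ^ 3 + c.c1 z * i ^ 4 + 2 * c.c0 z * i ^ 5‖ ≤
      2 / 3 * B * ‖i‖ + B * ‖i‖ + 2 * B * ‖i‖ := by
    refine (norm_add₃_le).trans ?_
    simp only [norm_mul, norm_pow, norm_div, RCLike.norm_ofNat]
    gcongr
    exacts [h.c2, hp 3 (by norm_num), h.c1, hp 4 (by norm_num), h.c0, hp 5 (by norm_num)]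
  rw [hdec]
  refine (norm_add₃_le.trans (add_le_add_three n1 n2 n3)).trans ?_
  have : 0 ≤ B * ‖i‖ := by positivity
  nlinarith

theorem exists_hasLimitPoint {C : Chart} {t : ℕ → ℝ} (ht : ∀ n, t n ∈ Set.Ico (0 : ℝ) 1)
    (ht1 : Tendsto t atTop (𝓝 1)) {u v : ℕ → ℂ} {M : ℝ}
    (hover : ∀ᶠ n in atTop, IsOver C (γ (t n)) (u n) (v n) (x (t n)) (y (t n)))
    (hu : ∀ᶠ n in atTop, ‖u n‖ ≤ M) (hv : Tendsto v atTop (𝓝 0)) :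
    ∃ h, HasLimitPoint C γ x y h 0 := by
  obtain ⟨N, hN⟩ := eventually_atTop.1 (hover.and hu)
  obtain ⟨h, -, φ, hφ, hh⟩ := tendsto_subseq_of_bounded (Metric.isBounded_closedBall (x := (0 : ℂ))
    (r := M)) (x := fun n => u (n + N)) fun n => by simpa using (hN _ (Nat.le_add_left N n)).2
  have hφN : Tendsto (fun n => φ n + N) atTop atTop := (tendsto_add_atTop_nat N).comp hφ.tendsto_atTop
  exact ⟨h, fun n => t (φ n + N), fun n => u (φ n + N), fun n => v (φ n + N), fun n => ht _,
    ht1.comp hφN, fun n => (hN _ (Nat.le_add_left N _)).1, hh, hv.comp hφN⟩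

theorem isOver_thirteen {z U V x y : ℂ} : IsOver (upperChart c 13) z U V x y ↔
    V ≠ 0 ∧ x * V = cascLift (fun j => secondCentre c j z) 4 U V ∧ y * V = 1 := by
  obtain ⟨e0, e1, e2⟩ := casc_T (chartU0 c) (secondCentre c) 4 z U V
  rw [IsOver, upperChart_thirteen, e0, e1, e2]
  rfl

theorem isOver_nine {z U V x y : ℂ} : IsOver (upperChart c 9) z U V x y ↔
    cascLift (fun j => firstCentre c j z) 6 U V ^ 2 * V ^ 3 ≠ 0 ∧
      x * (cascLift (fun j => firstCentre c j z) 6 U V ^ 2 * V ^ 3) = 1 ∧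
      y * (cascLift (fun j => firstCentre c j z) 6 U V ^ 2 * V ^ 3) =
        cascLift (fun j => firstCentre c j z) 6 U V * V ^ 2 := by
  obtain ⟨e0, e1, e2⟩ := casc_T (upperChart c 3) (firstCentre c) 6 z U V
  obtain ⟨f0, f1, f2⟩ := upperChart_three_T (c := c) z
    (cascLift (fun j => firstCentre c j z) 6 U V) V
  rw [IsOver, upperChart_nine, e0, e1, e2, f0, f1, f2]

theorem secondTail_eq (z V : ℂ) :
    cascTail (fun j => secondCentre c j z) 4 0 V = V * secondTail c z V := by
  have h0 : secondCentre c 0 z = 0 := rfl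
  have h1 : secondCentre c 1 z = centre c 11 z := rfl
  have h2 : secondCentre c 2 z = centre c 12 z := rfl
  have h3 : secondCentre c 3 z = centre c 13 z := rfl
  simp only [cascTail, secondTail, h0, h1, h2, h3]
  ring

/-- At the end of a path of finite length, a solution is analytic or reaches one of the two last
exceptional curves. -/
theorem endsRegular_or_endsOnCurve_nine_or_thirteen (hγ : IsFinitePathIn U γ)
    (hxy : IsContinuedAlong c γ x y) (hU : IsOpen U) (hc : ∀ z ∈ U, c.AnalyticAt z)
    (h1 : ∀ z ∈ U, deriv c.c1 z = 0) (h3 : ∀ z ∈ U, deriv (deriv c.c3) z = 0) :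
    EndsRegular c γ x y ∨ EndsOnCurve c (upperChart c 9) (4 / -1) γ x y ∨
      EndsOnCurve c (upperChart c 13) (1 / 1) γ x y := by
  have hz1 : γ 1 ∈ U := hγ.2.2 (by simp)
  have hev : ∀ᶠ z in 𝓝 (γ 1), z ∈ U := hU.mem_nhds hz1
  have hcev : ∀ᶠ z in 𝓝 (γ 1), c.AnalyticAt z := hev.mono fun z hz => hc z hz
  obtain ⟨M, hM⟩ := exists_Wcut_bound hγ hxy hc h1 h3
  have hP : IsCompact (γ '' Set.Icc 0 1) := isCompact_Icc.image_of_continuousOn hγ.1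
  have hPc : ∀ z ∈ γ '' Set.Icc 0 1, c.AnalyticAt z := by
    rintro _ ⟨t, ht, rfl⟩; exact hc _ (hγ.2.2 ht)
  have hmem : ∀ t ∈ Set.Ico (0 : ℝ) 1, γ t ∈ γ '' Set.Icc 0 1 := fun t ht =>
    ⟨t, Set.Ico_subset_Icc_self ht, rfl⟩
  obtain ⟨B, hB⟩ := exists_coeffBound hP hPc
  set t : ℕ → ℝ := fun n => 1 - 1 / ((n : ℝ) + 1) with ht_def
  have ht : ∀ n, t n ∈ Set.Ico (0 : ℝ) 1 := by
    intro n
    have h0 : (0 : ℝ) < 1 / ((n : ℝ) + 1) := by positivity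
    have h1 : 1 / ((n : ℝ) + 1) ≤ 1 := by
      rw [div_le_one (by positivity)]; linarith [(Nat.cast_nonneg n : (0 : ℝ) ≤ n)]
    exact ⟨by simp only [ht_def]; linarith, by simp only [ht_def]; linarith⟩
  have ht1 : Tendsto t atTop (𝓝 1) := by
    simpa [ht_def] using tendsto_const_nhds.sub (tendsto_one_div_add_atTop_nhds_zero_nat (𝕜 := ℝ))
  have hM0 : 0 ≤ M := (norm_nonneg _).trans (hM _ (ht 0))
  -- If `y → ∞`, a limit `k` of `x/y³` is `0` or `2`; otherwise a subsequence of `(x, y)` converges.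
  by_cases hY : Tendsto (fun n => ‖y (t n)‖) atTop atTop
  · have hi : Tendsto (fun n => 1 / y (t n)) atTop (𝓝 0) := by
      rw [tendsto_zero_iff_norm_tendsto_zero]
      simpa [Function.comp_def] using tendsto_inv_atTop_zero.comp hY
    have hY2 : ∀ᶠ n in atTop, 2 ≤ ‖y (t n)‖ := hY.eventually_ge_atTop 2
    have hB' : ∀ n, CoeffBound c (γ (t n)) B := fun n => hB _ (hmem _ (ht n))
    set R := 1 + 8 * M + 184 * B ^ 2
    set R' := 2 * (2 * M + 40 * B ^ 2) + 2 * R * B + 4 * B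
    have hk : ∀ᶠ n in atTop, ‖x (t n) / y (t n) ^ 3‖ ≤ R ∧
        ‖x (t n) / y (t n) ^ 3 * (x (t n) / y (t n) ^ 3 - 2)‖ ≤ R' * ‖1 / y (t n)‖ := by
      filter_upwards [hY2] with n hn
      exact norm_ratio_le (hB' n) (by linarith) (hM _ (ht n))
    obtain ⟨N, hN⟩ := eventually_atTop.1 hk
    obtain ⟨k, -, φ, hφ, hkφ⟩ := tendsto_subseq_of_bounded (Metric.isBounded_closedBall
      (x := (0 : ℂ)) (r := R)) (x := fun n => x (t (n + N)) / y (t (n + N)) ^ 3) fun n => by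
        simpa using (hN _ (Nat.le_add_left N n)).1
    set ψ : ℕ → ℕ := fun n => φ n + N with hψ
    have hψt : Tendsto ψ atTop atTop := (tendsto_add_atTop_nat N).comp hφ.tendsto_atTop
    replace hkφ : Tendsto (fun n => x (t (ψ n)) / y (t (ψ n)) ^ 3) atTop (𝓝 k) := hkφ
    have hiψ := hi.comp hψt
    have hlim0 : Tendsto (fun n => x (t (ψ n)) / y (t (ψ n)) ^ 3
        * (x (t (ψ n)) / y (t (ψ n)) ^ 3 - 2)) atTop (𝓝 0) := by
      refine squeeze_zero_norm (fun n => (hN _ (Nat.le_add_left N _)).2) ?_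
      simpa using hiψ.norm.const_mul R'
    have hk2 : k * (k - 2) = 0 :=
      tendsto_nhds_unique (hkφ.mul (hkφ.sub_const 2)) hlim0
    have htψ : ∀ n, t (ψ n) ∈ Set.Ico (0 : ℝ) 1 := fun n => ht _
    have htψ1 := ht1.comp hψt
    have hYψ := hψt.eventually hY2
    rcases mul_eq_zero.1 hk2 with hk0 | hk0
    -- For `k = 0` the coordinate `U₁₃` is bounded.
    · have hlim : ∃ h, HasLimitPoint (upperChart c 13) γ x y h 0 := by
        obtain ⟨δ, C, hδ, -, hC, hb⟩ := exists_modifiedH_second_bound hP hPc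
        refine exists_hasLimitPoint (t := t ∘ ψ) htψ htψ1 (v := fun n => 1 / y (t (ψ n)))
          (u := fun n => (x (t (ψ n)) - secondTail c (γ (t (ψ n))) (1 / y (t (ψ n))))
            / (1 / y (t (ψ n))) ^ 3) (M := 4 * (M + C)) ?_ ?_ hiψ
        · filter_upwards [hYψ] with n hn
          have hy0 : y (t (ψ n)) ≠ 0 := norm_pos_iff.1 (by linarith)
          simp only [Function.comp_apply]
          rw [isOver_thirteen, cascLift_eq, secondTail_eq]
          refine ⟨one_div_ne_zero hy0, ?_, mul_one_div_cancel hy0⟩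
          field_simp
          ring
        · have e1 : ∀ᶠ n in atTop, ‖1 / y (t (ψ n))‖ < δ := by
            have := hiψ.norm.eventually (gt_mem_nhds (show ‖(0 : ℂ)‖ < δ by simpa))
            exact this
          have e2 : ∀ᶠ n in atTop, ‖x (t (ψ n)) / y (t (ψ n)) ^ 3‖ < δ :=
            hkφ.norm.eventually (gt_mem_nhds (by rw [hk0]; simpa))
          filter_upwards [hYψ, e1, e2] with n hn a1 a2
          have hy0 : y (t (ψ n)) ≠ 0 := norm_pos_iff.1 (by linarith)
          have hi0 := one_div_ne_zero hy0
          have := (hb _ (hmem _ (htψ n))).2 (x (t (ψ n))) (1 / y (t (ψ n))) hi0 a1.le (by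
            rw [one_div, inv_pow, ← div_eq_mul_inv]; exact a2.le)
          have h2 := this.2.1
          rw [one_div_one_div, ← Wcut_eq_modifiedH hn] at h2
          rw [norm_div, norm_pow, div_le_iff₀ (pow_pos (norm_pos_iff.2 hi0) 3)]
          refine h2.trans ?_
          have := hM _ (htψ n)
          calc _ ≤ 4 * ‖1 / y (t (ψ n))‖ ^ 3 * (M + C) := by gcongr
            _ = _ := by ring
      obtain ⟨h, hlim⟩ := hlim
      obtain ⟨q, N, D, hF⟩ := exists_isFinalChart_thirteen hcev
      have hκ : ∀ᶠ z in 𝓝 (γ 1), secondE c z 0 = 0 := by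
        filter_upwards [hev] with z hz
        rw [secondE_zero, h1 z hz, mul_zero]
      have := endsRegular_or_endsOnCurve hγ hxy hc hU (isPolarChart_thirteen hc) hF hκ hlim
      tauto
    -- For `k = 2` the coordinate `U₉` is bounded.
    · have hk2 : k = 2 := sub_eq_zero.1 hk0
      have hlim : ∃ h, HasLimitPoint (upperChart c 9) γ x y h 0 := by
        obtain ⟨δ, C, hδ, -, hC, hb⟩ := exists_modifiedH_first_bound hP hPc
        have hne : ∀ᶠ n in atTop, x (t (ψ n)) / y (t (ψ n)) ^ 3 ≠ 0 :=
          hkφ.eventually_ne (by rw [hk2]; norm_num)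
        have hV : Tendsto (fun n => 1 / (x (t (ψ n)) / y (t (ψ n)) ^ 3) * (1 / y (t (ψ n)))) atTop
            (𝓝 0) := by
          have := (hkφ.inv₀ (by rw [hk2]; norm_num)).mul hiψ
          simpa using this
        refine exists_hasLimitPoint (t := t ∘ ψ) htψ htψ1
          (v := fun n => 1 / (x (t (ψ n)) / y (t (ψ n)) ^ 3) * (1 / y (t (ψ n))))
          (u := fun n => (x (t (ψ n)) / y (t (ψ n)) ^ 3 - firstTail c (γ (t (ψ n)))
            (1 / (x (t (ψ n)) / y (t (ψ n)) ^ 3) * (1 / y (t (ψ n)))))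
            / (1 / (x (t (ψ n)) / y (t (ψ n)) ^ 3) * (1 / y (t (ψ n)))) ^ 6)
          (M := C * (M + 1)) ?_ ?_ hV
        · filter_upwards [hYψ, hne] with n hn hk0
          have hy0 : y (t (ψ n)) ≠ 0 := norm_pos_iff.1 (by linarith)
          simp only [Function.comp_apply]
          set K := x (t (ψ n)) / y (t (ψ n)) ^ 3 with hK
          have hV0 : 1 / K * (1 / y (t (ψ n))) ≠ 0 :=
            mul_ne_zero (one_div_ne_zero hk0) (one_div_ne_zero hy0)
          have hL : cascLift (fun j => firstCentre c j (γ (t (ψ n)))) 6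
              ((K - firstTail c (γ (t (ψ n))) (1 / K * (1 / y (t (ψ n)))))
                / (1 / K * (1 / y (t (ψ n)))) ^ 6) (1 / K * (1 / y (t (ψ n)))) = K := by
            rw [cascLift_eq, mul_div_cancel₀ _ (pow_ne_zero 6 hV0), firstTail]
            ring
          rw [isOver_nine, hL]
          have hx : x (t (ψ n)) = K * y (t (ψ n)) ^ 3 := by rw [hK]; field_simp
          refine ⟨mul_ne_zero (pow_ne_zero 2 hk0) (pow_ne_zero 3 hV0), ?_, ?_⟩
          · rw [hx]; field_simp
          · field_simp
        · have e1 : ∀ᶠ n in atTop, ‖1 / (x (t (ψ n)) / y (t (ψ n)) ^ 3) * (1 / y (t (ψ n)))‖ < δ :=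
            hV.norm.eventually (gt_mem_nhds (by simpa))
          have e2 : ∀ᶠ n in atTop, ‖x (t (ψ n)) / y (t (ψ n)) ^ 3 - 2‖ < 1 :=
            (hkφ.sub_const 2).norm.eventually (gt_mem_nhds (by rw [hk2]; simp))
          filter_upwards [hYψ, e1, e2, hne] with n hn a1 a2 hk0
          have hy0 : y (t (ψ n)) ≠ 0 := norm_pos_iff.1 (by linarith)
          set K := x (t (ψ n)) / y (t (ψ n)) ^ 3 with hK
          have hV0 : 1 / K * (1 / y (t (ψ n))) ≠ 0 :=
            mul_ne_zero (one_div_ne_zero hk0) (one_div_ne_zero hy0)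
          have h2 := (hb _ (hmem _ (htψ n)) K _ hV0 a1.le a2.le).2.1
          have hx : 1 / (K ^ 2 * (1 / K * (1 / y (t (ψ n)))) ^ 3) = x (t (ψ n)) := by
            have : x (t (ψ n)) = K * y (t (ψ n)) ^ 3 := by rw [hK]; field_simp
            rw [this]; field_simp
          have hy : 1 / (K * (1 / K * (1 / y (t (ψ n))))) = y (t (ψ n)) := by field_simp
          rw [hx, hy, ← Wcut_eq_modifiedH hn] at h2
          rw [norm_div, norm_pow, div_le_iff₀ (pow_pos (norm_pos_iff.2 hV0) 6)]
          refine h2.trans ?_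
          have := hM _ (htψ n)
          calc _ ≤ C * ‖1 / K * (1 / y (t (ψ n)))‖ ^ 6 * (M + 1) := by gcongr
            _ = _ := by ring
      obtain ⟨h, hlim⟩ := hlim
      obtain ⟨q, N, D, hF⟩ := exists_isFinalChart_nine hcev
      have hκ : ∀ᶠ z in 𝓝 (γ 1), firstE c z 0 = 0 := by
        filter_upwards [hev] with z hz
        rw [firstE_zero (hc z hz), h1 z hz, h3 z hz]; ring
      have := endsRegular_or_endsOnCurve hγ hxy hc hU (isPolarChart_nine hc) hF hκ hlim
      tauto
  · left
    rw [tendsto_atTop] at hY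
    push Not at hY
    obtain ⟨b, hb⟩ := hY
    obtain ⟨φ, hφ, hφb⟩ := extraction_of_frequently_atTop hb
    set w := max 1 b
    have hw : 1 ≤ w := le_max_left _ _
    set R := 4 * (2 * M + 40 * B ^ 2 * w ^ 2) + 24 * B ^ 2 * w ^ 6
    have hR : 0 ≤ R := by positivity
    have hbd : ∀ n, (x (t (φ n)), y (t (φ n))) ∈ Metric.closedBall (0 : ℂ × ℂ) (R + 1 + w) := by
      intro n
      have hy : ‖y (t (φ n))‖ ≤ w := (hφb n).le.trans (le_max_right _ _)
      have g1 := norm_x_sq_le (x := x (t (φ n))) (hB _ (hmem _ (ht (φ n)))) hw hy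
      have g2 := norm_H_le (x := x (t (φ n))) (hB _ (hmem _ (ht (φ n))))
        (cutoff_nonneg ‖y (t (φ n))‖) (cutoff_le_one ‖y (t (φ n))‖) (by
          rcases le_total ‖y (t (φ n))‖ 1 with h | h
          · exact Or.inl (cutoff_of_le h)
          · exact Or.inr h) hw hy
      change _ ≤ 2 * ‖Wcut c (γ (t (φ n))) (x (t (φ n))) (y (t (φ n)))‖ + _ at g2
      have g3 := hM _ (ht (φ n))
      have g4 : ‖x (t (φ n))‖ ^ 2 ≤ R := g1.trans (by simp only [R]; linarith)
      rw [mem_closedBall_zero_iff, Prod.norm_def, max_le_iff]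
      refine ⟨?_, by simp only; linarith⟩
      simp only
      nlinarith [sq_nonneg (‖x (t (φ n))‖ - 1)]
    obtain ⟨p, -, φ', hφ', hp⟩ := tendsto_subseq_of_bounded Metric.isBounded_closedBall hbd
    have hp1 : Tendsto (fun n => x (t (φ (φ' n)))) atTop (𝓝 p.1) :=
      (continuous_fst.tendsto p).comp hp
    have hp2 : Tendsto (fun n => y (t (φ (φ' n)))) atTop (𝓝 p.2) :=
      (continuous_snd.tendsto p).comp hp
    exact endsRegular_of_limit (t := fun n => t (φ (φ' n))) hγ hxy hc (fun n => ht _)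
      (ht1.comp (hφ.tendsto_atTop.comp hφ'.tendsto_atTop)) hp1 hp2

theorem quasiPainleve (hU : IsOpen U) (hc : ∀ z ∈ U, c.AnalyticAt z)
    (h1 : ∀ z ∈ U, deriv c.c1 z = 0) (h3 : ∀ z ∈ U, deriv (deriv c.c3) z = 0) :
    QuasiPainleve c U := by
  intro γ x y hγ hxy
  have hz1 : γ 1 ∈ U := hγ.2.2 (by simp)
  rcases endsRegular_or_endsOnCurve_nine_or_thirteen hγ hxy hU hc h1 h3 with h | h | h
  · exact .inl h
  · exact .inr (h.endsSqrtPole_nine hc hz1)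
  · exact .inr (h.endsSqrtPole_thirteen hc hz1)

end Trichotomy

/-! ### Inaccessible curves -/

section Ends

variable {c : Coeffs} {U : Set ℂ} {γ : ℝ → ℂ} {x y : ℝ → ℂ}

theorem false_of_mul_eq_one {f g : ℕ → ℂ} {a : ℂ} (hf : Tendsto f atTop (𝓝 a))
    (hg : Tendsto g atTop (𝓝 0)) (h : ∀ᶠ n in atTop, f n * g n = 1) : False := by
  have h1 := hf.mul hg
  rw [mul_zero] at h1
  exact zero_ne_one (tendsto_nhds_unique h1 (tendsto_const_nhds.congr' (h.mono fun n hn => hn.symm)))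

/-- The sequence `(x, y)`, at `z`, reaches the last exceptional curve of the first cascade. -/
def TendsToNine (c : Coeffs) (z x y : ℕ → ℂ) : Prop :=
  ∃ (h : ℂ) (u v k : ℕ → ℂ), Tendsto u atTop (𝓝 h) ∧ Tendsto v atTop (𝓝 0) ∧
    Tendsto k atTop (𝓝 2) ∧ ∀ᶠ n in atTop, v n ≠ 0 ∧ k n ≠ 0 ∧
      k n = cascLift (fun j => firstCentre c j (z n)) 6 (u n) (v n) ∧
      x n * (k n ^ 2 * v n ^ 3) = 1 ∧ y n * (k n * v n) = 1

/-- The sequence `(x, y)`, at `z`, reaches the last exceptional curve of the second cascade. -/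
def TendsToThirteen (c : Coeffs) (z x y : ℕ → ℂ) : Prop :=
  ∃ (h x₁ : ℂ) (u v : ℕ → ℂ), Tendsto u atTop (𝓝 h) ∧ Tendsto v atTop (𝓝 0) ∧
    Tendsto x atTop (𝓝 x₁) ∧ ∀ᶠ n in atTop, v n ≠ 0 ∧
      x n * v n = cascLift (fun j => secondCentre c j (z n)) 4 (u n) (v n) ∧ y n * v n = 1

theorem tendsto_cascTail {ι : Type*} {l : Filter ι} {a : ℕ → ℂ → ℂ} {z₀ : ℂ}
    (ha : ∀ j, AnalyticAt ℂ (a j) z₀) (j m : ℕ) {z v : ι → ℂ} (hz : Tendsto z l (𝓝 z₀))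
    (hv : Tendsto v l (𝓝 0)) :
    Tendsto (fun n => cascTail (fun j => a j (z n)) (j + 1) m (v n)) l (𝓝 (a m z₀)) := by
  have h := ((IsPolyNear.cascTail ha (j + 1) m).analyticAt 0 0).continuousAt.tendsto.comp
    (hz.prodMk_nhds ((tendsto_const_nhds (x := (0 : ℂ))).prodMk_nhds hv))
  simp only [cascTail, zero_mul, add_zero] at h ⊢
  exact h

theorem tendsto_cascLift {a : ℕ → ℂ → ℂ} {z₀ : ℂ} (ha : ∀ j, AnalyticAt ℂ (a j) z₀) (m : ℕ)
    {z u v : ℕ → ℂ} {h : ℂ} (hz : Tendsto z atTop (𝓝 z₀)) (hu : Tendsto u atTop (𝓝 h))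
    (hv : Tendsto v atTop (𝓝 0)) :
    Tendsto (fun n => cascLift (fun j => a j (z n)) m (u n) (v n)) atTop
      (𝓝 (cascLift (fun j => a j z₀) m h 0)) :=
  ((IsPolyNear.cascLift ha m).analyticAt h 0).continuousAt.tendsto.comp
    (hz.prodMk_nhds (hu.prodMk_nhds hv))

/-- The limits of a solution at the end of a path. -/
theorem limit_cases (hγ : IsFinitePathIn U γ) (hxy : IsContinuedAlong c γ x y) (hU : IsOpen U)
    (hc : ∀ z ∈ U, c.AnalyticAt z) (h1 : ∀ z ∈ U, deriv c.c1 z = 0)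
    (h3 : ∀ z ∈ U, deriv (deriv c.c3) z = 0) {t : ℕ → ℝ} (ht : ∀ n, t n ∈ Set.Ico (0 : ℝ) 1)
    (ht1 : Tendsto t atTop (𝓝 1)) :
    (∃ x₁ y₁, Tendsto (fun n => x (t n)) atTop (𝓝 x₁) ∧ Tendsto (fun n => y (t n)) atTop (𝓝 y₁)) ∨
      TendsToNine c (fun n => γ (t n)) (fun n => x (t n)) (fun n => y (t n)) ∨
      TendsToThirteen c (fun n => γ (t n)) (fun n => x (t n)) (fun n => y (t n)) := by
  have hz1 : γ 1 ∈ U := hγ.2.2 (by simp)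
  have htt := tendsto_nhdsLT_one ht ht1
  have hγt : Tendsto (fun n => γ (t n)) atTop (𝓝 (γ 1)) := hγ.tendsto_one.comp htt
  have key : ∀ {C : Chart} {m : ℂ}, EndsOnCurve c C m γ x y → ∃ (h : ℂ) (u v : ℕ → ℂ),
      Tendsto u atTop (𝓝 h) ∧ Tendsto v atTop (𝓝 0) ∧
      ∀ᶠ n in atTop, IsOver C (γ (t n)) (u n) (v n) (x (t n)) (y (t n)) := by
    rintro C m ⟨τ, s₀, Ξ, ψ, hs₀, -, hτ, hΞ, hψ, hψ0, -, hs, -⟩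
    have hτt := hτ.comp htt
    refine ⟨Ξ 0, fun n => Ξ (τ (t n)), fun n => ψ (τ (t n)), hΞ.continuousAt.tendsto.comp hτt, ?_, ?_⟩
    · have := hψ.continuousAt.tendsto.comp hτt
      rwa [hψ0] at this
    · filter_upwards [ht1.eventually (lt_mem_nhds hs₀.2)] with n hn
      exact (hs _ ⟨hn.le, (ht n).2⟩).2.2
  rcases endsRegular_or_endsOnCurve_nine_or_thirteen hγ hxy hU hc h1 h3 with h | h | h
  · left
    obtain ⟨ξ, η, hsol, hev⟩ := h
    have hs := hsol.self_of_nhds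
    refine ⟨ξ (γ 1), η (γ 1), (hs.1.continuousAt.tendsto.comp hγt).congr' ?_,
      (hs.2.continuousAt.tendsto.comp hγt).congr' ?_⟩
    · filter_upwards [htt.eventually hev] with n hn using hn.1.symm
    · filter_upwards [htt.eventually hev] with n hn using hn.2.symm
  · right; left
    obtain ⟨h, u, v, hu, hv, hov⟩ := key h
    have hk := tendsto_cascLift (a := firstCentre c) (fun j => (hc _ hz1).centre (4 + j)) 6 hγt hu hv
    rw [cascLift_zero_right _ (by norm_num)] at hk
    refine ⟨h, u, v, _, hu, hv, hk, ?_⟩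
    filter_upwards [hov] with n hn
    rw [isOver_nine] at hn
    obtain ⟨e0, e1, e2⟩ := hn
    have hv0 : v n ≠ 0 := by rintro h; rw [h] at e0; simp at e0
    have hk0 : cascLift (fun j => firstCentre c j (γ (t n))) 6 (u n) (v n) ≠ 0 := by
      rintro h; rw [h] at e0; simp at e0
    refine ⟨hv0, hk0, rfl, e1, ?_⟩
    refine mul_right_cancel₀ (mul_ne_zero hk0 (pow_ne_zero 2 hv0)) ?_
    linear_combination e2
  · right; right
    obtain ⟨h, u, v, hu, hv, hov⟩ := key h
    have hu' : Tendsto (fun n => secondTail c (γ (t n)) (v n) + v n ^ 3 * u n) atTop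
        (𝓝 (centre c 11 (γ 1))) := by
      have e := tendsto_cascTail (a := secondCentre c) (fun j => (hc _ hz1).centre (10 + j)) 2 1
        hγt hv
      have e2 := e.add ((hv.pow 3).mul hu)
      simp only [ne_eq, OfNat.ofNat_ne_zero, not_false_eq_true, zero_pow, zero_mul, add_zero] at e2
      refine e2.congr fun n => ?_
      have h1 : secondCentre c 1 (γ (t n)) = centre c 11 (γ (t n)) := rfl
      have h2 : secondCentre c 2 (γ (t n)) = centre c 12 (γ (t n)) := rfl
      have h3 : secondCentre c 3 (γ (t n)) = centre c 13 (γ (t n)) := rfl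
      simp only [cascTail, secondTail, h1, h2, h3]
      ring
    refine ⟨h, _, u, v, hu, hv, hu'.congr' ?_, ?_⟩
    · filter_upwards [hov] with n hn
      rw [isOver_thirteen, cascLift_eq, secondTail_eq] at hn
      refine mul_right_cancel₀ hn.1 ?_
      rw [hn.2.1]
      ring
    · filter_upwards [hov] with n hn
      exact isOver_thirteen.1 hn

variable {z₀ : ℂ} {z : ℕ → ℂ} {a : ℕ → ℂ → ℂ}

/-- A sequence that converges on a later curve of a cascade has, in the coordinates of an earlier
blow-up, a limit determined by the tail: the centre of the next blow-up. -/
theorem tendsto_of_cascLift_eq (ha : ∀ j, AnalyticAt ℂ (a j) z₀) (hz : Tendsto z atTop (𝓝 z₀))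
    {m j : ℕ} {u v u' : ℕ → ℂ} {h : ℂ} (hv : Tendsto v atTop (𝓝 0)) (hu' : Tendsto u' atTop (𝓝 h))
    (he : ∀ᶠ n in atTop, v n ≠ 0 ∧ cascLift (fun j => a j (z n)) m (u n) (v n)
      = cascLift (fun j => a j (z n)) (m + j) (u' n) (v n)) :
    Tendsto u atTop (𝓝 (cascTail (fun j => a j z₀) j m 0 + 0 ^ j * h)) := by
  have h1 := ((IsPolyNear.cascTail ha j m).analyticAt 0 0).continuousAt.tendsto.comp
    (hz.prodMk_nhds ((tendsto_const_nhds (x := (0 : ℂ))).prodMk_nhds hv))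
  refine (h1.add ((hv.pow j).mul hu')).congr' ?_
  filter_upwards [he] with n ⟨hv0, hn⟩
  have e1 := cascLift_sub_cascTail (fun j => a j (z n)) m j (u n) (v n)
  rw [hn, cascLift_eq, add_sub_cancel_left, pow_add, mul_assoc] at e1
  have := mul_left_cancel₀ (pow_ne_zero m hv0) e1
  simp only [Function.comp]
  linear_combination this

/-- The possible limits of a solution at the end of a path, along a sequence. -/
def IsLimitCase (c : Coeffs) (z x y : ℕ → ℂ) : Prop :=
  (∃ x₁ y₁, Tendsto x atTop (𝓝 x₁) ∧ Tendsto y atTop (𝓝 y₁)) ∨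
    TendsToNine c z x y ∨ TendsToThirteen c z x y

variable {x y u v p q : ℕ → ℂ} {u₀ v₀ : ℂ}

/-- If `1/x` tends to zero, then the solution reaches the last curve of the first cascade. -/
theorem IsLimitCase.tendsToNine (h : IsLimitCase c z x y) (hp : Tendsto p atTop (𝓝 0))
    (hxp : ∀ n, x n * p n = 1) (hq : ∀ n, y n * p n = q n) :
    ∃ (h : ℂ) (u v k : ℕ → ℂ), Tendsto u atTop (𝓝 h) ∧ Tendsto v atTop (𝓝 0) ∧
      Tendsto k atTop (𝓝 2) ∧ ∀ᶠ n in atTop, v n ≠ 0 ∧ k n ≠ 0 ∧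
        k n = cascLift (fun j => firstCentre c j (z n)) 6 (u n) (v n) ∧
        p n = k n ^ 2 * v n ^ 3 ∧ q n = k n * v n ^ 2 := by
  rcases h with ⟨x₁, y₁, hx, -⟩ | ⟨h, u, v, k, hu, hv, hk, he⟩ | ⟨h, x₁, u, v, -, -, hx, -⟩
  · exact (false_of_mul_eq_one hx hp (Eventually.of_forall hxp)).elim
  · refine ⟨h, u, v, k, hu, hv, hk, ?_⟩
    filter_upwards [he] with n ⟨hv0, hk0, e, ex, ey⟩
    have hx0 : x n ≠ 0 := left_ne_zero_of_mul_eq_one (hxp n)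
    have hpe : p n = k n ^ 2 * v n ^ 3 := mul_left_cancel₀ hx0 ((hxp n).trans ex.symm)
    refine ⟨hv0, hk0, e, hpe, ?_⟩
    rw [← hq, hpe]
    linear_combination k n * v n ^ 2 * ey
  · exact (false_of_mul_eq_one hx hp (Eventually.of_forall hxp)).elim

/-- If `1/y` tends to zero while `x/y` converges, then the solution reaches the last curve of the
second cascade. -/
theorem IsLimitCase.tendsToThirteen (h : IsLimitCase c z x y) (hp : Tendsto p atTop (𝓝 0))
    (hyp : ∀ n, y n * p n = 1) (hq : ∀ n, x n * p n = q n) {q₀ : ℂ}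
    (hq0 : Tendsto q atTop (𝓝 q₀)) :
    ∃ (h : ℂ) (u : ℕ → ℂ), Tendsto u atTop (𝓝 h) ∧ q₀ = 0 ∧
      ∀ᶠ n in atTop, p n ≠ 0 ∧ q n = cascLift (fun j => secondCentre c j (z n)) 4 (u n) (p n) := by
  rcases h with ⟨x₁, y₁, -, hy⟩ | ⟨h, u, v, k, hu, hv, hk, he⟩ | ⟨h, x₁, u, v, hu, hv, hx, he⟩
  · exact (false_of_mul_eq_one hy hp (Eventually.of_forall hyp)).elim
  · have hkv : Tendsto (fun n => k n * v n ^ 2) atTop (𝓝 0) := by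
      simpa using hk.mul (hv.pow 2)
    refine (false_of_mul_eq_one hq0 hkv ?_).elim
    filter_upwards [he] with n ⟨hv0, hk0, e, ex, ey⟩
    have hy0 : y n ≠ 0 := left_ne_zero_of_mul_eq_one (hyp n)
    have hpe : p n = k n * v n := mul_left_cancel₀ hy0 ((hyp n).trans ey.symm)
    rw [← hq, hpe]
    linear_combination ex
  · refine ⟨h, u, hu, ?_, ?_⟩
    · have := hx.mul hp
      rw [mul_zero] at this
      exact tendsto_nhds_unique hq0 (this.congr hq)
    · filter_upwards [he] with n ⟨hv0, ex, ey⟩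
      have hy0 : y n ≠ 0 := left_ne_zero_of_mul_eq_one (hyp n)
      have hpe : p n = v n := mul_left_cancel₀ hy0 ((hyp n).trans ey.symm)
      rw [hpe, ← hq, hpe]
      exact ⟨hv0, ex⟩

theorem IsLimitCase.chartu0 (hl : IsLimitCase c z x y) (hu : Tendsto u atTop (𝓝 0))
    (hv : Tendsto v atTop (𝓝 v₀))
    (ho : ∀ n, IsOver (chartu0 c) (z n) (u n) (v n) (x n) (y n)) : v₀ = 0 := by
  obtain ⟨h, u', v', k, -, hv', hk, he⟩ := hl.tendsToNine hu (fun n => (ho n).2.1)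
    (fun n => (ho n).2.2)
  have : Tendsto (fun n => k n * v' n ^ 2) atTop (𝓝 0) := by simpa using hk.mul (hv'.pow 2)
  refine tendsto_nhds_unique hv (this.congr' ?_)
  filter_upwards [he] with n hn using hn.2.2.2.2.symm

theorem IsLimitCase.chartU0 (hl : IsLimitCase c z x y) (hu : Tendsto u atTop (𝓝 u₀))
    (hv : Tendsto v atTop (𝓝 0))
    (ho : ∀ n, IsOver (chartU0 c) (z n) (u n) (v n) (x n) (y n)) : u₀ = 0 := by
  obtain ⟨h, u', -, h0, -⟩ := hl.tendsToThirteen hv (fun n => (ho n).2.2) (fun n => (ho n).2.1) hu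
  exact h0

theorem isOver_lowerChart_one {z u v x y : ℂ} : IsOver (lowerChart c 1) z u v x y ↔
    u ≠ 0 ∧ x * u = 1 ∧ y * u = u * v := by
  simp [IsOver, lowerChart_one, Chart.lower, QPII.chartu0]

theorem isOver_upperChart_one {z u v x y : ℂ} : IsOver (upperChart c 1) z u v x y ↔
    u * v ≠ 0 ∧ x * (u * v) = 1 ∧ y * (u * v) = v := by
  simp [IsOver, upperChart_one, Chart.upper, QPII.chartu0]

theorem isOver_lowerChart_two {z u v x y : ℂ} : IsOver (lowerChart c 2) z u v x y ↔
    u * (u * v) ≠ 0 ∧ x * (u * (u * v)) = 1 ∧ y * (u * (u * v)) = u * v := by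
  simp [IsOver, lowerChart_two, upperChart_one, Chart.upper, Chart.lower, QPII.chartu0]

theorem isOver_upperChart_two {z u v x y : ℂ} : IsOver (upperChart c 2) z u v x y ↔
    u * v * v ≠ 0 ∧ x * (u * v * v) = 1 ∧ y * (u * v * v) = v := by
  simp [IsOver, upperChart_two, upperChart_one, Chart.upper, QPII.chartu0]

theorem isOver_lowerChart_three {z u v x y : ℂ} : IsOver (lowerChart c 3) z u v x y ↔
    u * (u * (u * v)) ≠ 0 ∧ x * (u * (u * (u * v))) = 1 ∧
      y * (u * (u * (u * v))) = u * (u * v) := by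
  simp [IsOver, lowerChart_three, lowerChart_two, upperChart_one, Chart.upper, Chart.lower,
    QPII.chartu0]

theorem isOver_upperChart_three {z u v x y : ℂ} : IsOver (upperChart c 3) z u v x y ↔
    u ^ 2 * v ^ 3 ≠ 0 ∧ x * (u ^ 2 * v ^ 3) = 1 ∧ y * (u ^ 2 * v ^ 3) = u * v ^ 2 := by
  obtain ⟨f0, f1, f2⟩ := upperChart_three_T (c := c) z u v
  rw [IsOver, f0, f1, f2]

theorem IsLimitCase.lowerChart_one (hl : IsLimitCase c z x y) (hu : Tendsto u atTop (𝓝 0))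
    (hv : Tendsto v atTop (𝓝 v₀))
    (ho : ∀ n, IsOver (lowerChart c 1) (z n) (u n) (v n) (x n) (y n)) : False := by
  simp only [isOver_lowerChart_one] at ho
  obtain ⟨h, u', v', k, -, hv', hk, he⟩ := hl.tendsToNine hu (fun n => (ho n).2.1)
    (fun n => (ho n).2.2)
  refine false_of_mul_eq_one hv (g := fun n => k n * v' n) (by simpa using hk.mul hv') ?_
  filter_upwards [he] with n ⟨hv0, hk0, _, e1, e2⟩
  refine mul_left_cancel₀ (mul_ne_zero hk0 (pow_ne_zero 2 hv0)) ?_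
  rw [e1] at e2
  linear_combination e2

theorem IsLimitCase.upperChart_one (hl : IsLimitCase c z x y) (hu : Tendsto u atTop (𝓝 u₀))
    (hv : Tendsto v atTop (𝓝 0))
    (ho : ∀ n, IsOver (upperChart c 1) (z n) (u n) (v n) (x n) (y n)) : u₀ = 0 := by
  simp only [isOver_upperChart_one] at ho
  obtain ⟨h, u', v', k, -, hv', hk, he⟩ := hl.tendsToNine (by simpa using hu.mul hv)
    (fun n => (ho n).2.1) (fun n => (ho n).2.2)
  have : Tendsto (fun n => k n * v' n) atTop (𝓝 0) := by simpa using hk.mul hv'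
  refine tendsto_nhds_unique hu (this.congr' ?_)
  filter_upwards [he] with n ⟨hv0, hk0, _, e1, e2⟩
  refine mul_left_cancel₀ (mul_ne_zero hk0 (pow_ne_zero 2 hv0)) ?_
  rw [e2] at e1
  linear_combination -e1

theorem IsLimitCase.lowerChart_two (hl : IsLimitCase c z x y) (hu : Tendsto u atTop (𝓝 0))
    (hv : Tendsto v atTop (𝓝 v₀))
    (ho : ∀ n, IsOver (lowerChart c 2) (z n) (u n) (v n) (x n) (y n)) : v₀ = 0 := by
  simp only [isOver_lowerChart_two] at ho
  obtain ⟨h, u', v', k, -, hv', hk, he⟩ := hl.tendsToNine (by simpa using hu.mul (hu.mul hv))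
    (fun n => (ho n).2.1) (fun n => (ho n).2.2)
  refine tendsto_nhds_unique hv (hv'.congr' ?_)
  filter_upwards [he] with n ⟨hv0, hk0, _, e1, e2⟩
  have hu : u n = k n * v' n := by
    refine mul_left_cancel₀ (mul_ne_zero hk0 (pow_ne_zero 2 hv0)) ?_
    rw [e2] at e1
    linear_combination e1
  refine mul_left_cancel₀ (mul_ne_zero hk0 hv0) ?_
  rw [hu] at e2
  linear_combination -e2

theorem IsLimitCase.upperChart_two (hl : IsLimitCase c z x y) (hu : Tendsto u atTop (𝓝 u₀))
    (hv : Tendsto v atTop (𝓝 0))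
    (ho : ∀ n, IsOver (upperChart c 2) (z n) (u n) (v n) (x n) (y n)) : False := by
  simp only [isOver_upperChart_two] at ho
  obtain ⟨h, u', v', k, -, hv', hk, he⟩ := hl.tendsToNine (by simpa using (hu.mul hv).mul hv)
    (fun n => (ho n).2.1) (fun n => (ho n).2.2)
  refine false_of_mul_eq_one hu hv' ?_
  filter_upwards [he] with n ⟨hv0, hk0, _, e1, e2⟩
  refine mul_left_cancel₀ (mul_ne_zero (pow_ne_zero 2 hk0) (pow_ne_zero 3 hv0)) ?_
  rw [e2] at e1
  linear_combination e1

theorem IsLimitCase.lowerChart_three (hl : IsLimitCase c z x y) (hu : Tendsto u atTop (𝓝 0))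
    (hv : Tendsto v atTop (𝓝 v₀))
    (ho : ∀ n, IsOver (lowerChart c 3) (z n) (u n) (v n) (x n) (y n)) : v₀ * 2 = 1 := by
  simp only [isOver_lowerChart_three] at ho
  obtain ⟨h, u', v', k, -, hv', hk, he⟩ := hl.tendsToNine
    (by simpa using hu.mul (hu.mul (hu.mul hv))) (fun n => (ho n).2.1) (fun n => (ho n).2.2)
  refine tendsto_nhds_unique ((hv.mul hk).congr' ?_) tendsto_const_nhds
  filter_upwards [he] with n ⟨hv0, hk0, _, e1, e2⟩
  have hu : u n = k n * v' n := by
    refine mul_left_cancel₀ (mul_ne_zero hk0 (pow_ne_zero 2 hv0)) ?_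
    rw [e2] at e1
    linear_combination e1
  refine mul_left_cancel₀ (mul_ne_zero hk0 (pow_ne_zero 2 hv0)) ?_
  rw [hu] at e2
  linear_combination e2

/-- In the chart `(x/y³, y²/x)`, the coordinates along a solution are those of the limit on the
last curve of the first cascade. -/
theorem IsLimitCase.first {w K : ℕ → ℂ} (hl : IsLimitCase c z x y) (hw : Tendsto w atTop (𝓝 0))
    {K₀ : ℂ} (hK : Tendsto K atTop (𝓝 K₀))
    (ho : ∀ n, IsOver (upperChart c 3) (z n) (K n) (w n) (x n) (y n)) :
    K₀ = 2 ∧ ∃ (h : ℂ) (u : ℕ → ℂ), Tendsto u atTop (𝓝 h) ∧ ∀ᶠ n in atTop, w n ≠ 0 ∧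
      K n = cascLift (fun j => firstCentre c j (z n)) 6 (u n) (w n) := by
  simp only [isOver_upperChart_three] at ho
  obtain ⟨h, u', v', k, hu', hv', hk, he⟩ := hl.tendsToNine
    (by simpa using (hK.pow 2).mul (hw.pow 3)) (fun n => (ho n).2.1) (fun n => (ho n).2.2)
  have key : ∀ᶠ n in atTop, K n = k n ∧ w n = v' n ∧ v' n ≠ 0 := by
    filter_upwards [he] with n ⟨hv0, hk0, _, e1, e2⟩
    have hw0 : w n ≠ 0 := by rintro h; have := (ho n).1; rw [h] at this; simp at this
    have hKk : K n = k n := by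
      have hA : (K n ^ 2 * w n ^ 3) ^ 2 = K n * (K n * w n ^ 2) ^ 3 := by ring
      rw [e1, e2] at hA
      refine mul_left_cancel₀ (mul_ne_zero (pow_ne_zero 3 hk0) (pow_ne_zero 6 hv0)) ?_
      linear_combination -hA
    have hA : K n ^ 2 * w n ^ 3 = w n * K n * (K n * w n ^ 2) := by ring
    rw [e1, e2, hKk] at hA
    refine ⟨hKk, ?_, hv0⟩
    refine mul_left_cancel₀ (mul_ne_zero (pow_ne_zero 2 hk0) (pow_ne_zero 2 hv0)) ?_
    linear_combination -hA
  refine ⟨tendsto_nhds_unique (hK.congr' (key.mono fun n hn => hn.1)) hk, h, u', hu', ?_⟩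
  filter_upwards [key, he] with n ⟨e1, e2, e3⟩ ⟨_, _, e4, _⟩
  rw [e1, e2]
  exact ⟨e3, e4⟩

theorem isOver_casc {C : Chart} {a : ℕ → ℂ → ℂ} {m : ℕ} {z u v x y : ℂ} :
    IsOver (casc C a m) z u v x y ↔ IsOver C z (cascLift (fun j => a j z) m u v) v x y := by
  obtain ⟨e0, e1, e2⟩ := casc_T C a m z u v
  rw [IsOver, IsOver, e0, e1, e2]

theorem isOver_lower {C : Chart} {a : ℂ → ℂ} {z u v x y : ℂ} :
    IsOver (C.lower a fun _ => 0) z u v x y ↔ IsOver C z (u + a z) (u * v) x y := by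
  simp [IsOver, Chart.lower]

/-- If, along a sequence over `C`, the coordinates are those of a point converging on the last curve
of the cascade, then in the charts of each blow-up the sequence converges to the next centre. -/
theorem limit_casc {C : Chart} {N : ℕ} (ha : ∀ j, AnalyticAt ℂ (a j) z₀)
    (hz : Tendsto z atTop (𝓝 z₀))
    (hlim : ∀ {K V : ℕ → ℂ} {K₀ : ℂ}, Tendsto K atTop (𝓝 K₀) → Tendsto V atTop (𝓝 0) →
      (∀ n, IsOver C (z n) (K n) (V n) (x n) (y n)) → ∃ (h : ℂ) (U : ℕ → ℂ),
        Tendsto U atTop (𝓝 h) ∧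
        ∀ᶠ n in atTop, V n ≠ 0 ∧ K n = cascLift (fun j => a j (z n)) N (U n) (V n))
    {m : ℕ} (hu : Tendsto u atTop (𝓝 u₀)) (hv : Tendsto v atTop (𝓝 v₀)) :
    (m + 1 < N → v₀ = 0 → (∀ n, IsOver (casc C a (m + 1)) (z n) (u n) (v n) (x n) (y n)) →
      u₀ = a (m + 1) z₀) ∧
    (u₀ = 0 →
      (∀ n, IsOver ((casc C a m).lower (a m) fun _ => 0) (z n) (u n) (v n) (x n) (y n)) →
      (m + 1 < N → v₀ * a (m + 1) z₀ = 1) ∧ (m + 1 = N → v₀ ≠ 0)) := by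
  refine ⟨?_, ?_⟩
  · rintro hm rfl ho
    simp only [isOver_casc] at ho
    obtain ⟨h, U, hU, he⟩ := hlim (tendsto_cascLift ha (m + 1) hz hu hv) hv ho
    obtain ⟨j, rfl⟩ := Nat.exists_eq_add_of_lt hm
    have := tendsto_nhds_unique hu (tendsto_of_cascLift_eq (j := j + 1) ha hz hv hU he)
    simpa [cascTail] using this
  · rintro rfl ho
    simp only [isOver_lower, isOver_casc] at ho
    have huv : Tendsto (fun n => u n * v n) atTop (𝓝 0) := by simpa using hu.mul hv
    obtain ⟨h, U, hU, he⟩ := hlim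
      (tendsto_cascLift ha m hz (hu.add ((ha m).continuousAt.tendsto.comp hz)) huv) huv ho
    -- The chart is the other one of the blow-up in terms of `1 / v` and `u v`.
    have key : ∀ j, m + 1 + j = N → v₀ * (cascTail (fun i => a i z₀) j (m + 1) 0 + 0 ^ j * h) = 1 := by
      rintro j rfl
      refine tendsto_nhds_unique ((hv.mul (tendsto_of_cascLift_eq (u := fun n => 1 / v n)
        ha hz huv hU ?_)).congr' ?_) tendsto_const_nhds
      · filter_upwards [he] with n ⟨h0, hn⟩
        have hv0 := right_ne_zero_of_mul h0
        refine ⟨h0, ?_⟩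
        rw [← hn, cascLift, one_div_mul_eq_div, mul_div_cancel_right₀ _ hv0]
        rfl
      · filter_upwards [he] with n ⟨h0, _⟩
        exact mul_one_div_cancel (right_ne_zero_of_mul h0)
    refine ⟨fun hm => ?_, fun hm h0 => ?_⟩
    · obtain ⟨j, rfl⟩ := Nat.exists_eq_add_of_lt hm
      simpa [cascTail] using key (j + 1) rfl
    · have := key 0 hm
      rw [h0, zero_mul] at this
      exact zero_ne_one this

theorem IsLimitCase.limit_first (hl : IsLimitCase c z x y) (hz : Tendsto z atTop (𝓝 z₀))
    (hc : c.AnalyticAt z₀) {m : ℕ} (hm : m ≤ 5) (hu : Tendsto u atTop (𝓝 u₀))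
    (hv : Tendsto v atTop (𝓝 v₀)) :
    (m < 5 → v₀ = 0 → (∀ n, IsOver (upperChart c (4 + m)) (z n) (u n) (v n) (x n) (y n)) →
      u₀ = centre c (4 + m + 1) z₀) ∧
    (u₀ = 0 → (∀ n, IsOver (lowerChart c (4 + m)) (z n) (u n) (v n) (x n) (y n)) →
      (m < 5 → v₀ * centre c (4 + m + 1) z₀ = 1) ∧ (m = 5 → v₀ ≠ 0)) := by
  rw [upperChart_first hm, lowerChart_first hm]
  have h := limit_casc (N := 5 + 1) (a := firstCentre c) (fun j => hc.centre _) hz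
      (fun hK hV ho => (hl.first hV hK ho).2) (m := m) hu hv
  simp only [Nat.add_lt_add_iff_right, Nat.add_right_cancel_iff] at h
  exact h

theorem IsLimitCase.limit_second (hl : IsLimitCase c z x y) (hz : Tendsto z atTop (𝓝 z₀))
    (hc : c.AnalyticAt z₀) {m : ℕ} (hm : m ≤ 3) (hu : Tendsto u atTop (𝓝 u₀))
    (hv : Tendsto v atTop (𝓝 v₀)) :
    (m < 3 → v₀ = 0 → (∀ n, IsOver (upperChart c (10 + m)) (z n) (u n) (v n) (x n) (y n)) →
      u₀ = centre c (10 + m + 1) z₀) ∧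
    (u₀ = 0 → (∀ n, IsOver (lowerChart c (10 + m)) (z n) (u n) (v n) (x n) (y n)) →
      (m < 3 → v₀ * centre c (10 + m + 1) z₀ = 1) ∧ (m = 3 → v₀ ≠ 0)) := by
  rw [upperChart_second hm, lowerChart_second hm]
  have h := limit_casc (C := QPII.chartU0 c) (N := 3 + 1) (a := secondCentre c) (fun j => hc.centre _) hz
      (fun hK hV ho => by
        obtain ⟨h, U, hU, -, he⟩ := hl.tendsToThirteen hV (fun n => (ho n).2.2)
          (fun n => (ho n).2.1) hK
        exact ⟨h, U, hU, he⟩) (m := m) hu hv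
  simp only [Nat.add_lt_add_iff_right, Nat.add_right_cancel_iff] at h
  exact h

variable {C : Chart} {γ : ℝ → ℂ} {ζ v₁ u₁ : ℂ}

theorem inaccessible_of_isLimitCase (hU : IsOpen U) (hc : ∀ z ∈ U, c.AnalyticAt z)
    (h1 : ∀ z ∈ U, deriv c.c1 z = 0) (h3 : ∀ z ∈ U, deriv (deriv c.c3) z = 0)
    (h : ∀ z x y u v : ℕ → ℂ, Tendsto z atTop (𝓝 ζ) → Tendsto u atTop (𝓝 u₁) →
      Tendsto v atTop (𝓝 v₁) → IsLimitCase c z x y →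
      (∀ n, IsOver C (z n) (u n) (v n) (x n) (y n)) → False) : Inaccessible c U C ζ u₁ v₁ := by
  rintro γ x y hγ rfl hxy ⟨t, u, v, ht, ht1, ho, hu, hv⟩
  exact h _ _ _ u v (hγ.tendsto_one.comp (tendsto_nhdsLT_one ht ht1)) hu hv
    (limit_cases hγ hxy hU hc h1 h3 ht ht1) ho

/-- The points of the line at infinity and of the intermediate curves that are not base points. -/
theorem OnIntermediateCurve.cases (hC : OnIntermediateCurve c C u₁ v₁) (hc : c.AnalyticAt ζ)
    (hb : ¬ IsBasePoint C ζ u₁ v₁) :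
    (C = chartu0 c ∧ u₁ = 0 ∧ v₁ ≠ 0) ∨ (C = chartU0 c ∧ v₁ = 0 ∧ u₁ ≠ 0) ∨
      (C = lowerChart c 2 ∧ u₁ = 0 ∧ v₁ ≠ 0) ∨ (C = upperChart c 2 ∧ v₁ = 0) ∨
      ∃ i, (i = 1 ∨ i = 3 ∨ (4 ≤ i ∧ i ≤ 8) ∨ 10 ≤ i ∧ i ≤ 12) ∧
        ((C = lowerChart c i ∧ u₁ = 0 ∧ v₁ * centre c (i + 1) ζ ≠ 1) ∨
          C = upperChart c i ∧ v₁ = 0 ∧ u₁ ≠ centre c (i + 1) ζ) := by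
  rcases hC with ⟨rfl, rfl⟩ | ⟨rfl, rfl⟩ | ⟨i, hi, hC⟩
  · exact .inl ⟨rfl, rfl, fun e => hb ((chartu0_isBasePoint_iff v₁).2 e)⟩
  · exact .inr (.inl ⟨rfl, rfl, fun e => hb ((chartU0_isBasePoint_iff u₁).2 e)⟩)
  rcases eq_or_ne i 2 with rfl | h2
  · rcases hC with ⟨rfl, rfl⟩ | ⟨rfl, rfl⟩
    · exact .inr (.inr (.inl ⟨rfl, rfl, fun e => hb ((lowerChart_two_isBasePoint_iff v₁).2 e)⟩))
    · exact .inr (.inr (.inr (.inl ⟨rfl, rfl⟩)))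
  simp only [Set.mem_insert_iff, Set.mem_singleton_iff] at hi
  have hbi := isBasePoint_intermediate hc (i := i)
    (by simp only [Set.mem_insert_iff, Set.mem_singleton_iff]; omega)
  refine .inr (.inr (.inr (.inr ⟨i, by omega, ?_⟩)))
  rcases hC with ⟨rfl, rfl⟩ | ⟨rfl, rfl⟩
  · exact .inl ⟨rfl, rfl, fun e => hb ((hbi.2 _).2 e)⟩
  · exact .inr ⟨rfl, rfl, fun e => hb ((hbi.1 _).2 e)⟩

theorem inaccessible_intermediate (hU : IsOpen U) (hc : ∀ z ∈ U, c.AnalyticAt z)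
    (h1 : ∀ z ∈ U, deriv c.c1 z = 0) (h3 : ∀ z ∈ U, deriv (deriv c.c3) z = 0) (hζ : ζ ∈ U)
    (hC : OnIntermediateCurve c C u₁ v₁) (hb : ¬ IsBasePoint C ζ u₁ v₁) :
    Inaccessible c U C ζ u₁ v₁ := by
  refine inaccessible_of_isLimitCase hU hc h1 h3 fun z x y u v hz hu hv hl ho => ?_
  have hcζ := hc ζ hζ
  rcases hC.cases hcζ hb with
    ⟨rfl, rfl, hn⟩ | ⟨rfl, rfl, hn⟩ | ⟨rfl, rfl, hn⟩ | ⟨rfl, rfl⟩ | ⟨i, hi, hC⟩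
  · exact hn (hl.chartu0 hu hv ho)
  · exact hn (hl.chartU0 hu hv ho)
  · exact hn (hl.lowerChart_two hu hv ho)
  · exact hl.upperChart_two hu hv ho
  rcases hi with rfl | rfl | ⟨hi, hi'⟩ | ⟨hi, hi'⟩
  · rcases hC with ⟨rfl, rfl, -⟩ | ⟨rfl, rfl, hn⟩
    · exact hl.lowerChart_one hu hv ho
    · exact hn (hl.upperChart_one hu hv ho)
  · rcases hC with ⟨rfl, rfl, hn⟩ | ⟨rfl, rfl, hn⟩
    · exact hn (hl.lowerChart_three hu hv ho)
    · exact hn (hl.first hv hu ho).1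
  · obtain ⟨m, rfl⟩ := Nat.exists_eq_add_of_le hi
    have h := hl.limit_first hz hcζ (m := m) (by omega) hu hv
    rcases hC with ⟨rfl, rfl, hn⟩ | ⟨rfl, rfl, hn⟩
    · exact hn ((h.2 rfl ho).1 (by omega))
    · exact hn (h.1 (by omega) rfl ho)
  · obtain ⟨m, rfl⟩ := Nat.exists_eq_add_of_le hi
    have h := hl.limit_second hz hcζ (m := m) (by omega) hu hv
    rcases hC with ⟨rfl, rfl, hn⟩ | ⟨rfl, rfl, hn⟩
    · exact hn ((h.2 rfl ho).1 (by omega))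
    · exact hn (h.1 (by omega) rfl ho)

theorem inaccessible_last (hU : IsOpen U) (hc : ∀ z ∈ U, c.AnalyticAt z)
    (h1 : ∀ z ∈ U, deriv c.c1 z = 0) (h3 : ∀ z ∈ U, deriv (deriv c.c3) z = 0) (hζ : ζ ∈ U) {i : ℕ}
    (hi : i ∈ ({9, 13} : Set ℕ)) : Inaccessible c U (lowerChart c i) ζ 0 0 := by
  refine inaccessible_of_isLimitCase hU hc h1 h3 fun z x y u v hz hu hv hl ho => ?_
  simp only [Set.mem_insert_iff, Set.mem_singleton_iff] at hi
  rcases hi with rfl | rfl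
  · exact ((hl.limit_first (m := 5) hz (hc ζ hζ) le_rfl hu hv).2 rfl ho).2 rfl rfl
  · exact ((hl.limit_second (m := 3) hz (hc ζ hζ) le_rfl hu hv).2 rfl ho).2 rfl rfl

end Ends

/-! ### The derivative of `W` along the flow -/

section LogDeriv

variable {c : Coeffs} {z x y : ℂ}

theorem Wdot_eq (hc : c.AnalyticAt z) (hy : y ≠ 0)
    (hx : x ≠ 0 ∨ c.c2 z * deriv c.c2 z = 0) :
    c.Wdot z x y = (-(deriv c.c3 z * x * y) - deriv c.c2 z / 3 * y ^ 3 - deriv c.c1 z / 2 * y ^ 2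
        - deriv c.c0 z * y + deriv (deriv c.c2) z / 6 * (x / y ^ 2)
        + (deriv c.c2 z * deriv c.c2 z + c.c2 z * deriv (deriv c.c2) z) / 9 * (y / x))
      + c.xdot z x y * (x - (y ^ 3 + c.c3 z * y) + 1 / 2 * (1 / y) + deriv c.c2 z / 6 * (1 / y ^ 2)
        - c.c2 z * deriv c.c2 z / 9 * (y / x ^ 2))
      + c.ydot z x y * (-(x * (3 * y ^ 2 + c.c3 z)) - c.c2 z * y ^ 2 - c.c1 z * y - c.c0 z
        - 1 / 2 * (x / y ^ 2) - deriv c.c2 z / 3 * (x / y ^ 3)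
        + c.c2 z * deriv c.c2 z / 9 * (1 / x)) := by
  have h0 := hc.c0.differentiableAt.hasDerivAt
  have h1 := hc.c1.differentiableAt.hasDerivAt
  have h2 := hc.c2.differentiableAt.hasDerivAt
  have h3 := hc.c3.differentiableAt.hasDerivAt
  have h2' := hc.c2.deriv.differentiableAt.hasDerivAt
  have ez : deriv (fun ζ => c.W ζ x y) z = -(deriv c.c3 z * x * y) - deriv c.c2 z / 3 * y ^ 3
        - deriv c.c1 z / 2 * y ^ 2 - deriv c.c0 z * y + deriv (deriv c.c2) z / 6 * (x / y ^ 2)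
        + (deriv c.c2 z * deriv c.c2 z + c.c2 z * deriv (deriv c.c2) z) / 9 * (y / x) := by
    have e1 := ((hasDerivAt_const z (x ^ 2 / 2)).fun_sub
      ((((hasDerivAt_const z (y ^ 3)).fun_add (h3.mul_const y)).const_mul x))).fun_sub
      ((h2.div_const 3).mul_const (y ^ 3))
    have e2 := (e1.fun_sub ((h1.div_const 2).mul_const (y ^ 2))).fun_sub (h0.mul_const y)
    have e3 := ((e2.fun_add (hasDerivAt_const z (1 / 2 * (x / y)))).fun_add
      ((h2'.div_const 6).mul_const (x / y ^ 2))).fun_add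
      (((h2.fun_mul h2').div_const 9).mul_const (y / x))
    have : HasDerivAt (fun ζ => c.W ζ x y) _ z := e3
    rw [this.deriv]
    ring
  have ex : deriv (fun ξ => c.W z ξ y) x = x - (y ^ 3 + c.c3 z * y) + 1 / 2 * (1 / y)
        + deriv c.c2 z / 6 * (1 / y ^ 2) - c.c2 z * deriv c.c2 z / 9 * (y / x ^ 2) := by
    have hid := hasDerivAt_id' x
    have hlast : HasDerivAt (fun ξ => c.c2 z * deriv c.c2 z / 9 * (y / ξ))
        (-(c.c2 z * deriv c.c2 z / 9 * (y / x ^ 2))) x := by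
      rcases hx with hx | hx
      · refine (((hasDerivAt_const x y).fun_div hid hx).const_mul _).congr_deriv ?_
        field_simp
        ring
      · simp only [hx, zero_div, zero_mul, neg_zero]
        exact hasDerivAt_const x 0
    have e1 := ((((hid.fun_pow 2).div_const 2).fun_sub (hid.mul_const (y ^ 3 + c.c3 z * y))).fun_sub
      (hasDerivAt_const x (c.c2 z / 3 * y ^ 3))).fun_sub
      (hasDerivAt_const x (c.c1 z / 2 * y ^ 2)) |>.fun_sub (hasDerivAt_const x (c.c0 z * y))
    have e2 := ((e1.fun_add ((hid.div_const y).const_mul (1 / 2))).fun_add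
      ((hid.div_const (y ^ 2)).const_mul (deriv c.c2 z / 6))).fun_add hlast
    have : HasDerivAt (fun ξ => c.W z ξ y) _ x := e2
    rw [this.deriv]
    push_cast
    ring
  have ey : deriv (fun η => c.W z x η) y = -(x * (3 * y ^ 2 + c.c3 z)) - c.c2 z * y ^ 2
        - c.c1 z * y - c.c0 z - 1 / 2 * (x / y ^ 2) - deriv c.c2 z / 3 * (x / y ^ 3)
        + c.c2 z * deriv c.c2 z / 9 * (1 / x) := by
    have hid := hasDerivAt_id' y
    have e1 := ((((hasDerivAt_const y (x ^ 2 / 2)).fun_sub (((hid.fun_pow 3).fun_add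
      (hid.const_mul (c.c3 z))).const_mul x)).fun_sub ((hid.fun_pow 3).const_mul (c.c2 z / 3))).fun_sub
      ((hid.fun_pow 2).const_mul (c.c1 z / 2))).fun_sub (hid.const_mul (c.c0 z))
    have e2 := ((e1.fun_add (((hasDerivAt_const y x).fun_div hid hy).const_mul (1 / 2))).fun_add
      (((hasDerivAt_const y x).fun_div (hid.fun_pow 2) (pow_ne_zero 2 hy)).const_mul
        (deriv c.c2 z / 6))).fun_add ((hid.div_const x).const_mul (c.c2 z * deriv c.c2 z / 9))
    have : HasDerivAt (fun η => c.W z x η) _ y := e2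
    rw [this.deriv]
    push_cast
    field_simp
    ring
  rw [Coeffs.Wdot, ez, ex, ey]

/-- The coefficient of `y` in the derivative of `W`, with `i = 1/y` and `j = 1/x`. -/
noncomputable def rateY (c : Coeffs) (z i j : ℂ) : ℂ :=
  c.c2 z / 6 - deriv c.c0 z - c.c0 z * i ^ 2 / 2
    + deriv c.c2 z / 6 * (-c.c2 z / 3 * i - c.c1 z * i ^ 2 - 3 * c.c0 z * i ^ 3)
    + c.c2 z * deriv c.c2 z / 9 * (i - 2 * c.c3 z * j - c.c0 z * j ^ 2)
    + (deriv c.c2 z * deriv c.c2 z + c.c2 z * deriv (deriv c.c2) z) / 9 * j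
    + deriv c.c2 z / 3 * ((1 + c.c2 z * j) * (c.c3 z + c.c0 z * j) - c.c2 z / 2 * i)
    + deriv c.c2 z * c.c1 z / 6 * (i ^ 2 / 2 - c.c3 z * j * i - c.c1 z * j ^ 2 / 2
      - c.c0 z * j ^ 2 * i)

theorem Wdot_eq_of_ne (hc : c.AnalyticAt z) (h1 : deriv c.c1 z = 0) (h3 : deriv c.c3 z = 1)
    (hy : y ≠ 0) (hx : x ≠ 0) : c.Wdot z x y = rateY c z (1 / y) (1 / x) * y
      + (-1 - 2 / 3 * deriv c.c2 z * (1 / y)) * (c.H z x y * (1 / y) ^ 2)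
      + (deriv (deriv c.c2) z - deriv c.c2 z * c.c3 z) / 6 * (x * (1 / y) ^ 2)
      + (deriv c.c2 z / 3 * (1 + c.c2 z * (1 / x))
        - deriv c.c2 z * c.c1 z / 6 * (1 / x) * (1 / y)) * (c.H z x y * (1 / x)) := by
  rw [Wdot_eq hc hy (.inl hx), h1, h3, xdot_eq, ydot_eq, rateY, Coeffs.H]
  field_simp
  ring

theorem Wdot_eq_of_deriv_eq_zero (hc : c.AnalyticAt z) (h1 : deriv c.c1 z = 0)
    (h3 : deriv c.c3 z = 1) (hy : y ≠ 0) (h2 : deriv c.c2 z = 0) (h2' : deriv (deriv c.c2) z = 0) :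
    c.Wdot z x y = rateY c z (1 / y) 0 * y + -1 * (c.H z x y * (1 / y) ^ 2) := by
  rw [Wdot_eq hc hy (.inr (by rw [h2, mul_zero])), h1, h3, h2, h2', xdot_eq, ydot_eq, rateY,
    Coeffs.H, h2, h2']
  simp only [zero_div, mul_zero, zero_mul, sub_zero, add_zero]
  field_simp
  ring

theorem rate_isPolyNear (hc : c.AnalyticAt z) : IsPolyNear z (rateY c) ∧
    (IsPolyNear z fun z i _ => -1 - 2 / 3 * deriv c.c2 z * i) ∧
    (IsPolyNear z fun z _ _ => (deriv (deriv c.c2) z - deriv c.c2 z * c.c3 z) / 6) ∧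
    IsPolyNear z fun z i j =>
      deriv c.c2 z / 3 * (1 + c.c2 z * j) - deriv c.c2 z * c.c1 z / 6 * j * i := by
  obtain ⟨h0, h1, h2, h3⟩ := hc
  unfold rateY
  simp only [div_eq_mul_inv]
  refine ⟨?_, ?_, ?_, ?_⟩ <;> repeat' first | assumption | fun_prop | constructor

/-- Estimates for `|H / y²|`, `|x / y²|` and `|H / x|` in terms of `|W|` and `|y|`. -/
theorem size_bounds {H W X Y I J B C D : ℝ} (hH : 0 ≤ H) (hW : 0 ≤ W) (hX : 0 ≤ X) (hY : 0 ≤ Y)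
    (hI : 0 ≤ I) (hJ : 0 ≤ J) (hC : 0 ≤ C) (hD : 0 ≤ D) (hI1 : I ≤ 1) (hIY : I * Y = 1)
    (hJD : J ≤ D) (hXJ : X * J ≤ 1) (hHW : H ≤ W + C * (X * I + Y * J))
    (hx2 : X ^ 2 ≤ 4 * H + 24 * B ^ 2 * Y ^ 6) :
    H * I ^ 2 ≤ (2 + 6 * B ^ 2 + 4 * C ^ 2 + 2 * C * D) * (W + 1) ∧
      X * I ^ 2 ≤ (1 + 24 * B ^ 2) * Y + 4 * (H * I ^ 2) ∧
      H * J ≤ D * W + C + C * D ^ 2 * Y := by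
  have hHW' : H ≤ W + C * (X * I + D * Y) := by
    refine hHW.trans ?_
    rw [mul_comm Y J]
    gcongr
  set r := X * I ^ 3 with hr
  have hr0 : 0 ≤ r := by positivity
  have e0 : I ^ 6 * Y ^ 6 = 1 := by rw [← mul_pow, hIY, one_pow]
  have e1 : I ^ 6 ≤ I ^ 2 := pow_le_pow_of_le_one hI hI1 (by norm_num)
  have hr2 : r ^ 2 ≤ 4 * (H * I ^ 2) + 24 * B ^ 2 := by
    calc r ^ 2 = X ^ 2 * I ^ 6 := by rw [hr]; ring
      _ ≤ (4 * H + 24 * B ^ 2 * Y ^ 6) * I ^ 6 := by gcongr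
      _ = 4 * (H * I ^ 6) + 24 * B ^ 2 * (I ^ 6 * Y ^ 6) := by ring
      _ ≤ 4 * (H * I ^ 2) + 24 * B ^ 2 := by rw [e0, mul_one]; gcongr
  refine ⟨?_, ?_, ?_⟩
  · have e1 : H * I ^ 2 ≤ W + C * r + C * D := by
      calc H * I ^ 2 ≤ (W + C * (X * I + D * Y)) * I ^ 2 := by gcongr
        _ = W * I ^ 2 + C * r + C * D * (I * (I * Y)) := by rw [hr]; ring
        _ ≤ W * 1 + C * r + C * D * 1 := by
            rw [hIY, mul_one]
            have : I ^ 2 ≤ 1 := pow_le_one₀ hI hI1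
            gcongr
        _ = _ := by ring
    have e2 : C * r ≤ r ^ 2 / 8 + 2 * C ^ 2 := by
      have := sq_nonneg (r - 4 * C)
      have h : (r - 4 * C) ^ 2 = 8 * (r ^ 2 / 8 + 2 * C ^ 2 - C * r) := by ring
      linarith
    have e4 : 0 ≤ (6 * B ^ 2 + 4 * C ^ 2 + 2 * C * D) * W := by positivity
    calc H * I ^ 2 ≤ 2 * W + (6 * B ^ 2 + 4 * C ^ 2 + 2 * C * D) := by linarith
      _ ≤ 2 * W + (6 * B ^ 2 + 4 * C ^ 2 + 2 * C * D) + 2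
          + (6 * B ^ 2 + 4 * C ^ 2 + 2 * C * D) * W := by linarith
      _ = _ := by ring
  · have e1 : X * I ^ 2 = Y * r := by
      calc X * I ^ 2 = X * I ^ 2 * (I * Y) := by rw [hIY, mul_one]
        _ = _ := by rw [hr]; ring
    have e0 : I ^ 5 * Y ^ 6 = Y := by
      calc I ^ 5 * Y ^ 6 = (I * Y) ^ 5 * Y := by ring
        _ = Y := by rw [hIY]; ring
    have e2 : Y * r ^ 2 ≤ 4 * (H * I ^ 2) + 24 * B ^ 2 * Y := by
      calc Y * r ^ 2 = X ^ 2 * (I ^ 5 * (I * Y)) := by rw [hr]; ring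
        _ ≤ (4 * H + 24 * B ^ 2 * Y ^ 6) * I ^ 5 := by rw [hIY, mul_one]; gcongr
        _ = 4 * (H * I ^ 5) + 24 * B ^ 2 * (I ^ 5 * Y ^ 6) := by ring
        _ ≤ 4 * (H * I ^ 2) + 24 * B ^ 2 * Y := by
          rw [e0]
          have : I ^ 5 ≤ I ^ 2 := pow_le_pow_of_le_one hI hI1 (by norm_num)
          gcongr
    have e3 : Y * r ≤ Y * (1 + r ^ 2) := by
      gcongr; nlinarith [sq_nonneg (r - 1)]
    rw [e1]
    linarith
  · calc H * J ≤ (W + C * (X * I + D * Y)) * J := by gcongr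
      _ = W * J + C * (X * J * I) + C * D * Y * J := by ring
      _ ≤ W * D + C * (1 * 1) + C * D * Y * D := by gcongr
      _ = _ := by ring

/-- The derivative of `W` along the flow is at most of the order of `|y| + |W| + 1`. -/
theorem exists_Wdot_bound {P : Set ℂ} (hP : IsCompact P) (hc : ∀ z ∈ P, c.AnalyticAt z)
    (h1 : ∀ z ∈ P, deriv c.c1 z = 0) (h3 : ∀ z ∈ P, deriv c.c3 z = 1) {δ : ℝ} (hδ : 0 < δ) :
    ∃ K, 0 ≤ K ∧ ∀ z ∈ P, ∀ x y : ℂ, 1 ≤ ‖y‖ →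
      (δ ≤ ‖x‖ ∨ (deriv c.c2 z = 0 ∧ deriv (deriv c.c2) z = 0)) →
      ‖c.Wdot z x y‖ ≤ K * (‖y‖ + ‖c.W z x y‖ + 1) := by
  obtain ⟨B, hB⟩ := exists_coeffBound hP hc
  have hp := fun z hz => rate_isPolyNear (hc z hz)
  obtain ⟨K, hK, hKb⟩ := exists_bound_of_isPolyNear hP (fun z hz => (hp z hz).1) (max 1 (1 / δ))
  obtain ⟨K₁, k₁, b₁⟩ := exists_bound_of_isPolyNear hP (fun z hz => (hp z hz).2.1) (max 1 (1 / δ))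
  obtain ⟨K₂, k₂, b₂⟩ := exists_bound_of_isPolyNear hP (fun z hz => (hp z hz).2.2.1)
    (max 1 (1 / δ))
  obtain ⟨K₃, k₃, b₃⟩ := exists_bound_of_isPolyNear hP (fun z hz => (hp z hz).2.2.2)
    (max 1 (1 / δ))
  set D := 1 + 1 / δ with hD
  have hD1 : 1 ≤ D := by rw [hD]; linarith [one_div_pos.2 hδ]
  set C := 2 * |B| + 2 + B ^ 2 * D with hC
  have hC0 : 1 ≤ C := by rw [hC]; have := abs_nonneg B; nlinarith [sq_nonneg B]
  set E := 2 + 6 * B ^ 2 + 4 * C ^ 2 + 2 * C * D with hE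
  refine ⟨K + K₁ * E + K₂ * (1 + 24 * B ^ 2 + 4 * E) + K₃ * (D + C + C * D ^ 2), by positivity,
    fun z hz x y hy hxδ => ?_⟩
  have hBz := hB z hz
  have hB1 := hBz.one_le
  have hBa : |B| = B := abs_of_nonneg (by linarith)
  have hy0 : y ≠ 0 := norm_pos_iff.1 (by linarith)
  set i := 1 / y with hi
  have hi1 : ‖i‖ ≤ 1 := by rw [hi, norm_div, norm_one, div_le_one (by linarith)]; exact hy
  have hi0 := norm_nonneg i
  have hiy : ‖i‖ * ‖y‖ = 1 := by rw [← norm_mul, hi, one_div_mul_cancel hy0, norm_one]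
  obtain ⟨j, hj, hjD, hWd, hWH⟩ : ∃ j : ℂ, ‖x * j‖ ≤ 1 ∧ ‖j‖ ≤ 1 / δ ∧
      c.Wdot z x y = rateY c z i j * y + (-1 - 2 / 3 * deriv c.c2 z * i) * (c.H z x y * i ^ 2)
      + (deriv (deriv c.c2) z - deriv c.c2 z * c.c3 z) / 6 * (x * i ^ 2)
      + (deriv c.c2 z / 3 * (1 + c.c2 z * j) - deriv c.c2 z * c.c1 z / 6 * j * i)
        * (c.H z x y * j) ∧
      c.W z x y = c.H z x y + (1 / 2 + deriv c.c2 z / 6 * i) * (x * i)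
        + c.c2 z * deriv c.c2 z / 9 * (y * j) := by
    rcases hxδ with hx | ⟨h2, h2'⟩
    · have hx0 : x ≠ 0 := norm_pos_iff.1 (hδ.trans_le hx)
      refine ⟨1 / x, by rw [mul_one_div_cancel hx0, norm_one], ?_,
        Wdot_eq_of_ne (hc z hz) (h1 z hz) (h3 z hz) hy0 hx0, ?_⟩
      · rw [norm_div, norm_one]; gcongr
      · rw [Coeffs.W, hi]; field_simp; ring
    · refine ⟨0, by simp, by simpa using hδ.le, ?_, ?_⟩
      · rw [Wdot_eq_of_deriv_eq_zero (hc z hz) (h1 z hz) (h3 z hz) hy0 h2 h2', h2, h2']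
        ring
      · rw [Coeffs.W, h2, hi]; field_simp; ring
  have hjD' : ‖j‖ ≤ D := hjD.trans (by rw [hD]; linarith)
  set H := c.H z x y
  set W := c.W z x y
  have hW0 := norm_nonneg W
  have hH0 := norm_nonneg H
  -- `H` is close to `W`
  have hHW : ‖H‖ ≤ ‖W‖ + C * (‖x * i‖ + ‖y * j‖) := by
    have e : H = W - (1 / 2 + deriv c.c2 z / 6 * i) * (x * i)
        - c.c2 z * deriv c.c2 z / 9 * (y * j) := by rw [hWH]; ring
    have n1 : ‖(1 / 2 + deriv c.c2 z / 6 * i) * (x * i)‖ ≤ C * ‖x * i‖ := by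
      rw [norm_mul]
      gcongr
      have : ‖deriv c.c2 z / 6 * i‖ ≤ B / 6 * 1 := by
        rw [norm_mul, norm_div, RCLike.norm_ofNat]; gcongr; exact hBz.d2
      have h12 : ‖(1 / 2 : ℂ)‖ = 1 / 2 := by norm_num
      refine (norm_add_le _ _).trans ?_
      rw [h12, hC, hBa]
      nlinarith [sq_nonneg B]
    have n2 : ‖c.c2 z * deriv c.c2 z / 9 * (y * j)‖ ≤ C * ‖y * j‖ := by
      rw [norm_mul, norm_div, norm_mul, RCLike.norm_ofNat]
      gcongr
      have : ‖c.c2 z‖ * ‖deriv c.c2 z‖ ≤ B * B := by gcongr; exacts [hBz.c2, hBz.d2]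
      rw [hC, hBa]
      nlinarith [sq_nonneg B]
    rw [e]
    refine (norm_sub_le_of_le (norm_sub_le_of_le le_rfl n1) n2).trans (le_of_eq ?_)
    ring
  have hx2 := norm_x_sq_le (x := x) hBz hy le_rfl
  change ‖x‖ ^ 2 ≤ 4 * ‖H‖ + _ at hx2
  have hi2 := hi1.trans (le_max_left _ (1 / δ))
  have hj2 := hjD.trans (le_max_right 1 _)
  have q1 := hKb z hz i j hi2 hj2
  have q2 := b₁ z hz i j hi2 hj2
  have q3 := b₂ z hz i j hi2 hj2
  have q4 := b₃ z hz i j hi2 hj2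
  obtain ⟨hHi, hxi, hHj⟩ := size_bounds (B := B) (C := C) (D := D) hH0 hW0 (norm_nonneg x)
    (norm_nonneg y) (norm_nonneg i) (norm_nonneg j) (zero_le_one.trans hC0)
    (zero_le_one.trans hD1) hi1 hiy hjD' (by rwa [← norm_mul])
    (by rwa [← norm_mul, ← norm_mul]) hx2
  rw [← norm_pow, ← norm_mul] at hHi
  rw [← norm_pow, ← norm_mul, ← norm_mul] at hxi
  rw [← norm_mul] at hHj
  have hS : 0 ≤ ‖y‖ + ‖W‖ := by positivity
  set S := ‖y‖ + ‖W‖ + 1 with hSdef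
  have hE0 : 0 ≤ E := by positivity
  have hHi' : ‖H * i ^ 2‖ ≤ E * S := hHi.trans (by gcongr; linarith [norm_nonneg y])
  have hxi' : ‖x * i ^ 2‖ ≤ (1 + 24 * B ^ 2 + 4 * E) * S := by
    have : (1 + 24 * B ^ 2) * ‖y‖ ≤ (1 + 24 * B ^ 2) * S := by gcongr; linarith
    linarith
  have hHj' : ‖H * j‖ ≤ (D + C + C * D ^ 2) * S := by
    have t1 : D * ‖W‖ ≤ D * S := by gcongr; linarith [norm_nonneg y]
    have t2 : C * 1 ≤ C * S := by gcongr; linarith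
    have t3 : C * D ^ 2 * ‖y‖ ≤ C * D ^ 2 * S := by gcongr; linarith
    linarith
  have hyS : ‖y‖ ≤ S := by linarith
  rw [hWd]
  have t1 : ‖rateY c z i j * y‖ ≤ K * S := by rw [norm_mul]; gcongr
  have t2 : ‖(-1 - 2 / 3 * deriv c.c2 z * i) * (H * i ^ 2)‖ ≤ K₁ * (E * S) := by
    rw [norm_mul]; gcongr
  have t3 : ‖(deriv (deriv c.c2) z - deriv c.c2 z * c.c3 z) / 6 * (x * i ^ 2)‖ ≤
      K₂ * ((1 + 24 * B ^ 2 + 4 * E) * S) := by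
    rw [norm_mul]; gcongr
  have t4 : ‖(deriv c.c2 z / 3 * (1 + c.c2 z * j) - deriv c.c2 z * c.c1 z / 6 * j * i) * (H * j)‖ ≤
      K₃ * ((D + C + C * D ^ 2) * S) := by
    rw [norm_mul]; gcongr
  refine (norm_add_le_of_le (norm_add_le_of_le (norm_add_le_of_le t1 t2) t3) t4).trans (le_of_eq ?_)
  ring

end LogDeriv

/-! ### `W` near the last curves -/

section LogDerivRegions

/-- The normalisation `c₃' = 1`, `c₁' = 0` on a compact set. -/
structure NormalizedOn (c : Coeffs) (P : Set ℂ) : Prop where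
  isCompact : IsCompact P
  analyticAt : ∀ z ∈ P, c.AnalyticAt z
  deriv_c1 : ∀ z ∈ P, deriv c.c1 z = 0
  deriv_c3 : ∀ z ∈ P, deriv c.c3 z = 1

variable {c : Coeffs} {P : Set ℂ}

/-- Two-sided estimates by a quantity `D` for `M = |modifiedH|` pass to `W = |W|`, when the two
functions differ by at most a multiple of `D / v + 1`. -/
theorem transfer_bounds {D v M W C A : ℝ} {n : ℕ} (hn : 2 ≤ n) (hD : 0 ≤ D) (hv : 0 < v)
    (hv1 : v ≤ 1) (hC : 0 ≤ C) (hA : 0 ≤ A) (h1 : D ≤ C * v ^ n * (M + C))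
    (h2 : v ^ n * M ≤ C * (D + v ^ n)) (hd : |M - W| ≤ A * (D / v + 1)) (hs : 2 * C * A * v ≤ 1) :
    D ≤ 2 * C * v ^ n * (W + A + C) ∧ v ^ n * W ≤ (C + A) * (D + v ^ n) := by
  obtain ⟨k, rfl⟩ := Nat.exists_eq_add_of_le' hn
  obtain ⟨d1, d2⟩ := abs_le.1 hd
  have hp : 0 < v ^ (k + 2) := by positivity
  have e : v ^ (k + 2) * (D / v) ≤ v * D := by
    have : v ^ (k + 2) * (D / v) = v ^ k * (v * D) := by field_simp; ring
    rw [this]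
    exact mul_le_of_le_one_left (by positivity) (pow_le_one₀ hv.le hv1)
  constructor
  · have : C * v ^ (k + 2) * M ≤ C * v ^ (k + 2) * (W + A * (D / v + 1)) := by gcongr; linarith
    have e2 : C * A * (v ^ (k + 2) * (D / v)) ≤ C * A * (v * D) := by gcongr
    have e3 : 2 * C * A * v * D ≤ 1 * D := by gcongr
    linarith
  · have : v ^ (k + 2) * W ≤ v ^ (k + 2) * (M + A * (D / v + 1)) := by gcongr; linarith
    have e2 : A * (v ^ (k + 2) * (D / v)) ≤ A * (1 * D) := by
      refine mul_le_mul_of_nonneg_left (e.trans ?_) hA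
      gcongr
    linarith

/-- Along the second cascade, `W` is comparable with `(x - tail) y³`, up to bounded terms. -/
theorem NormalizedOn.exists_W_second_bound (h : NormalizedOn c P) {ρ : ℝ} (hρ : 0 < ρ) :
    ∃ δ C : ℝ, 0 < δ ∧ δ ≤ 1 ∧ 0 < C ∧ ∀ z ∈ P, ∀ x V : ℂ, V ≠ 0 → ‖V‖ ≤ δ → ‖x * V ^ 3‖ ≤ δ →
      (ρ ≤ ‖x‖ ∨ deriv c.c2 z = 0) →
      ‖x - secondTail c z V‖ ≤ C * ‖V‖ ^ 3 * (‖c.W z x (1 / V)‖ + C) ∧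
      ‖V‖ ^ 3 * ‖c.W z x (1 / V)‖ ≤ C * (‖x - secondTail c z V‖ + ‖V‖ ^ 3) := by
  obtain ⟨δ, C, hδ, hδ1, hC, hb⟩ := exists_modifiedH_second_bound h.isCompact h.analyticAt
  obtain ⟨B, hB⟩ := exists_coeffBound h.isCompact h.analyticAt
  obtain ⟨M, hM, hMb⟩ := exists_bound_of_isPolyNear h.isCompact
    (F := fun z _ V => centre c 12 z + V * centre c 13 z)
    (fun z hz => (IsPolyNear.coeff ((h.analyticAt z hz).centre 12)).add
      (.mul .snd (.coeff ((h.analyticAt z hz).centre 13)))) 1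
  set C₁ := 4 * (C + 1) with hC1
  set A := 2 * |B| + 2 * |B| * C + |B| + |B| / ρ * (1 + M) with hA
  have hA0 : 0 ≤ A := by positivity
  have hC10 : 0 < C₁ := by positivity
  refine ⟨min δ (1 / (2 * C₁ * A + 1)), 2 * C₁ + A, lt_min hδ (by positivity),
    (min_le_left _ _).trans hδ1, by positivity, fun z hz x V hV hVδ hx hρx => ?_⟩
  obtain ⟨-, hb⟩ := hb z hz
  obtain ⟨b0, b1, b2⟩ := hb x V hV (hVδ.trans (min_le_left _ _)) (hx.trans (min_le_left _ _))
  have hBz := hB z hz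
  have hBa : |B| = B := abs_of_nonneg (by linarith [hBz.one_le])
  have hB0 : 0 ≤ B := by linarith [hBz.one_le]
  have hV0 : 0 < ‖V‖ := norm_pos_iff.2 hV
  have hV1 : ‖V‖ ≤ 1 := hVδ.trans ((min_le_left _ _).trans hδ1)
  have hm : ‖centre c 12 z + V * centre c 13 z‖ ≤ M := hMb z hz 0 V (by simp) hV1
  set m := centre c 12 z + V * centre c 13 z with hmdef
  set t := secondTail c z V with ht
  -- the terms of order `y` cancel, because `-c₂/3` is the leading term of the tail
  obtain ⟨j, hj, hΔ⟩ : ∃ j : ℂ, ‖j‖ ≤ 1 / ρ ∧ c.W z x (1 / V) - modifiedH c z x (1 / V) =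
      -(deriv c.c2 z / 6 * (x * V ^ 2)) - theta c z * (x * V ^ 4) - muCoeff c z * V
        + deriv c.c2 z / 3 * j * ((x - t) / V + m) := by
    rcases hρx with hρx | h2
    · have hx0 : x ≠ 0 := norm_pos_iff.1 (hρ.trans_le hρx)
      refine ⟨1 / x, by rw [norm_div, norm_one]; gcongr, ?_⟩
      have h11 : centre c 11 z = -c.c2 z / 3 := rfl
      rw [Coeffs.W, modifiedH, corr, ht, secondTail, h11, hmdef, h.deriv_c3 z hz]
      field_simp
      ring
    · refine ⟨0, by simpa using hρ.le, ?_⟩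
      rw [Coeffs.W, modifiedH, corr, h2, h.deriv_c3 z hz]
      field_simp
      ring
  have hxn : ‖x‖ ≤ ‖x - t‖ + C := by
    have := norm_add_le (x - t) t
    rw [sub_add_cancel] at this
    linarith
  set D := ‖x - t‖ with hD
  have hD0 : 0 ≤ D := norm_nonneg _
  have hDV : D ≤ D / ‖V‖ := le_div_self hD0 hV0 hV1
  have hV4 : ‖V‖ ^ 4 ≤ 1 := pow_le_one₀ hV0.le hV1
  have hV2 : ‖V‖ ^ 2 ≤ 1 := pow_le_one₀ hV0.le hV1
  have hd : |‖modifiedH c z x (1 / V)‖ - ‖c.W z x (1 / V)‖| ≤ A * (D / ‖V‖ + 1) := by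
    refine (abs_norm_sub_norm_le _ _).trans ?_
    rw [norm_sub_rev, hΔ]
    have n1 : ‖-(deriv c.c2 z / 6 * (x * V ^ 2))‖ ≤ B / 6 * ((D + C) * 1) := by
      rw [norm_neg, norm_mul, norm_div, norm_mul, norm_pow, RCLike.norm_ofNat]
      gcongr
      exact hBz.d2
    have n2 : ‖theta c z * (x * V ^ 4)‖ ≤ B * ((D + C) * 1) := by
      rw [norm_mul, norm_mul, norm_pow]
      gcongr
      exact hBz.θ
    have n3 : ‖muCoeff c z * V‖ ≤ B * 1 := by
      rw [norm_mul]
      gcongr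
      exact hBz.μ
    have n4 : ‖deriv c.c2 z / 3 * j * ((x - t) / V + m)‖ ≤ B / 3 * (1 / ρ) * (D / ‖V‖ + M) := by
      rw [norm_mul, norm_mul, norm_div, RCLike.norm_ofNat]
      gcongr
      · exact hBz.d2
      · refine (norm_add_le _ _).trans ?_
        rw [norm_div]
        gcongr
    refine (norm_add_le_of_le (norm_sub_le_of_le (norm_sub_le_of_le n1 n2) n3) n4).trans ?_
    rw [hA, hBa]
    set q := D / ‖V‖
    have hq0 : 0 ≤ q := hD0.trans hDV
    have p1 : B * D ≤ B * q := by gcongr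
    have p2 : B / 3 * (1 / ρ) * (q + M) = B / ρ * (q + M) / 3 := by ring
    have p3 : 0 ≤ B / ρ * (q + M) := by positivity
    have p4 : B / ρ * (q + M) ≤ B / ρ * (1 + M) * (q + 1) := by
      rw [mul_assoc]; gcongr; nlinarith [mul_nonneg hM hq0]
    have p5 : 0 ≤ B * C := by positivity
    have p6 : 0 ≤ B * C * q := by positivity
    have p7 : 0 ≤ B * q := by positivity
    rw [p2]
    linarith
  have hs : 2 * C₁ * A * ‖V‖ ≤ 1 := by
    have h1 : ‖V‖ ≤ 1 / (2 * C₁ * A + 1) := hVδ.trans (min_le_right _ _)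
    rw [le_div_iff₀ (by positivity)] at h1
    linarith
  have hV3 : 0 < ‖V‖ ^ 3 := by positivity
  obtain ⟨r1, r2⟩ := transfer_bounds (n := 3) (by norm_num) hD0 hV0 hV1 hC10.le hA0
    (b1.trans (by
      have := norm_nonneg (modifiedH c z x (1 / V))
      rw [mul_assoc, mul_assoc]
      gcongr <;> linarith))
    (b2.trans (by
      rw [hC1, mul_assoc]
      gcongr 4 * ?_
      nlinarith [mul_nonneg hC hD0])) hd hs
  have hW0 := norm_nonneg (c.W z x (1 / V))
  refine ⟨r1.trans ?_, r2.trans ?_⟩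
  · exact mul_le_mul (mul_le_mul_of_nonneg_right (by linarith) (by positivity)) (by linarith)
      (by linarith) (by positivity)
  · gcongr; linarith

/-- Along the first cascade, `W` is comparable with `(K - tail) V⁻⁶`, up to bounded terms, where
`K = x/y³` and `V = y²/x`. -/
theorem NormalizedOn.exists_W_first_bound (h : NormalizedOn c P) :
    ∃ δ C : ℝ, 0 < δ ∧ δ ≤ 1 ∧ 0 < C ∧ ∀ z ∈ P, ∀ K V : ℂ, V ≠ 0 → ‖V‖ ≤ δ → ‖K - 2‖ ≤ 1 →
      ‖K - firstTail c z V‖ ≤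
        C * ‖V‖ ^ 6 * (‖c.W z (1 / (K ^ 2 * V ^ 3)) (1 / (K * V))‖ + C) ∧
      ‖V‖ ^ 6 * ‖c.W z (1 / (K ^ 2 * V ^ 3)) (1 / (K * V))‖ ≤
        C * (‖K - firstTail c z V‖ + ‖V‖ ^ 6) := by
  obtain ⟨δ, C, hδ, hδ1, hC, hb⟩ := exists_modifiedH_first_bound h.isCompact h.analyticAt
  obtain ⟨B, hB⟩ := exists_coeffBound h.isCompact h.analyticAt
  set A := |B| * C + |B| ^ 2 + 12 * |B| + |B| with hA
  have hA0 : 0 ≤ A := by positivity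
  refine ⟨min δ (1 / (2 * C * A + 1)), 2 * C + A, lt_min hδ (by positivity),
    (min_le_left _ _).trans hδ1, by positivity, fun z hz K V hV hVδ hK => ?_⟩
  obtain ⟨b0, b1, b2⟩ := hb z hz K V hV (hVδ.trans (min_le_left _ _)) hK
  have hBz := hB z hz
  have hBa : |B| = B := abs_of_nonneg (by linarith [hBz.one_le])
  have hB0 : 0 ≤ B := by linarith [hBz.one_le]
  have hV0 : 0 < ‖V‖ := norm_pos_iff.2 hV
  have hV1 : ‖V‖ ≤ 1 := hVδ.trans ((min_le_left _ _).trans hδ1)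
  have hK3 : ‖K‖ ≤ 3 := by
    have := norm_add_le (K - 2) 2
    rw [sub_add_cancel, RCLike.norm_ofNat] at this; linarith
  have hK1 : 1 ≤ ‖K‖ := by
    have := norm_sub_le (K - 2) K
    rw [sub_sub_cancel_left, norm_neg, RCLike.norm_ofNat] at this; linarith
  have hK0 : K ≠ 0 := norm_pos_iff.1 (by linarith)
  set S := firstTail c z V with hS
  set x := 1 / (K ^ 2 * V ^ 3) with hx
  set y := 1 / (K * V) with hy
  -- the terms of order `1/V` cancel, because `K` is close to `2`
  have hΔ : c.W z x y - modifiedH c z x y = -(deriv c.c2 z / 6 * ((K - 2) / (K * V)))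
      + c.c2 z * deriv c.c2 z / 9 * (K * V ^ 2) - theta c z * (K ^ 2 * V) - muCoeff c z * (K * V) := by
    rw [Coeffs.W, modifiedH, corr, h.deriv_c3 z hz, hx, hy]
    field_simp
    ring
  set D := ‖K - S‖ with hD
  have hD0 : 0 ≤ D := norm_nonneg _
  have hK2 : ‖K - 2‖ ≤ D + C * ‖V‖ ^ 2 := by
    have := norm_add_le (K - S) (S - 2)
    rw [sub_add_sub_cancel] at this
    linarith
  have hV2 : ‖V‖ ^ 2 ≤ 1 := pow_le_one₀ hV0.le hV1
  have hd : |‖modifiedH c z x y‖ - ‖c.W z x y‖| ≤ A * (D / ‖V‖ + 1) := by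
    refine (abs_norm_sub_norm_le _ _).trans ?_
    rw [norm_sub_rev, hΔ]
    have n1 : ‖-(deriv c.c2 z / 6 * ((K - 2) / (K * V)))‖ ≤ B / 6 * (D / ‖V‖ + C) := by
      rw [norm_neg, norm_mul, norm_div, norm_div, norm_mul, RCLike.norm_ofNat]
      gcongr
      · exact hBz.d2
      · rw [div_le_iff₀ (by positivity)]
        have e1 : (D / ‖V‖ + C) * (‖K‖ * ‖V‖) = (D + C * ‖V‖) * ‖K‖ := by field_simp
        rw [e1]
        have e2 : C * ‖V‖ ^ 2 ≤ C * ‖V‖ := by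
          gcongr; exact pow_le_of_le_one hV0.le hV1 (by norm_num)
        have e3 : (D + C * ‖V‖) * 1 ≤ (D + C * ‖V‖) * ‖K‖ := by gcongr
        linarith
    have n2 : ‖c.c2 z * deriv c.c2 z / 9 * (K * V ^ 2)‖ ≤ B * B / 9 * (3 * 1) := by
      rw [norm_mul, norm_div, norm_mul, norm_mul, norm_pow, RCLike.norm_ofNat]
      gcongr
      exacts [hBz.c2, hBz.d2]
    have n3 : ‖theta c z * (K ^ 2 * V)‖ ≤ B * (3 ^ 2 * 1) := by
      rw [norm_mul, norm_mul, norm_pow]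
      gcongr
      exact hBz.θ
    have n4 : ‖muCoeff c z * (K * V)‖ ≤ B * (3 * 1) := by
      rw [norm_mul, norm_mul]
      gcongr
      exact hBz.μ
    refine (norm_sub_le_of_le (norm_sub_le_of_le (norm_add_le_of_le n1 n2) n3) n4).trans ?_
    rw [hA, hBa]
    set q := D / ‖V‖
    have hq0 : 0 ≤ q := by positivity
    have p1 : 0 ≤ B * q := by positivity
    have p2 : 0 ≤ (B * C + B ^ 2 + 12 * B) * q := by positivity
    have p3 : 0 ≤ B * C := by positivity
    have p4 := sq_nonneg B
    linarith
  have hs : 2 * C * A * ‖V‖ ≤ 1 := by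
    have h1 : ‖V‖ ≤ 1 / (2 * C * A + 1) := hVδ.trans (min_le_right _ _)
    rw [le_div_iff₀ (by positivity)] at h1
    linarith
  obtain ⟨r1, r2⟩ := transfer_bounds (n := 6) (by norm_num) hD0 hV0 hV1 (by linarith) hA0
    (b1.trans (by gcongr)) b2 hd hs
  have hW0 := norm_nonneg (c.W z x y)
  refine ⟨r1.trans ?_, r2.trans ?_⟩
  · exact mul_le_mul (mul_le_mul_of_nonneg_right (by linarith) (by positivity)) (by linarith)
      (by linarith) (by positivity)
  · gcongr; linarith

end LogDerivRegions

/-! ### Regions where `W` becomes infinite -/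

section BlowUpRegions

variable {c : Coeffs} {P : Set ℂ} {α : Type*} {l : Filter α} {Z X Y : α → ℂ}

/-- Along the filter `l` of points `(Z, X, Y)`, the function `W` tends to infinity and its
logarithmic derivative along the flow stays bounded. -/
def WBlowsUp (c : Coeffs) (l : Filter α) (Z X Y : α → ℂ) : Prop :=
  Tendsto (fun a => ‖c.W (Z a) (X a) (Y a)‖) l atTop ∧
    ∃ K : ℝ, ∀ᶠ a in l, ‖c.Wdot (Z a) (X a) (Y a) / c.W (Z a) (X a) (Y a)‖ ≤ K

theorem WBlowsUp.congr {X' Y' : α → ℂ} (h : WBlowsUp c l Z X' Y') (hX : X =ᶠ[l] X')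
    (hY : Y =ᶠ[l] Y') : WBlowsUp c l Z X Y := by
  obtain ⟨h1, K, h2⟩ := h
  refine ⟨h1.congr' ?_, K, ?_⟩
  · filter_upwards [hX, hY] with a hx hy
    rw [hx, hy]
  · filter_upwards [hX, hY, h2] with a hx hy h
    rwa [hx, hy]

/-- Where `|y| → ∞` and `|W|` is at least of the order of `|y|`, the derivative of `W` along the
flow is at most of the order of `|W|`. -/
theorem NormalizedOn.wBlowsUp (h : NormalizedOn c P) (hZ : ∀ᶠ a in l, Z a ∈ P)
    (hY : Tendsto (fun a => ‖Y a‖) l atTop) {ρ ε A : ℝ} (hρ : 0 < ρ) (hε : 0 < ε)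
    (hx : ∀ᶠ a in l, ρ ≤ ‖X a‖ ∨ (deriv c.c2 (Z a) = 0 ∧ deriv (deriv c.c2) (Z a) = 0))
    (hW : ∀ᶠ a in l, ε * ‖Y a‖ - A ≤ ‖c.W (Z a) (X a) (Y a)‖) : WBlowsUp c l Z X Y := by
  have hW' : ∀ᶠ a in l, ε / 2 * ‖Y a‖ ≤ ‖c.W (Z a) (X a) (Y a)‖ := by
    filter_upwards [hW, hY.eventually_ge_atTop (2 * A / ε)] with a h1 h2
    rw [div_le_iff₀ hε] at h2
    linarith
  refine ⟨tendsto_atTop_mono' l hW' (hY.const_mul_atTop (by positivity)), ?_⟩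
  obtain ⟨K, hK, hb⟩ :=
    exists_Wdot_bound h.isCompact h.analyticAt h.deriv_c1 h.deriv_c3 hρ
  refine ⟨K * (4 / ε + 1), ?_⟩
  filter_upwards [hZ, hx, hW', hY.eventually_ge_atTop 1] with a hz hx hW hy
  have hW0 : 0 < ‖c.W (Z a) (X a) (Y a)‖ := (by positivity : 0 < ε / 2 * ‖Y a‖).trans_le hW
  rw [norm_div, div_le_iff₀ hW0]
  refine (hb _ hz _ _ hy hx).trans ?_
  rw [mul_assoc]
  gcongr
  have : ‖Y a‖ ≤ 2 / ε * ‖c.W (Z a) (X a) (Y a)‖ := by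
    calc ‖Y a‖ = 2 / ε * (ε / 2 * ‖Y a‖) := by field_simp
      _ ≤ _ := by gcongr
  calc _ ≤ 2 * ‖Y a‖ + ‖c.W (Z a) (X a) (Y a)‖ := by linarith
    _ ≤ 2 * (2 / ε * ‖c.W (Z a) (X a) (Y a)‖) + ‖c.W (Z a) (X a) (Y a)‖ := by gcongr
    _ = _ := by ring

theorem tendsto_norm_inv_atTop {V : α → ℂ} (hV : Tendsto V l (𝓝 0)) (hV0 : ∀ᶠ a in l, V a ≠ 0) :
    Tendsto (fun a => ‖1 / V a‖) l atTop := by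
  have : Tendsto V l (𝓝[≠] 0) := tendsto_nhdsWithin_iff.2 ⟨hV, hV0⟩
  simp only [one_div]
  exact (tendsto_norm_cobounded_atTop.comp tendsto_inv₀_nhdsNE_zero).comp this

theorem continuousAt_comp_fst {f : ℂ → ℂ} {z u v : ℂ} (hf : _root_.AnalyticAt ℂ f z) :
    ContinuousAt (fun p : ℂ × ℂ × ℂ => f p.1) (z, u, v) :=
  ((IsPolyNear.coeff hf).analyticAt u v).continuousAt

theorem NormalizedOn.wBlowsUp_second (h : NormalizedOn c P) {V : α → ℂ}
    (hZ : ∀ᶠ a in l, Z a ∈ P) (hV : Tendsto V l (𝓝 0)) (hV0 : ∀ᶠ a in l, V a ≠ 0)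
    (hXV : Tendsto (fun a => X a * V a ^ 3) l (𝓝 0)) {ρ ε : ℝ} (hρ : 0 < ρ) (hε : 0 < ε)
    (hx : ∀ᶠ a in l, ρ ≤ ‖X a‖ ∨ (deriv c.c2 (Z a) = 0 ∧ deriv (deriv c.c2) (Z a) = 0))
    (hD : ∀ᶠ a in l, ε * ‖V a‖ ^ 2 ≤ ‖X a - secondTail c (Z a) (V a)‖) :
    WBlowsUp c l Z X fun a => 1 / V a := by
  obtain ⟨δ, C, hδ, -, hC, hb⟩ := h.exists_W_second_bound hρ
  refine h.wBlowsUp (A := C) (ε := ε / C) hZ (tendsto_norm_inv_atTop hV hV0) hρ (by positivity) hx ?_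
  filter_upwards [hZ, hV0, hD, hx, hV.norm.eventually_le_const (by simpa using hδ),
    hXV.norm.eventually_le_const (by simpa using hδ)] with a hz h0 hD hx hVδ hXδ
  have hn : 0 < ‖V a‖ := norm_pos_iff.2 h0
  have h1 := hD.trans (hb _ hz _ _ h0 hVδ hXδ (hx.imp_right And.left)).1
  rw [norm_div, norm_one, sub_le_iff_le_add, div_mul_div_comm, mul_one, div_le_iff₀ (by positivity)]
  refine le_of_mul_le_mul_right ?_ (pow_pos hn 2)
  calc _ ≤ _ := h1
    _ = _ := by ring

theorem NormalizedOn.wBlowsUp_first (h : NormalizedOn c P) {K V : α → ℂ}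
    (hZ : ∀ᶠ a in l, Z a ∈ P) (hV : Tendsto V l (𝓝 0)) (hV0 : ∀ᶠ a in l, V a ≠ 0)
    (hK : Tendsto K l (𝓝 2)) {ε : ℝ} (hε : 0 < ε)
    (hD : ∀ᶠ a in l, ε * ‖V a‖ ^ 5 ≤ ‖K a - firstTail c (Z a) (V a)‖) :
    WBlowsUp c l Z (fun a => 1 / (K a ^ 2 * V a ^ 3)) fun a => 1 / (K a * V a) := by
  obtain ⟨δ, C, hδ, -, hC, hb⟩ := h.exists_W_first_bound
  have hK0 : ∀ᶠ a in l, K a ≠ 0 := hK.eventually_ne two_ne_zero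
  have hKs : ∀ᶠ a in l, ‖K a - 2‖ ≤ 1 :=
    (hK.sub_const 2).norm.eventually_le_const (by simp)
  have hKn : ∀ᶠ a in l, 1 ≤ ‖K a‖ ∧ ‖K a‖ ≤ 3 := by
    filter_upwards [hKs] with a ha
    have h1 := norm_sub_le (K a - 2) (K a)
    have h2 := norm_add_le (K a - 2) 2
    rw [sub_sub_cancel_left, norm_neg, RCLike.norm_ofNat] at h1
    rw [sub_add_cancel, RCLike.norm_ofNat] at h2
    exact ⟨by linarith, by linarith⟩
  have hV1 : ∀ᶠ a in l, ‖V a‖ ≤ 1 := hV.norm.eventually_le_const (by simp)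
  refine h.wBlowsUp (A := C) (ε := ε / C) (ρ := 1 / 9) hZ (tendsto_norm_inv_atTop ?_ ?_)
    (by norm_num) (by positivity) ?_ ?_
  · simpa using hK.mul hV
  · filter_upwards [hK0, hV0] with a h1 h2 using mul_ne_zero h1 h2
  · filter_upwards [hKn, hV1, hV0] with a h1 h2 h3
    have hn : 0 < ‖V a‖ := norm_pos_iff.2 h3
    refine .inl ?_
    rw [norm_div, norm_one, norm_mul, norm_pow, norm_pow]
    gcongr
    · have := h1.1; positivity
    · have e1 : ‖K a‖ ^ 2 ≤ 3 ^ 2 := by gcongr; exact h1.2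
      have e2 : ‖V a‖ ^ 3 ≤ 1 := pow_le_one₀ hn.le h2
      calc _ ≤ (3 ^ 2 : ℝ) * 1 := by gcongr
        _ = 9 := by norm_num
  filter_upwards [hZ, hV0, hD, hKn, hKs, hV.norm.eventually_le_const (by simpa using hδ)]
    with a hz h0 hD hKn hKs hVδ
  have hn : 0 < ‖V a‖ := norm_pos_iff.2 h0
  have h1 := hD.trans (hb _ hz _ _ h0 hVδ hKs).1
  have h2 : ε / C * ‖1 / (K a * V a)‖ ≤ ε / C * (1 / ‖V a‖) := by
    rw [norm_div, norm_one, norm_mul]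
    gcongr
    exact le_mul_of_one_le_left hn.le hKn.1
  refine (sub_le_sub_right h2 C).trans ?_
  rw [sub_le_iff_le_add, div_mul_div_comm, mul_one, div_le_iff₀ (by positivity)]
  refine le_of_mul_le_mul_right ?_ (pow_pos hn 5)
  calc _ ≤ _ := h1
    _ = _ := by ring

/-- Where `y³/x` has a limit other than `1/2` and `|y| → ∞`, the leading term of `W` is
`x² (1/2 - y³/x)`. -/
theorem NormalizedOn.wBlowsUp_of_cubic (h : NormalizedOn c P) {q i : α → ℂ} {z q₀ : ℂ} (hz : z ∈ P)
    (hZ : ∀ᶠ a in l, Z a ∈ P) (hZz : Tendsto Z l (𝓝 z)) (hi : Tendsto i l (𝓝 0))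
    (hi0 : ∀ᶠ a in l, i a ≠ 0) (hq : Tendsto q l (𝓝 q₀)) (hqn : ∀ᶠ a in l, q a ≠ 0)
    (hq0 : q₀ ≠ 1 / 2) : WBlowsUp c l Z (fun a => 1 / (q a * i a ^ 3)) fun a => 1 / i a := by
  have hc := h.analyticAt z hz
  -- `Φ` is `W / x²` as a function of `z`, `1/y` and `y³/x`.
  set Φ : ℂ × ℂ × ℂ → ℂ := fun p => 1 / 2 - (p.2.2 + c.c3 p.1 * p.2.2 * p.2.1 ^ 2)
    - c.c2 p.1 / 3 * p.2.2 ^ 2 * p.2.1 ^ 3 - c.c1 p.1 / 2 * p.2.2 ^ 2 * p.2.1 ^ 4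
    - c.c0 p.1 * p.2.2 ^ 2 * p.2.1 ^ 5 + 1 / 2 * p.2.2 * p.2.1 ^ 4
    + deriv c.c2 p.1 / 6 * p.2.2 * p.2.1 ^ 5
    + c.c2 p.1 * deriv c.c2 p.1 / 9 * p.2.2 ^ 3 * p.2.1 ^ 8 with hΦ
  have hcont : ContinuousAt Φ (z, 0, q₀) := by
    have k0 : ContinuousAt (fun p : ℂ × ℂ × ℂ => c.c0 p.1) (z, 0, q₀) :=
      continuousAt_comp_fst hc.c0
    have k1 : ContinuousAt (fun p : ℂ × ℂ × ℂ => c.c1 p.1) (z, 0, q₀) :=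
      continuousAt_comp_fst hc.c1
    have k2 : ContinuousAt (fun p : ℂ × ℂ × ℂ => c.c2 p.1) (z, 0, q₀) :=
      continuousAt_comp_fst hc.c2
    have k3 : ContinuousAt (fun p : ℂ × ℂ × ℂ => c.c3 p.1) (z, 0, q₀) :=
      continuousAt_comp_fst hc.c3
    have k4 : ContinuousAt (fun p : ℂ × ℂ × ℂ => deriv c.c2 p.1) (z, 0, q₀) :=
      continuousAt_comp_fst hc.c2.deriv
    fun_prop
  have hlim : Tendsto (fun a => Φ (Z a, i a, q a)) l (𝓝 (1 / 2 - q₀)) := by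
    have : Φ (z, 0, q₀) = 1 / 2 - q₀ := by simp [hΦ]
    rw [← this]
    exact hcont.tendsto.comp (hZz.prodMk_nhds (hi.prodMk_nhds hq))
  have hne : (1 / 2 - q₀) ≠ 0 := sub_ne_zero.2 hq0.symm
  have hpos : 0 < ‖1 / 2 - q₀‖ := norm_pos_iff.2 hne
  have hqb : ∀ᶠ a in l, ‖q a‖ ≤ ‖q₀‖ + 1 := hq.norm.eventually_le_const (by linarith)
  have hi1 : ∀ᶠ a in l, ‖i a‖ ≤ 1 := hi.norm.eventually_le_const (by simp)
  refine h.wBlowsUp (A := 0) (ρ := 1 / (‖q₀‖ + 1)) (ε := ‖1 / 2 - q₀‖ / 2 / (‖q₀‖ + 1) ^ 2) hZ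
    (tendsto_norm_inv_atTop hi hi0) (by positivity) (by positivity) ?_ ?_
  · filter_upwards [hqb, hqn, hi0, hi1] with a h1 h2 h3 h4
    have hn : 0 < ‖i a‖ := norm_pos_iff.2 h3
    have hqn : 0 < ‖q a‖ := norm_pos_iff.2 h2
    refine .inl ?_
    rw [norm_div, norm_one, norm_mul, norm_pow]
    gcongr
    calc ‖q a‖ * ‖i a‖ ^ 3 ≤ (‖q₀‖ + 1) * 1 := by gcongr; exact pow_le_one₀ hn.le h4
      _ = _ := mul_one _
  · filter_upwards [hlim.norm.eventually_const_le (half_lt_self hpos), hqb, hqn, hi0, hi1]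
      with a h0 h1 h2 h3 h4
    have hn : 0 < ‖i a‖ := norm_pos_iff.2 h3
    have hqn : 0 < ‖q a‖ := norm_pos_iff.2 h2
    have e : c.W (Z a) (1 / (q a * i a ^ 3)) (1 / i a)
        = Φ (Z a, i a, q a) / (q a ^ 2 * i a ^ 6) := by
      rw [hΦ, Coeffs.W, Coeffs.H]
      field_simp
    rw [e, sub_zero, norm_div, norm_div, norm_one, norm_mul, norm_pow, norm_pow, div_mul_div_comm,
      mul_one]
    gcongr
    exact pow_le_of_le_one hn.le h4 (by norm_num)

/-- Where `|x| → ∞` and `y` has a finite limit, `W` and its derivative along the flow are both of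
the order of `x²`. -/
theorem wBlowsUp_of_x {z y₀ : ℂ} (hc : ∀ᶠ w in 𝓝 z, c.AnalyticAt w) {j : α → ℂ}
    (hZz : Tendsto Z l (𝓝 z)) (hY : Tendsto Y l (𝓝 y₀)) (hy0 : y₀ ≠ 0) (hj : Tendsto j l (𝓝 0))
    (hj0 : ∀ᶠ a in l, j a ≠ 0) : WBlowsUp c l Z (fun a => 1 / j a) Y := by
  have hcz := hc.self_of_nhds
  -- `Φ` and `Ψ` are `W / x²` and `W' / x²` as functions of `z`, `y` and `1/x`.
  set Φ : ℂ × ℂ × ℂ → ℂ := fun p => 1 / 2 - p.2.2 * (p.2.1 ^ 3 + c.c3 p.1 * p.2.1)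
    - p.2.2 ^ 2 * (c.c2 p.1 / 3 * p.2.1 ^ 3 + c.c1 p.1 / 2 * p.2.1 ^ 2 + c.c0 p.1 * p.2.1)
    + 1 / 2 * (p.2.2 / p.2.1) + deriv c.c2 p.1 / 6 * (p.2.2 / p.2.1 ^ 2)
    + c.c2 p.1 * deriv c.c2 p.1 / 9 * p.2.1 * p.2.2 ^ 3 with hΦ
  set Ψ : ℂ × ℂ × ℂ → ℂ := fun p => p.2.2 * (-(deriv c.c3 p.1 * p.2.1)
      + deriv (deriv c.c2) p.1 / 6 / p.2.1 ^ 2)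
    + p.2.2 ^ 2 * (-(deriv c.c2 p.1 / 3 * p.2.1 ^ 3) - deriv c.c1 p.1 / 2 * p.2.1 ^ 2
      - deriv c.c0 p.1 * p.2.1)
    + (deriv c.c2 p.1 * deriv c.c2 p.1 + c.c2 p.1 * deriv (deriv c.c2) p.1) / 9 * p.2.1 * p.2.2 ^ 3
    + (3 * p.2.1 ^ 2 + c.c3 p.1 + p.2.2 * (c.c2 p.1 * p.2.1 ^ 2 + c.c1 p.1 * p.2.1 + c.c0 p.1))
      * (1 - p.2.2 * (p.2.1 ^ 3 + c.c3 p.1 * p.2.1) + 1 / 2 * (p.2.2 / p.2.1)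
        + deriv c.c2 p.1 / 6 * (p.2.2 / p.2.1 ^ 2)
        - c.c2 p.1 * deriv c.c2 p.1 / 9 * p.2.1 * p.2.2 ^ 3)
    + (1 - p.2.2 * (p.2.1 ^ 3 + c.c3 p.1 * p.2.1)) * (-(3 * p.2.1 ^ 2 + c.c3 p.1)
      - p.2.2 * (c.c2 p.1 * p.2.1 ^ 2 + c.c1 p.1 * p.2.1 + c.c0 p.1) - 1 / 2 / p.2.1 ^ 2
      - deriv c.c2 p.1 / 3 / p.2.1 ^ 3 + c.c2 p.1 * deriv c.c2 p.1 / 9 * p.2.2 ^ 2) with hΨ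
  have hcont : ContinuousAt Φ (z, y₀, 0) ∧ ContinuousAt Ψ (z, y₀, 0) := by
    have k0 : ContinuousAt (fun p : ℂ × ℂ × ℂ => c.c0 p.1) (z, y₀, 0) :=
      continuousAt_comp_fst hcz.c0
    have k1 : ContinuousAt (fun p : ℂ × ℂ × ℂ => c.c1 p.1) (z, y₀, 0) :=
      continuousAt_comp_fst hcz.c1
    have k2 : ContinuousAt (fun p : ℂ × ℂ × ℂ => c.c2 p.1) (z, y₀, 0) :=
      continuousAt_comp_fst hcz.c2
    have k3 : ContinuousAt (fun p : ℂ × ℂ × ℂ => c.c3 p.1) (z, y₀, 0) :=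
      continuousAt_comp_fst hcz.c3
    have d0 : ContinuousAt (fun p : ℂ × ℂ × ℂ => deriv c.c0 p.1) (z, y₀, 0) :=
      continuousAt_comp_fst hcz.c0.deriv
    have d1 : ContinuousAt (fun p : ℂ × ℂ × ℂ => deriv c.c1 p.1) (z, y₀, 0) :=
      continuousAt_comp_fst hcz.c1.deriv
    have d2 : ContinuousAt (fun p : ℂ × ℂ × ℂ => deriv c.c2 p.1) (z, y₀, 0) :=
      continuousAt_comp_fst hcz.c2.deriv
    have d3 : ContinuousAt (fun p : ℂ × ℂ × ℂ => deriv c.c3 p.1) (z, y₀, 0) :=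
      continuousAt_comp_fst hcz.c3.deriv
    have e2 : ContinuousAt (fun p : ℂ × ℂ × ℂ => deriv (deriv c.c2) p.1) (z, y₀, 0) :=
      continuousAt_comp_fst hcz.c2.deriv.deriv
    constructor <;> fun_prop (disch := simp [hy0])
  have ht : Tendsto (fun a => (Z a, Y a, j a)) l (𝓝 (z, y₀, 0)) :=
    hZz.prodMk_nhds (hY.prodMk_nhds hj)
  have hlim : Tendsto (fun a => Φ (Z a, Y a, j a)) l (𝓝 (1 / 2)) := by
    have : Φ (z, y₀, 0) = 1 / 2 := by simp [hΦ]
    rw [← this]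
    exact hcont.1.tendsto.comp ht
  have hlim2 := hcont.2.tendsto.comp ht
  have hYne : ∀ᶠ a in l, Y a ≠ 0 := hY.eventually_ne hy0
  have hW : ∀ᶠ a in l, c.W (Z a) (1 / j a) (Y a) = Φ (Z a, Y a, j a) * (1 / j a) ^ 2 := by
    filter_upwards [hYne, hj0] with a h1 h2
    rw [hΦ, Coeffs.W, Coeffs.H]
    field_simp
    ring
  have hWd : ∀ᶠ a in l, c.Wdot (Z a) (1 / j a) (Y a) = Ψ (Z a, Y a, j a) * (1 / j a) ^ 2 := by
    filter_upwards [hYne, hj0, hZz.eventually hc] with a h1 h2 h3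
    rw [hΨ, Wdot_eq h3 h1 (.inl (one_div_ne_zero h2)), xdot_eq, ydot_eq]
    field_simp
    ring
  constructor
  · have h1 := (tendsto_norm_inv_atTop hj hj0)
    have h2 : Tendsto (fun a => ‖Φ (Z a, Y a, j a)‖ * ‖1 / j a‖ ^ 2) l atTop :=
      hlim.norm.pos_mul_atTop (by norm_num)
        ((tendsto_pow_atTop two_ne_zero).comp h1)
    refine h2.congr' ?_
    filter_upwards [hW] with a ha
    rw [ha, norm_mul, norm_pow]
  · refine ⟨‖Ψ (z, y₀, 0) / (1 / 2)‖ + 1, ?_⟩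
    have h1 := (hlim2.div hlim (by norm_num)).norm.eventually_le_const
      (lt_add_one ‖Ψ (z, y₀, 0) / (1 / 2)‖)
    filter_upwards [hW, hWd, hj0, h1] with a h1 h2 h3 h4
    rw [h1, h2, mul_div_mul_right _ _ (pow_ne_zero 2 (one_div_ne_zero h3))]
    exact h4

end BlowUpRegions

/-! ### `W` at the intermediate curves -/

section BlowUpCharts

variable {c : Coeffs} {P : Set ℂ} {α : Type*} {l : Filter α} {Z X Y u v : α → ℂ} {z u₀ v₀ : ℂ}

/-- The case of `NormalizedOn.wBlowsUp_second` where moreover `|x| → ∞`. -/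
theorem NormalizedOn.wBlowsUp_second_of_atTop (h : NormalizedOn c P) {V : α → ℂ}
    (hz : z ∈ P) (hZ : ∀ᶠ a in l, Z a ∈ P) (hZz : Tendsto Z l (𝓝 z)) (hV : Tendsto V l (𝓝 0))
    (hV0 : ∀ᶠ a in l, V a ≠ 0) (hXV : Tendsto (fun a => X a * V a ^ 3) l (𝓝 0))
    (hX : Tendsto (fun a => ‖X a‖) l atTop) (hY : ∀ᶠ a in l, Y a * V a = 1) :
    WBlowsUp c l Z X Y := by
  have hc := h.analyticAt z hz
  have ht : Tendsto (fun a => secondTail c (Z a) (V a)) l (𝓝 (centre c 11 z)) := by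
    have e := tendsto_cascTail (a := secondCentre c) (fun j => hc.centre (10 + j)) 2 1 hZz hV
    refine e.congr fun a => ?_
    have h1 : secondCentre c 1 (Z a) = centre c 11 (Z a) := rfl
    have h2 : secondCentre c 2 (Z a) = centre c 12 (Z a) := rfl
    have h3 : secondCentre c 3 (Z a) = centre c 13 (Z a) := rfl
    simp only [cascTail, secondTail, h1, h2, h3, mul_zero, add_zero]
  refine (h.wBlowsUp_second (ρ := 1) (ε := 1) hZ hV hV0 hXV one_pos one_pos
    ((hX.eventually_ge_atTop 1).mono fun a ha => .inl ha) ?_).congr .rfl ?_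
  · filter_upwards [hX.eventually_ge_atTop (‖centre c 11 z‖ + 1 + 1), hV.norm.eventually_le_const
      (show ‖(0 : ℂ)‖ < 1 by simp), ht.norm.eventually_le_const (lt_add_one _)] with a h1 h2 h3
    have h4 := norm_sub_norm_le (X a) (secondTail c (Z a) (V a))
    have h5 : ‖V a‖ ^ 2 ≤ 1 := pow_le_one₀ (norm_nonneg _) h2
    linarith
  · filter_upwards [hV0, hY] with a h1 h2
    rw [eq_div_iff h1, h2]

theorem tendsto_div_zero {f g : α → ℂ} {b : ℂ} (hf : Tendsto f l (𝓝 0)) (hg : Tendsto g l (𝓝 b))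
    (hb : b ≠ 0) : Tendsto (fun a => f a / g a) l (𝓝 0) := by
  have := hf.div hg hb
  rwa [zero_div] at this

theorem norm_atTop_of_mul_eq_one {p : α → ℂ} (hp : Tendsto p l (𝓝 0))
    (h : ∀ᶠ a in l, X a * p a = 1) : Tendsto (fun a => ‖X a‖) l atTop := by
  have hp0 : ∀ᶠ a in l, p a ≠ 0 := h.mono fun a ha => right_ne_zero_of_mul_eq_one ha
  refine (tendsto_norm_inv_atTop hp hp0).congr' ?_
  filter_upwards [h, hp0] with a h1 h2
  rw [← h1, mul_div_cancel_right₀ _ h2]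

/-- `W` blows up where the first two charts at infinity, or the charts of the first three blow-ups,
have a point at infinity that is not a base point. -/
theorem NormalizedOn.wBlowsUp_chartu0 (h : NormalizedOn c P) (hz : z ∈ P)
    (hZ : ∀ᶠ a in l, Z a ∈ P) (hZz : Tendsto Z l (𝓝 z)) (hu : Tendsto u l (𝓝 0))
    (hv : Tendsto v l (𝓝 v₀)) (hv0 : v₀ ≠ 0)
    (ho : ∀ᶠ a in l, IsOver (chartu0 c) (Z a) (u a) (v a) (X a) (Y a)) : WBlowsUp c l Z X Y := by
  have ho : ∀ᶠ a in l, u a ≠ 0 ∧ X a * u a = 1 ∧ Y a * u a = v a := ho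
  refine h.wBlowsUp_second_of_atTop (V := fun a => u a / v a) hz hZ hZz ?_ ?_ ?_
    (norm_atTop_of_mul_eq_one hu (ho.mono fun a ha => ha.2.1)) ?_
  · exact tendsto_div_zero hu hv hv0
  · filter_upwards [ho, hv.eventually_ne hv0] with a h1 h2 using div_ne_zero h1.1 h2
  · have e : Tendsto (fun a => u a ^ 2 / v a ^ 3) l (𝓝 0) :=
      tendsto_div_zero (by simpa using hu.pow 2) (hv.pow 3) (pow_ne_zero 3 hv0)
    refine e.congr' ?_
    filter_upwards [ho] with a h1
    have : X a * (u a / v a) ^ 3 = (X a * u a) * (u a ^ 2 / v a ^ 3) := by ring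
    rw [this, h1.2.1, one_mul]
  · filter_upwards [ho, hv.eventually_ne hv0] with a h1 h2
    rw [← mul_div_assoc, h1.2.2, div_self h2]

theorem NormalizedOn.wBlowsUp_chartU0 (h : NormalizedOn c P) (hz : z ∈ P)
    (hZ : ∀ᶠ a in l, Z a ∈ P) (hZz : Tendsto Z l (𝓝 z)) (hu : Tendsto u l (𝓝 u₀))
    (hv : Tendsto v l (𝓝 0)) (hu0 : u₀ ≠ 0)
    (ho : ∀ᶠ a in l, IsOver (chartU0 c) (Z a) (u a) (v a) (X a) (Y a)) : WBlowsUp c l Z X Y := by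
  have ho : ∀ᶠ a in l, v a ≠ 0 ∧ X a * v a = u a ∧ Y a * v a = 1 := ho
  refine h.wBlowsUp_second_of_atTop (V := v) hz hZ hZz hv (ho.mono fun a ha => ha.1) ?_
    (norm_atTop_of_mul_eq_one (p := fun a => v a / u a) ?_ ?_) (ho.mono fun a ha => ha.2.2)
  · have e : Tendsto (fun a => u a * v a ^ 2) l (𝓝 0) := by simpa using hu.mul (hv.pow 2)
    refine e.congr' ?_
    filter_upwards [ho] with a h1
    rw [← h1.2.1]
    ring
  · exact tendsto_div_zero hv hu hu0
  · filter_upwards [ho, hu.eventually_ne hu0] with a h1 h2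
    rw [← mul_div_assoc, h1.2.1, div_self h2]

theorem wBlowsUp_lowerChart_one (hc : ∀ᶠ w in 𝓝 z, c.AnalyticAt w) (hZz : Tendsto Z l (𝓝 z))
    (hu : Tendsto u l (𝓝 0)) (hv : Tendsto v l (𝓝 v₀)) (hv0 : v₀ ≠ 0)
    (ho : ∀ᶠ a in l, IsOver (lowerChart c 1) (Z a) (u a) (v a) (X a) (Y a)) :
    WBlowsUp c l Z X Y := by
  simp only [isOver_lowerChart_one] at ho
  refine (wBlowsUp_of_x hc hZz hv hv0 hu (ho.mono fun a ha => ha.1)).congr ?_ ?_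
  · filter_upwards [ho] with a h1 using eq_div_of_mul_eq h1.1 h1.2.1
  · filter_upwards [ho] with a h1
    exact mul_right_cancel₀ h1.1 (h1.2.2.trans (mul_comm _ _))

theorem wBlowsUp_upperChart_one (hc : ∀ᶠ w in 𝓝 z, c.AnalyticAt w) (hZz : Tendsto Z l (𝓝 z))
    (hu : Tendsto u l (𝓝 u₀)) (hv : Tendsto v l (𝓝 0)) (hu0 : u₀ ≠ 0)
    (ho : ∀ᶠ a in l, IsOver (upperChart c 1) (Z a) (u a) (v a) (X a) (Y a)) :
    WBlowsUp c l Z X Y := by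
  simp only [isOver_upperChart_one] at ho
  refine (wBlowsUp_of_x (j := fun a => u a * v a) hc hZz (hu.inv₀ hu0) (inv_ne_zero hu0)
    (by simpa using hu.mul hv) (ho.mono fun a ha => ha.1)).congr ?_ ?_
  · filter_upwards [ho] with a h1 using eq_div_of_mul_eq h1.1 h1.2.1
  · filter_upwards [ho] with a ⟨h1, _, h3⟩
    refine eq_inv_of_mul_eq_one_left ?_
    refine mul_right_cancel₀ (right_ne_zero_of_mul h1) ?_
    rw [one_mul, mul_assoc, h3]

theorem NormalizedOn.wBlowsUp_lowerChart_two (h : NormalizedOn c P) (hz : z ∈ P)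
    (hZ : ∀ᶠ a in l, Z a ∈ P) (hZz : Tendsto Z l (𝓝 z)) (hu : Tendsto u l (𝓝 0))
    (hv : Tendsto v l (𝓝 v₀)) (hv0 : v₀ ≠ 0)
    (ho : ∀ᶠ a in l, IsOver (lowerChart c 2) (Z a) (u a) (v a) (X a) (Y a)) :
    WBlowsUp c l Z X Y := by
  simp only [isOver_lowerChart_two] at ho
  have hp : Tendsto (fun a => u a * (u a * v a)) l (𝓝 0) := by simpa using hu.mul (hu.mul hv)
  refine h.wBlowsUp_second_of_atTop (V := u) hz hZ hZz hu
    (ho.mono fun a ha => left_ne_zero_of_mul ha.1) ?_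
    (norm_atTop_of_mul_eq_one hp (ho.mono fun a ha => ha.2.1)) ?_
  · have e : Tendsto (fun a => u a / v a) l (𝓝 0) := tendsto_div_zero hu hv hv0
    refine e.congr' ?_
    filter_upwards [ho, hv.eventually_ne hv0] with a h1 h2
    rw [div_eq_iff h2]
    linear_combination -(u a * h1.2.1)
  · filter_upwards [ho] with a ⟨h1, _, h3⟩
    refine mul_right_cancel₀ (right_ne_zero_of_mul h1) ?_
    rw [one_mul, mul_assoc, h3]

theorem NormalizedOn.wBlowsUp_upperChart_two (h : NormalizedOn c P) (hz : z ∈ P)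
    (hZ : ∀ᶠ a in l, Z a ∈ P) (hZz : Tendsto Z l (𝓝 z)) (hu : Tendsto u l (𝓝 u₀))
    (hv : Tendsto v l (𝓝 0))
    (ho : ∀ᶠ a in l, IsOver (upperChart c 2) (Z a) (u a) (v a) (X a) (Y a)) :
    WBlowsUp c l Z X Y := by
  simp only [isOver_upperChart_two] at ho
  have hp : Tendsto (fun a => u a * v a * v a) l (𝓝 0) := by simpa using (hu.mul hv).mul hv
  refine h.wBlowsUp_second_of_atTop (V := fun a => u a * v a) hz hZ hZz (by simpa using hu.mul hv)
    (ho.mono fun a ha => left_ne_zero_of_mul ha.1) ?_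
    (norm_atTop_of_mul_eq_one hp (ho.mono fun a ha => ha.2.1)) ?_
  · have e : Tendsto (fun a => u a ^ 2 * v a) l (𝓝 0) := by simpa using (hu.pow 2).mul hv
    refine e.congr' ?_
    filter_upwards [ho] with a h1
    linear_combination -(u a ^ 2 * v a * h1.2.1)
  · filter_upwards [ho] with a ⟨h1, _, h3⟩
    refine mul_right_cancel₀ (right_ne_zero_of_mul h1) ?_
    rw [one_mul, mul_assoc, h3]

theorem NormalizedOn.wBlowsUp_lowerChart_three (h : NormalizedOn c P) (hz : z ∈ P)
    (hZ : ∀ᶠ a in l, Z a ∈ P) (hZz : Tendsto Z l (𝓝 z)) (hu : Tendsto u l (𝓝 0))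
    (hv : Tendsto v l (𝓝 v₀)) (hv0 : v₀ * 2 ≠ 1)
    (ho : ∀ᶠ a in l, IsOver (lowerChart c 3) (Z a) (u a) (v a) (X a) (Y a)) :
    WBlowsUp c l Z X Y := by
  simp only [isOver_lowerChart_three] at ho
  refine (h.wBlowsUp_of_cubic (q := v) (i := u) hz hZ hZz hu
    (ho.mono fun a ha => left_ne_zero_of_mul ha.1) hv
    (ho.mono fun a ha => right_ne_zero_of_mul (right_ne_zero_of_mul (right_ne_zero_of_mul ha.1)))
    (fun e => hv0 (by rw [e]; norm_num))).congr ?_ ?_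
  · filter_upwards [ho] with a ⟨h1, h2, _⟩
    have e : v a * u a ^ 3 = u a * (u a * (u a * v a)) := by ring
    rw [e]
    exact eq_div_of_mul_eq h1 h2
  · filter_upwards [ho] with a ⟨h1, _, h3⟩
    refine eq_div_of_mul_eq (left_ne_zero_of_mul h1) ?_
    refine mul_right_cancel₀ (right_ne_zero_of_mul h1) ?_
    rw [one_mul, mul_assoc, h3]

theorem isOver_upperChart_three_eq {z K V x y : ℂ} (h : IsOver (upperChart c 3) z K V x y) :
    K ≠ 0 ∧ V ≠ 0 ∧ x = 1 / (K ^ 2 * V ^ 3) ∧ y = 1 / (K * V) := by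
  rw [isOver_upperChart_three] at h
  obtain ⟨h1, h2, h3⟩ := h
  have hK : K ≠ 0 := by rintro rfl; simp at h1
  have hV : V ≠ 0 := by rintro rfl; simp at h1
  refine ⟨hK, hV, eq_div_of_mul_eq h1 h2, eq_div_of_mul_eq (mul_ne_zero hK hV) ?_⟩
  refine mul_right_cancel₀ (mul_ne_zero hK (pow_ne_zero 2 hV)) ?_
  linear_combination h3

theorem NormalizedOn.wBlowsUp_upperChart_three (h : NormalizedOn c P) (hz : z ∈ P)
    (hZ : ∀ᶠ a in l, Z a ∈ P) (hZz : Tendsto Z l (𝓝 z)) (hu : Tendsto u l (𝓝 u₀))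
    (hv : Tendsto v l (𝓝 0)) (hu0 : u₀ ≠ 2)
    (ho : ∀ᶠ a in l, IsOver (upperChart c 3) (Z a) (u a) (v a) (X a) (Y a)) :
    WBlowsUp c l Z X Y := by
  have ho := ho.mono fun a ha => isOver_upperChart_three_eq ha
  have hi : Tendsto (fun a => u a * v a) l (𝓝 0) := by simpa using hu.mul hv
  have hi0 : ∀ᶠ a in l, u a * v a ≠ 0 := ho.mono fun a ha => mul_ne_zero ha.1 ha.2.1
  rcases eq_or_ne u₀ 0 with rfl | h0
  · refine h.wBlowsUp_second_of_atTop (V := fun a => u a * v a) hz hZ hZz hi hi0 ?_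
      (norm_atTop_of_mul_eq_one (p := fun a => u a ^ 2 * v a ^ 3)
        (by simpa using (hu.pow 2).mul (hv.pow 3)) ?_) ?_
    · refine hu.congr' ?_
      filter_upwards [ho] with a ⟨h1, h2, h3, _⟩
      rw [h3]
      field_simp
    · filter_upwards [ho] with a ⟨h1, h2, h3, _⟩
      rw [h3]
      field_simp
    · filter_upwards [ho] with a ⟨h1, h2, _, h4⟩
      rw [h4]
      field_simp
  · refine (h.wBlowsUp_of_cubic (q := fun a => (u a)⁻¹) (i := fun a => u a * v a) hz hZ hZz hi hi0
      (hu.inv₀ h0) (ho.mono fun a ha => inv_ne_zero ha.1) ?_).congr ?_ ?_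
    · intro e
      exact hu0 (by rw [← inv_inv u₀, e]; norm_num)
    · filter_upwards [ho] with a ⟨h1, h2, h3, _⟩
      rw [h3]
      field_simp
    · filter_upwards [ho] with a ha using ha.2.2.2

/-- In a chart of the cascade `a` the coordinate `u` stays away from the centre of the next
blow-up; both charts of a blow-up are covered, the lower one by `U = 1/v`, `V = u v`. -/
def AvoidsCentre (a : ℕ → ℂ → ℂ) (m : ℕ) (l : Filter α) (Z U V : α → ℂ) : Prop :=
  Tendsto V l (𝓝 0) ∧ Tendsto (fun t => U t * V t) l (𝓝 0) ∧ ∀ j, ∃ ε > 0, ∀ᶠ t in l,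
    ε ≤ ‖U t - cascTail (fun i => a i (Z t)) (j + 1) (m + 1) (V t)‖

variable {a : ℕ → ℂ → ℂ} {m : ℕ}

theorem avoidsCentre_upper (ha : ∀ j, AnalyticAt ℂ (a j) z) (hZz : Tendsto Z l (𝓝 z))
    (hu : Tendsto u l (𝓝 u₀)) (hv : Tendsto v l (𝓝 0)) (hne : u₀ ≠ a (m + 1) z) :
    AvoidsCentre a m l Z u v := by
  refine ⟨hv, by simpa using hu.mul hv, fun j => ?_⟩
  have h1 := hu.sub (tendsto_cascTail ha j (m + 1) hZz hv)
  have hpos : 0 < ‖u₀ - a (m + 1) z‖ := norm_pos_iff.2 (sub_ne_zero.2 hne)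
  exact ⟨_, half_pos hpos, h1.norm.eventually_const_le (half_lt_self hpos)⟩

theorem avoidsCentre_lower (ha : ∀ j, AnalyticAt ℂ (a j) z) (hZz : Tendsto Z l (𝓝 z))
    (hu : Tendsto u l (𝓝 0)) (hv : Tendsto v l (𝓝 v₀)) (hne : v₀ * a (m + 1) z ≠ 1)
    (hv0 : ∀ᶠ t in l, v t ≠ 0) : AvoidsCentre a m l Z (fun t => 1 / v t) fun t => u t * v t := by
  have huv : Tendsto (fun t => u t * v t) l (𝓝 0) := by simpa using hu.mul hv
  refine ⟨huv, hu.congr' ?_, fun j => ?_⟩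
  · filter_upwards [hv0] with t h1
    field_simp
  have h1 := (tendsto_const_nhds (x := (1 : ℂ))).sub
    (hv.mul (tendsto_cascTail ha j (m + 1) hZz huv))
  have hpos : 0 < ‖1 - v₀ * a (m + 1) z‖ := norm_pos_iff.2 (sub_ne_zero.2 hne.symm)
  refine ⟨‖1 - v₀ * a (m + 1) z‖ / 2 / (‖v₀‖ + 1), by positivity, ?_⟩
  filter_upwards [h1.norm.eventually_const_le (half_lt_self hpos), hv0,
    hv.norm.eventually_le_const (lt_add_one _)] with t h1 h2 h3
  have hvn : 0 < ‖v t‖ := norm_pos_iff.2 h2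
  have e : 1 / v t - cascTail (fun i => a i (Z t)) (j + 1) (m + 1) (u t * v t)
      = (1 - v t * cascTail (fun i => a i (Z t)) (j + 1) (m + 1) (u t * v t)) / v t := by
    field_simp
  rw [e, norm_div]
  gcongr

theorem tendsto_cascLift_succ (ha : ∀ j, AnalyticAt ℂ (a j) z) (hZz : Tendsto Z l (𝓝 z))
    {U V : α → ℂ} (hV : Tendsto V l (𝓝 0)) (hUV : Tendsto (fun t => U t * V t) l (𝓝 0)) (m : ℕ) :
    Tendsto (fun t => cascLift (fun j => a j (Z t)) (m + 1) (U t) (V t)) l (𝓝 (a 0 z)) := by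
  have h := (tendsto_cascTail ha m 0 hZz hV).add ((hV.pow m).mul hUV)
  rw [mul_zero, add_zero] at h
  refine h.congr fun t => ?_
  rw [cascLift_eq, pow_succ]
  ring

/-- `W` blows up at the points over the first cascade that avoid the centres. -/
theorem NormalizedOn.wBlowsUp_first_cascade (h : NormalizedOn c P) {U V : α → ℂ} (hz : z ∈ P)
    (hZ : ∀ᶠ a in l, Z a ∈ P) (hZz : Tendsto Z l (𝓝 z)) (hm : m ≤ 4)
    (hav : AvoidsCentre (firstCentre c) m l Z U V)
    (ho : ∀ᶠ a in l, IsOver (upperChart c 3) (Z a)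
      (cascLift (fun j => firstCentre c j (Z a)) (m + 1) (U a) (V a)) (V a) (X a) (Y a)) :
    WBlowsUp c l Z X Y := by
  obtain ⟨hV, hUV, hav⟩ := hav
  have hc := h.analyticAt z hz
  have ho := ho.mono fun a ha => isOver_upperChart_three_eq ha
  obtain ⟨ε, hε, hgap⟩ := hav (4 - m)
  refine (h.wBlowsUp_first hZ hV (ho.mono fun a ha => ha.2.1)
    (tendsto_cascLift_succ (a := firstCentre c) (fun j => hc.centre _) hZz hV hUV m) hε ?_).congr
    (ho.mono fun a ha => ha.2.2.1) (ho.mono fun a ha => ha.2.2.2)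
  filter_upwards [hgap, hV.norm.eventually_le_const (show ‖(0 : ℂ)‖ < 1 by simp)] with t h1 h2
  have e := cascLift_sub_cascTail (fun j => firstCentre c j (Z t)) (m + 1) (4 - m + 1) (U t) (V t)
  rw [show m + 1 + (4 - m + 1) = 6 by omega] at e
  rw [firstTail, e, norm_mul, norm_pow, mul_comm]
  gcongr ?_ * ?_
  exact pow_le_pow_of_le_one (norm_nonneg _) h2 (by omega)

theorem isOver_cascLift_chartU0 {z U V x y : ℂ}
    (h : IsOver (chartU0 c) z (cascLift (fun j => secondCentre c j z) (m + 1) U V) V x y) :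
    V ≠ 0 ∧ x = cascTail (fun j => secondCentre c j z) m 1 V + V ^ m * U ∧ y = 1 / V := by
  obtain ⟨h1, h2, h3⟩ : V ≠ 0 ∧
    x * V = cascLift (fun j => secondCentre c j z) (m + 1) U V ∧ y * V = 1 := h
  refine ⟨h1, mul_right_cancel₀ h1 ?_, eq_div_of_mul_eq h1 h3⟩
  have h0 : secondCentre c 0 z = 0 := rfl
  rw [h2, cascLift_eq, cascTail, h0, zero_add, pow_succ]
  ring

theorem NormalizedOn.wBlowsUp_second_cascade (h : NormalizedOn c P) {U V : α → ℂ} (hz : z ∈ P)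
    (hZ : ∀ᶠ a in l, Z a ∈ P) (hZz : Tendsto Z l (𝓝 z)) (hm : m ≤ 2)
    (hav : AvoidsCentre (secondCentre c) m l Z U V)
    (ho : ∀ᶠ a in l, IsOver (chartU0 c) (Z a)
      (cascLift (fun j => secondCentre c j (Z a)) (m + 1) (U a) (V a)) (V a) (X a) (Y a))
    {ρ : ℝ} (hρ : 0 < ρ)
    (hx : ∀ᶠ a in l, ρ ≤ ‖X a‖ ∨ (deriv c.c2 (Z a) = 0 ∧ deriv (deriv c.c2) (Z a) = 0)) :
    WBlowsUp c l Z X Y := by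
  obtain ⟨hV, hUV, hav⟩ := hav
  have hc := h.analyticAt z hz
  have ho' := ho.mono fun a ha => isOver_cascLift_chartU0 ha
  obtain ⟨ε, hε, hgap⟩ := hav (2 - m)
  refine (h.wBlowsUp_second hZ hV (ho'.mono fun a ha => ha.1) ?_ hρ hε hx ?_).congr .rfl
    (ho'.mono fun a ha => ha.2.2)
  · have e := (tendsto_cascLift_succ (a := secondCentre c) (fun j => hc.centre _) hZz hV hUV m).mul
      (hV.pow 2)
    simp only [ne_eq, OfNat.ofNat_ne_zero, not_false_eq_true, zero_pow, mul_zero] at e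
    refine e.congr' ?_
    filter_upwards [ho] with t ht
    have : X t * V t = _ := ht.2.1
    rw [← show X t * V t = cascLift (fun j => secondCentre c j (Z t)) (m + 1) (U t) (V t)
      from this]
    ring
  · filter_upwards [ho, ho', hgap, hV.norm.eventually_le_const (show ‖(0 : ℂ)‖ < 1 by simp)]
      with t ht ht' h1 h2
    have hX : X t * V t = cascLift (fun j => secondCentre c j (Z t)) (m + 1) (U t) (V t) := ht.2.1
    have e := cascLift_sub_cascTail (fun j => secondCentre c j (Z t)) (m + 1) (2 - m + 1) (U t)
      (V t)
    rw [show m + 1 + (2 - m + 1) = 4 by omega, secondTail_eq, ← hX, pow_succ] at e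
    have e' : X t - secondTail c (Z t) (V t) = V t ^ m * (U t
        - cascTail (fun j => secondCentre c j (Z t)) (2 - m + 1) (m + 1) (V t)) := by
      refine mul_left_cancel₀ ht'.1 ?_
      linear_combination e
    rw [e', norm_mul, norm_pow, mul_comm]
    gcongr ?_ * ?_
    exact pow_le_pow_of_le_one (norm_nonneg _) h2 (by omega)

end BlowUpCharts

/-! ### Where the terms of `W` are defined -/

section WDefined

variable {c : Coeffs} {P : Set ℂ} {z u₀ v₀ : ℂ} {C : Chart}

theorem pow_card_le_norm_prod {r : ℝ} (hr : 0 ≤ r) (s : Multiset ℂ) (h : ∀ w ∈ s, r ≤ ‖w‖) :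
    r ^ s.card ≤ ‖s.prod‖ := by
  induction s using Multiset.induction with
  | empty => simp
  | cons w s ih =>
    have h1 := h w (Multiset.mem_cons_self w s)
    have h2 := ih fun x hx => h x (Multiset.mem_cons_of_mem hx)
    rw [Multiset.card_cons, Multiset.prod_cons, norm_mul, pow_succ, mul_comm]
    gcongr

/-- The product of the roots bounds the smallest one. -/
theorem exists_root_norm_lt {p : Polynomial ℂ} {r : ℝ} (hr : 0 < r)
    (h : ‖p.coeff 0‖ < ‖p.leadingCoeff‖ * r ^ p.natDegree) : ∃ w, p.eval w = 0 ∧ ‖w‖ < r := by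
  by_contra! hcon
  have hs := IsAlgClosed.splits p
  have h1 := pow_card_le_norm_prod hr.le p.roots fun w hw => hcon w (Polynomial.isRoot_of_mem_roots hw)
  rw [← hs.natDegree_eq_card_roots] at h1
  rw [hs.coeff_zero_eq_leadingCoeff_mul_prod_roots, norm_mul, norm_mul, norm_pow, norm_neg, norm_one,
    one_pow, one_mul] at h
  exact h.not_ge (by gcongr)

theorem exists_polynomial_cascTail (a : ℕ → ℂ) {B : ℂ} (hB : B ≠ 0) (m j : ℕ) :
    ∃ p : Polynomial ℂ, p.natDegree = m ∧ p.leadingCoeff = B ∧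
      ∀ V, p.eval V = cascTail a m j V + V ^ m * B := by
  induction m generalizing j with
  | zero => exact ⟨Polynomial.C B, by simp, by simp, fun V => by simp [cascTail]⟩
  | succ m ih =>
    obtain ⟨p, hd, hl, he⟩ := ih (j + 1)
    have hp : p ≠ 0 := by rintro rfl; exact hB (by simpa using hl.symm)
    have hd' : (Polynomial.C (a j) + Polynomial.X * p).natDegree = m + 1 := by
      rw [Polynomial.natDegree_C_add, Polynomial.natDegree_X_mul hp, hd]
    refine ⟨Polynomial.C (a j) + Polynomial.X * p, hd', ?_, fun V => ?_⟩
    · rw [Polynomial.leadingCoeff, hd', Polynomial.coeff_add, Polynomial.coeff_C_succ,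
        Polynomial.coeff_X_mul, zero_add, ← hl, Polynomial.leadingCoeff, hd]
    · simp only [Polynomial.eval_add, Polynomial.eval_C, Polynomial.eval_mul, Polynomial.eval_X, he,
        cascTail]
      ring

theorem exists_cascTail_root (a : ℕ → ℂ) {B : ℂ} (hB : B ≠ 0) {m j : ℕ} (hm : m ≠ 0) {r : ℝ}
    (hr : 0 < r) (h : ‖a j‖ < ‖B‖ * r ^ m) :
    ∃ V, cascTail a m j V + V ^ m * B = 0 ∧ ‖V‖ < r := by
  obtain ⟨p, hd, hl, he⟩ := exists_polynomial_cascTail a hB m j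
  obtain ⟨m, rfl⟩ := Nat.exists_eq_succ_of_ne_zero hm
  have h0 : p.coeff 0 = a j := by
    rw [Polynomial.coeff_zero_eq_eval_zero, he]
    simp [cascTail]
  obtain ⟨V, h1, h2⟩ := exists_root_norm_lt hr (p := p) (by rw [h0, hd, hl]; exact h)
  exact ⟨V, by rw [← he, h1], h2⟩

theorem eventually_deriv_eq_zero {f : ℂ → ℂ} (hf : _root_.AnalyticAt ℂ f z)
    (h : ∀ᶠ w in 𝓝 z, f w * deriv f w = 0) :
    ∀ᶠ w in 𝓝 z, deriv f w = 0 ∧ deriv (deriv f) w = 0 := by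
  have key : ∀ {g : ℂ → ℂ}, (∀ᶠ w in 𝓝 z, g w = 0) → ∀ᶠ w in 𝓝 z, deriv g w = 0 := fun {g} hg => by
    have : g =ᶠ[𝓝 z] fun _ => 0 := hg
    filter_upwards [this.deriv] with w hw
    rw [hw, deriv_const]
  have hd : ∀ᶠ w in 𝓝 z, deriv f w = 0 := by
    rcases hf.eventually_eq_zero_or_eventually_ne_zero with h0 | h0
    · exact key h0
    rcases hf.deriv.eventually_eq_zero_or_eventually_ne_zero with h1 | h1
    · exact h1
    obtain ⟨w, hw0, hw1, hw⟩ := (h0.and (h1.and (h.filter_mono nhdsWithin_le_nhds))).exists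
    exact (mul_ne_zero hw0 hw1 hw).elim
  exact hd.and (key hd)

theorem wDefinedNear_spec (h : WDefinedNear c C z u₀ v₀) : ∃ r > 0, ∀ w u v x y : ℂ, ‖w - z‖ < r →
    ‖u - u₀‖ < r → ‖v - v₀‖ < r → IsOver C w u v x y → c.WDefinedAt w x y := by
  obtain ⟨r, hr, h⟩ := Metric.eventually_nhds_iff.1 (eventually_nhdsWithin_iff.1 h)
  refine ⟨r, hr, fun w u v x y h1 h2 h3 ho => ?_⟩
  have := @h (w, u, v) (by simpa [Prod.dist_eq, dist_eq_norm] using ⟨h1, h2, h3⟩) ho.1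
  rw [ho.eq.1, ho.eq.2]
  exact this

theorem exists_ne_zero_norm_sub_lt (u₀ : ℂ) {r : ℝ} (hr : 0 < r) : ∃ B : ℂ, B ≠ 0 ∧ ‖B - u₀‖ < r := by
  obtain ⟨B, hB, h⟩ := (dense_compl_singleton (0 : ℂ)).exists_dist_lt u₀ hr
  exact ⟨B, hB, by rwa [dist_comm, dist_eq_norm] at h⟩

theorem cascLift_second_succ (z U V : ℂ) (m : ℕ) :
    cascLift (fun j => secondCentre c j z) (m + 1) U V
      = V * (cascTail (fun j => secondCentre c j z) m 1 V + V ^ m * U) := by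
  have h0 : secondCentre c 0 z = 0 := rfl
  rw [cascLift_eq, cascTail, h0, zero_add, pow_succ]
  ring

variable {α : Type*} {l : Filter α} {Z X U V : α → ℂ} {m : ℕ}

/-- If the terms of `W` are defined along `x = tail(V) + V ^ m B`, then in the second cascade `x`
stays away from zero or `c₂' = 0`: otherwise, where `c₂ c₂' ≠ 0`, the polynomial
`tail(V) + V ^ m B` has a small root `V ≠ 0`, at which `x = 0`. -/
theorem exists_x_bound (hc : c.AnalyticAt z) (hm : m ≠ 0) (hZz : Tendsto Z l (𝓝 z))
    (hV : Tendsto V l (𝓝 0)) (hUV : Tendsto (fun t => U t * V t) l (𝓝 0))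
    (hX : ∀ᶠ t in l, X t = cascTail (fun j => secondCentre c j (Z t)) m 1 (V t) + V t ^ m * U t)
    {B : ℂ} (hB : B ≠ 0) {r : ℝ} (hr : 0 < r) (hroot : ∀ w V : ℂ, ‖w - z‖ < r → ‖V‖ < r → V ≠ 0 →
      c.c2 w * deriv c.c2 w ≠ 0 → cascTail (fun j => secondCentre c j w) m 1 V + V ^ m * B ≠ 0) :
    ∃ ρ > 0, ∀ᶠ t in l,
      ρ ≤ ‖X t‖ ∨ (deriv c.c2 (Z t) = 0 ∧ deriv (deriv c.c2) (Z t) = 0) := by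
  rcases (hc.c2.mul hc.c2.deriv).eventually_eq_zero_or_eventually_ne_zero with h0 | h0
  · exact ⟨1, one_pos, (hZz.eventually (eventually_deriv_eq_zero hc.c2 h0)).mono fun t ht => .inr ht⟩
  obtain ⟨k, rfl⟩ := Nat.exists_eq_succ_of_ne_zero hm
  have ha : ∀ j, AnalyticAt ℂ (secondCentre c j) z := fun j => hc.centre _
  have hlim : Tendsto X l (𝓝 (secondCentre c 1 z)) := by
    have h := (tendsto_cascTail ha k 1 hZz hV).add ((hV.pow k).mul hUV)
    rw [mul_zero, add_zero] at h
    refine h.congr' ?_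
    filter_upwards [hX] with t ht
    rw [ht, pow_succ]
    ring
  by_cases h1 : secondCentre c 1 z = 0
  · exfalso
    have hsm : ∀ᶠ w in 𝓝 z, ‖secondCentre c 1 w‖ < ‖B‖ * r ^ (k + 1) := by
      refine (ha 1).continuousAt.norm.eventually_lt_const ?_
      show ‖secondCentre c 1 z‖ < _
      rw [h1, norm_zero]
      have := norm_pos_iff.2 hB
      positivity
    have hnear : ∀ᶠ w in 𝓝 z, ‖w - z‖ < r :=
      (continuous_id.sub continuous_const).norm.continuousAt.eventually_lt_const (by simpa)
    obtain ⟨w, hw, hw1, hw2⟩ := (h0.and ((hsm.and hnear).filter_mono nhdsWithin_le_nhds)).exists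
    obtain ⟨V, hV1, hV2⟩ := exists_cascTail_root (fun j => secondCentre c j w) hB hm hr hw1
    refine hroot w V hw2 hV2 ?_ hw hV1
    rintro rfl
    have h2 : secondCentre c 1 w = -c.c2 w / 3 := rfl
    simp only [cascTail, zero_mul, add_zero, ne_eq, Nat.succ_eq_add_one, Nat.add_eq_zero_iff,
      one_ne_zero, and_false, not_false_eq_true, zero_pow, h2] at hV1
    refine hw ?_
    have : c.c2 w = 0 := by linear_combination -3 * hV1
    show c.c2 w * deriv c.c2 w = 0
    rw [this, zero_mul]
  · have hpos := norm_pos_iff.2 h1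
    exact ⟨_, half_pos hpos,
      (hlim.norm.eventually_const_le (half_lt_self hpos)).mono fun t ht => .inl ht⟩

variable {u v Y : α → ℂ}

theorem exists_x_bound_upper (hc : c.AnalyticAt z) (hm : m ≤ 3) (hZz : Tendsto Z l (𝓝 z))
    (hu : Tendsto u l (𝓝 u₀)) (hv : Tendsto v l (𝓝 0))
    (ho : ∀ᶠ t in l, IsOver (upperChart c (10 + m)) (Z t) (u t) (v t) (X t) (Y t))
    (hW : WDefinedNear c (upperChart c (10 + m)) z u₀ 0) :
    ∃ ρ > 0, ∀ᶠ t in l,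
      ρ ≤ ‖X t‖ ∨ (deriv c.c2 (Z t) = 0 ∧ deriv (deriv c.c2) (Z t) = 0) := by
  obtain ⟨r, hr, hdef⟩ := wDefinedNear_spec hW
  simp only [upperChart_second hm, isOver_casc] at ho hdef
  have hX := ho.mono fun t ht => (isOver_cascLift_chartU0 ht).2.1
  -- Where `c₂ c₂' ≠ 0`, the terms of `W` are defined only if `x ≠ 0`.
  have hroot : ∀ B : ℂ, ‖B - u₀‖ < r → ∀ w V : ℂ, ‖w - z‖ < r → ‖V‖ < r → V ≠ 0 →
      c.c2 w * deriv c.c2 w ≠ 0 →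
      cascTail (fun j => secondCentre c j w) m 1 V + V ^ m * B ≠ 0 := by
    intro B hB w V hw hVr hV0 hc2 h0
    refine (hdef w B V 0 (1 / V) hw hB (by simpa) ⟨hV0, ?_, one_div_mul_cancel hV0⟩).2 hc2 rfl
    rw [zero_mul]
    exact ((cascLift_second_succ w B V m).trans (by rw [h0, mul_zero])).symm
  rcases eq_or_ne m 0 with rfl | hm0
  · simp only [cascTail, zero_add, pow_zero, one_mul] at hX hroot
    rcases eq_or_ne u₀ 0 with rfl | h0
    · refine ⟨1, one_pos, (hZz.eventually (eventually_deriv_eq_zero hc.c2 ?_)).mono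
        fun t ht => .inr ht⟩
      have hnear : ∀ᶠ w in 𝓝 z, ‖w - z‖ < r :=
        (continuous_id.sub continuous_const).norm.continuousAt.eventually_lt_const (by simpa)
      obtain ⟨V, hV0, hV⟩ := exists_ne_zero_norm_sub_lt 0 hr
      filter_upwards [hnear] with w hw
      by_contra hne
      exact hroot 0 (by simpa) w V hw (by simpa using hV) hV0 hne rfl
    · have hpos := norm_pos_iff.2 h0
      refine ⟨_, half_pos hpos, ?_⟩
      filter_upwards [hX, hu.norm.eventually_const_le (half_lt_self hpos)] with t h1 h2
      rw [h1]
      exact .inl h2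
  · obtain ⟨B, hB0, hB⟩ := exists_ne_zero_norm_sub_lt u₀ hr
    exact exists_x_bound hc hm0 hZz hv (by simpa using hu.mul hv) hX hB0 hr (hroot B hB)

/-- The lower chart of a blow-up in the second cascade, in terms of `U = 1/v` and `V = u v`. -/
theorem isOver_lowerChart_second {z u v x y : ℂ} (hm : m ≤ 3) (hv : v ≠ 0) :
    IsOver (lowerChart c (10 + m)) z u v x y ↔ IsOver (chartU0 c) z
      (cascLift (fun j => secondCentre c j z) (m + 1) (1 / v) (u * v)) (u * v) x y := by
  have e : 1 / v * (u * v) = u := by field_simp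
  rw [lowerChart_second hm, isOver_lower, isOver_casc, cascLift, e]

theorem isOver_lowerChart_first {z u v x y : ℂ} (hm : m ≤ 5) (hv : v ≠ 0) :
    IsOver (lowerChart c (4 + m)) z u v x y ↔ IsOver (upperChart c 3) z
      (cascLift (fun j => firstCentre c j z) (m + 1) (1 / v) (u * v)) (u * v) x y := by
  have e : 1 / v * (u * v) = u := by field_simp
  rw [lowerChart_first hm, isOver_lower, isOver_casc, cascLift, e]

theorem ne_zero_of_isOver_lowerChart_second {z u v x y : ℂ} (hm : m ≤ 3)
    (h : IsOver (lowerChart c (10 + m)) z u v x y) : v ≠ 0 := by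
  rw [lowerChart_second hm, isOver_lower, isOver_casc] at h
  exact right_ne_zero_of_mul (show u * v ≠ 0 from h.1)

theorem ne_zero_of_isOver_lowerChart_first {z u v x y : ℂ} (hm : m ≤ 5)
    (h : IsOver (lowerChart c (4 + m)) z u v x y) : v ≠ 0 := by
  rw [lowerChart_first hm, isOver_lower, isOver_casc] at h
  exact right_ne_zero_of_mul (isOver_upperChart_three_eq h).2.1

theorem exists_x_bound_lower (hc : c.AnalyticAt z) (hm : m ≤ 3) (hZz : Tendsto Z l (𝓝 z))
    (hu : Tendsto u l (𝓝 0)) (hv : Tendsto v l (𝓝 v₀))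
    (ho : ∀ᶠ t in l, IsOver (lowerChart c (10 + m)) (Z t) (u t) (v t) (X t) (Y t))
    (hW : WDefinedNear c (lowerChart c (10 + m)) z 0 v₀) :
    ∃ ρ > 0, ∀ᶠ t in l,
      ρ ≤ ‖X t‖ ∨ (deriv c.c2 (Z t) = 0 ∧ deriv (deriv c.c2) (Z t) = 0) := by
  obtain ⟨r, hr, hdef⟩ := wDefinedNear_spec hW
  have hv0 := ho.mono fun t ht => ne_zero_of_isOver_lowerChart_second hm ht
  have hX : ∀ᶠ t in l, X t = cascTail (fun j => secondCentre c j (Z t)) m 1 (u t * v t)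
      + (u t * v t) ^ m * (1 / v t) := by
    filter_upwards [ho, hv0] with t h1 h2
    exact (isOver_cascLift_chartU0 ((isOver_lowerChart_second hm h2).1 h1)).2.1
  rcases eq_or_ne m 0 with rfl | hm0
  · simp only [cascTail, zero_add, pow_zero, one_mul] at hX
    refine ⟨1 / (‖v₀‖ + 1), by positivity, ?_⟩
    filter_upwards [hX, hv0, hv.norm.eventually_le_const (lt_add_one _)] with t h1 h2 h3
    have := norm_pos_iff.2 h2
    rw [h1, norm_div, norm_one]
    exact .inl (by gcongr)
  · obtain ⟨v₁, hv1, hv⟩ := exists_ne_zero_norm_sub_lt v₀ hr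
    have hn := norm_pos_iff.2 hv1
    refine exists_x_bound hc hm0 hZz (V := fun t => u t * v t) (U := fun t => 1 / v t)
      (by simpa using hu.mul ‹Tendsto v l (𝓝 v₀)›) (hu.congr' ?_) hX (one_div_ne_zero hv1)
      (r := min r (r * ‖v₁‖)) (by positivity) fun w V hw hVr hV0 hc2 h0 => ?_
    · filter_upwards [hv0] with t h1
      field_simp
    have e : V / v₁ * v₁ = V := div_mul_cancel₀ _ hv1
    have hVr' : ‖V / v₁ - 0‖ < r := by
      rw [sub_zero, norm_div, div_lt_iff₀ hn]
      exact hVr.trans_le (min_le_right _ _)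
    refine (hdef w (V / v₁) v₁ 0 (1 / V) (hw.trans_le (min_le_left _ _)) hVr' hv ?_).2 hc2 rfl
    rw [isOver_lowerChart_second hm hv1, e]
    refine ⟨hV0, ?_, one_div_mul_cancel hV0⟩
    rw [zero_mul]
    exact ((cascLift_second_succ w _ V m).trans (by rw [h0, mul_zero])).symm

end WDefined

/-! ### `W` at the points at infinity -/

section WAtInfinity

variable {c : Coeffs} {P : Set ℂ} {z u₀ v₀ : ℂ} {C : Chart}

theorem tendsto_finiteNhds (C : Chart) (z u₀ v₀ : ℂ) :
    Tendsto (fun p : ℂ × ℂ × ℂ => p.1) (finiteNhds C z u₀ v₀) (𝓝 z) ∧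
      Tendsto (fun p : ℂ × ℂ × ℂ => p.2.1) (finiteNhds C z u₀ v₀) (𝓝 u₀) ∧
      Tendsto (fun p : ℂ × ℂ × ℂ => p.2.2) (finiteNhds C z u₀ v₀) (𝓝 v₀) := by
  have h : Tendsto id (finiteNhds C z u₀ v₀) (𝓝 (z, u₀, v₀)) := nhdsWithin_le_nhds
  exact ⟨h.fst_nhds, h.snd_nhds.fst_nhds, h.snd_nhds.snd_nhds⟩

theorem eventually_isOver_finiteNhds (C : Chart) (z u₀ v₀ : ℂ) :
    ∀ᶠ p in finiteNhds C z u₀ v₀, IsOver C p.1 p.2.1 p.2.2 (C.xOf p) (C.yOf p) := by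
  filter_upwards [self_mem_nhdsWithin] with p hp using isOver_of_eq hp rfl rfl

/-- `W` at the points of the intermediate curves that are not base points. -/
theorem NormalizedOn.w_intermediate (h : NormalizedOn c P) (hP : P ∈ 𝓝 z)
    (hC : OnIntermediateCurve c C u₀ v₀) (hb : ¬ IsBasePoint C z u₀ v₀)
    (hW : WDefinedNear c C z u₀ v₀) : WInfinite c C z u₀ v₀ ∧ WLogDerivBounded c C z u₀ v₀ := by
  show WBlowsUp c (finiteNhds C z u₀ v₀) (fun p => p.1) C.xOf C.yOf
  obtain ⟨hZz, hu, hv⟩ := tendsto_finiteNhds C z u₀ v₀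
  have ho := eventually_isOver_finiteNhds C z u₀ v₀
  have hz : z ∈ P := mem_of_mem_nhds hP
  have hcz := h.analyticAt z hz
  have hZ : ∀ᶠ p : ℂ × ℂ × ℂ in finiteNhds C z u₀ v₀, p.1 ∈ P := hZz.eventually hP
  have hcn : ∀ᶠ w in 𝓝 z, c.AnalyticAt w := by
    filter_upwards [hP] with w hw using h.analyticAt w hw
  rcases hC.cases hcz hb with
    ⟨rfl, rfl, hn⟩ | ⟨rfl, rfl, hn⟩ | ⟨rfl, rfl, hn⟩ | ⟨rfl, rfl⟩ | ⟨i, hi, hC⟩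
  · exact h.wBlowsUp_chartu0 hz hZ hZz hu hv hn ho
  · exact h.wBlowsUp_chartU0 hz hZ hZz hu hv hn ho
  · exact h.wBlowsUp_lowerChart_two hz hZ hZz hu hv hn ho
  · exact h.wBlowsUp_upperChart_two hz hZ hZz hu hv ho
  rcases hi with rfl | rfl | ⟨hi, hi'⟩ | ⟨hi, hi'⟩
  · rcases hC with ⟨rfl, rfl, -⟩ | ⟨rfl, rfl, hn⟩
    · refine wBlowsUp_lowerChart_one hcn hZz hu hv ?_ ho
      -- At the points `v = 0` of this chart `y = 0`, and the term `x / y` is not defined.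
      rintro rfl
      obtain ⟨r, hr, hdef⟩ := wDefinedNear_spec hW
      obtain ⟨u, hu0, hu⟩ := exists_ne_zero_norm_sub_lt 0 hr
      refine (hdef z u 0 (1 / u) 0 (by simpa) hu (by simpa) ?_).1 rfl
      rw [isOver_lowerChart_one]
      exact ⟨hu0, one_div_mul_cancel hu0, by ring⟩
    · exact wBlowsUp_upperChart_one hcn hZz hu hv hn ho
  · rcases hC with ⟨rfl, rfl, hn⟩ | ⟨rfl, rfl, hn⟩
    · exact h.wBlowsUp_lowerChart_three hz hZ hZz hu hv hn ho
    · exact h.wBlowsUp_upperChart_three hz hZ hZz hu hv hn ho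
  · obtain ⟨m, rfl⟩ := Nat.exists_eq_add_of_le hi
    have ha : ∀ j, AnalyticAt ℂ (firstCentre c j) z := fun j => hcz.centre _
    rcases hC with ⟨rfl, rfl, hn⟩ | ⟨rfl, rfl, hn⟩
    · have hv0 := ho.mono fun p hp => ne_zero_of_isOver_lowerChart_first (by omega) hp
      refine h.wBlowsUp_first_cascade hz hZ hZz (by omega)
        (avoidsCentre_lower ha hZz hu hv hn hv0) ?_
      filter_upwards [ho, hv0] with p h1 h2
      exact (isOver_lowerChart_first (by omega) h2).1 h1
    · refine h.wBlowsUp_first_cascade hz hZ hZz (by omega)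
        (avoidsCentre_upper ha hZz hu hv hn) (ho.mono fun p h1 => isOver_casc.1 ?_)
      rwa [← upperChart_first (by omega)]
  · obtain ⟨m, rfl⟩ := Nat.exists_eq_add_of_le hi
    have ha : ∀ j, AnalyticAt ℂ (secondCentre c j) z := fun j => hcz.centre _
    rcases hC with ⟨rfl, rfl, hn⟩ | ⟨rfl, rfl, hn⟩
    · have hv0 := ho.mono fun p hp => ne_zero_of_isOver_lowerChart_second (by omega) hp
      obtain ⟨ρ, hρ, hx⟩ := exists_x_bound_lower hcz (by omega) hZz hu hv ho hW
      refine h.wBlowsUp_second_cascade hz hZ hZz (by omega)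
        (avoidsCentre_lower ha hZz hu hv hn hv0) ?_ hρ hx
      filter_upwards [ho, hv0] with p h1 h2
      exact (isOver_lowerChart_second (by omega) h2).1 h1
    · obtain ⟨ρ, hρ, hx⟩ := exists_x_bound_upper hcz (by omega) hZz hu hv ho hW
      refine h.wBlowsUp_second_cascade hz hZ hZz (by omega)
        (avoidsCentre_upper ha hZz hu hv hn) (ho.mono fun p h1 => isOver_casc.1 ?_) hρ hx
      rwa [← upperChart_second (by omega)]

theorem NormalizedOn.wBounded_nine (h : NormalizedOn c P) (hP : P ∈ 𝓝 z) (k : ℂ) :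
    WBounded c (upperChart c 9) z k 0 := by
  obtain ⟨δ, B, hδ, -, hB, hb⟩ := h.exists_W_first_bound
  obtain ⟨hZz, hu, hv⟩ := tendsto_finiteNhds (upperChart c 9) z k 0
  have hcz := h.analyticAt z (mem_of_mem_nhds hP)
  have hK := tendsto_cascLift_succ (a := firstCentre c) (fun j => hcz.centre _) hZz hv
    (by simpa using hu.mul hv) 5
  refine ⟨B * (‖k‖ + 1 + 1), ?_⟩
  filter_upwards [eventually_isOver_finiteNhds (upperChart c 9) z k 0, hZz.eventually hP,
    hu.norm.eventually_le_const (lt_add_one _), hv.norm.eventually_le_const (by simpa using hδ),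
    (hK.sub_const 2).norm.eventually_le_const (show ‖firstCentre c 0 z - 2‖ < 1 by
      have : firstCentre c 0 z = 2 := rfl
      simp [this])] with p ho hz hu hv hK
  have ho' : IsOver (upperChart c 3) p.1 (cascLift (fun j => firstCentre c j p.1) 6 p.2.1 p.2.2)
      p.2.2 _ _ := isOver_casc.1 ho
  obtain ⟨-, hV, hx, hy⟩ := isOver_upperChart_three_eq ho'
  have h2 := (hb _ hz _ _ hV hv hK).2
  rw [← hx, ← hy, firstTail, cascLift_eq, add_sub_cancel_left, norm_mul, norm_pow] at h2
  have hn : 0 < ‖p.2.2‖ ^ 6 := pow_pos (norm_pos_iff.2 hV) 6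
  refine le_of_mul_le_mul_left (h2.trans ?_) hn
  calc B * (‖p.2.2‖ ^ 6 * ‖p.2.1‖ + ‖p.2.2‖ ^ 6)
      ≤ B * (‖p.2.2‖ ^ 6 * (‖k‖ + 1) + ‖p.2.2‖ ^ 6) := by gcongr
    _ = _ := by ring

theorem NormalizedOn.wBounded_thirteen (h : NormalizedOn c P) (hP : P ∈ 𝓝 z) {k : ℂ}
    (hW : WDefinedNear c (upperChart c 13) z k 0) : WBounded c (upperChart c 13) z k 0 := by
  obtain ⟨hZz, hu, hv⟩ := tendsto_finiteNhds (upperChart c 13) z k 0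
  have ho := eventually_isOver_finiteNhds (upperChart c 13) z k 0
  have hcz := h.analyticAt z (mem_of_mem_nhds hP)
  obtain ⟨ρ, hρ, hx⟩ := exists_x_bound_upper (m := 3) hcz le_rfl hZz hu hv ho hW
  obtain ⟨δ, B, hδ, -, hB, hb⟩ := h.exists_W_second_bound hρ
  have hK := (tendsto_cascLift_succ (a := secondCentre c) (fun j => hcz.centre _) hZz hv
    (by simpa using hu.mul hv) 3).mul (hv.pow 2)
  simp only [ne_eq, OfNat.ofNat_ne_zero, not_false_eq_true, zero_pow, mul_zero] at hK
  refine ⟨B * (‖k‖ + 1 + 1), ?_⟩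
  filter_upwards [ho, hZz.eventually hP, hx, hu.norm.eventually_le_const (lt_add_one _),
    hv.norm.eventually_le_const (by simpa using hδ),
    hK.norm.eventually_le_const (by simpa using hδ)] with p ho hz hx hu hv hK
  obtain ⟨hV, hX, hY⟩ := isOver_thirteen.1 ho
  rw [← hX, mul_assoc, ← pow_succ'] at hK
  have h2 := (hb _ hz _ _ hV hv hK (hx.imp_right And.left)).2
  rw [cascLift_eq, secondTail_eq] at hX
  have e : (upperChart c 13).xOf p - secondTail c p.1 p.2.2 = p.2.2 ^ 3 * p.2.1 := by
    refine mul_left_cancel₀ hV ?_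
    linear_combination hX
  rw [e, ← eq_div_of_mul_eq hV hY, norm_mul, norm_pow] at h2
  have hn : 0 < ‖p.2.2‖ ^ 3 := pow_pos (norm_pos_iff.2 hV) 3
  refine le_of_mul_le_mul_left (h2.trans ?_) hn
  calc B * (‖p.2.2‖ ^ 3 * ‖p.2.1‖ + ‖p.2.2‖ ^ 3)
      ≤ B * (‖p.2.2‖ ^ 3 * (‖k‖ + 1) + ‖p.2.2‖ ^ 3) := by gcongr
    _ = _ := by ring

theorem exists_normalizedOn {U : Set ℂ} (hU : IsOpen U) (hc : ∀ z ∈ U, c.AnalyticAt z)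
    (h3 : ∀ z ∈ U, c.c3 z = z) (h1 : ∀ z ∈ U, deriv c.c1 z = 0) (hz : z ∈ U) :
    ∃ P ∈ 𝓝 z, NormalizedOn c P := by
  obtain ⟨P, hP, hPz, hPU⟩ := exists_compact_subset hU hz
  refine ⟨P, mem_interior_iff_mem_nhds.1 hPz, hP, fun w hw => hc w (hPU hw),
    fun w hw => h1 w (hPU hw), fun w hw => ?_⟩
  have : c.c3 =ᶠ[𝓝 w] id := by filter_upwards [hU.mem_nhds (hPU hw)] with s hs using h3 s hs
  rw [this.deriv_eq, deriv_id]

end WAtInfinity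

end QPII

theorem mainTheorem4 (c : QPII.Coeffs) (U : Set ℂ) (hU : IsOpen U) (hUc : IsPreconnected U)
    (h0 : AnalyticOnNhd ℂ c.c0 U) (h1 : AnalyticOnNhd ℂ c.c1 U)
    (h2 : AnalyticOnNhd ℂ c.c2 U) (h3 : AnalyticOnNhd ℂ c.c3 U) :
    -- the system on the projective plane has exactly the two base points `q_1` and `q_10`
    (∀ z ∈ U, (∀ x y : ℂ, ¬ QPII.IsBasePoint (QPII.affineChart c) z x y) ∧
      (∀ v : ℂ, QPII.IsBasePoint (QPII.chartu0 c) z 0 v ↔ v = 0) ∧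
      (∀ u : ℂ, QPII.IsBasePoint (QPII.chartU0 c) z u 0 ↔ u = 0)) ∧
    -- on `E_i`, `i = 1, 3, …, 8, 10, 11, 12`, the only base point is `q_(i+1)`, which lies at
    -- `(U_i, V_i) = (centre, 0)`, that is at `(u_i, v_i) = (0, 1/centre)`
    (∀ z ∈ U, ∀ i ∈ ({1, 3, 4, 5, 6, 7, 8, 10, 11, 12} : Set ℕ),
      (∀ u : ℂ, QPII.IsBasePoint (QPII.upperChart c i) z u 0 ↔ u = QPII.centre c (i + 1) z) ∧
      (∀ v : ℂ, QPII.IsBasePoint (QPII.lowerChart c i) z 0 v ↔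
        v * QPII.centre c (i + 1) z = 1)) ∧
    -- on `E_2` the only base point is `q_3`, at `(u_2, v_2) = (0, 0)`
    (∀ z ∈ U, (∀ v : ℂ, QPII.IsBasePoint (QPII.lowerChart c 2) z 0 v ↔ v = 0) ∧
      (∀ u : ℂ, ¬ QPII.IsBasePoint (QPII.upperChart c 2) z u 0)) ∧
    -- the cascades end: there is no base point on `E_9` and on `E_13`
    (∀ z ∈ U, ∀ i ∈ ({9, 13} : Set ℕ),
      (∀ u : ℂ, ¬ QPII.IsBasePoint (QPII.upperChart c i) z u 0) ∧
      (∀ v : ℂ, ¬ QPII.IsBasePoint (QPII.lowerChart c i) z 0 v)) ∧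
    -- the condition from the first cascade
    ((∀ z ∈ U, ∀ h : ℂ, QPII.RegularAfterSwap (QPII.upperChart c 9) z h) ↔
      ∀ z ∈ U, deriv (deriv c.c3) z - 1 / 2 * deriv c.c1 z = 0) ∧
    ((∀ z ∈ U, ∀ h : ℂ, QPII.HasSqrtExpansion (QPII.upperChart c 9) z h) ↔
      ∀ z ∈ U, deriv (deriv c.c3) z - 1 / 2 * deriv c.c1 z = 0) ∧
    -- the condition from the second cascade
    ((∀ z ∈ U, ∀ h : ℂ, QPII.RegularAfterSwap (QPII.upperChart c 13) z h) ↔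
      ∀ z ∈ U, deriv c.c1 z = 0) ∧
    ((∀ z ∈ U, ∀ h : ℂ, QPII.HasSqrtExpansion (QPII.upperChart c 13) z h) ↔
      ∀ z ∈ U, deriv c.c1 z = 0) ∧
    -- the two conditions together: `c_1` is constant and `c_3` is at most linear
    (((∀ z ∈ U, deriv (deriv c.c3) z - 1 / 2 * deriv c.c1 z = 0) ∧ ∀ z ∈ U, deriv c.c1 z = 0) ↔
      (∃ κ : ℂ, ∀ z ∈ U, c.c1 z = κ) ∧ ∃ α β : ℂ, ∀ z ∈ U, c.c3 z = α * z + β) ∧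
    -- under them: the quasi-Painlevé property, and inaccessibility of the line at infinity and of
    -- the intermediate curves (with the points of `E_8` on `E_9` and of `E_12` on `E_13`)
    ((∀ z ∈ U, deriv (deriv c.c3) z - 1 / 2 * deriv c.c1 z = 0) → (∀ z ∈ U, deriv c.c1 z = 0) →
      QPII.QuasiPainleve c U ∧
      (∀ z ∈ U, ∀ (C : QPII.Chart) (u v : ℂ), QPII.OnIntermediateCurve c C u v →
        ¬ QPII.IsBasePoint C z u v → QPII.Inaccessible c U C z u v) ∧
      (∀ z ∈ U, ∀ i ∈ ({9, 13} : Set ℕ),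
        QPII.Inaccessible c U (QPII.lowerChart c i) z 0 0)) ∧
    -- the auxiliary function `W`, in the normalisation `c_3(z) = z`
    ((∀ z ∈ U, c.c3 z = z) → (∀ z ∈ U, deriv c.c1 z = 0) →
      (∀ z ∈ U, ∀ (C : QPII.Chart) (u v : ℂ), QPII.OnIntermediateCurve c C u v →
        ¬ QPII.IsBasePoint C z u v → QPII.WDefinedNear c C z u v →
        QPII.WInfinite c C z u v ∧ QPII.WLogDerivBounded c C z u v) ∧
      (∀ z ∈ U, ∀ i ∈ ({9, 13} : Set ℕ), ∀ h : ℂ,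
        QPII.WDefinedNear c (QPII.upperChart c i) z h 0 →
        QPII.WBounded c (QPII.upperChart c i) z h 0)) := by
  have hc : ∀ z ∈ U, c.AnalyticAt z := fun z hz => ⟨h0 z hz, h1 z hz, h2 z hz, h3 z hz⟩
  have hev : ∀ z ∈ U, ∀ᶠ w in 𝓝 z, c.AnalyticAt w := fun z hz => by
    filter_upwards [hU.mem_nhds hz] with w hw using hc w hw
  obtain ⟨hA, hA'⟩ := QPII.forall_regular_iff (k := 64)
    (K := fun z => deriv (deriv c.c3) z - 1 / 2 * deriv c.c1 z) hU
    (fun z hz => QPII.exists_isFinalChart_nine (hev z hz)) (by norm_num)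
    (fun z hz => QPII.firstE_zero (hc z hz))
  obtain ⟨hB, hB'⟩ := QPII.forall_regular_iff (k := 1 / 2) (K := fun z => deriv c.c1 z) hU
    (fun z hz => QPII.exists_isFinalChart_thirteen (hev z hz)) (by norm_num)
    (fun z hz => QPII.secondE_zero z)
  refine ⟨fun z hz => ⟨QPII.affineChart_not_isBasePoint, QPII.chartu0_isBasePoint_iff,
      QPII.chartU0_isBasePoint_iff⟩, fun z hz i hi => QPII.isBasePoint_intermediate (hc z hz) hi,
    fun z hz => ⟨QPII.lowerChart_two_isBasePoint_iff, QPII.upperChart_two_not_isBasePoint⟩,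
    fun z hz i hi => QPII.not_isBasePoint_last (hc z hz) hi, hA, hA', hB, hB',
    QPII.conditions_iff hU hUc h1 h3, ?_, ?_⟩
  · intro hA hB
    have hA' : ∀ z ∈ U, deriv (deriv c.c3) z = 0 := fun z hz => by
      have := hA z hz
      rwa [hB z hz, mul_zero, sub_zero] at this
    exact ⟨QPII.quasiPainleve hU hc hB hA', fun z hz C u v hC hb =>
      QPII.inaccessible_intermediate hU hc hB hA' hz hC hb,
      fun z hz i hi => QPII.inaccessible_last hU hc hB hA' hz hi⟩
  · intro h3' h1'
    refine ⟨fun z hz C u v hC hb hW => ?_, fun z hz i hi k hW => ?_⟩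
    · obtain ⟨P, hP, h⟩ := QPII.exists_normalizedOn hU hc h3' h1' hz
      exact h.w_intermediate hP hC hb hW
    · obtain ⟨P, hP, h⟩ := QPII.exists_normalizedOn hU hc h3' h1' hz
      simp only [Set.mem_insert_iff, Set.mem_singleton_iff] at hi
      rcases hi with rfl | rfl
      · exact h.wBounded_nine hP k
      · exact h.wBounded_thirteen hP hW
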